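/- **Corollary (Legendrian flag).** Let $n\ge 2$, let $Y^{2n+1}$ be a contact manifold with contact hyperplane bundle $P\to Y$ (locally $P=\ker\theta_0$, with $d\theta_0$ nondegenerate on $P$), and let $D$ be a *Legendrian connection* on $P$. This means: $D$ preserves the conformal class of $d\theta_0|_P$; $D$ is torsion free, i.e. for some line field transversal to $P$ with induced projection $p:TY\to P$ one has $D_VW-D_WV=p([V,W])$ for all sections $V,W$ of $P$; and the differential system on the bundle of Legendrian $n$-planes whose solutions are the Legendrian submanifolds with $D$-parallel tangent planes is Frobenius. A *geodesic isotropic $k$-fold* is an immersed $k$-dimensional submanifold of $Y$ whose tangent planes are isotropic (contained in $P$, with $d\theta_0$ vanishing on them) and are $D$-parallel along the submanifold. A *normal symplectic connection* over $Y$ is a principal $P_1$-bundle $B\to Y$, where $P_1\subset Sp(n+1,\mathbb R)$ is the stabilizer of the line spanned by the first standard basis vector of $\mathbb R^{2n+2}$, with an $\mathfrak{sp}(n+1,\mathbb R)$-valued Cartan connection form $$\Phi=\begin{pmatrix}\phi&\pi\\ \eta&-\phi^t\end{pmatrix},\quad \eta=\begin{pmatrix}2\theta_0&\theta^t\\ \theta&\Theta\end{pmatrix},\quad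 \phi=\begin{pmatrix}-\rho&-\tfrac12\phi_0^t\\ \omega&\alpha\end{pmatrix},\quad \pi=\begin{pmatrix}\pi_0^0&-\tfrac12\pi_0^t\\-\tfrac12\pi_0&\gamma\end{pmatrix}$$ such that $\ker\theta_0$ is the preimage of $P$ and the curvature $\Omega=d\Phi+\Phi\wedge\Phi$ is normal: the components of $\Omega$ belonging to $\rho,\omega,\theta_0,\theta$ vanish; its components belonging to $\alpha,\gamma,\Theta$ form an $\mathfrak{sp}(n,\mathbb R)$-valued form $\theta_0\wedge\Upsilon$, where $\Upsilon$ takes values in $S^2(V)\otimes V$ ($V=\mathbb R^{2n}$) and has no component in $V$; and $\sum_iK^i_i=0$, where $K^i_j$ is the coefficient of $\theta_0\wedge\theta_j$ in the component of $\Omega$ belonging to $\phi_0^i$. A point of $B$ defines a conformal symplectic frame $(A_1,\dots,A_n,B_1,\dots,B_n)$ of $P$, dual to $(\omega,\theta)$. The normal symplectic connection is *associated* to $D$ if $D$ arises from it, i.e. if near each point of $Y$ there is a local section of $B\to Y$ whose frame satisfies $D(A,B)=(A,B)\,\Psi$ modulo $\theta_0$, where $\Psi=\begin{pmatrix}\alpha+\rho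 I&\gamma\\ \Theta&-\alpha^t+\rho I\end{pmatrix}$ is pulled back by the section. For $1\le k\le n$ let $\mathcal I_k$ be the differential system on $B$ generated by $\theta_0$, $\theta_i$, $\Theta_{ij}$ (all $i,j$), $\omega^i$ ($i>k$) and $\alpha^i_j$ ($i>k\ge j$). Then for every $1\le k\le n$: 1. For each $y\in Y$ and each isotropic $k$-plane $W\subset P_y$ there is a geodesic isotropic $k$-fold through $y$ with tangent plane $W$ at $y$, and any two such have the same germ at $y$ (up to a smooth change of parameters). 2. For every normal symplectic connection $(B,\Phi)$ associated to $D$, the system $\mathcal I_k$ is Frobenius on $B$, and an immersed $k$-fold in $Y$ is a geodesic isotropic $k$-fold of $D$ if and only if it is locally the projection of a $k$-dimensional integral manifold of $\mathcal I_k$. 3. The family of geodesic isotropic $k$-folds is an invariant of the normal symplectic connection: if $D'$ is a Legendrian connection on a contact manifold $Y'^{2n+1}$ with associated normal symplectic connection $(B',\Phi')$, and $F:B\to B'$ is a $P_1$-equivariant diffeomorphism with $F^*\Phi'=\Phi$ covering a diffeomorphism $f:Y\to Y'$, then an immersed $k$-fold in $Y$ is geodesic isotropic for $D$ if and only if its image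 under $f$ is geodesic isotropic for $D'$. In particular (with $F=\mathrm{id}$) two Legendrian connections with the same associated normal symplectic connection have the same geodesic isotropic $k$-folds. -/

import Mathlib

open scoped Manifold ContDiff Topology Matrix
open Filter

namespace LegendrianGeometry

noncomputable section

/-- Euclidean space of dimension `d`, the model of a `d`-dimensional manifold. -/
abbrev Euc (d : ℕ) : Type := EuclideanSpace ℝ (Fin d)

/-! ### Vector fields, 1-forms, exterior derivative, Frobenius systems -/

section Forms

variable {d : ℕ} {M : Type*} [TopologicalSpace M] [ChartedSpace (Euc d) M]

/-- (Not necessarily continuous) vector fields on a `d`-manifold. -/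
abbrev VField (d : ℕ) (M : Type*) [TopologicalSpace M] [ChartedSpace (Euc d) M] :=
  (x : M) → TangentSpace (𝓡 d) x

/-- (Not necessarily continuous) real 1-forms on a `d`-manifold. -/
abbrev OneForm (d : ℕ) (M : Type*) [TopologicalSpace M] [ChartedSpace (Euc d) M] :=
  (x : M) → TangentSpace (𝓡 d) x →ₗ[ℝ] ℝ

/-- The vector field `V` is smooth near `x`. -/
def SmoothNear [IsManifold (𝓡 d) ∞ M] (V : VField d M) (x : M) : Prop :=
  ∀ᶠ z in 𝓝 x, ContMDiffAt (𝓡 d) (𝓡 d).tangent ∞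
    (fun p => (⟨p, V p⟩ : TangentBundle (𝓡 d) M)) z

/-- The expression of a 1-form in the preferred chart at `x`: its pullback under the inverse
of the chart. -/
def OneForm.inChart (α : OneForm d M) (x : M) (e : Euc d) : Euc d →L[ℝ] ℝ :=
  LinearMap.toContinuousLinearMap
    ((α ((extChartAt (𝓡 d) x).symm e)).comp
      (mfderiv 𝓘(ℝ, Euc d) (𝓡 d) (extChartAt (𝓡 d) x).symm e).toLinearMap)

/-- Smoothness of a 1-form at a point. -/
def OneForm.IsSmoothAt (α : OneForm d M) (x : M) : Prop :=
  ContDiffAt ℝ ∞ (α.inChart x) (extChartAt (𝓡 d) x x)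

/-- The alternating bilinear form `(v, w) ↦ L v w - L w v`. -/
def alternation (L : Euc d →L[ℝ] Euc d →L[ℝ] ℝ) : Euc d →ₗ[ℝ] Euc d →ₗ[ℝ] ℝ :=
  LinearMap.mk₂ ℝ (fun v w => L v w - L w v)
    (fun v v' w => by simp; ring) (fun c v w => by simp; ring)
    (fun v w w' => by simp; ring) (fun c v w => by simp; ring)

/-- The exterior derivative `dα` at `x` as a bilinear form, computed in the preferred chart at `x`:
`dα(v, w) = ∂_v (α w) - ∂_w (α v)` for constant coordinate vectors `v`, `w`
(a tangent vector at `x` is its own coordinate vector in the preferred chart at `x`). -/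
def OneForm.extD (α : OneForm d M) (x : M) :
    TangentSpace (𝓡 d) x →ₗ[ℝ] TangentSpace (𝓡 d) x →ₗ[ℝ] ℝ :=
  alternation (fderiv ℝ (α.inChart x) (extChartAt (𝓡 d) x x))

/-- The differential system generated by the 1-forms `S i` satisfies the Frobenius condition
`d (S i) ≡ 0` modulo the system, at the point `x`. -/
def IsFrobeniusAt {ι : Type*} (S : ι → OneForm d M) (x : M) : Prop :=
  ∀ v w : TangentSpace (𝓡 d) x, (∀ i, S i x v = 0) → (∀ i, S i x w = 0) →
    ∀ i, (S i).extD x v w = 0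

end Forms

/-! ### Contact manifolds -/

section Contact

variable {n : ℕ} {Y : Type*} [TopologicalSpace Y] [ChartedSpace (Euc (2 * n + 1)) Y]

/-- Near `y`, the 1-form `θ` is a smooth contact form generating the hyperplane field `P`:
it is nowhere zero with kernel `P`, and `dθ` is nondegenerate on `P`
(equivalently `θ ∧ (dθ)ⁿ ≠ 0`). -/
def IsContactFormNear (P : (y : Y) → Submodule ℝ (TangentSpace (𝓡 (2 * n + 1)) y))
    (θ : OneForm (2 * n + 1) Y) (y : Y) : Prop :=
  ∀ᶠ z in 𝓝 y, θ.IsSmoothAt z ∧ θ z ≠ 0 ∧ LinearMap.ker (θ z) = P z ∧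
    ∀ v ∈ P z, (∀ w ∈ P z, θ.extD z v w = 0) → v = 0

/-- A contact structure on a `(2n+1)`-manifold: a hyperplane field that is locally the kernel
of a contact form. -/
structure ContactStructure (n : ℕ) (Y : Type*) [TopologicalSpace Y]
    [ChartedSpace (Euc (2 * n + 1)) Y] where
  plane : (y : Y) → Submodule ℝ (TangentSpace (𝓡 (2 * n + 1)) y)
  exists_form : ∀ y, ∃ θ : OneForm (2 * n + 1) Y, IsContactFormNear plane θ y

/-- `θ` is a local generator of the contact structure near `y`. -/
def ContactStructure.IsGenerator (C : ContactStructure n Y) (θ : OneForm (2 * n + 1) Y)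
    (y : Y) : Prop :=
  IsContactFormNear C.plane θ y

/-- `V` is, near `y`, a smooth section of the contact hyperplane bundle. -/
def ContactStructure.IsSectionNear [IsManifold (𝓡 (2 * n + 1)) ∞ Y] (C : ContactStructure n Y)
    (V : VField (2 * n + 1) Y) (y : Y) : Prop :=
  SmoothNear V y ∧ ∀ᶠ z in 𝓝 y, V z ∈ C.plane z

/-- `W` is an isotropic `k`-plane at `y`. -/
def ContactStructure.IsIsotropicPlane (C : ContactStructure n Y) (k : ℕ) (y : Y)
    (W : Submodule ℝ (TangentSpace (𝓡 (2 * n + 1)) y)) : Prop :=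
  Module.finrank ℝ W = k ∧ W ≤ C.plane y ∧
    ∀ θ, C.IsGenerator θ y → ∀ v ∈ W, ∀ w ∈ W, θ.extD y v w = 0

/-- A conformal symplectic connection on the contact hyperplane bundle; `cov V y X` is `D_X V` at
`y`. The value is only meaningful for `V` a smooth section near `y` of the contact
hyperplane bundle, and the axioms only concern such `V`. -/
structure ConformalSymplecticConnection [IsManifold (𝓡 (2 * n + 1)) ∞ Y]
    (C : ContactStructure n Y) where
  cov : VField (2 * n + 1) Y → (y : Y) →
    TangentSpace (𝓡 (2 * n + 1)) y →ₗ[ℝ] TangentSpace (𝓡 (2 * n + 1)) y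
  mem_plane : ∀ V y X, C.IsSectionNear V y → cov V y X ∈ C.plane y
  add : ∀ V W y, C.IsSectionNear V y → C.IsSectionNear W y →
    cov (fun z => V z + W z) y = cov V y + cov W y
  leibniz : ∀ (f : Y → ℝ) V y X, C.IsSectionNear V y →
    (∀ᶠ z in 𝓝 y, ContMDiffAt (𝓡 (2 * n + 1)) 𝓘(ℝ, ℝ) ∞ f z) →
    cov (fun z => f z • V z) y X =
      f y • cov V y X + (show ℝ from mfderiv (𝓡 (2 * n + 1)) 𝓘(ℝ, ℝ) f y X) • V y
  smooth : ∀ V X y, C.IsSectionNear V y → SmoothNear X y →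
    SmoothNear (fun z => cov V z (X z)) y
  /-- The conformal class of `dθ` on the contact hyperplanes is parallel. -/
  conformal : ∀ θ y, C.IsGenerator θ y → ∃ c : TangentSpace (𝓡 (2 * n + 1)) y →ₗ[ℝ] ℝ,
    ∀ V W X, C.IsSectionNear V y → C.IsSectionNear W y →
      (show ℝ from mfderiv (𝓡 (2 * n + 1)) 𝓘(ℝ, ℝ) (fun z => θ.extD z (V z) (W z)) y X)
        - θ.extD y (cov V y X) (W y) - θ.extD y (V y) (cov W y X) = c X * θ.extD y (V y) (W y)

namespace ConformalSymplecticConnection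

variable [IsManifold (𝓡 (2 * n + 1)) ∞ Y] {C : ContactStructure n Y}

/-- `D` is torsion free: for some smooth line field `ℓ` transversal to the contact
hyperplanes, `D_V W - D_W V` is the projection of `[V, W]` along `ℓ`. -/
def IsTorsionFree (D : ConformalSymplecticConnection C) : Prop :=
  ∃ ℓ : (y : Y) → Submodule ℝ (TangentSpace (𝓡 (2 * n + 1)) y),
    (∀ y, IsCompl (ℓ y) (C.plane y)) ∧
    (∀ y, ∃ T : VField (2 * n + 1) Y, SmoothNear T y ∧
      ∀ᶠ z in 𝓝 y, ℓ z = Submodule.span ℝ {T z}) ∧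
    ∀ V W y, C.IsSectionNear V y → C.IsSectionNear W y →
      VectorField.mlieBracket (𝓡 (2 * n + 1)) V W y - (D.cov W y (V y) - D.cov V y (W y)) ∈ ℓ y

/-- Near `y`, the vector fields `A i` form a smooth frame of a field of Legendrian `n`-planes;
`θ` is a local contact form. -/
def IsLegendrianFrameNear (C : ContactStructure n Y) (θ : OneForm (2 * n + 1) Y)
    (A : Fin n → VField (2 * n + 1) Y) (y : Y) : Prop :=
  (∀ i, C.IsSectionNear (A i) y) ∧
    ∀ᶠ z in 𝓝 y, LinearIndependent ℝ (fun i => A i z) ∧ ∀ i j, θ.extD z (A i z) (A j z) = 0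

/-- The differential system of geodesic Legendrian submanifolds, pulled back by a local section
`z ↦ span (A 1, …, A n)` of the bundle of Legendrian planes. For a conformal symplectic
frame `(A, B)` with `dθ (A i, B j) = c δ_ij`, dual coframe `(ω, θ_i)`, and connection matrix with
lower left block `Θ` (so `Θ_ij` is the `B i`-component of `D A_j`), the three families are `θ`,
`dθ (A i, ·) = c θ_i` modulo `θ`, and `dθ (A i, D A_j) = c Θ_ij`. -/
def legendrianSystem (D : ConformalSymplecticConnection C) (θ : OneForm (2 * n + 1) Y)
    (A : Fin n → VField (2 * n + 1) Y) :
    Unit ⊕ Fin n ⊕ (Fin n × Fin n) → OneForm (2 * n + 1) Y :=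
  Sum.elim (fun _ => θ) (Sum.elim (fun i z => θ.extD z (A i z))
    (fun p z => (θ.extD z (A p.1 z)).comp (D.cov (A p.2) z)))

/-- A Legendrian connection: a torsion free connection whose differential system of
geodesic Legendrian submanifolds is Frobenius. By the structure equation
`dΘ = Ω_Θ - Θ ∧ (α + ρ) - (-αᵗ + ρ) ∧ Θ` with `Ω_Θ` semibasic, the Frobenius condition
upstairs may be tested on the pullbacks by all local sections. -/
def IsLegendrian (D : ConformalSymplecticConnection C) : Prop :=
  D.IsTorsionFree ∧
    ∀ y θ A, C.IsGenerator θ y → IsLegendrianFrameNear C θ A y →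
      IsFrobeniusAt (D.legendrianSystem θ A) y

end ConformalSymplecticConnection

/-! ### Geodesic isotropic `k`-folds -/

section Folds

variable {k : ℕ}

/-- `σ` is a smooth immersion of the open set `U` of `ℝᵏ`. -/
def IsImmersedOn (U : Set (Euc k)) (σ : Euc k → Y) : Prop :=
  IsOpen U ∧ ∀ x ∈ U, ContMDiffAt (𝓡 k) (𝓡 (2 * n + 1)) ∞ σ x ∧
    Function.Injective (mfderiv (𝓡 k) (𝓡 (2 * n + 1)) σ x)

/-- The tangent plane of the immersion `σ` at the parameter `x`. -/
def tangentPlane (σ : Euc k → Y) (x : Euc k) :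
    Submodule ℝ (TangentSpace (𝓡 (2 * n + 1)) (σ x)) :=
  LinearMap.range (mfderiv (𝓡 k) (𝓡 (2 * n + 1)) σ x).toLinearMap

/-- `σ` passes through `y` at the parameter `x` with tangent plane `W`. -/
def IsTangentTo (σ : Euc k → Y) (x : Euc k) (y : Y)
    (W : Submodule ℝ (TangentSpace (𝓡 (2 * n + 1)) y)) : Prop :=
  ∃ h : σ x = y, h ▸ tangentPlane σ x = W

/-- `σ : U → Y` is a (parametrized) geodesic isotropic `k`-fold of `D`: an immersion with
isotropic tangent planes that are parallel along it, i.e. the derivative, in directions tangent to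
the fold, of a field tangent to the fold is tangent to the fold (`V` is a local extension to `Y`
of such a field). -/
def IsGeodesicIsotropic [IsManifold (𝓡 (2 * n + 1)) ∞ Y] {C : ContactStructure n Y}
    (D : ConformalSymplecticConnection C) (U : Set (Euc k)) (σ : Euc k → Y) : Prop :=
  IsImmersedOn (n := n) U σ ∧ ∀ x ∈ U, C.IsIsotropicPlane k (σ x) (tangentPlane σ x) ∧
    ∀ V : VField (2 * n + 1) Y, C.IsSectionNear V (σ x) →
      (∀ᶠ x' in 𝓝 x, V (σ x') ∈ tangentPlane σ x') →
      ∀ w ∈ tangentPlane σ x, D.cov V (σ x) w ∈ tangentPlane σ x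

/-- The parametrized `k`-folds `σ` at `x` and `σ'` at `x'` have the same germ up to a smooth change
of parameters. -/
def SameGerm (U : Set (Euc k)) (σ : Euc k → Y) (x : Euc k)
    (U' : Set (Euc k)) (σ' : Euc k → Y) (x' : Euc k) : Prop :=
  ∃ φ : OpenPartialHomeomorph (Euc k) (Euc k), x ∈ φ.source ∧ φ x = x' ∧
    φ.source ⊆ U ∧ φ.target ⊆ U' ∧
    ContDiffOn ℝ ∞ φ φ.source ∧ ContDiffOn ℝ ∞ φ.symm φ.target ∧
    ∀ z ∈ φ.source, σ' (φ z) = σ z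

end Folds

end Contact

/-! ### The symplectic Lie algebra `sp(n+1, ℝ)` and the parabolic subgroup -/

/-- Indices `0, …, n` (left) and `0, …, n` (right) of `(2n+2) × (2n+2)` matrices. -/
abbrev Idx (n : ℕ) : Type := Fin (n + 1) ⊕ Fin (n + 1)

/-- The Lie algebra `sp(n+1, ℝ)` (as a space of matrices): the matrices skew-adjoint for the
standard symplectic form. -/
abbrev spAlg (n : ℕ) : Submodule ℝ (Matrix (Idx n) (Idx n) ℝ) :=
  skewAdjointMatricesSubmodule (Matrix.J (Fin (n + 1)) ℝ)

lemma block_mem_spAlg {n : ℕ} (φ π η : Matrix (Fin (n + 1)) (Fin (n + 1)) ℝ)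
    (hπ : πᵀ = π) (hη : ηᵀ = η) : Matrix.fromBlocks φ π η (-φᵀ) ∈ spAlg n := by
  rw [spAlg, mem_skewAdjointMatricesSubmodule]
  simp [Matrix.IsSkewAdjoint, Matrix.IsAdjointPair, Matrix.J, Matrix.fromBlocks_transpose,
    Matrix.fromBlocks_multiply, Matrix.fromBlocks_neg, hπ, hη]

/-- The elements of `sp(n+1, ℝ)` with `ω^i = 1`, resp. `θ_i = 1`, and all other components zero. -/
def basisElt (n : ℕ) : Fin n ⊕ Fin n → spAlg n
  | .inl i => ⟨Matrix.fromBlocks (Matrix.single i.succ 0 1) 0 0 (-(Matrix.single i.succ 0 1)ᵀ),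
      block_mem_spAlg _ _ _ (by simp) (by simp)⟩
  | .inr i => ⟨Matrix.fromBlocks 0 0 (Matrix.single i.succ 0 1 + Matrix.single 0 i.succ 1) (-0ᵀ),
      block_mem_spAlg _ _ _ (by simp) (by simp [add_comm])⟩

/-- The element of `sp(n+1, ℝ)` with `θ_0 = 1` and all other components zero. -/
def reebElt (n : ℕ) : spAlg n :=
  ⟨Matrix.fromBlocks 0 0 (Matrix.single 0 0 2) (-0ᵀ),
    block_mem_spAlg _ _ _ (by simp) (by simp)⟩

/-- The stabilizer in `Sp(n+1, ℝ)` of the line spanned by the first standard basis vector. -/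
def parabolic (n : ℕ) : Subgroup (Matrix.symplecticGroup (Fin (n + 1)) ℝ) where
  carrier := {g | ∃ c : ℝ, (g : Matrix (Idx n) (Idx n) ℝ) *ᵥ Pi.single (Sum.inl 0) 1 =
    c • Pi.single (Sum.inl 0) 1}
  one_mem' := ⟨1, by rw [OneMemClass.coe_one, Matrix.one_mulVec, one_smul]⟩
  mul_mem' := by
    rintro g h ⟨a, ha⟩ ⟨b, hb⟩
    refine ⟨b * a, ?_⟩
    rw [Submonoid.coe_mul, ← Matrix.mulVec_mulVec, hb, Matrix.mulVec_smul, ha, smul_smul]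
  inv_mem' := by
    rintro g ⟨a, ha⟩
    have h1 : ((g⁻¹ : Matrix.symplecticGroup (Fin (n + 1)) ℝ) : Matrix (Idx n) (Idx n) ℝ) *
        (g : Matrix (Idx n) (Idx n) ℝ) = 1 := by
      rw [← Submonoid.coe_mul, inv_mul_cancel, Submonoid.coe_one]
    have h2 := congrArg (fun v =>
      ((g⁻¹ : Matrix.symplecticGroup (Fin (n + 1)) ℝ) : Matrix (Idx n) (Idx n) ℝ) *ᵥ v) ha
    simp only [Matrix.mulVec_mulVec, h1, Matrix.one_mulVec, Matrix.mulVec_smul] at h2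
    have ha0 : a ≠ 0 := by
      rintro rfl
      have := congrFun h2 (Sum.inl 0)
      simp at this
    refine ⟨a⁻¹, ?_⟩
    conv_rhs => rw [h2]
    rw [smul_smul, inv_mul_cancel₀ ha0, one_smul]

/-- The underlying matrix of an element of the parabolic subgroup. -/
def pmat {n : ℕ} (g : parabolic n) : Matrix (Idx n) (Idx n) ℝ :=
  ((g : Matrix.symplecticGroup (Fin (n + 1)) ℝ) : Matrix (Idx n) (Idx n) ℝ)

/-- The index in `Idx n` of the `a`-th vector of a conformal symplectic frame. -/
def subIdx {n : ℕ} : Fin n ⊕ Fin n → Idx n := Sum.map Fin.succ Fin.succ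

/-- `dim Sp(n+1, ℝ) = (n+1)(2n+3)`. -/
abbrev dimSp (n : ℕ) : ℕ := (n + 1) * (2 * n + 3)

/-! ### Normal symplectic connections -/

section Normal

variable {n : ℕ} {Y : Type*} [TopologicalSpace Y] [ChartedSpace (Euc (2 * n + 1)) Y]
  [IsManifold (𝓡 (2 * n + 1)) ∞ Y]

/-- A principal bundle `B → Y` with group the parabolic subgroup `P₁` of `Sp(n+1, ℝ)`, with an
`sp(n+1, ℝ)`-valued Cartan connection form `Φ` compatible with the contact structure. Blockwise,
```
Φ = ( φ  π ; η  -φᵗ ),  η = ( 2θ₀ θᵗ ; θ Θ ),  φ = ( -ρ -½φ₀ᵗ ; ω α ),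
π = ( π₀⁰ -½π₀ᵗ ; -½π₀ γ ).
``` -/
structure SymplecticConnection (C : ContactStructure n Y) (B : Type*) [TopologicalSpace B]
    [ChartedSpace (Euc (dimSp n)) B] [IsManifold (𝓡 (dimSp n)) ∞ B] where
  proj : B → Y
  proj_smooth : ContMDiff (𝓡 (dimSp n)) (𝓡 (2 * n + 1)) ∞ proj
  proj_surjective : Function.Surjective proj
  proj_submersion : ∀ u,
    Function.Surjective (mfderiv (𝓡 (dimSp n)) (𝓡 (2 * n + 1)) proj u)
  /-- The right action of `P₁`. -/
  act : B → parabolic n → B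
  act_one : ∀ u, act u 1 = u
  act_mul : ∀ u g h, act u (g * h) = act (act u g) h
  proj_act : ∀ u g, proj (act u g) = proj u
  act_simply_transitive : ∀ u u', proj u = proj u' → ∃! g, act u g = u'
  /-- The action is smooth, tested on smooth families of points and of group elements. -/
  act_smooth : ∀ (m : ℕ) (f : Euc m → B) (g : Euc m → parabolic n) (x : Euc m),
    ContMDiffAt (𝓡 m) (𝓡 (dimSp n)) ∞ f x →
    (∀ i j, ContDiffAt ℝ ∞ (fun z => pmat (g z) i j) x) →
    ContMDiffAt (𝓡 m) (𝓡 (dimSp n)) ∞ (fun z => act (f z) (g z)) x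
  /-- The Cartan connection form `Φ`, an isomorphism on each tangent space. -/
  form : (u : B) → TangentSpace (𝓡 (dimSp n)) u ≃ₗ[ℝ] spAlg n
  form_smooth : ∀ i j u, OneForm.IsSmoothAt (d := dimSp n) (M := B)
    (fun u => (Matrix.entryLinearMap ℝ ℝ i j).comp
      ((spAlg n).subtype.comp (form u).toLinearMap)) u
  /-- `Φ_{u g} = Ad_{g⁻¹} Φ_u`. -/
  form_act : ∀ u g v,
    (form (act u g) (mfderiv (𝓡 (dimSp n)) (𝓡 (dimSp n)) (fun z => act z g) u v) :
      Matrix (Idx n) (Idx n) ℝ) = pmat g⁻¹ * (form u v : Matrix (Idx n) (Idx n) ℝ) * pmat g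
  /-- `Φ` reproduces the generators of the fundamental vector fields. -/
  form_fundamental : ∀ (u : B) (g : ℝ → parabolic n) (X : Matrix (Idx n) (Idx n) ℝ), g 0 = 1 →
    (∀ i j, ContDiffAt ℝ ∞ (fun t => pmat (g t) i j) 0) →
    (∀ i j, HasDerivAt (fun t => pmat (g t) i j) (X i j) 0) →
    (form (act u (g 0)) (mfderiv 𝓘(ℝ, ℝ) (𝓡 (dimSp n)) (fun t => act u (g t)) 0 (1 : ℝ)) :
      Matrix (Idx n) (Idx n) ℝ) = X
  /-- The kernel of `θ₀` is the preimage of the contact hyperplane. -/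
  contact : ∀ u v, (form u v : Matrix (Idx n) (Idx n) ℝ) (Sum.inr 0) (Sum.inl 0) = 0 ↔
    mfderiv (𝓡 (dimSp n)) (𝓡 (2 * n + 1)) proj u v ∈ C.plane (proj u)

namespace SymplecticConnection

variable {C : ContactStructure n Y} {B : Type*} [TopologicalSpace B]
  [ChartedSpace (Euc (dimSp n)) B] [IsManifold (𝓡 (dimSp n)) ∞ B]

/-- The matrix entries of `Φ`, as 1-forms on `B`. -/
def entry (N : SymplecticConnection C B) (i j : Idx n) : OneForm (dimSp n) B :=
  fun u => (Matrix.entryLinearMap ℝ ℝ i j).comp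
    ((spAlg n).subtype.comp (N.form u).toLinearMap)

/-- The form `θ₀`. -/
def theta0 (N : SymplecticConnection C B) : OneForm (dimSp n) B :=
  fun u => (2⁻¹ : ℝ) • N.entry (Sum.inr 0) (Sum.inl 0) u

/-- The forms `θ_i`. -/
def theta (N : SymplecticConnection C B) (i : Fin n) : OneForm (dimSp n) B :=
  N.entry (Sum.inr i.succ) (Sum.inl 0)

/-- The forms `ω^i`. -/
def omega (N : SymplecticConnection C B) (i : Fin n) : OneForm (dimSp n) B :=
  N.entry (Sum.inl i.succ) (Sum.inl 0)

/-- The forms `Θ_ij`. -/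
def bigTheta (N : SymplecticConnection C B) (i j : Fin n) : OneForm (dimSp n) B :=
  N.entry (Sum.inr i.succ) (Sum.inl j.succ)

/-- The forms `α^i_j`. -/
def alpha (N : SymplecticConnection C B) (i j : Fin n) : OneForm (dimSp n) B :=
  N.entry (Sum.inl i.succ) (Sum.inl j.succ)

/-- The form `ρ`. -/
def rho (N : SymplecticConnection C B) : OneForm (dimSp n) B :=
  fun u => -N.entry (Sum.inl 0) (Sum.inl 0) u

/-- The curvature `Ω = dΦ + Φ ∧ Φ`. -/
def curv (N : SymplecticConnection C B) (u : B) (v w : TangentSpace (𝓡 (dimSp n)) u) :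
    Matrix (Idx n) (Idx n) ℝ :=
  Matrix.of (fun i j => (N.entry i j).extD u v w) +
    ((N.form u v : Matrix (Idx n) (Idx n) ℝ) * (N.form u w : Matrix (Idx n) (Idx n) ℝ)
      - (N.form u w : Matrix (Idx n) (Idx n) ℝ) * (N.form u v : Matrix (Idx n) (Idx n) ℝ))

/-- The tangent vector at `u` with `θ₀ = 1` on which the other components of `Φ` vanish. -/
def reebVec (N : SymplecticConnection C B) (u : B) : TangentSpace (𝓡 (dimSp n)) u :=
  (N.form u).symm (reebElt n)

/-- The tangent vectors at `u` dual to `ω^i` (left indices) and to `θ_i` (right indices). -/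
def baseVec (N : SymplecticConnection C B) (u : B) (a : Fin n ⊕ Fin n) :
    TangentSpace (𝓡 (dimSp n)) u :=
  (N.form u).symm (basisElt n a)

/-- The conformal symplectic frame `(A_1, …, A_n, B_1, …, B_n)` of the contact hyperplane at
`proj u` defined by `u`, dual to `(ω, θ)`. This is the projection from `B` to the bundle of
conformal symplectic frames. -/
def frame (N : SymplecticConnection C B) (u : B) (a : Fin n ⊕ Fin n) :
    TangentSpace (𝓡 (2 * n + 1)) (N.proj u) :=
  mfderiv (𝓡 (dimSp n)) (𝓡 (2 * n + 1)) N.proj u (N.baseVec u a)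

/-- Normality of the curvature. -/
structure IsNormal (N : SymplecticConnection C B) : Prop where
  /-- The components of `Ω` belonging to `ρ, ω, θ₀, θ` vanish. -/
  torsion : ∀ u v w i, N.curv u v w i (Sum.inl 0) = 0
  /-- The `sp(n, ℝ)`-part of `Ω` is of the form `θ₀ ∧ Υ`. -/
  mod_theta0 : ∀ u v w, N.theta0 u v = 0 → N.theta0 u w = 0 →
    ∀ a b : Fin n ⊕ Fin n, N.curv u v w (subIdx a) (subIdx b) = 0
  /-- `Υ`, with values in `S²(V) ⊗ V`, has no component in `V`: its contraction vanishes. -/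
  trace_upsilon : ∀ u (b : Fin n ⊕ Fin n),
    ∑ a : Fin n ⊕ Fin n, N.curv u (N.reebVec u) (N.baseVec u a) (subIdx a) (subIdx b) = 0
  /-- `∑ K^i_i = 0`, where `Ω_{φ₀}^i ≡ ∑ K^i_j θ₀ ∧ θ_j` and
  `-½ Ω_{φ₀}^i` is the entry of `Ω` at the place of `-½ φ₀^i` in `Φ`. -/
  trace_phi0 : ∀ u, ∑ i : Fin n,
    (-2) * N.curv u (N.reebVec u) (N.baseVec u (Sum.inr i)) (Sum.inl 0) (Sum.inl i.succ) = 0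

/-- The connection matrix `Ψ = Ψ. + ρ I`, where `Ψ. = ( α γ ; Θ -αᵗ )`. -/
def psi (N : SymplecticConnection C B) (u : B) (v : TangentSpace (𝓡 (dimSp n)) u)
    (b a : Fin n ⊕ Fin n) : ℝ :=
  N.entry (subIdx b) (subIdx a) u v + if b = a then N.rho u v else 0

/-- `D` arises from local sections of `B`: near each point there is a smooth section `s` of
`B → Y` such that the frame `e = (A, B)` defined by `s` satisfies `D e = e Ψ`, with `Ψ` pulled back
by `s`, along the contact hyperplanes (the derivative in the transversal direction plays no role
for isotropic submanifolds and is normalized in `Φ`, so `Ψ` is compared modulo `θ₀`). -/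
def ArisesFrom (N : SymplecticConnection C B) (D : ConformalSymplecticConnection C) : Prop :=
  ∀ y : Y, ∃ (s : Y → B) (e : Fin n ⊕ Fin n → VField (2 * n + 1) Y), ∀ᶠ z in 𝓝 y,
    ContMDiffAt (𝓡 (2 * n + 1)) (𝓡 (dimSp n)) ∞ s z ∧ N.proj (s z) = z ∧
    (∀ a, e a (N.proj (s z)) = N.frame (s z) a) ∧
    ∀ (X : TangentSpace (𝓡 (2 * n + 1)) z) (a : Fin n ⊕ Fin n), X ∈ C.plane z →
      D.cov (e a) (N.proj (s z)) (mfderiv (𝓡 (dimSp n)) (𝓡 (2 * n + 1)) N.proj (s z)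
          (mfderiv (𝓡 (2 * n + 1)) (𝓡 (dimSp n)) s z X)) =
        ∑ b, N.psi (s z) (mfderiv (𝓡 (2 * n + 1)) (𝓡 (dimSp n)) s z X) b a •
          e b (N.proj (s z))

/-- `(B, Φ)` is a normal symplectic connection associated to `D`. -/
def IsAssociated (N : SymplecticConnection C B) (D : ConformalSymplecticConnection C) : Prop :=
  N.IsNormal ∧ N.ArisesFrom D

/-- The differential system `I_k` on `B`, generated by `θ₀`, `θ_i`, `Θ_ij`,
`ω^i` for `i > k`, and `α^i_j` for `i > k`, `j ≤ k`. (Indices in `Fin n` start at `0`, so that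
`i > k` becomes `k ≤ i`, and `j ≤ k` becomes `j < k`.) -/
def flagSystem (N : SymplecticConnection C B) (k : ℕ) :
    Unit ⊕ Fin n ⊕ (Fin n × Fin n) ⊕ {i : Fin n // k ≤ i} ⊕
      ({i : Fin n // k ≤ i} × {j : Fin n // j < k}) → OneForm (dimSp n) B :=
  Sum.elim (fun _ => N.theta0) <| Sum.elim (fun i => N.theta i) <|
    Sum.elim (fun p => N.bigTheta p.1 p.2) <| Sum.elim (fun i => N.omega i.1) <|
      fun p => N.alpha p.1.1 p.2.1

/-- The `k`-fold `σ : U → Y` is defined by `I_k`: locally it is the projection of a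
`k`-dimensional integral manifold of `I_k` in `B`. -/
def IsProjectionOfIntegral (N : SymplecticConnection C B) (k : ℕ) (U : Set (Euc k))
    (σ : Euc k → Y) : Prop :=
  ∀ x ∈ U, ∃ τ : Euc k → B, ∀ᶠ x' in 𝓝 x,
    ContMDiffAt (𝓡 k) (𝓡 (dimSp n)) ∞ τ x' ∧ N.proj (τ x') = σ x' ∧
    ∀ i (v : TangentSpace (𝓡 k) x'),
      N.flagSystem k i (τ x') (mfderiv (𝓡 k) (𝓡 (dimSp n)) τ x' v) = 0

end SymplecticConnection

/-- An isomorphism of symplectic connections over possibly different contact manifolds: an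
equivariant diffeomorphism `F` with `F^* Φ' = Φ`, covering a diffeomorphism `f`. -/
structure IsConnectionIso {C : ContactStructure n Y} {B : Type*} [TopologicalSpace B]
    [ChartedSpace (Euc (dimSp n)) B] [IsManifold (𝓡 (dimSp n)) ∞ B]
    {Y' : Type*} [TopologicalSpace Y'] [ChartedSpace (Euc (2 * n + 1)) Y']
    [IsManifold (𝓡 (2 * n + 1)) ∞ Y'] {C' : ContactStructure n Y'}
    {B' : Type*} [TopologicalSpace B']
    [ChartedSpace (Euc (dimSp n)) B'] [IsManifold (𝓡 (dimSp n)) ∞ B']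
    (N : SymplecticConnection C B) (N' : SymplecticConnection C' B')
    (F : Diffeomorph (𝓡 (dimSp n)) (𝓡 (dimSp n)) B B' ∞)
    (f : Diffeomorph (𝓡 (2 * n + 1)) (𝓡 (2 * n + 1)) Y Y' ∞) : Prop where
  covers : ∀ u, N'.proj (F u) = f (N.proj u)
  equivariant : ∀ u g, F (N.act u g) = N'.act (F u) g
  pullback : ∀ u v,
    N'.form (F u) (mfderiv (𝓡 (dimSp n)) (𝓡 (dimSp n)) F u v) = N.form u v

end Normal

end

end LegendrianGeometry

/-!
# Geodesic isotropic folds of a Legendrian connection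

In a chart of `Y`, a conformal symplectic connection `D` extends to a connection `∇ = d + Γ` on the
tangent bundle that makes a transversal field `t` with `θ(t) = 1` parallel
(`LocalConnection`, `exists_represents`). Let `τ` be `dθ` on `ker θ`, extended by `t ∈ ker τ`. The
hypotheses on `D` become: `∇θ = 0`, `∇τ = c ⊗ τ`; the torsion of `∇` vanishes on pairs `v, w` in
`ker θ` with `τ(v, w) = 0`; and the curvature `R(v, w)`, for `v, w` in an isotropic subspace `W`, maps
`W` into itself. The last property is what the Frobenius condition on the system of geodesic
Legendrian submanifolds says when it is evaluated on a Legendrian frame that is parallel at a point;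
it passes from Lagrangian to arbitrary isotropic subspaces because an isotropic subspace is the
intersection of the Lagrangian subspaces containing it (`curvature_mem_of_frobenius`).

*Existence and uniqueness.* Let `W` be isotropic at a point, parametrized by `ι`. The exponential
map on `W`, together with the parallel frame along its rays, is a map `u = (σ, A)` on a neighbourhood
of `0` that satisfies the radial equation `du(x) x = (A ι x, -Γ(A ι x) A)`. Radial equations have
smooth solutions (`exists_radial_flow`), by smooth dependence of integral curves on parameters, and
the germ of the solution is unique (`radial_flow_unique`). The pairs of a point and a frame carry a
coframe made of the soldering form and the connection form. By its structure equations, the system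
requiring these to lie in `W` and in the stabilizer of `W`, respectively, is Frobenius wherever the
frame maps `W` to an isotropic subspace, and parallel transport preserves isotropy. A radial solution
whose rays are integral curves of a Frobenius system is an integral manifold: along each ray the
components of `du` transversal to the system solve a homogeneous linear equation
(`radial_coframe_mem`). Hence the exponential image of `W` is isotropic and totally geodesic, that is,
its tangent planes `A(W)` are parallel (`exists_exp`, `eventually_isTotallyGeodesicAt_exp`).
Conversely, a totally geodesic fold is locally parametrized by the exponential map of its induced
connection, and the composition solves the radial equation of `σ` (`exists_reparam_exp`), so any two
folds with the same tangent plane have the same germ (`sameGerm_of_isTangentTo`).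

*The system `I_k`.* Modulo `θ₀`, the system says that `Φ` takes values in the algebra `flagAlg`
of matrices that stabilize the spans of the first `k + 1` and of the first `n + 1` standard basis
vectors. This algebra is closed under products, and normality makes the components of the curvature
belonging to the system multiples of `θ₀`, so `I_k` is Frobenius (`isFrobeniusAt_flagSystem`). The
radial argument, with `Φ` as the coframe, gives integral manifolds through every point
(`exists_integral_flagSystem`).

The connection is related to `Φ` by `chartFrame_covariant`: along every vector `X` tangent to
`B`, the covariant derivative of the frame has the matrix of `Φ(X)`, up to terms proportional to the
frame vector and to the projection of `X`. Along the local sections from which `D` arises this is the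
definition; equivariance carries it to sections through any point of `B`, and in the vertical
directions it is the derivative of the right action. On an integral manifold of `I_k` the matrix
preserves the span of the first `k` frame vectors, which is the tangent plane of the projection, so
the projection is geodesic. For the converse, every isotropic plane is spanned by the first `k`
vectors of the frame at some point of `B` over it: by the vanishing of the torsion of `Φ`, `dθ₀` is
the standard symplectic form in the frame, and isotropic families complete to symplectic bases
(`exists_adapted_point`). The projection of the integral manifold through this point is a
geodesic fold with the given tangent plane, and uniqueness of germs identifies it with any other.

*Invariance.* The forms of `I_k` are components of `Φ`, so an isomorphism of Cartan connections
carries integral manifolds to integral manifolds, and their projections to each other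
(`isGeodesicIsotropic_comp_iff`).
-/

namespace LegendrianGeometry

/-! ### Smooth dependence of radial flows on parameters -/

section Nemytskii

universe u

variable {K : Type*} [TopologicalSpace K] [CompactSpace K]
  {E F : Type u} [NormedAddCommGroup E] [NormedSpace ℝ E] [NormedAddCommGroup F] [NormedSpace ℝ F]

/-- Pointwise application of a continuous family of operators to a continuous map. -/
noncomputable def pointwiseApply (K : Type*) [TopologicalSpace K] [CompactSpace K] (E F : Type u)
    [NormedAddCommGroup E] [NormedSpace ℝ E] [NormedAddCommGroup F] [NormedSpace ℝ F] :
    C(K, E →L[ℝ] F) →L[ℝ] C(K, E) →L[ℝ] C(K, F) :=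
  LinearMap.mkContinuous₂
    (LinearMap.mk₂ ℝ
      (fun (A : C(K, E →L[ℝ] F)) (γ : C(K, E)) => (⟨fun t => A t (γ t), by fun_prop⟩ : C(K, F)))
      (fun A A' γ => by ext; simp) (fun c A γ => by ext; simp)
      (fun A γ γ' => by ext; simp) (fun c A γ => by ext; simp)) 1
    (fun A γ => by
      rw [ContinuousMap.norm_le _ (by positivity)]
      intro t
      simp only [LinearMap.mk₂_apply, ContinuousMap.coe_mk, one_mul]
      exact (A t).le_of_opNorm_le (A.norm_coe_le_norm t) _ |>.trans
        (by gcongr; exact γ.norm_coe_le_norm t))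

@[simp] lemma pointwiseApply_apply (A : C(K, E →L[ℝ] F)) (γ : C(K, E)) (t : K) :
    pointwiseApply K E F A γ t = A t (γ t) := rfl

lemma hasFDerivAt_postcomp (G : E → F) (hG : ContDiff ℝ 1 G) (γ : C(K, E)) :
    HasFDerivAt (fun γ : C(K, E) => (ContinuousMap.mk G hG.continuous).comp γ)
      (pointwiseApply K E F
        ((ContinuousMap.mk (fderiv ℝ G) (hG.continuous_fderiv one_ne_zero)).comp γ)) γ := by
  rw [hasFDerivAt_iff_isLittleO_nhds_zero, Asymptotics.isLittleO_iff]
  intro ε hε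
  obtain ⟨δ, hδ, hc⟩ := (Metric.continuous_iff (α := C(K, E))
    (β := C(K, E →L[ℝ] F))).1 (ContinuousMap.continuous_postcomp (X := K)
    (ContinuousMap.mk (fderiv ℝ G) (hG.continuous_fderiv one_ne_zero))) γ ε hε
  filter_upwards [Metric.ball_mem_nhds (0 : C(K, E)) hδ] with h hh
  rw [mem_ball_zero_iff] at hh
  rw [ContinuousMap.norm_le _ (by positivity)]
  intro t
  have key : ∀ x ∈ segment ℝ (γ t) (γ t + h t), ‖fderiv ℝ G x - fderiv ℝ G (γ t)‖ ≤ ε := by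
    intro x hx
    rw [segment_eq_image'] at hx
    obtain ⟨s, hs, rfl⟩ := hx
    have h1 : dist (γ + s • h) γ < δ := by
      rw [dist_eq_norm, add_sub_cancel_left, norm_smul]
      refine lt_of_le_of_lt ?_ hh
      rw [Real.norm_of_nonneg hs.1]
      exact mul_le_of_le_one_left (norm_nonneg _) hs.2
    have h2 := (ContinuousMap.dist_lt_iff hε).1 (hc _ h1) t
    rw [dist_eq_norm] at h2
    simpa using h2.le
  have := (convex_segment (𝕜 := ℝ) (γ t) (γ t + h t)).norm_image_sub_le_of_norm_hasFDerivWithin_le'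
    (fun x _ => ((hG.differentiable one_ne_zero) x).hasFDerivAt.hasFDerivWithinAt) key
    (left_mem_segment ..) (right_mem_segment ..)
  simp only [add_sub_cancel_left] at this
  simpa using this.trans (by gcongr; exact h.norm_coe_le_norm t)

/-- The composition operator `γ ↦ G ∘ γ` on continuous maps from a compact space is smooth when
`G` is. -/
lemma contDiff_postcomp_nat (n : ℕ) : ∀ {F : Type u} [NormedAddCommGroup F] [NormedSpace ℝ F]
    (G : E → F) (hG : ContDiff ℝ n G),
    ContDiff ℝ n (fun γ : C(K, E) => (ContinuousMap.mk G hG.continuous).comp γ) := by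
  induction n with
  | zero =>
    intro F _ _ G hG
    exact contDiff_zero.2 (ContinuousMap.continuous_postcomp _)
  | succ n ih =>
    intro F _ _ G hG
    have hG' : ContDiff ℝ ((n : WithTop ℕ∞) + 1) G := by exact_mod_cast hG
    have h1 : ContDiff ℝ 1 G := hG'.of_le (by simp)
    have h2 : ContDiff ℝ n (fderiv ℝ G) := (contDiff_succ_iff_fderiv.1 hG').2.2
    have : ContDiff ℝ ((n : WithTop ℕ∞) + 1)
        (fun γ : C(K, E) => (ContinuousMap.mk G hG.continuous).comp γ) := by
      rw [contDiff_succ_iff_hasFDerivAt]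
      exact ⟨_, (pointwiseApply K E F).contDiff.comp (ih (fderiv ℝ G) h2),
        hasFDerivAt_postcomp G h1⟩
    exact_mod_cast this

lemma contDiff_postcomp (G : E → F) (hG : ContDiff ℝ ∞ G) :
    ContDiff ℝ ∞ (fun γ : C(K, E) => (ContinuousMap.mk G hG.continuous).comp γ) := by
  rw [contDiff_infty]
  intro n
  exact contDiff_postcomp_nat n G (hG.of_le (by exact_mod_cast le_top))

end Nemytskii

section Inverse

variable {E F : Type*} [NormedAddCommGroup E] [NormedSpace ℝ E] [CompleteSpace E]
  [NormedAddCommGroup F] [NormedSpace ℝ F]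

/-- Inverse function theorem with a local inverse that is smooth on its whole domain. -/
lemma exists_smooth_localInverse {f : E → F} {a : E} {f' : E ≃L[ℝ] F}
    (hf : ∀ᶠ x in 𝓝 a, ContDiffAt ℝ ∞ f x) (hf' : HasFDerivAt f (f' : E →L[ℝ] F) a)
    {s : Set E} (hs : s ∈ 𝓝 a) :
    ∃ φ : OpenPartialHomeomorph E F, a ∈ φ.source ∧ φ.source ⊆ s ∧ (∀ x, φ x = f x) ∧
      (∀ x ∈ φ.source, ContDiffAt ℝ ∞ f x) ∧ ∀ y ∈ φ.target, ContDiffAt ℝ ∞ φ.symm y := by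
  have ha : ContDiffAt ℝ ∞ f a := hf.self_of_nhds
  let φ₀ := ha.toOpenPartialHomeomorph f hf' (by simp)
  have hc : ContinuousAt (fderiv ℝ f) a := (ha.fderiv_right (m := 0) (by simp)).continuousAt
  have hinv : ∀ᶠ x in 𝓝 a, fderiv ℝ f x ∈ Set.range
      (ContinuousLinearEquiv.toContinuousLinearMap : (E ≃L[ℝ] F) → E →L[ℝ] F) := by
    apply hc
    rw [hf'.fderiv]
    exact f'.nhds
  obtain ⟨t, ht, hto, hat⟩ := eventually_nhds_iff.1 (hf.and (hinv.and hs))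
  refine ⟨φ₀.restrOpen t hto, ⟨ha.mem_toOpenPartialHomeomorph_source hf' (by simp), hat⟩,
    fun x hx => (ht x hx.2).2.2, fun x => rfl, fun x hx => (ht x hx.2).1, fun y hy => ?_⟩
  have hy' := (φ₀.restrOpen t hto).map_target hy
  obtain ⟨h1, ⟨e, he⟩, -⟩ := ht _ hy'.2
  refine (φ₀.restrOpen t hto).contDiffAt_symm (f₀' := e) hy ?_ h1
  rw [he]
  exact (h1.differentiableAt (by simp)).hasFDerivAt

end Inverse

section Flow

universe u

variable {E : Type u} [NormedAddCommGroup E] [NormedSpace ℝ E] [CompleteSpace E]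

/-- The primitive vanishing at `0` of a curve on `[0, 1]`. -/
noncomputable def primitive (E : Type u) [NormedAddCommGroup E] [NormedSpace ℝ E]
    [CompleteSpace E] : C(Set.Icc (0 : ℝ) 1, E) →L[ℝ] C(Set.Icc (0 : ℝ) 1, E) :=
  LinearMap.mkContinuous
    { toFun := fun δ => ⟨fun t => ∫ s in (0 : ℝ)..t, Set.IccExtend zero_le_one δ s, by
        have : Continuous (Set.IccExtend (zero_le_one' ℝ) δ) := δ.continuous.Icc_extend'
        exact (intervalIntegral.continuous_primitive
          (fun a b => this.intervalIntegrable a b) 0).comp continuous_subtype_val⟩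
      map_add' := fun δ δ' => by
        have h : ∀ δ : C(Set.Icc (0 : ℝ) 1, E), Continuous (Set.IccExtend (zero_le_one' ℝ) δ) :=
          fun δ => δ.continuous.Icc_extend'
        ext t
        exact intervalIntegral.integral_add ((h δ).intervalIntegrable _ _)
          ((h δ').intervalIntegrable _ _)
      map_smul' := fun c δ => by
        ext t
        exact intervalIntegral.integral_smul c _ } 1
    (fun δ => by
      rw [ContinuousMap.norm_le _ (by positivity)]
      intro t
      have := intervalIntegral.norm_integral_le_of_norm_le_const (a := (0 : ℝ)) (b := t)
        (f := Set.IccExtend (zero_le_one' ℝ) δ) (C := ‖δ‖)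
        (fun x _ => δ.norm_coe_le_norm _)
      refine this.trans ?_
      rw [sub_zero, abs_of_nonneg t.2.1, mul_comm]
      gcongr
      exact t.2.2)

lemma primitive_apply (δ : C(Set.Icc (0 : ℝ) 1, E)) (t : Set.Icc (0 : ℝ) 1) :
    primitive E δ t = ∫ s in (0 : ℝ)..t, Set.IccExtend zero_le_one δ s := rfl

lemma hasDerivAt_primitive (δ : C(Set.Icc (0 : ℝ) 1, E)) (t : ℝ) :
    HasDerivAt (fun t => ∫ s in (0 : ℝ)..t, Set.IccExtend zero_le_one δ s)
      (Set.IccExtend zero_le_one δ t) t := by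
  have : Continuous (Set.IccExtend (zero_le_one' ℝ) δ) := δ.continuous.Icc_extend'
  exact intervalIntegral.integral_hasDerivAt_right (this.intervalIntegrable _ _)
    (this.stronglyMeasurableAtFilter _ _) this.continuousAt

/-- A curve on `[0, 1]` with continuous derivative is its initial value plus the primitive of its
derivative. -/
lemma primitive_eq_of_hasDerivAt (γ δ : C(Set.Icc (0 : ℝ) 1, E)) (c : ℝ → E)
    (hc : ∀ t : Set.Icc (0 : ℝ) 1, γ t = c t)
    (hd : ∀ t : Set.Icc (0 : ℝ) 1, HasDerivAt c (δ t) t) (t : Set.Icc (0 : ℝ) 1) :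
    γ t = c 0 + primitive E δ t := by
  rw [primitive_apply, hc]
  have hcont : Continuous (Set.IccExtend (zero_le_one' ℝ) δ) := δ.continuous.Icc_extend'
  have hmem : ∀ x ∈ Set.uIcc (0 : ℝ) t, x ∈ Set.Icc (0 : ℝ) 1 := by
    intro x hx
    rw [Set.uIcc_of_le t.2.1] at hx
    exact ⟨hx.1, hx.2.trans t.2.2⟩
  rw [intervalIntegral.integral_eq_sub_of_hasDerivAt (f := c) (fun x hx => ?_)
    (hcont.intervalIntegrable _ _)]
  · abel
  · rw [Set.IccExtend_of_mem _ _ (hmem x hx)]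
    exact hd ⟨x, hmem x hx⟩

end Flow

/-- A function smooth near a point agrees near it with a globally smooth function. -/
lemma exists_contDiff_eventuallyEq {E F : Type*} [NormedAddCommGroup E] [NormedSpace ℝ E]
    [FiniteDimensional ℝ E] [NormedAddCommGroup F] [NormedSpace ℝ F] {f : E → F} {a : E}
    (hf : ∀ᶠ x in 𝓝 a, ContDiffAt ℝ ∞ f x) : ∃ g : E → F, ContDiff ℝ ∞ g ∧ g =ᶠ[𝓝 a] f := by
  obtain ⟨r, hr, h⟩ := Metric.eventually_nhds_iff_ball.1 hf
  let χ : ContDiffBump a := ⟨r / 4, r / 2, by positivity, by linarith⟩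
  refine ⟨fun x => χ x • f x, contDiff_iff_contDiffAt.2 fun x => ?_, ?_⟩
  · by_cases hx : x ∈ tsupport χ
    · rw [χ.tsupport_eq] at hx
      have : x ∈ Metric.ball a r :=
        Metric.closedBall_subset_ball (show χ.rOut < r by change r / 2 < r; linarith) hx
      exact χ.contDiff.contDiffAt.smul (h x this)
    · have := notMem_tsupport_iff_eventuallyEq.1 hx
      refine (contDiffAt_const (c := (0 : F))).congr_of_eventuallyEq ?_
      filter_upwards [this] with z hz
      simp [hz]
  · filter_upwards [χ.eventuallyEq_one] with x hx
    simp [hx]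

section Radial

variable {E X : Type*} [NormedAddCommGroup E] [NormedSpace ℝ E] [FiniteDimensional ℝ E]
  [NormedAddCommGroup X] [NormedSpace ℝ X] [FiniteDimensional ℝ X]

/-- The equation `du(x) x = G(u(x)) x` has a smooth solution near `0` with prescribed value
at `0`. The solution is `u(x) = γ(1)` for the curve with `γ' = G(γ) x` and `γ(0) = u₀`. -/
theorem exists_radial_flow (G : E → X →L[ℝ] E) (u₀ : E) (hG : ∀ᶠ u in 𝓝 u₀, ContDiffAt ℝ ∞ G u) :
    ∃ u : X → E, u 0 = u₀ ∧
      ∀ᶠ x in 𝓝 (0 : X), ContDiffAt ℝ ∞ u x ∧ fderiv ℝ u x x = G (u x) x := by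
  have : CompleteSpace E := FiniteDimensional.complete ℝ E
  have : CompleteSpace X := FiniteDimensional.complete ℝ X
  obtain ⟨H, hH, hHG⟩ := exists_contDiff_eventuallyEq hG
  -- The parameter `x` becomes part of the state, so that only a fixed vector field is composed.
  let V : E × X → E × X := fun q => (H q.1 q.2, 0)
  have hV : ContDiff ℝ ∞ V := by
    have h1 : ContDiff ℝ ∞ (fun q : E × X => H q.1) := hH.comp contDiff_fst
    exact (h1.clm_apply contDiff_snd).prodMk contDiff_const
  let p : E × X := (u₀, 0)
  let A : E × X →L[ℝ] E × X := ((H u₀).comp (ContinuousLinearMap.snd ℝ E X)).prod 0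
  have hA : HasFDerivAt V A p := by
    have h1 : HasFDerivAt (fun q : E × X => H q.1) _ p :=
      ((hH.differentiable (by simp)) u₀).hasFDerivAt.comp p hasFDerivAt_fst
    have h2 := (h1.clm_apply (hasFDerivAt_snd (𝕜 := ℝ) (p := p))).prodMk
      (hasFDerivAt_const (0 : X) p)
    refine h2.congr_fderiv ?_
    ext q <;> simp [A, p]
  have hAA : ∀ q, A (A q) = 0 := fun q => by simp [A]
  let c : E × X → C(Set.Icc (0 : ℝ) 1, E × X) := ContinuousMap.const _
  have hc : ContDiff ℝ ∞ c :=
    (ContinuousLinearMap.const ℝ (Set.Icc (0 : ℝ) 1) : E × X →L[ℝ] _).contDiff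
  let N : C(Set.Icc (0 : ℝ) 1, E × X) →L[ℝ] C(Set.Icc (0 : ℝ) 1, E × X) :=
    (primitive (E × X)).comp (pointwiseApply (Set.Icc (0 : ℝ) 1) (E × X) (E × X)
      (ContinuousMap.const _ A))
  have hNN : ∀ δ, N (N δ) = 0 := by
    intro δ
    have h : ∀ t, A (N δ t) = 0 := by
      intro t
      change A (∫ s in (0 : ℝ)..t, Set.IccExtend zero_le_one
        (pointwiseApply (Set.Icc (0 : ℝ) 1) (E × X) (E × X) (ContinuousMap.const _ A) δ) s) = 0
      rw [← A.intervalIntegral_comp_comm]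
      · simp only [Set.IccExtend, Function.comp, pointwiseApply_apply, ContinuousMap.const_apply,
          hAA, intervalIntegral.integral_zero]
      · exact (ContinuousMap.continuous _).Icc_extend'.intervalIntegrable _ _
    have : pointwiseApply (Set.Icc (0 : ℝ) 1) (E × X) (E × X) (ContinuousMap.const _ A) (N δ) = 0 := by
      ext1 t
      exact h t
    change primitive (E × X) (pointwiseApply (Set.Icc (0 : ℝ) 1) (E × X) (E × X)
      (ContinuousMap.const _ A) (N δ)) = 0
    rw [this, map_zero]
  let e : C(Set.Icc (0 : ℝ) 1, E × X) ≃L[ℝ] C(Set.Icc (0 : ℝ) 1, E × X) :=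
    ContinuousLinearEquiv.equivOfInverse (ContinuousLinearMap.id ℝ _ - N)
      (ContinuousLinearMap.id ℝ _ + N)
      (fun δ => by simp [hNN]) (fun δ => by simp [hNN])
  let Vc : C(Set.Icc (0 : ℝ) 1, E × X) → C(Set.Icc (0 : ℝ) 1, E × X) :=
    fun γ => (ContinuousMap.mk V hV.continuous).comp γ
  let Ψ : C(Set.Icc (0 : ℝ) 1, E × X) → C(Set.Icc (0 : ℝ) 1, E × X) :=
    fun γ => γ - primitive (E × X) (Vc γ)
  have hΨ : ContDiff ℝ ∞ Ψ :=
    contDiff_id.sub ((primitive (E × X)).contDiff.comp (contDiff_postcomp V hV))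
  have hΨ' : HasFDerivAt Ψ (e : _ →L[ℝ] _) (c p) := by
    have h1 := (hasFDerivAt_id (𝕜 := ℝ) (c p)).sub ((primitive (E × X)).hasFDerivAt.comp (c p)
      (hasFDerivAt_postcomp V (hV.of_le (by simp)) (c p)))
    refine h1.congr_fderiv ?_
    have h2 : ((ContinuousMap.mk (fderiv ℝ V)
        ((hV.of_le (by simp : (1 : WithTop ℕ∞) ≤ ∞)).continuous_fderiv one_ne_zero)).comp (c p))
        = ContinuousMap.const _ A := by
      ext1 t
      exact hA.fderiv
    rw [h2]
    rfl
  obtain ⟨φ, hφp, -, hφ, -, hφs⟩ := exists_smooth_localInverse (a := c p) (f' := e)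
    (Eventually.of_forall fun γ => hΨ.contDiffAt) hΨ' univ_mem
  have hVp : V p = 0 := by simp [V, p]
  have hΨp : Ψ (c p) = c p := by
    have : Vc (c p) = 0 := by ext1 t; exact hVp
    simp only [Ψ, this, map_zero, sub_zero]
  have hsymm : φ.symm (c p) = c p := by
    have := φ.left_inv hφp
    rwa [hφ, hΨp] at this
  have hct : c p ∈ φ.target := by
    have := φ.map_source hφp
    rwa [hφ, hΨp] at this
  obtain ⟨r, hr, hball⟩ := Metric.isOpen_iff.1 φ.open_source _ hφp
  let j : X → C(Set.Icc (0 : ℝ) 1, E × X) := fun x => c (u₀, x)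
  have hj : ContDiff ℝ ∞ j := hc.comp (contDiff_const.prodMk contDiff_id)
  let γ : X → C(Set.Icc (0 : ℝ) 1, E × X) := fun x => φ.symm (j x)
  have hγ0 : γ 0 = c p := hsymm
  have htarget : ∀ᶠ x in 𝓝 (0 : X), j x ∈ φ.target :=
    hj.continuous.continuousAt.eventually_mem (φ.open_target.mem_nhds hct)
  have hγsm : ∀ᶠ x in 𝓝 (0 : X), ContDiffAt ℝ ∞ γ x := by
    filter_upwards [htarget] with x hx
    exact (hφs _ hx).comp x hj.contDiffAt
  have hγball : ∀ᶠ x in 𝓝 (0 : X), γ x ∈ Metric.ball (c p) r := by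
    apply hγsm.self_of_nhds.continuousAt
    rw [hγ0]
    exact Metric.ball_mem_nhds _ hr
  let one : Set.Icc (0 : ℝ) 1 := ⟨1, by simp⟩
  let ev : C(Set.Icc (0 : ℝ) 1, E × X) →L[ℝ] E :=
    (ContinuousLinearMap.fst ℝ E X).comp (ContinuousMap.evalCLM ℝ one)
  let u : X → E := fun x => ev (γ x)
  have hu0 : u 0 = u₀ := by simp only [u, hγ0]; rfl
  have husm : ∀ᶠ x in 𝓝 (0 : X), ContDiffAt ℝ ∞ u x := by
    filter_upwards [hγsm] with x hx
    exact ev.contDiff.contDiffAt.comp x hx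
  have hnear : ∀ᶠ x in 𝓝 (0 : X), H (u x) = G (u x) := by
    have h1 := husm.self_of_nhds.continuousAt
    rw [ContinuousAt, hu0] at h1
    exact h1.eventually hHG
  refine ⟨u, hu0, ?_⟩
  filter_upwards [htarget, hγball, husm, hnear] with x hx hxb hxs hxn
  refine ⟨hxs, ?_⟩
  have hφγ : Ψ (γ x) = j x := by rw [← hφ]; exact φ.right_inv hx
  -- The curve through `(u₀, x)`, extended to all times.
  let C : ℝ → E × X := fun t => (u₀, x) + ∫ s in (0 : ℝ)..t, Set.IccExtend zero_le_one (Vc (γ x)) s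
  have hγC : ∀ t : Set.Icc (0 : ℝ) 1, γ x t = C t := by
    intro t
    have := DFunLike.congr_fun hφγ t
    exact eq_add_of_sub_eq this
  have hCd : ∀ t : Set.Icc (0 : ℝ) 1, HasDerivAt C (V (γ x t)) t := by
    intro t
    have := (hasDerivAt_primitive (Vc (γ x)) t).const_add (u₀, x)
    rwa [Set.IccExtend_of_mem _ _ t.2] at this
  have hC2 : ∀ t : Set.Icc (0 : ℝ) 1, (C t).2 = x := by
    intro t
    change x + (∫ s in (0 : ℝ)..t, Set.IccExtend zero_le_one (Vc (γ x)) s).2 = x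
    have h0 := (ContinuousLinearMap.snd ℝ E X).intervalIntegral_comp_comm (μ := MeasureTheory.volume)
      (a := 0) (b := t) (f := Set.IccExtend zero_le_one (Vc (γ x)))
      ((ContinuousMap.continuous _).Icc_extend'.intervalIntegrable _ _)
    have h1 : ∀ s, (ContinuousLinearMap.snd ℝ E X)
        (Set.IccExtend (zero_le_one' ℝ) (Vc (γ x)) s) = 0 := fun s => rfl
    simp only [h1, intervalIntegral.integral_zero] at h0
    exact (congrArg (x + ·) h0.symm).trans (add_zero x)
  have hVγ : ∀ t : Set.Icc (0 : ℝ) 1, V (γ x t) = (H (γ x t).1 x, 0) := by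
    intro t
    simp only [V]
    rw [hγC t, hC2]
  -- Rescaling time: the curve through `(u₀, s x)` is the one through `(u₀, x)` slowed down.
  have hscale : ∀ s : Set.Icc (0 : ℝ) 1, u ((s : ℝ) • x) = (C s).1 := by
    intro s
    let m : Set.Icc (0 : ℝ) 1 → Set.Icc (0 : ℝ) 1 := fun t => ⟨s * t, by
      exact ⟨mul_nonneg s.2.1 t.2.1, mul_le_one₀ s.2.2 t.2.1 t.2.2⟩⟩
    have hm : Continuous m := by
      refine Continuous.subtype_mk ?_ _
      fun_prop
    let δ : C(Set.Icc (0 : ℝ) 1, E × X) :=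
      ⟨fun t => ((γ x (m t)).1, (s : ℝ) • x), by fun_prop⟩
    have hδ : δ ∈ φ.source := by
      apply hball
      rw [Metric.mem_ball, ContinuousMap.dist_lt_iff hr] at hxb ⊢
      intro t
      have h1 := hxb (m t)
      rw [Prod.dist_eq, max_lt_iff] at h1 ⊢
      refine ⟨h1.1, lt_of_le_of_lt ?_ h1.2⟩
      rw [hγC, hC2]
      change dist ((s : ℝ) • x) 0 ≤ dist x 0
      rw [dist_zero_right, dist_zero_right, norm_smul, Real.norm_of_nonneg s.2.1]
      exact mul_le_of_le_one_left (norm_nonneg _) s.2.2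
    have hΨδ : Ψ δ = j ((s : ℝ) • x) := by
      ext1 t
      have h1 := primitive_eq_of_hasDerivAt δ (Vc δ) (fun t => ((C (s * t)).1, (s : ℝ) • x))
        (fun t => by
          change ((γ x (m t)).1, (s : ℝ) • x) = _
          rw [hγC (m t)])
        (fun t => by
          have h2 := hCd (m t)
          have h3 : HasDerivAt (fun t : ℝ => (s : ℝ) * t) s t := by
            simpa using (hasDerivAt_id (t : ℝ)).const_mul (s : ℝ)
          have h4 := h2.scomp (t : ℝ) h3
          have h5 := ((ContinuousLinearMap.fst ℝ E X).hasFDerivAt.comp_hasDerivAt (t : ℝ) h4).prodMk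
            (hasDerivAt_const (t : ℝ) ((s : ℝ) • x))
          refine h5.congr_deriv ?_
          change _ = (H (γ x (m t)).1 ((s : ℝ) • x), (0 : X))
          rw [hVγ]
          simp) t
      have h6 : C ((s : ℝ) * 0) = (u₀, x) := by simp [C]
      change δ t - primitive (E × X) (Vc δ) t = (u₀, (s : ℝ) • x)
      rw [h1, h6]
      simp
    have : γ ((s : ℝ) • x) = δ := by
      change φ.symm (j ((s : ℝ) • x)) = δ
      rw [← hΨδ, ← hφ]
      exact φ.left_inv hδ
    change (γ ((s : ℝ) • x) one).1 = _
    rw [this]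
    change (γ x (m one)).1 = _
    rw [hγC]
    simp [m, one]
  have hd1 : HasDerivAt (fun s : ℝ => u (s • x)) (fderiv ℝ u x x) 1 := by
    have h1 : HasFDerivAt u (fderiv ℝ u x) ((1 : ℝ) • x) := by
      rw [one_smul]; exact (hxs.differentiableAt (by simp)).hasFDerivAt
    have h2 : HasDerivAt (fun s : ℝ => s • x) x 1 := by
      simpa using (hasDerivAt_id (1 : ℝ)).smul_const x
    exact h1.comp_hasDerivAt 1 h2
  have hd2 : HasDerivAt (fun s : ℝ => (C s).1) (H (u x) x) 1 := by
    have h1 := (ContinuousLinearMap.fst ℝ E X).hasFDerivAt.comp_hasDerivAt (1 : ℝ) (hCd one)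
    refine h1.congr_deriv ?_
    rw [hVγ]
    rfl
  rw [← hxn]
  have hmem : (1 : ℝ) ∈ Set.Icc (0 : ℝ) 1 := by simp
  refine (uniqueDiffOn_Icc (zero_lt_one' ℝ) 1 hmem).eq_deriv _ hd1.hasDerivWithinAt
    (hd2.hasDerivWithinAt.congr (fun s hs => hscale ⟨s, hs⟩) (hscale one))

end Radial

/-! ### Linear differential equations along rays -/

/-- A solution of an inhomogeneous linear differential equation stays in a subspace that is
invariant under the coefficients and contains the inhomogeneity. -/
lemma mem_of_linear_ode {F : Type*} [NormedAddCommGroup F] [NormedSpace ℝ F]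
    [FiniteDimensional ℝ F] (q : Submodule ℝ F) (A : ℝ → F →L[ℝ] F) (b m : ℝ → F)
    (hA : ContinuousOn A (Set.Icc 0 1))
    (hm : ∀ t ∈ Set.Icc (0 : ℝ) 1, HasDerivAt m (A t (m t) + b t) t)
    (hq : ∀ t ∈ Set.Icc (0 : ℝ) 1, ∀ x ∈ q, A t x ∈ q)
    (hb : ∀ t ∈ Set.Icc (0 : ℝ) 1, b t ∈ q) (h0 : m 0 ∈ q) :
    ∀ t ∈ Set.Icc (0 : ℝ) 1, m t ∈ q := by
  obtain ⟨f, hf⟩ := Submodule.ClosedComplemented.of_finiteDimensional (𝕜 := ℝ) q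
  let P : F →L[ℝ] F := ContinuousLinearMap.id ℝ F - q.subtypeL.comp f
  have hP0 : ∀ x ∈ q, P x = 0 := by
    intro x hx
    have := hf ⟨x, hx⟩
    simp [P, this]
  have hPq : ∀ x, x - P x ∈ q := by
    intro x
    simp [P]
  obtain ⟨K, hK⟩ := isCompact_Icc.exists_bound_of_continuousOn
    (f := fun t => P.comp (A t)) ((ContinuousLinearMap.compL ℝ F F F P).continuous.comp_continuousOn hA)
  have hd : ∀ t ∈ Set.Icc (0 : ℝ) 1, HasDerivAt (fun t => P (m t)) (P.comp (A t) (P (m t))) t := by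
    intro t ht
    have h1 := P.hasFDerivAt.comp_hasDerivAt t (hm t ht)
    refine h1.congr_deriv ?_
    have h2 := hP0 _ (hq t ht _ (hPq (m t)))
    have h3 := hP0 _ (hb t ht)
    rw [map_sub, map_sub, sub_eq_zero] at h2
    rw [map_add, h3, add_zero, h2]
    rfl
  have := eq_zero_of_abs_deriv_le_mul_abs_self_of_eq_zero_right (K := K)
    (fun t ht => (hd t ht).continuousAt.continuousWithinAt)
    (fun t ht => (hd t ⟨ht.1, ht.2.le⟩).hasDerivWithinAt) (hP0 _ h0)
    (fun t ht => (P.comp (A t)).le_of_opNorm_le (hK t ⟨ht.1, ht.2.le⟩) _)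
  intro t ht
  have h := hPq (m t)
  rwa [this t ht, sub_zero] at h

section Radial

variable {E X : Type*} [NormedAddCommGroup E] [NormedSpace ℝ E]
  [NormedAddCommGroup X] [NormedSpace ℝ X]

/-- A property that holds near `0` holds along all rays from `0` to points near `0`. -/
lemma eventually_forall_ray {P : X → Prop} (h : ∀ᶠ x in 𝓝 (0 : X), P x) :
    ∀ᶠ x in 𝓝 (0 : X), ∀ t ∈ Set.Icc (0 : ℝ) 1, P (t • x) := by
  obtain ⟨r, hr, h⟩ := Metric.eventually_nhds_iff_ball.1 h
  filter_upwards [Metric.ball_mem_nhds (0 : X) hr] with x hx t ht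
  apply h
  rw [mem_ball_zero_iff] at hx ⊢
  rw [norm_smul, Real.norm_of_nonneg ht.1]
  exact lt_of_le_of_lt (mul_le_of_le_one_left (norm_nonneg _) ht.2) hx

lemma hasDerivAt_comp_ray {u : X → E} {x : X} {t : ℝ} (h : DifferentiableAt ℝ u (t • x)) :
    HasDerivAt (fun s : ℝ => u (s • x)) (fderiv ℝ u (t • x) x) t := by
  have h2 : HasDerivAt (fun s : ℝ => s • x) x t := by
    simpa using (hasDerivAt_id t).smul_const x
  exact h.hasFDerivAt.comp_hasDerivAt t h2

/-- The derivative at `0` of a solution of a radial equation `H(x) x = L(x) x`. -/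
lemma radial_eq_at_zero {H L : X → X →L[ℝ] E} (hH : ContinuousAt H 0) (hL : ContinuousAt L 0)
    (h : ∀ᶠ x in 𝓝 (0 : X), H x x = L x x) : H 0 = L 0 := by
  ext v
  have hs : Tendsto (fun t : ℝ => t • v) (𝓝 0) (𝓝 (0 : X)) := by
    have : Continuous (fun t : ℝ => t • v) := by fun_prop
    simpa using this.tendsto 0
  have h1 : Tendsto (fun t : ℝ => H (t • v) v) (𝓝[≠] 0) (𝓝 (H 0 v)) :=
    ((ContinuousLinearMap.apply ℝ E v).continuous.tendsto _ |>.comp (hH.tendsto.comp hs)).mono_left nhdsWithin_le_nhds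
  have h2 : Tendsto (fun t : ℝ => L (t • v) v) (𝓝[≠] 0) (𝓝 (L 0 v)) :=
    ((ContinuousLinearMap.apply ℝ E v).continuous.tendsto _ |>.comp (hL.tendsto.comp hs)).mono_left nhdsWithin_le_nhds
  refine tendsto_nhds_unique h1 (h2.congr' ?_)
  filter_upwards [(hs.eventually h).filter_mono nhdsWithin_le_nhds, self_mem_nhdsWithin]
    with t ht ht0
  rw [map_smul, map_smul] at ht
  exact (smul_right_injective E ht0 ht).symm

/-- A function with value `0` at `0` satisfying a homogeneous linear differential equation along
rays vanishes near `0`. -/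
lemma eventually_eq_zero_of_radial {f : X → E} {c : X → X →L[ℝ] ℝ} (h0 : f 0 = 0)
    (h : ∀ᶠ x in 𝓝 (0 : X), ContDiffAt ℝ 1 f x ∧ ContinuousAt c x ∧
      fderiv ℝ f x x = c x x • f x) :
    ∀ᶠ x in 𝓝 (0 : X), f x = 0 := by
  have hz : fderiv ℝ f 0 = (c 0).smulRight (f 0) := by
    refine radial_eq_at_zero (L := fun x => (c x).smulRight (f x))
      (h.self_of_nhds.1.fderiv_right (m := 0) (by simp)).continuousAt ?_ (h.mono fun x hx => ?_)
    · exact (ContinuousLinearMap.smulRightL ℝ X E).continuous₂.continuousAt.comp₂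
        h.self_of_nhds.2.1 h.self_of_nhds.1.continuousAt
    · simpa using hx.2.2
  filter_upwards [eventually_forall_ray h] with x hx
  have hc : ContinuousOn (fun t : ℝ => c (t • x) x) (Set.Icc 0 1) := by
    intro t ht
    have h1 : ContinuousAt (fun t : ℝ => c (t • x)) t :=
      (hx t ht).2.1.comp (f := fun t : ℝ => t • x) (by fun_prop)
    exact (h1.clm_apply continuousAt_const).continuousWithinAt
  obtain ⟨K, hK⟩ := isCompact_Icc.exists_bound_of_continuousOn hc
  have hd : ∀ t ∈ Set.Icc (0 : ℝ) 1,
      HasDerivAt (fun s : ℝ => f (s • x)) (c (t • x) x • f (t • x)) t := by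
    intro t ht
    refine (hasDerivAt_comp_ray ((hx t ht).1.differentiableAt (by simp))).congr_deriv ?_
    by_cases ht0 : t = 0
    · rw [ht0, zero_smul, hz]
      simp
    · have := (hx t ht).2.2
      rw [map_smul, map_smul, smul_assoc] at this
      exact smul_right_injective E ht0 this
  have := eq_zero_of_abs_deriv_le_mul_abs_self_of_eq_zero_right (K := K) (a := 0) (b := 1)
    (fun t ht => (hd t ht).continuousAt.continuousWithinAt)
    (fun t ht => (hd t ⟨ht.1, ht.2.le⟩).hasDerivWithinAt) (by simpa using h0)
    (fun t ht => by
      rw [norm_smul]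
      gcongr
      exact hK t ⟨ht.1, ht.2.le⟩) 1 (by simp)
  simpa using this

/-- Two solutions of the same radial equation with the same value at `0` have the same germ. -/
theorem radial_flow_unique {G : E → X →L[ℝ] E} {u v : X → E} (hG : ContDiffAt ℝ 1 G (u 0))
    (h0 : u 0 = v 0)
    (hu : ∀ᶠ x in 𝓝 (0 : X), ContDiffAt ℝ ∞ u x ∧ fderiv ℝ u x x = G (u x) x)
    (hv : ∀ᶠ x in 𝓝 (0 : X), ContDiffAt ℝ ∞ v x ∧ fderiv ℝ v x x = G (v x) x) :
    u =ᶠ[𝓝 0] v := by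
  have huc := hu.self_of_nhds.1.continuousAt
  have hvc := hv.self_of_nhds.1.continuousAt
  have hzero : ∀ w : X → E, w 0 = u 0 → (∀ᶠ x in 𝓝 (0 : X), ContDiffAt ℝ ∞ w x ∧
      fderiv ℝ w x x = G (w x) x) → fderiv ℝ w 0 = G (w 0) := by
    intro w hw0 hw
    refine radial_eq_at_zero (L := fun x => G (w x))
      (hw.self_of_nhds.1.fderiv_right (m := 0) (by simp)).continuousAt ?_ (hw.mono fun x h => h.2)
    refine ContinuousAt.comp ?_ hw.self_of_nhds.1.continuousAt
    rw [hw0]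
    exact hG.continuousAt
  have hray : ∀ w : X → E, w 0 = u 0 → (∀ᶠ x in 𝓝 (0 : X), ContDiffAt ℝ ∞ w x ∧
      fderiv ℝ w x x = G (w x) x) → ∀ᶠ x in 𝓝 (0 : X), ∀ t ∈ Set.Icc (0 : ℝ) 1,
      HasDerivAt (fun s : ℝ => w (s • x)) (G (w (t • x)) x) t := by
    intro w hw0 hw
    filter_upwards [eventually_forall_ray hw] with x hx t ht
    refine (hasDerivAt_comp_ray ((hx t ht).1.differentiableAt (by simp))).congr_deriv ?_
    by_cases ht0 : t = 0
    · rw [ht0, zero_smul, hzero w hw0 hw]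
    · have := (hx t ht).2
      rw [map_smul, map_smul] at this
      exact smul_right_injective E ht0 this
  obtain ⟨K, s, hs, hK⟩ := hG.exists_lipschitzOnWith
  filter_upwards [hray u rfl hu, hray v h0.symm hv, eventually_forall_ray (huc.eventually_mem hs),
    eventually_forall_ray (hvc.eventually_mem (h0 ▸ hs))] with x h1 h2 h3 h4
  have := eq_zero_of_abs_deriv_le_mul_abs_self_of_eq_zero_right (K := K * ‖x‖) (a := 0) (b := 1)
    (f := fun t : ℝ => u (t • x) - v (t • x))
    (fun t ht => ((h1 t ht).sub (h2 t ht)).continuousAt.continuousWithinAt)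
    (fun t ht => ((h1 t ⟨ht.1, ht.2.le⟩).sub (h2 t ⟨ht.1, ht.2.le⟩)).hasDerivWithinAt)
    (by simp [h0])
    (fun t ht => by
      rw [← sub_apply]
      refine ((_ : X →L[ℝ] E).le_of_opNorm_le
        (hK.norm_sub_le (h3 t ⟨ht.1, ht.2.le⟩) (h4 t ⟨ht.1, ht.2.le⟩)) x).trans (le_of_eq ?_)
      ring) 1 (by simp)
  simpa [sub_eq_zero] using this

end Radial

section Coframe

variable {E F X : Type*} [NormedAddCommGroup E] [NormedSpace ℝ E]
  [NormedAddCommGroup F] [NormedSpace ℝ F]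
  [NormedAddCommGroup X] [NormedSpace ℝ X]

/-- The exterior derivative of a vector-valued 1-form on a vector space. -/
noncomputable def dForm (Φ : E → E →L[ℝ] F) (e v w : E) : F := fderiv ℝ Φ e v w - fderiv ℝ Φ e w v

/-- Pullback commutes with the exterior derivative. -/
lemma dForm_pullback {Φ : E → E →L[ℝ] F} {u : X → E} {x : X} (hu : ContDiffAt ℝ 2 u x)
    (hΦ : DifferentiableAt ℝ Φ (u x)) (v w : X) :
    DifferentiableAt ℝ (fun y => (Φ (u y)).comp (fderiv ℝ u y)) x ∧
    dForm (fun y => (Φ (u y)).comp (fderiv ℝ u y)) x v w =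
      dForm Φ (u x) (fderiv ℝ u x v) (fderiv ℝ u x w) := by
  have h1 : HasFDerivAt (fderiv ℝ u) (fderiv ℝ (fderiv ℝ u) x) x :=
    ((hu.fderiv_right (m := 1) (by norm_num)).differentiableAt (by simp)).hasFDerivAt
  have h2 : HasFDerivAt (fun y => Φ (u y)) ((fderiv ℝ Φ (u x)).comp (fderiv ℝ u x)) x :=
    hΦ.hasFDerivAt.comp x (hu.differentiableAt (by simp)).hasFDerivAt
  have h3 := h2.clm_comp h1
  refine ⟨h3.differentiableAt, ?_⟩
  have hsymm := (hu.isSymmSndFDerivAt (by simp)) v w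
  rw [dForm, dForm, h3.fderiv]
  simp [hsymm]

/-- Let `u` be a solution of the radial equation `Φ(du(x) x) = Ξ x` for a coframe `Φ` and a linear
map `Ξ` with values in `q`. If the system `Φ ≡ 0` modulo `q` is Frobenius along `u`, then `u` is an
integral manifold of it. -/
theorem radial_coframe_mem [FiniteDimensional ℝ E] [FiniteDimensional ℝ F]
    {Φ : E → E →L[ℝ] F} {u : X → E} {Ξ : X →L[ℝ] F} {q : Submodule ℝ F}
    (hu : ∀ᶠ x in 𝓝 (0 : X), ContDiffAt ℝ ∞ u x ∧ ContDiffAt ℝ ∞ Φ (u x) ∧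
      (Φ (u x)).IsInvertible ∧ Φ (u x) (fderiv ℝ u x x) = Ξ x ∧
      ∀ v w, Φ (u x) v ∈ q → Φ (u x) w ∈ q → dForm Φ (u x) v w ∈ q)
    (hΞ : ∀ x, Ξ x ∈ q) :
    ∀ᶠ x in 𝓝 (0 : X), ∀ v, Φ (u x) (fderiv ℝ u x v) ∈ q := by
  have : CompleteSpace E := FiniteDimensional.complete ℝ E
  let H : X → X →L[ℝ] F := fun y => (Φ (u y)).comp (fderiv ℝ u y)
  have hHd : ∀ᶠ x in 𝓝 (0 : X), DifferentiableAt ℝ H x ∧ ∀ v w, fderiv ℝ H x v w - fderiv ℝ H x w v =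
      dForm Φ (u x) (fderiv ℝ u x v) (fderiv ℝ u x w) := by
    filter_upwards [hu] with x hx
    have h := dForm_pullback (hx.1.of_le (by norm_cast))
      (hx.2.1.differentiableAt (by simp))
    exact ⟨(h 0 0).1, fun v w => (h v w).2⟩
  have hrad : ∀ᶠ x in 𝓝 (0 : X), ∀ v, fderiv ℝ H x v x + H x v = Ξ v := by
    have h1 : ∀ᶠ x in 𝓝 (0 : X), H x x = Ξ x := hu.mono fun x hx => hx.2.2.2.1
    filter_upwards [h1.eventually_nhds, hHd] with x hx hd v
    have h2 := hd.1.hasFDerivAt.clm_apply (hasFDerivAt_id x)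
    have h3 : HasFDerivAt (fun y => H y (id y)) Ξ x :=
      Ξ.hasFDerivAt.congr_of_eventuallyEq hx
    have h4 := DFunLike.congr_fun (h2.unique h3) v
    rw [← h4]
    simp [add_comm]
  have hH0 : H 0 = Ξ := by
    ext v
    simpa using hrad.self_of_nhds v
  filter_upwards [eventually_forall_ray hu, eventually_forall_ray hHd, eventually_forall_ray hrad]
    with x h1 h2 h3 v
  have hHx : ∀ t ∈ Set.Icc (0 : ℝ) 1, H (t • x) x = Ξ x := by
    intro t ht
    by_cases ht0 : t = 0
    · rw [ht0, zero_smul, hH0]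
    · have := (h1 t ht).2.2.2.1
      rw [map_smul, map_smul, map_smul] at this
      exact smul_right_injective F ht0 this
  let J : ℝ → E := fun t => fderiv ℝ u (t • x) x
  let A : ℝ → F →L[ℝ] F := fun t =>
    (fderiv ℝ Φ (u (t • x)) (J t) - (fderiv ℝ Φ (u (t • x))).flip (J t)).comp
      (Φ (u (t • x))).inverse
  have hA : ∀ t ∈ Set.Icc (0 : ℝ) 1, ∀ w, A t (Φ (u (t • x)) w) =
      dForm Φ (u (t • x)) (J t) w := by
    intro t ht w
    obtain ⟨e, he⟩ := (h1 t ht).2.2.1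
    simp only [A, ← he, ContinuousLinearMap.inverse_equiv, ContinuousLinearMap.comp_apply]
    simp [dForm]
  have key := mem_of_linear_ode q A (fun _ => Ξ v) (fun t => t • H (t • x) v) ?_ ?_ ?_
    (fun _ _ => hΞ v) (by simp) 1 (by simp)
  · simpa [H] using key
  · intro t ht
    have hray : ContinuousAt (fun t : ℝ => t • x) t := by fun_prop
    have hux : ContinuousAt (fun t : ℝ => u (t • x)) t :=
      (h1 t ht).1.continuousAt.comp (f := fun t : ℝ => t • x) hray
    have hΦx : ContinuousAt (fun t : ℝ => Φ (u (t • x))) t :=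
      (h1 t ht).2.1.continuousAt.comp (f := fun t : ℝ => u (t • x)) hux
    have hdΦ : ContinuousAt (fun t : ℝ => fderiv ℝ Φ (u (t • x))) t :=
      ((h1 t ht).2.1.fderiv_right (m := 0) (by simp)).continuousAt.comp
        (f := fun t : ℝ => u (t • x)) hux
    have hdu : ContinuousAt (fun t : ℝ => fderiv ℝ u (t • x)) t :=
      ((h1 t ht).1.fderiv_right (m := 0) (by simp)).continuousAt.comp
        (f := fun t : ℝ => t • x) hray
    have hinv : ContinuousAt (fun t : ℝ => (Φ (u (t • x))).inverse) t := by
      obtain ⟨e, he⟩ := (h1 t ht).2.2.1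
      refine ContinuousAt.comp (g := ContinuousLinearMap.inverse) (f := fun t : ℝ => Φ (u (t • x))) ?_ hΦx
      rw [← he]
      exact (contDiffAt_map_inverse (n := 0) e).continuousAt
    have hJ : ContinuousAt J t := hdu.clm_apply continuousAt_const
    have hflip : ContinuousAt (fun t : ℝ => (fderiv ℝ Φ (u (t • x))).flip) t :=
      (ContinuousLinearMap.flipₗᵢ ℝ E E F).continuous.continuousAt.comp hdΦ
    exact (((hdΦ.clm_apply hJ).sub (hflip.clm_apply hJ)).clm_comp hinv).continuousWithinAt
  · intro t ht
    have h4 := (hasDerivAt_id t).smul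
      ((hasDerivAt_comp_ray (h2 t ht).1).clm_apply (hasDerivAt_const t v))
    refine h4.congr_deriv ?_
    have h5 : (t • H (t • x) v : F) = Φ (u (t • x)) (t • fderiv ℝ u (t • x) v) := by
      simp [H]
    rw [h5, hA t ht]
    have h6 := (h2 t ht).2 x v
    have h7 := h3 t ht v
    have h8 : dForm Φ (u (t • x)) (J t) (t • fderiv ℝ u (t • x) v) =
        t • dForm Φ (u (t • x)) (J t) (fderiv ℝ u (t • x) v) := by
      simp [dForm, smul_sub]
    rw [h8, ← h6, ← h7]
    simp only [map_smul, map_zero, add_zero, smul_sub, id, one_smul]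
    abel
  · intro t ht y hy
    obtain ⟨e, he⟩ := (h1 t ht).2.2.1
    obtain ⟨w, rfl⟩ : ∃ w, Φ (u (t • x)) w = y := ⟨e.symm y, by rw [← he]; simp⟩
    rw [hA t ht]
    refine (h1 t ht).2.2.2.2 _ _ ?_ hy
    have := hHx t ht
    simp only [H, ContinuousLinearMap.comp_apply] at this
    rw [this]
    exact hΞ x

end Coframe

/-! ### Conformal symplectic connections in coordinates -/

/-- Coordinate data of a connection `∇ = d + Γ` on the tangent bundle of a vector space, with a
1-form `θ`, a bilinear form `τ` and the conformal factor `c` of `τ`. In the application `∇` extends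
a connection on `ker θ` by making a transversal field parallel, and `τ` is `dθ` on `ker θ`. -/
structure LocalConnection (E : Type*) [NormedAddCommGroup E] [NormedSpace ℝ E] where
  θ : E → E →L[ℝ] ℝ
  τ : E → E →L[ℝ] E →L[ℝ] ℝ
  Γ : E → E →L[ℝ] E →L[ℝ] E
  c : E → E →L[ℝ] ℝ

namespace LocalConnection

variable {E X : Type*} [NormedAddCommGroup E] [NormedSpace ℝ E]
  [NormedAddCommGroup X] [NormedSpace ℝ X]

/-- `W` is isotropic at `e`. -/
def IsIsotropic (L : LocalConnection E) (e : E) (W : Submodule ℝ E) : Prop :=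
  ∀ v ∈ W, L.θ e v = 0 ∧ ∀ w ∈ W, L.τ e v w = 0

/-- Smoothness of the data at `e`, `∇θ = 0` and `∇τ = c ⊗ τ`. -/
structure IsConformalAt (L : LocalConnection E) (e : E) : Prop where
  smooth_θ : ContDiffAt ℝ ∞ L.θ e
  smooth_τ : ContDiffAt ℝ ∞ L.τ e
  smooth_Γ : ContDiffAt ℝ ∞ L.Γ e
  cont_c : ContinuousAt L.c e
  parallel_θ : ∀ v a, fderiv ℝ L.θ e v a = L.θ e (L.Γ e v a)
  parallel_τ : ∀ v a b, fderiv ℝ L.τ e v a b - L.τ e (L.Γ e v a) b - L.τ e a (L.Γ e v b) =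
    L.c e v * L.τ e a b

/-- The curvature of `∇`. -/
noncomputable def curvature (L : LocalConnection E) (e v w u : E) : E :=
  fderiv ℝ L.Γ e v w u - fderiv ℝ L.Γ e w v u + L.Γ e v (L.Γ e w u) - L.Γ e w (L.Γ e v u)

/-- The torsion vanishes on isotropic pairs, and the curvature preserves isotropic subspaces. -/
structure IsIntegrableAt (L : LocalConnection E) (e : E) : Prop where
  torsion : ∀ v w, L.θ e v = 0 → L.θ e w = 0 → L.τ e v w = 0 → L.Γ e v w = L.Γ e w v
  curv : ∀ W, L.IsIsotropic e W → ∀ v ∈ W, ∀ w ∈ W, ∀ u ∈ W, L.curvature e v w u ∈ W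

variable {L : LocalConnection E}

lemma isIsotropic_span {ι : Type*} {e : E} {w : ι → E} (h1 : ∀ i, L.θ e (w i) = 0)
    (h2 : ∀ i j, L.τ e (w i) (w j) = 0) : L.IsIsotropic e (Submodule.span ℝ (Set.range w)) := by
  have hθ : Submodule.span ℝ (Set.range w) ≤ LinearMap.ker (L.θ e).toLinearMap := by
    rw [Submodule.span_le]
    rintro _ ⟨i, rfl⟩
    exact h1 i
  have h3 : ∀ i, Submodule.span ℝ (Set.range w) ≤ LinearMap.ker (L.τ e (w i)).toLinearMap := by
    intro i
    rw [Submodule.span_le]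
    rintro _ ⟨j, rfl⟩
    exact h2 i j
  intro v hv
  refine ⟨hθ hv, fun x hx => ?_⟩
  have h4 : Submodule.span ℝ (Set.range w) ≤ LinearMap.ker ((L.τ e).flip x).toLinearMap := by
    rw [Submodule.span_le]
    rintro _ ⟨i, rfl⟩
    exact h3 i hx
  exact h4 hv

/-- Parallel transport along the images of rays preserves isotropy. -/
lemma eventually_isotropic_transport {σ : X → E} {A : X → E →L[ℝ] E}
    (hL : ∀ᶠ x in 𝓝 (0 : X), L.IsConformalAt (σ x))
    (hσ : ∀ᶠ x in 𝓝 (0 : X), ContDiffAt ℝ ∞ σ x) (hA : ∀ᶠ x in 𝓝 (0 : X), ContDiffAt ℝ ∞ A x)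
    (h : ∀ᶠ x in 𝓝 (0 : X), fderiv ℝ A x x = -(L.Γ (σ x) (fderiv ℝ σ x x)).comp (A x))
    (hA0 : A 0 = ContinuousLinearMap.id ℝ E) {W : Submodule ℝ E} [FiniteDimensional ℝ W]
    (hW : L.IsIsotropic (σ 0) W) :
    ∀ᶠ x in 𝓝 (0 : X), L.IsIsotropic (σ x) (W.map (A x).toLinearMap) := by
  let b := Module.finBasis ℝ W
  have hspan : ∀ x, W.map (A x).toLinearMap =
      Submodule.span ℝ (Set.range fun i => A x (b i)) := by
    intro x
    have h1 : W = Submodule.span ℝ (Set.range fun i => (b i : E)) := by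
      have := b.span_eq
      have h2 := congrArg (Submodule.map W.subtype) this
      rw [Submodule.map_span, Submodule.map_top, Submodule.range_subtype, ← Set.range_comp] at h2
      exact h2.symm
    conv_lhs => rw [h1]
    rw [Submodule.map_span, ← Set.range_comp]
    rfl
  have hAv : ∀ a : E, ∀ᶠ x in 𝓝 (0 : X), HasFDerivAt (fun x => A x a)
      ((fderiv ℝ A x).flip a) x := by
    intro a
    filter_upwards [hA] with x hx
    have := (hx.differentiableAt (by simp)).hasFDerivAt.clm_apply (hasFDerivAt_const a x)
    refine this.congr_fderiv ?_
    ext v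
    simp
  have hAc : ∀ a : E, ∀ᶠ x in 𝓝 (0 : X), ContDiffAt ℝ 1 (fun x => A x a) x := by
    intro a
    filter_upwards [hA] with x hx
    exact (hx.clm_apply contDiffAt_const).of_le (by simp)
  have hθ : ∀ i, ∀ᶠ x in 𝓝 (0 : X), L.θ (σ x) (A x (b i)) = 0 := by
    intro i
    refine eventually_eq_zero_of_radial (c := 0) ?_ ?_
    · rw [hA0]
      exact (hW _ (b i).2).1
    · filter_upwards [hL, hσ, hAv (b i), hAc (b i), h] with x h1 h2 h3 h4 h5
      have hθd := (h1.smooth_θ.differentiableAt (by simp)).hasFDerivAt.comp x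
        (h2.differentiableAt (by simp)).hasFDerivAt
      refine ⟨((h1.smooth_θ.comp x h2).of_le (by simp)).clm_apply h4, continuousAt_const, ?_⟩
      have h6 := hθd.clm_apply h3
      rw [HasFDerivAt.fderiv (f := fun x => L.θ (σ x) (A x (b i))) h6]
      simp [h5, h1.parallel_θ]
  have hτ : ∀ i j, ∀ᶠ x in 𝓝 (0 : X), L.τ (σ x) (A x (b i)) (A x (b j)) = 0 := by
    intro i j
    refine eventually_eq_zero_of_radial (c := fun x => (L.c (σ x)).comp (fderiv ℝ σ x)) ?_ ?_
    · rw [hA0]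
      exact (hW _ (b i).2).2 _ (b j).2
    · filter_upwards [hL, hσ, hAv (b i), hAc (b i), hAv (b j), hAc (b j), h]
        with x h1 h2 h3 h4 h3' h4' h5
      have hτd := (h1.smooth_τ.differentiableAt (by simp)).hasFDerivAt.comp x
        (h2.differentiableAt (by simp)).hasFDerivAt
      refine ⟨(((h1.smooth_τ.comp x h2).of_le (by simp)).clm_apply h4).clm_apply h4',
        (h1.cont_c.comp h2.continuousAt).clm_comp
          (h2.fderiv_right (m := 0) (by simp)).continuousAt, ?_⟩
      have h6 := (hτd.clm_apply h3).clm_apply h3'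
      rw [HasFDerivAt.fderiv (f := fun x => L.τ (σ x) (A x (b i)) (A x (b j))) h6]
      have h7 := h1.parallel_τ (fderiv ℝ σ x x) (A x (b i)) (A x (b j))
      simp only [h5, ContinuousLinearMap.flip_apply, ContinuousLinearMap.comp_apply, smul_eq_mul,
        ← h7, neg_apply, map_neg, Function.comp_apply,
        add_apply]
      ring
  filter_upwards [eventually_all.2 hθ, eventually_all.2 fun i => eventually_all.2 (hτ i)]
    with x h1 h2
  rw [hspan]
  exact isIsotropic_span h1 h2

/-- The coframe on pairs `(y, A)` of a point and a frame consisting of the soldering form and the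
connection form of `∇`: `(y', A') ↦ (A⁻¹ y', A⁻¹ (A' + Γ(y') A))`. -/
noncomputable def frameForm (L : LocalConnection E) (p : E × (E →L[ℝ] E)) :
    E × (E →L[ℝ] E) →L[ℝ] E × (E →L[ℝ] E) :=
  (p.2.inverse.comp (ContinuousLinearMap.fst ℝ E (E →L[ℝ] E))).prod
    ((ContinuousLinearMap.compL ℝ E E E p.2.inverse).comp
      (ContinuousLinearMap.snd ℝ E (E →L[ℝ] E) +
        ((ContinuousLinearMap.compL ℝ E E E).flip p.2).comp
          ((L.Γ p.1).comp (ContinuousLinearMap.fst ℝ E (E →L[ℝ] E)))))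

lemma frameForm_apply (p v : E × (E →L[ℝ] E)) :
    L.frameForm p v =
      (p.2.inverse v.1, p.2.inverse.comp (v.2 + (L.Γ p.1 v.1).comp p.2)) := rfl

lemma frame_frameForm_fst {p : E × (E →L[ℝ] E)} (hp : p.2.IsInvertible) (v : E × (E →L[ℝ] E)) :
    p.2 (L.frameForm p v).1 = v.1 := by
  obtain ⟨f, hf⟩ := hp
  rw [frameForm_apply, ← hf]
  simp

lemma frame_frameForm_snd {p : E × (E →L[ℝ] E)} (hp : p.2.IsInvertible) (v : E × (E →L[ℝ] E)) :
    p.2.comp (L.frameForm p v).2 = v.2 + (L.Γ p.1 v.1).comp p.2 := by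
  obtain ⟨f, hf⟩ := hp
  rw [frameForm_apply, ← hf]
  ext x
  simp

/-- The components of `frameForm` form a coframe where the frame is invertible. -/
lemma isInvertible_frameForm {p : E × (E →L[ℝ] E)} (hp : p.2.IsInvertible) :
    (L.frameForm p).IsInvertible := by
  refine ⟨ContinuousLinearEquiv.equivOfInverse (L.frameForm p)
    ((p.2.comp (ContinuousLinearMap.fst ℝ E (E →L[ℝ] E))).prod
      ((ContinuousLinearMap.compL ℝ E E E p.2).comp (ContinuousLinearMap.snd ℝ E (E →L[ℝ] E)) -
        ((ContinuousLinearMap.compL ℝ E E E).flip p.2).comp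
          ((L.Γ p.1).comp (p.2.comp (ContinuousLinearMap.fst ℝ E (E →L[ℝ] E)))))) ?_ ?_, rfl⟩
  · intro v
    refine Prod.ext (frame_frameForm_fst (L := L) hp v) ?_
    change p.2.comp (L.frameForm p v).2 - (L.Γ p.1 (p.2 (L.frameForm p v).1)).comp p.2 = v.2
    rw [frame_frameForm_snd hp, frame_frameForm_fst hp, add_sub_cancel_right]
  · intro v
    obtain ⟨f, hf⟩ := hp
    rw [frameForm_apply, ← hf]
    ext x <;> simp

section Complete

variable [CompleteSpace E]

lemma contDiffAt_frameForm {p : E × (E →L[ℝ] E)} (hp : p.2.IsInvertible)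
    (hΓ : ContDiffAt ℝ ∞ L.Γ p.1) : ContDiffAt ℝ ∞ L.frameForm p := by
  have h1 : ContDiffAt ℝ ∞ (fun p : E × (E →L[ℝ] E) => p.2.inverse) p := by
    obtain ⟨f, hf⟩ := hp
    refine ContDiffAt.comp p (g := ContinuousLinearMap.inverse) ?_ contDiffAt_snd
    rw [← hf]
    exact contDiffAt_map_inverse f
  have h2 : ContDiffAt ℝ ∞ (fun p : E × (E →L[ℝ] E) => L.Γ p.1) p := hΓ.comp p contDiffAt_fst
  have h3 : ContDiffAt ℝ ∞ (fun p : E × (E →L[ℝ] E) =>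
      ContinuousLinearMap.compL ℝ E E E p.2.inverse) p :=
    (ContinuousLinearMap.compL ℝ E E E).contDiff.contDiffAt.comp p h1
  have h4 : ContDiffAt ℝ ∞ (fun p : E × (E →L[ℝ] E) =>
      (ContinuousLinearMap.compL ℝ E E E).flip p.2) p :=
    (ContinuousLinearMap.compL ℝ E E E).flip.contDiff.contDiffAt.comp p contDiffAt_snd
  have h5 := (h1.clm_comp (contDiffAt_const (c := ContinuousLinearMap.fst ℝ E (E →L[ℝ] E))))
  have h6 := h3.clm_comp ((contDiffAt_const (c := ContinuousLinearMap.snd ℝ E (E →L[ℝ] E))).add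
    (h4.clm_comp (h2.clm_comp
      (contDiffAt_const (c := ContinuousLinearMap.fst ℝ E (E →L[ℝ] E))))))
  refine (((contDiffAt_const (c := ContinuousLinearMap.inl ℝ E (E →L[ℝ] E))).clm_comp h5).add
    ((contDiffAt_const (c := ContinuousLinearMap.inr ℝ E (E →L[ℝ] E))).clm_comp
      h6)).congr_of_eventuallyEq (Eventually.of_forall fun p => ?_)
  refine ContinuousLinearMap.ext fun v => ?_
  simp [frameForm]

/-- The structure equations of the coframe `frameForm`. -/
lemma dForm_frameForm {p : E × (E →L[ℝ] E)} (hp : p.2.IsInvertible)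
    (hΓ : ContDiffAt ℝ ∞ L.Γ p.1) (v w : E × (E →L[ℝ] E)) :
    p.2 (dForm L.frameForm p v w).1 =
      p.2 ((L.frameForm p w).2 (L.frameForm p v).1) - p.2 ((L.frameForm p v).2 (L.frameForm p w).1)
        + (L.Γ p.1 v.1 w.1 - L.Γ p.1 w.1 v.1) ∧
    ∀ a, p.2 ((dForm L.frameForm p v w).2 a) =
      p.2 ((L.frameForm p w).2 ((L.frameForm p v).2 a))
        - p.2 ((L.frameForm p v).2 ((L.frameForm p w).2 a)) +
        L.curvature p.1 v.1 w.1 (p.2 a) := by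
  have hinv : ∀ᶠ p' in 𝓝 p, p'.2.IsInvertible := by
    obtain ⟨f, hf⟩ := hp
    have h1 : ContinuousAt (fun p : E × (E →L[ℝ] E) => p.2) p := continuousAt_snd
    have h2 := f.nhds
    rw [hf] at h2
    filter_upwards [h1.eventually_mem h2] with p' hp'
    exact hp'
  have hD : HasFDerivAt L.frameForm (fderiv ℝ L.frameForm p) p :=
    ((contDiffAt_frameForm hp hΓ).differentiableAt (by simp)).hasFDerivAt
  have hDv : ∀ w, HasFDerivAt (fun p => L.frameForm p w) ((fderiv ℝ L.frameForm p).flip w) p := by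
    intro w
    refine (hD.clm_apply (hasFDerivAt_const w p)).congr_fderiv ?_
    ext <;> simp
  have hsnd : HasFDerivAt (fun p : E × (E →L[ℝ] E) => p.2) (ContinuousLinearMap.snd ℝ E _) p :=
    hasFDerivAt_snd
  -- Differentiating the defining identities of the form.
  have key1 : ∀ v w, v.2 (L.frameForm p w).1 + p.2 (fderiv ℝ L.frameForm p v w).1 = 0 := by
    intro v w
    have h1 : HasFDerivAt (fun p => (L.frameForm p w).1) _ p := (hDv w).fst
    have h2 := hsnd.clm_apply h1
    have h3 : HasFDerivAt (fun p : E × (E →L[ℝ] E) => p.2 (L.frameForm p w).1)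
        (0 : E × (E →L[ℝ] E) →L[ℝ] E) p := by
      refine (hasFDerivAt_const w.1 p).congr_of_eventuallyEq ?_
      filter_upwards [hinv] with p' hp'
      exact frame_frameForm_fst hp' w
    have h4 := DFunLike.congr_fun (h2.unique h3) v
    simpa [add_comm] using h4
  have key2 : ∀ v w a, v.2 ((L.frameForm p w).2 a) + p.2 ((fderiv ℝ L.frameForm p v w).2 a) =
      fderiv ℝ L.Γ p.1 v.1 w.1 (p.2 a) + L.Γ p.1 w.1 (v.2 a) := by
    intro v w a
    have h1 : HasFDerivAt (fun p => (L.frameForm p w).2) _ p := (hDv w).snd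
    have h2 := hsnd.clm_apply (h1.clm_apply (hasFDerivAt_const a p))
    have h3 : HasFDerivAt (fun p : E × (E →L[ℝ] E) => L.Γ p.1) _ p :=
      (hΓ.differentiableAt (by simp)).hasFDerivAt.comp p hasFDerivAt_fst
    have h4 := ((h3.clm_apply (hasFDerivAt_const w.1 p)).clm_apply
      (hsnd.clm_apply (hasFDerivAt_const a p))).const_add (w.2 a)
    have h5 : (fun p : E × (E →L[ℝ] E) => p.2 ((L.frameForm p w).2 a)) =ᶠ[𝓝 p]
        fun p => w.2 a + L.Γ p.1 w.1 (p.2 a) := by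
      filter_upwards [hinv] with p' hp'
      exact DFunLike.congr_fun (frame_frameForm_snd hp' w) a
    have h6 := DFunLike.congr_fun (h2.unique (h4.congr_of_eventuallyEq h5)) v
    simp only [add_apply, ContinuousLinearMap.comp_apply,
      ContinuousLinearMap.flip_apply, ContinuousLinearMap.coe_fst', ContinuousLinearMap.coe_snd',
      zero_apply, map_zero, zero_add] at h6
    rw [add_comm, h6, add_comm]
  have hv2 : ∀ (v : E × (E →L[ℝ] E)) (a : E),
      v.2 a = p.2 ((L.frameForm p v).2 a) - L.Γ p.1 v.1 (p.2 a) := by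
    intro v a
    rw [eq_sub_iff_add_eq]
    exact (DFunLike.congr_fun (frame_frameForm_snd hp v) a).symm
  refine ⟨?_, fun a => ?_⟩
  · have h1 := key1 v w
    have h2 := key1 w v
    rw [hv2 v, frame_frameForm_fst hp] at h1
    rw [hv2 w, frame_frameForm_fst hp] at h2
    simp only [dForm, Prod.fst_sub, map_sub]
    rw [eq_neg_of_add_eq_zero_right h1, eq_neg_of_add_eq_zero_right h2]
    abel
  · have h1 := key2 v w a
    have h2 := key2 w v a
    rw [hv2 v ((L.frameForm p w).2 a), hv2 v a, map_sub] at h1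
    rw [hv2 w ((L.frameForm p v).2 a), hv2 w a, map_sub] at h2
    simp only [dForm, Prod.snd_sub, sub_apply, map_sub, curvature]
    rw [← sub_eq_iff_eq_add'.2 h1.symm, ← sub_eq_iff_eq_add'.2 h2.symm]
    abel

end Complete

end LocalConnection
namespace LocalConnection

variable {E X : Type*} [NormedAddCommGroup E] [NormedSpace ℝ E] [FiniteDimensional ℝ E]
  [NormedAddCommGroup X] [NormedSpace ℝ X] [FiniteDimensional ℝ X] {L : LocalConnection E}

/-! ### The radial exponential map on an isotropic subspace -/

/-- The generator of the geodesic spray together with parallel transport: in direction `x`, the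
point moves with velocity `A (ι x)` and the frame `A` is parallel. -/
noncomputable def spray (L : LocalConnection E) (ι : X →L[ℝ] E) (p : E × (E →L[ℝ] E)) :
    X →L[ℝ] E × (E →L[ℝ] E) :=
  (ContinuousLinearMap.inl ℝ E (E →L[ℝ] E)).comp (p.2.comp ι) -
    (ContinuousLinearMap.inr ℝ E (E →L[ℝ] E)).comp
      (((ContinuousLinearMap.compL ℝ E E E).flip p.2).comp ((L.Γ p.1).comp (p.2.comp ι)))

omit [FiniteDimensional ℝ E] [FiniteDimensional ℝ X] in
lemma spray_apply (ι : X →L[ℝ] E) (p : E × (E →L[ℝ] E)) (x : X) :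
    L.spray ι p x = (p.2 (ι x), -(L.Γ p.1 (p.2 (ι x))).comp p.2) := by
  simp [spray]

omit [FiniteDimensional ℝ E] [FiniteDimensional ℝ X] in
lemma contDiffAt_spray (ι : X →L[ℝ] E) {p : E × (E →L[ℝ] E)} (hΓ : ContDiffAt ℝ ∞ L.Γ p.1) :
    ContDiffAt ℝ ∞ (L.spray ι) p := by
  have h2 : ContDiffAt ℝ ∞ (fun p : E × (E →L[ℝ] E) => L.Γ p.1) p := hΓ.comp p contDiffAt_fst
  have h3 : ContDiffAt ℝ ∞ (fun p : E × (E →L[ℝ] E) => p.2.comp ι) p :=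
    contDiffAt_snd.clm_comp contDiffAt_const
  have h4 : ContDiffAt ℝ ∞ (fun p : E × (E →L[ℝ] E) =>
      (ContinuousLinearMap.compL ℝ E E E).flip p.2) p :=
    (ContinuousLinearMap.compL ℝ E E E).flip.contDiff.contDiffAt.comp p contDiffAt_snd
  exact (contDiffAt_const.clm_comp h3).sub (contDiffAt_const.clm_comp (h4.clm_comp (h2.clm_comp h3)))

/-- The radial exponential map `σ` on an isotropic subspace `range ι`, with the parallel
frame `A` along rays. The images of `range ι` under `A` are the tangent planes of `σ`, they are
isotropic, and they are parallel along `σ` in all directions. -/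
theorem exists_exp {e₀ : E} (ι : X →L[ℝ] E)
    (hL : ∀ᶠ e in 𝓝 e₀, L.IsConformalAt e ∧ L.IsIntegrableAt e)
    (hι : L.IsIsotropic e₀ (LinearMap.range ι.toLinearMap)) :
    ∃ (σ : X → E) (A : X → E →L[ℝ] E), σ 0 = e₀ ∧ A 0 = ContinuousLinearMap.id ℝ E ∧
      ∀ᶠ x in 𝓝 (0 : X), ContDiffAt ℝ ∞ σ x ∧ ContDiffAt ℝ ∞ A x ∧ (A x).IsInvertible ∧
        fderiv ℝ σ x x = A x (ι x) ∧
        fderiv ℝ A x x = -(L.Γ (σ x) (A x (ι x))).comp (A x) ∧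
        L.IsIsotropic (σ x) ((LinearMap.range ι.toLinearMap).map (A x).toLinearMap) ∧
        (∀ v, fderiv ℝ σ x v ∈ (LinearMap.range ι.toLinearMap).map (A x).toLinearMap) ∧
        ∀ v b, fderiv ℝ A x v (ι b) + L.Γ (σ x) (fderiv ℝ σ x v) (A x (ι b)) ∈
          (LinearMap.range ι.toLinearMap).map (A x).toLinearMap := by
  have : CompleteSpace E := FiniteDimensional.complete ℝ E
  set W := LinearMap.range ι.toLinearMap with hWdef
  obtain ⟨u, hu0, hu⟩ := exists_radial_flow (L.spray ι) (e₀, ContinuousLinearMap.id ℝ E) (by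
    have h1 : Tendsto (fun p : E × (E →L[ℝ] E) => p.1) (𝓝 (e₀, ContinuousLinearMap.id ℝ E))
      (𝓝 e₀) := continuousAt_fst
    filter_upwards [h1.eventually hL] with p hp
    exact contDiffAt_spray ι hp.1.smooth_Γ)
  have huc : ContinuousAt u 0 := hu.self_of_nhds.1.continuousAt
  have hσc : Tendsto (fun x => (u x).1) (𝓝 0) (𝓝 e₀) := by
    have := continuousAt_fst.comp huc
    rwa [ContinuousAt, Function.comp, hu0] at this
  have hAc : Tendsto (fun x => (u x).2) (𝓝 0) (𝓝 (ContinuousLinearMap.id ℝ E)) := by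
    have := continuousAt_snd.comp huc
    rwa [ContinuousAt, Function.comp, hu0] at this
  have hinv : ∀ᶠ x in 𝓝 (0 : X), (u x).2.IsInvertible := by
    filter_upwards [hAc.eventually_mem (ContinuousLinearEquiv.refl ℝ E).nhds] with x hx
    exact hx
  have hLx : ∀ᶠ x in 𝓝 (0 : X), L.IsConformalAt (u x).1 ∧ L.IsIntegrableAt (u x).1 :=
    hσc.eventually hL
  have hfst : ∀ᶠ x in 𝓝 (0 : X), ContDiffAt ℝ ∞ (fun x => (u x).1) x ∧
      ContDiffAt ℝ ∞ (fun x => (u x).2) x ∧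
      ∀ v, fderiv ℝ u x v = (fderiv ℝ (fun x => (u x).1) x v, fderiv ℝ (fun x => (u x).2) x v) := by
    filter_upwards [hu] with x hx
    refine ⟨hx.1.fst, hx.1.snd, fun v => ?_⟩
    have h := (hx.1.differentiableAt (by simp)).hasFDerivAt
    rw [HasFDerivAt.fderiv (f := fun x => (u x).1) h.fst,
      HasFDerivAt.fderiv (f := fun x => (u x).2) h.snd]
    rfl
  have hrad : ∀ᶠ x in 𝓝 (0 : X), fderiv ℝ (fun x => (u x).1) x x = (u x).2 (ι x) ∧
      fderiv ℝ (fun x => (u x).2) x x = -(L.Γ (u x).1 ((u x).2 (ι x))).comp (u x).2 := by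
    filter_upwards [hu, hfst] with x hx hf
    have := (hf.2.2 x).symm.trans (hx.2.trans (spray_apply ι (u x) x))
    exact ⟨congrArg Prod.fst this, congrArg Prod.snd this⟩
  have hiso : ∀ᶠ x in 𝓝 (0 : X), L.IsIsotropic (u x).1 (W.map (u x).2.toLinearMap) := by
    refine eventually_isotropic_transport (σ := fun x => (u x).1) (A := fun x => (u x).2)
      (hLx.mono fun x h => h.1) (hfst.mono fun x h => h.1) (hfst.mono fun x h => h.2.1)
      (hrad.mono fun x h => ?_) (by rw [hu0]) (by rwa [hu0])
    rw [h.1, h.2]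
  have hmem : ∀ {f : E →L[ℝ] E}, f.IsInvertible → ∀ {y}, f y ∈ W.map f.toLinearMap → y ∈ W := by
    rintro f ⟨g, rfl⟩ y ⟨z, hz, hzy⟩
    rwa [← g.injective hzy]
  -- The subspace of infinitesimal motions that are tangent to `W` and preserve `W`.
  let q : Submodule ℝ (E × (E →L[ℝ] E)) :=
    { carrier := {p | p.1 ∈ W ∧ ∀ a ∈ W, p.2 a ∈ W}
      add_mem' := fun h h' => ⟨W.add_mem h.1 h'.1, fun a ha => W.add_mem (h.2 a ha) (h'.2 a ha)⟩
      zero_mem' := ⟨W.zero_mem, fun a _ => W.zero_mem⟩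
      smul_mem' := fun c p h => ⟨W.smul_mem c h.1, fun a ha => W.smul_mem c (h.2 a ha)⟩ }
  have hframe : ∀ᶠ x in 𝓝 (0 : X), ∀ v, L.frameForm (u x) (fderiv ℝ u x v) ∈ q := by
    refine radial_coframe_mem (Ξ := (ContinuousLinearMap.inl ℝ E (E →L[ℝ] E)).comp ι) ?_
      (fun x => ⟨⟨x, rfl⟩, fun a _ => W.zero_mem⟩)
    filter_upwards [hu, hLx, hinv, hiso] with x hx hl hi hs
    refine ⟨hx.1, contDiffAt_frameForm hi hl.1.smooth_Γ, isInvertible_frameForm hi, ?_, ?_⟩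
    · rw [hx.2, spray_apply, frameForm_apply]
      obtain ⟨f, hf⟩ := hi
      rw [← hf]
      simp
    · intro v w hv hw
      obtain ⟨h1, h2⟩ := dForm_frameForm hi hl.1.smooth_Γ v w
      have hmap : ∀ {y}, y ∈ W → (u x).2 y ∈ W.map (u x).2.toLinearMap :=
        fun hy => Submodule.mem_map_of_mem (f := (u x).2.toLinearMap) hy
      have hvW : v.1 ∈ W.map (u x).2.toLinearMap := by
        rw [← frame_frameForm_fst (L := L) hi v]
        exact hmap hv.1
      have hwW : w.1 ∈ W.map (u x).2.toLinearMap := by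
        rw [← frame_frameForm_fst (L := L) hi w]
        exact hmap hw.1
      refine ⟨hmem hi ?_, fun a ha => hmem hi ?_⟩
      · rw [h1, hl.2.torsion v.1 w.1 (hs _ hvW).1 (hs _ hwW).1 ((hs _ hvW).2 _ hwW), sub_self,
          add_zero]
        exact Submodule.sub_mem _ (hmap (hw.2 _ hv.1)) (hmap (hv.2 _ hw.1))
      · rw [h2]
        exact Submodule.add_mem _ (Submodule.sub_mem _ (hmap (hw.2 _ (hv.2 _ ha)))
          (hmap (hv.2 _ (hw.2 _ ha)))) (hl.2.curv _ hs _ hvW _ hwW _ (hmap ha))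
  refine ⟨fun x => (u x).1, fun x => (u x).2, congrArg Prod.fst hu0, congrArg Prod.snd hu0, ?_⟩
  filter_upwards [hfst, hinv, hrad, hiso, hframe] with x h1 h2 h3 h4 h5
  refine ⟨h1.1, h1.2.1, h2, h3.1, h3.2, h4, fun v => ?_, fun v b => ?_⟩
  · have h6 := frame_frameForm_fst (L := L) h2 (fderiv ℝ u x v)
    rw [h1.2.2 v] at h6
    have h7 := h5 v
    rw [h1.2.2 v] at h7
    simp only at h6
    rw [← h6]
    exact Submodule.mem_map_of_mem (f := (u x).2.toLinearMap) h7.1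
  · have h6 := DFunLike.congr_fun (frame_frameForm_snd (L := L) h2 (fderiv ℝ u x v)) (ι b)
    rw [h1.2.2 v] at h6
    have h7 := h5 v
    rw [h1.2.2 v] at h7
    simp only [ContinuousLinearMap.comp_apply, add_apply] at h6
    rw [← h6]
    exact Submodule.mem_map_of_mem (f := (u x).2.toLinearMap) (h7.2 _ ⟨b, rfl⟩)

/-- A frame on a neighbourhood of `e₀` that is parallel along the segments from `e₀`. -/
theorem exists_radially_parallel_frame {e₀ : E} (hΓ : ∀ᶠ e in 𝓝 e₀, ContDiffAt ℝ ∞ L.Γ e) :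
    ∃ A : E → E →L[ℝ] E, A 0 = ContinuousLinearMap.id ℝ E ∧
      ∀ᶠ x in 𝓝 (0 : E), ContDiffAt ℝ ∞ A x ∧
        fderiv ℝ A x x = -(L.Γ (e₀ + x) x).comp (A x) := by
  let G : E × (E →L[ℝ] E) → E →L[ℝ] E × (E →L[ℝ] E) := fun p =>
    (ContinuousLinearMap.inl ℝ E (E →L[ℝ] E)) -
    (ContinuousLinearMap.inr ℝ E (E →L[ℝ] E)).comp
      (((ContinuousLinearMap.compL ℝ E E E).flip p.2).comp (L.Γ p.1))
  have hG : ∀ p x, G p x = (x, -(L.Γ p.1 x).comp p.2) := fun p x => by simp [G]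
  obtain ⟨u, hu0, hu⟩ := exists_radial_flow G (e₀, ContinuousLinearMap.id ℝ E) (by
    have h1 : Tendsto (fun p : E × (E →L[ℝ] E) => p.1) (𝓝 (e₀, ContinuousLinearMap.id ℝ E))
      (𝓝 e₀) := continuousAt_fst
    filter_upwards [h1.eventually hΓ] with p hp
    have h2 : ContDiffAt ℝ ∞ (fun p : E × (E →L[ℝ] E) => L.Γ p.1) p := hp.comp p contDiffAt_fst
    have h4 : ContDiffAt ℝ ∞ (fun p : E × (E →L[ℝ] E) =>
        (ContinuousLinearMap.compL ℝ E E E).flip p.2) p :=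
      (ContinuousLinearMap.compL ℝ E E E).flip.contDiff.contDiffAt.comp p contDiffAt_snd
    exact contDiffAt_const.sub (contDiffAt_const.clm_comp (h4.clm_comp h2)))
  have hf : ∀ᶠ x in 𝓝 (0 : E),
      fderiv ℝ u x x = (fderiv ℝ (fun x => (u x).1) x x, fderiv ℝ (fun x => (u x).2) x x) := by
    filter_upwards [hu] with x hx
    have h := (hx.1.differentiableAt (by simp)).hasFDerivAt
    rw [HasFDerivAt.fderiv (f := fun x => (u x).1) h.fst,
      HasFDerivAt.fderiv (f := fun x => (u x).2) h.snd]
    rfl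
  have hσ : ∀ᶠ x in 𝓝 (0 : E), (u x).1 - e₀ - x = 0 := by
    refine eventually_eq_zero_of_radial (c := 0) (by simp [hu0]) ?_
    filter_upwards [hu, hf] with x hx hfx
    refine ⟨((hx.1.fst.sub contDiffAt_const).sub contDiffAt_id).of_le (by simp),
      continuousAt_const, ?_⟩
    have h := (hx.1.fst.differentiableAt (by simp)).hasFDerivAt
    have h2 := (h.sub_const e₀).sub (hasFDerivAt_id x)
    rw [HasFDerivAt.fderiv (f := fun x => (u x).1 - e₀ - x) h2]
    have h3 := congrArg Prod.fst (hfx.symm.trans (hx.2.trans (hG _ _)))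
    simp only at h3
    simp [h3]
  refine ⟨fun x => (u x).2, congrArg Prod.snd hu0, ?_⟩
  filter_upwards [hu, hf, hσ] with x hx hfx hs
  refine ⟨hx.1.snd, ?_⟩
  have h3 := congrArg Prod.snd (hfx.symm.trans (hx.2.trans (hG _ _)))
  have h4 : (u x).1 = e₀ + x := by rw [sub_sub, sub_eq_zero] at hs; exact hs
  rw [h4] at h3
  exact h3

end LocalConnection
namespace LocalConnection

variable {E X : Type*} [NormedAddCommGroup E] [NormedSpace ℝ E] [FiniteDimensional ℝ E]
  [NormedAddCommGroup X] [NormedSpace ℝ X] [FiniteDimensional ℝ X] {L : LocalConnection E}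

omit [FiniteDimensional ℝ X] in
lemma exists_leftInverse_clm {f : X →L[ℝ] E} (hf : Function.Injective f) :
    ∃ g : E →L[ℝ] X, ∀ x, g (f x) = x := by
  obtain ⟨g, hg⟩ := f.toLinearMap.exists_leftInverse_of_injective (LinearMap.ker_eq_bot.2 hf)
  exact ⟨LinearMap.toContinuousLinearMap g, fun x => DFunLike.congr_fun hg x⟩

omit [FiniteDimensional ℝ E] in
/-- Operators with a left inverse after composition with `g` form a neighbourhood of each operator
of which `g` is a left inverse. -/
lemma eventually_isInvertible_comp {Z : Type*} [TopologicalSpace Z] {z₀ : Z} {D : Z → X →L[ℝ] E}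
    (hD : ContinuousAt D z₀) {g : E →L[ℝ] X} (hg : ∀ x, g (D z₀ x) = x) :
    ∀ᶠ z in 𝓝 z₀, (g.comp (D z)).IsInvertible := by
  have : CompleteSpace X := FiniteDimensional.complete ℝ X
  have h1 : ContinuousAt (fun z => g.comp (D z)) z₀ := continuousAt_const.clm_comp hD
  have h2 : g.comp (D z₀) = (ContinuousLinearEquiv.refl ℝ X : X →L[ℝ] X) := by
    ext x
    exact hg x
  have h3 := (ContinuousLinearEquiv.refl ℝ X).nhds
  rw [← h2] at h3
  filter_upwards [h1.eventually_mem h3] with z hz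
  exact hz

omit [FiniteDimensional ℝ E] [FiniteDimensional ℝ X] in
lemma injective_of_isInvertible_comp {f : X →L[ℝ] E} {g : E →L[ℝ] X}
    (h : (g.comp f).IsInvertible) : Function.Injective f := by
  obtain ⟨e, he⟩ := h
  intro x y hxy
  apply e.injective
  have : ∀ x, e x = g (f x) := fun x => DFunLike.congr_fun he x
  rw [this, this, hxy]

/-- `s` is tangentially parallel at `x`: the second fundamental form of `s` with respect to `∇`
vanishes. -/
def IsTotallyGeodesicAt (L : LocalConnection E) (s : X → E) (x : X) : Prop :=
  ∀ a b, fderiv ℝ (fderiv ℝ s) x a b + L.Γ (s x) (fderiv ℝ s x a) (fderiv ℝ s x b) ∈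
    LinearMap.range (fderiv ℝ s x).toLinearMap

/-- The radial exponential map parametrizes a totally geodesic isotropic submanifold. -/
theorem eventually_isTotallyGeodesicAt_exp {σ : X → E} {A : X → E →L[ℝ] E} {ι : X →L[ℝ] E}
    (hι : Function.Injective ι) (hA0 : A 0 = ContinuousLinearMap.id ℝ E)
    (h : ∀ᶠ x in 𝓝 (0 : X), ContDiffAt ℝ ∞ σ x ∧ ContDiffAt ℝ ∞ A x ∧ (A x).IsInvertible ∧
        fderiv ℝ σ x x = A x (ι x) ∧
        (∀ v, fderiv ℝ σ x v ∈ (LinearMap.range ι.toLinearMap).map (A x).toLinearMap) ∧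
        ∀ v b, fderiv ℝ A x v (ι b) + L.Γ (σ x) (fderiv ℝ σ x v) (A x (ι b)) ∈
          (LinearMap.range ι.toLinearMap).map (A x).toLinearMap) :
    fderiv ℝ σ 0 = ι ∧ ∀ᶠ x in 𝓝 (0 : X), Function.Injective (fderiv ℝ σ x) ∧
      LinearMap.range (fderiv ℝ σ x).toLinearMap =
        (LinearMap.range ι.toLinearMap).map (A x).toLinearMap ∧
      L.IsTotallyGeodesicAt σ x := by
  have : CompleteSpace E := FiniteDimensional.complete ℝ E
  have hdc : ContinuousAt (fderiv ℝ σ) 0 :=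
    (h.self_of_nhds.1.fderiv_right (m := 0) (by simp)).continuousAt
  have h0 : fderiv ℝ σ 0 = ι := by
    rw [radial_eq_at_zero (L := fun x => (A x).comp ι) hdc
      (h.self_of_nhds.2.1.continuousAt.clm_comp continuousAt_const) (h.mono fun x hx => hx.2.2.2.1),
      hA0]
    rfl
  refine ⟨h0, ?_⟩
  obtain ⟨g, hg⟩ := exists_leftInverse_clm hι
  have hinv : ∀ᶠ x in 𝓝 (0 : X), (g.comp (fderiv ℝ σ x)).IsInvertible :=
    eventually_isInvertible_comp hdc (by rw [h0]; exact hg)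
  filter_upwards [h.eventually_nhds, hinv] with x hx' hxi
  have hx := hx'.self_of_nhds
  have hinj := injective_of_isInvertible_comp hxi
  have hAinj : Function.Injective (A x) := by
    obtain ⟨e, he⟩ := hx.2.2.1
    rw [← he]
    exact e.injective
  have hrange : LinearMap.range (fderiv ℝ σ x).toLinearMap =
      (LinearMap.range ι.toLinearMap).map (A x).toLinearMap := by
    apply Submodule.eq_of_le_of_finrank_eq
    · rintro _ ⟨v, rfl⟩
      exact hx.2.2.2.2.1 v
    · rw [← LinearMap.range_comp, LinearMap.finrank_range_of_inj hinj,
        LinearMap.finrank_range_of_inj]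
      exact hAinj.comp hι
  refine ⟨hinj, hrange, fun a b => ?_⟩
  rw [hrange]
  -- The coefficients of the tangent vector `dσ(b)` in the parallel frame.
  let m : X → X := fun y => g ((A y).inverse (fderiv ℝ σ y b))
  have hm : ∀ᶠ y in 𝓝 x, A y (ι (m y)) = fderiv ℝ σ y b := by
    filter_upwards [hx'] with y hy
    obtain ⟨_, ⟨z, rfl⟩, hz⟩ := hy.2.2.2.2.1 b
    obtain ⟨e, he⟩ := hy.2.2.1
    simp only [m]
    rw [← hz, ← he]
    simp [hg]
  have hmd : DifferentiableAt ℝ m x := by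
    obtain ⟨e, he⟩ := hx.2.2.1
    have h1 : ContDiffAt ℝ 1 (fun y => (A y).inverse) x := by
      refine ContDiffAt.comp x (g := ContinuousLinearMap.inverse) ?_ (hx.2.1.of_le (by simp))
      rw [← he]
      exact contDiffAt_map_inverse e
    have h2 : ContDiffAt ℝ 1 (fderiv ℝ σ) x := hx.1.fderiv_right (by norm_cast)
    exact ((contDiffAt_const (c := g)).clm_apply
      (h1.clm_apply (h2.clm_apply contDiffAt_const))).differentiableAt (by simp)
  have hd1 : HasFDerivAt (fun y => fderiv ℝ σ y b) _ x :=
    (((hx.1.fderiv_right (m := 1) (by norm_cast)).differentiableAt (by simp)).hasFDerivAt).clm_apply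
      (hasFDerivAt_const b x)
  have hd2 := (hx.2.1.differentiableAt (by simp)).hasFDerivAt.clm_apply
    (ι.hasFDerivAt.comp x hmd.hasFDerivAt)
  have hd := DFunLike.congr_fun (hd1.unique (hd2.congr_of_eventuallyEq
    (hm.mono fun y hy => hy.symm))) a
  simp only [add_apply, ContinuousLinearMap.comp_apply, ContinuousLinearMap.flip_apply,
    zero_apply, map_zero, zero_add, Function.comp_apply] at hd
  rw [hd, add_assoc, ← hm.self_of_nhds]
  exact Submodule.add_mem _ (Submodule.mem_map_of_mem (f := (A x).toLinearMap) ⟨_, rfl⟩)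
    (hx.2.2.2.2.2 a (m x))

/-- A totally geodesic submanifold is, up to reparametrization, the radial exponential map on its
tangent plane: the exponential map of the induced connection is a local diffeomorphism of the
parameter space. -/
theorem exists_reparam_exp {s : X → E} {x₀ : X} {σ : X → E} {A : X → E →L[ℝ] E} {ι : X →L[ℝ] E}
    {N : Set X} (hN : N ∈ 𝓝 x₀)
    (hs : ∀ᶠ x in 𝓝 x₀, ContDiffAt ℝ ∞ s x ∧ ContDiffAt ℝ ∞ L.Γ (s x) ∧ L.IsTotallyGeodesicAt s x)
    (hinj : Function.Injective (fderiv ℝ s x₀)) (f₀ : X ≃L[ℝ] X)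
    (hf₀ : (fderiv ℝ s x₀).comp (f₀ : X →L[ℝ] X) = ι) (hσ0 : σ 0 = s x₀)
    (hA0 : A 0 = ContinuousLinearMap.id ℝ E)
    (hσ : ∀ᶠ x in 𝓝 (0 : X), ContDiffAt ℝ ∞ σ x ∧ ContDiffAt ℝ ∞ A x ∧
        fderiv ℝ σ x x = A x (ι x) ∧ fderiv ℝ A x x = -(L.Γ (σ x) (A x (ι x))).comp (A x)) :
    ∃ φ : OpenPartialHomeomorph X X, 0 ∈ φ.source ∧ φ 0 = x₀ ∧ φ.target ⊆ N ∧
      (∀ x ∈ φ.source, ContDiffAt ℝ ∞ φ x) ∧ (∀ x ∈ φ.target, ContDiffAt ℝ ∞ φ.symm x) ∧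
      ∀ x ∈ φ.source, s (φ x) = σ x := by
  have : CompleteSpace X := FiniteDimensional.complete ℝ X
  obtain ⟨g, hg⟩ := exists_leftInverse_clm hinj
  have hdc : ContinuousAt (fderiv ℝ s) x₀ :=
    (hs.self_of_nhds.1.fderiv_right (m := 0) (by simp)).continuousAt
  have hinv : ∀ᶠ x in 𝓝 x₀, (g.comp (fderiv ℝ s x)).IsInvertible :=
    eventually_isInvertible_comp hdc hg
  -- The induced connection on the parameter space.
  let lam : X → E →L[ℝ] X := fun x => (g.comp (fderiv ℝ s x)).inverse.comp g
  let γ : X → X →L[ℝ] X →L[ℝ] X := fun x =>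
    (ContinuousLinearMap.compL ℝ X E X (lam x)).comp
      (fderiv ℝ (fderiv ℝ s) x + ((ContinuousLinearMap.compL ℝ X E E).flip (fderiv ℝ s x)).comp
        ((L.Γ (s x)).comp (fderiv ℝ s x)))
  let L' : LocalConnection X := ⟨0, 0, γ, 0⟩
  have hγ : ∀ᶠ x in 𝓝 x₀, ContDiffAt ℝ ∞ γ x ∧ ∀ a b, fderiv ℝ s x (γ x a b) =
      fderiv ℝ (fderiv ℝ s) x a b + L.Γ (s x) (fderiv ℝ s x a) (fderiv ℝ s x b) := by
    filter_upwards [hs, hinv] with x hx hi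
    have hds : ContDiffAt ℝ ∞ (fderiv ℝ s) x := hx.1.fderiv_right (by norm_cast)
    constructor
    · have h1 : ContDiffAt ℝ ∞ lam x := by
        obtain ⟨e, he⟩ := hi
        refine ContDiffAt.clm_comp ?_ contDiffAt_const
        refine ContDiffAt.comp x (g := ContinuousLinearMap.inverse) ?_
          (contDiffAt_const.clm_comp hds)
        rw [← he]
        exact contDiffAt_map_inverse e
      have h2 : ContDiffAt ℝ ∞ (fun x => ContinuousLinearMap.compL ℝ X E X (lam x)) x :=
        contDiffAt_const.clm_apply h1
      have h3 : ContDiffAt ℝ ∞ (fun x => (ContinuousLinearMap.compL ℝ X E E).flip (fderiv ℝ s x)) x :=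
        contDiffAt_const.clm_apply hds
      have h4 : ContDiffAt ℝ ∞ (fun x => L.Γ (s x)) x := hx.2.1.comp x hx.1
      exact h2.clm_comp ((hds.fderiv_right (by norm_cast)).add (h3.clm_comp (h4.clm_comp hds)))
    · intro a b
      obtain ⟨c, hc⟩ := hx.2.2 a b
      obtain ⟨e, he⟩ := hi
      have hc' : fderiv ℝ s x c = fderiv ℝ (fderiv ℝ s) x a b +
        L.Γ (s x) (fderiv ℝ s x a) (fderiv ℝ s x b) := hc
      have h1 : γ x a b = lam x (fderiv ℝ (fderiv ℝ s) x a b +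
        L.Γ (s x) (fderiv ℝ s x a) (fderiv ℝ s x b)) := by simp [γ]
      have h2 : ∀ c, e c = g (fderiv ℝ s x c) := fun c => DFunLike.congr_fun he c
      rw [h1, ← hc']
      simp only [lam, ← he, ContinuousLinearMap.comp_apply, ContinuousLinearMap.inverse_equiv,
        ← h2, ContinuousLinearEquiv.coe_coe, ContinuousLinearEquiv.symm_apply_apply]
  obtain ⟨u, hu0, hu⟩ := exists_radial_flow (L'.spray (f₀ : X →L[ℝ] X))
    (x₀, ContinuousLinearMap.id ℝ X) (by
    have h1 : Tendsto (fun p : X × (X →L[ℝ] X) => p.1) (𝓝 (x₀, ContinuousLinearMap.id ℝ X))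
      (𝓝 x₀) := continuousAt_fst
    filter_upwards [h1.eventually hγ] with p hp
    exact contDiffAt_spray _ hp.1)
  have hfst : ∀ᶠ x in 𝓝 (0 : X), ContDiffAt ℝ ∞ (fun x => (u x).1) x ∧
      ContDiffAt ℝ ∞ (fun x => (u x).2) x ∧
      fderiv ℝ (fun x => (u x).1) x x = (u x).2 (f₀ x) ∧
      fderiv ℝ (fun x => (u x).2) x x = -(γ (u x).1 ((u x).2 (f₀ x))).comp (u x).2 := by
    filter_upwards [hu] with x hx
    have h := (hx.1.differentiableAt (by simp)).hasFDerivAt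
    have h1 : fderiv ℝ u x x = (fderiv ℝ (fun x => (u x).1) x x, fderiv ℝ (fun x => (u x).2) x x) := by
      rw [HasFDerivAt.fderiv (f := fun x => (u x).1) h.fst,
        HasFDerivAt.fderiv (f := fun x => (u x).2) h.snd]
      rfl
    have h2 := h1.symm.trans (hx.2.trans (spray_apply _ (u x) x))
    exact ⟨hx.1.fst, hx.1.snd, congrArg Prod.fst h2, congrArg Prod.snd h2⟩
  have hφc : Tendsto (fun x => (u x).1) (𝓝 0) (𝓝 x₀) := by
    have := hfst.self_of_nhds.1.continuousAt
    rwa [ContinuousAt, hu0] at this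
  have hφ0 : fderiv ℝ (fun x => (u x).1) 0 = f₀ := by
    rw [radial_eq_at_zero (L := fun x => (u x).2.comp (f₀ : X →L[ℝ] X))
      (hfst.self_of_nhds.1.fderiv_right (m := 0) (by simp)).continuousAt
      (hfst.self_of_nhds.2.1.continuousAt.clm_comp continuousAt_const)
      (hfst.mono fun x hx => hx.2.2.1), hu0]
    rfl
  -- Both sides solve the equation of geodesics with a parallel partial frame.
  let G : E × (X →L[ℝ] E) → X →L[ℝ] E × (X →L[ℝ] E) := fun p =>
    (ContinuousLinearMap.inl ℝ E (X →L[ℝ] E)).comp p.2 -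
    (ContinuousLinearMap.inr ℝ E (X →L[ℝ] E)).comp
      (((ContinuousLinearMap.compL ℝ X E E).flip p.2).comp ((L.Γ p.1).comp p.2))
  have hG : ∀ p x, G p x = (p.2 x, -(L.Γ p.1 (p.2 x)).comp p.2) := fun p x => by simp [G]
  let v₁ : X → E × (X →L[ℝ] E) := fun x => (σ x, (A x).comp ι)
  let v₂ : X → E × (X →L[ℝ] E) := fun x =>
    (s (u x).1, (fderiv ℝ s (u x).1).comp ((u x).2.comp (f₀ : X →L[ℝ] X)))
  have heq : v₁ =ᶠ[𝓝 0] v₂ := by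
    refine radial_flow_unique (G := G) ?_ ?_ ?_ ?_
    · have h0 : (v₁ 0).1 = s x₀ := hσ0
      have h1 : ContDiffAt ℝ ∞ L.Γ (v₁ 0).1 := by rw [h0]; exact hs.self_of_nhds.2.1
      have h2 : ContDiffAt ℝ ∞ (fun p : E × (X →L[ℝ] E) => L.Γ p.1) (v₁ 0) :=
        h1.comp (v₁ 0) contDiffAt_fst
      have h4 : ContDiffAt ℝ ∞ (fun p : E × (X →L[ℝ] E) =>
          (ContinuousLinearMap.compL ℝ X E E).flip p.2) (v₁ 0) :=
        contDiffAt_const.clm_apply contDiffAt_snd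
      exact ((contDiffAt_const.clm_comp contDiffAt_snd).sub (contDiffAt_const.clm_comp
        (h4.clm_comp (h2.clm_comp contDiffAt_snd)))).of_le (by simp)
    · refine Prod.ext ?_ ?_
      · simp [v₁, v₂, hu0, hσ0]
      · simp only [v₁, v₂, hu0, hA0, ← hf₀]
        rfl
    · filter_upwards [hσ] with x hx
      refine ⟨hx.1.prodMk (hx.2.1.clm_comp contDiffAt_const), ?_⟩
      have h1 := (hx.1.differentiableAt (by simp)).hasFDerivAt.prodMk
        ((hx.2.1.differentiableAt (by simp)).hasFDerivAt.clm_comp (hasFDerivAt_const ι x))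
      rw [HasFDerivAt.fderiv (f := v₁) h1, hG]
      refine Prod.ext hx.2.2.1 ?_
      ext a
      simp [v₁, hx.2.2.2]
    · filter_upwards [hfst, hφc.eventually hs, hφc.eventually hγ] with x hx hsx hγx
      have hds : ContDiffAt ℝ ∞ (fderiv ℝ s) (u x).1 := hsx.1.fderiv_right (by norm_cast)
      refine ⟨(hsx.1.comp x hx.1).prodMk ((hds.comp x hx.1).clm_comp
        (hx.2.1.clm_comp contDiffAt_const)), ?_⟩
      have hd1 := (hx.1.differentiableAt (by simp)).hasFDerivAt
      have hd2 := (hx.2.1.differentiableAt (by simp)).hasFDerivAt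
      have h1 := ((hsx.1.differentiableAt (by simp)).hasFDerivAt.comp x hd1).prodMk
        (((hds.differentiableAt (by simp)).hasFDerivAt.comp x hd1).clm_comp
          (hd2.clm_comp (hasFDerivAt_const (f₀ : X →L[ℝ] X) x)))
      rw [HasFDerivAt.fderiv (f := v₂) h1, hG]
      refine Prod.ext ?_ ?_
      · simp [v₂, hx.2.2.1]
      · ext a
        have h3 := hγx.2 ((u x).2 (f₀ x)) ((u x).2 (f₀ a))
        simp [v₂, hx.2.2.1, hx.2.2.2, h3]
  obtain ⟨φ, h0, hsub, hφ, hsm, hsm'⟩ := exists_smooth_localInverse (a := (0 : X))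
    (f := fun x => (u x).1) (f' := f₀) (s := {x | v₁ x = v₂ x ∧ (u x).1 ∈ N})
    (hfst.mono fun x hx => hx.1)
    (by rw [← hφ0]; exact (hfst.self_of_nhds.1.differentiableAt (by simp)).hasFDerivAt)
    (heq.and (hφc.eventually_mem hN))
  refine ⟨φ, h0, by rw [hφ, hu0], ?_, fun x hx => ?_, hsm', fun x hx => ?_⟩
  · intro y hy
    have := (hsub (φ.map_target hy)).2
    rwa [← hφ, φ.right_inv hy] at this
  · rw [show (φ : X → X) = fun x => (u x).1 from funext hφ]
    exact hsm x hx
  · rw [hφ]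
    exact (congrArg Prod.fst (hsub hx).1).symm

end LocalConnection

/-! ### Isotropic subspaces of a symplectic vector space -/

section Symplectic

variable {V : Type*} [AddCommGroup V] [Module ℝ V] [FiniteDimensional ℝ V]
  {B : LinearMap.BilinForm ℝ V} {n : ℕ}

omit [FiniteDimensional ℝ V] in
lemma span_le_orthogonal_span {ι : Type*} {w : ι → V} (hw : ∀ i j, B (w i) (w j) = 0) :
    Submodule.span ℝ (Set.range w) ≤ B.orthogonal (Submodule.span ℝ (Set.range w)) := by
  rw [Submodule.span_le]
  rintro _ ⟨j, rfl⟩ x hx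
  have : Submodule.span ℝ (Set.range w) ≤ LinearMap.ker (B.flip (w j)) := by
    rw [Submodule.span_le]
    rintro _ ⟨i, rfl⟩
    exact hw i j
  exact this hx

/-- A linearly independent isotropic family extends to a basis of a Lagrangian subspace. -/
lemma exists_lagrangian_extension (hB : B.Nondegenerate) (hA : B.IsAlt)
    (hV : Module.finrank ℝ V = 2 * n) {k : ℕ} (w : Fin k → V) (hw : LinearIndependent ℝ w)
    (hiso : ∀ i j, B (w i) (w j) = 0) {m : ℕ} (hk : k ≤ m) (hm : m ≤ n) :
    ∃ w' : Fin m → V, LinearIndependent ℝ w' ∧ (∀ i j, B (w' i) (w' j) = 0) ∧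
      ∀ i : Fin k, w' (Fin.castLE hk i) = w i := by
  induction m, hk using Nat.le_induction with
  | base => exact ⟨w, hw, hiso, fun i => rfl⟩
  | succ m hk ih =>
    obtain ⟨w', h1, h2, h3⟩ := ih (by omega)
    set S := Submodule.span ℝ (Set.range w') with hS
    have hdim : Module.finrank ℝ S = m := by
      rw [hS, finrank_span_eq_card h1, Fintype.card_fin]
    have hdim' : Module.finrank ℝ (B.orthogonal S) = 2 * n - m := by
      rw [LinearMap.BilinForm.finrank_orthogonal hB, hV, hdim]
    obtain ⟨y, hy, hyS⟩ : ∃ y ∈ B.orthogonal S, y ∉ S := by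
      by_contra! h
      have := Submodule.finrank_mono (show B.orthogonal S ≤ S from h)
      omega
    have hwy : ∀ i, B (w' i) y = 0 := fun i => hy _ (Submodule.subset_span ⟨i, rfl⟩)
    refine ⟨Fin.snoc w' y, h1.finSnoc hyS, ?_, fun i => ?_⟩
    · intro i j
      refine Fin.lastCases ?_ (fun i => ?_) i <;> refine Fin.lastCases ?_ (fun j => ?_) j
      · simpa using hA y
      · simp only [Fin.snoc_last, Fin.snoc_castSucc]
        exact hA.isRefl _ _ (hwy j)
      · simpa using hwy i
      · simpa using h2 i j
    · have : Fin.castLE (Nat.le_succ_of_le hk) i = (Fin.castLE hk i).castSucc := rfl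
      rw [this, Fin.snoc_castSucc, h3]

lemma finrank_le_of_isotropic (hB : B.Nondegenerate) (hV : Module.finrank ℝ V = 2 * n)
    {W : Submodule ℝ V} (hW : W ≤ B.orthogonal W) : Module.finrank ℝ W ≤ n := by
  have h1 := Submodule.finrank_mono hW
  rw [LinearMap.BilinForm.finrank_orthogonal hB, hV] at h1
  omega

/-- An isotropic subspace is contained in a Lagrangian subspace. -/
lemma exists_lagrangian_ge (hB : B.Nondegenerate) (hA : B.IsAlt)
    (hV : Module.finrank ℝ V = 2 * n) {W : Submodule ℝ V} (hW : W ≤ B.orthogonal W) :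
    ∃ w : Fin n → V, LinearIndependent ℝ w ∧ (∀ i j, B (w i) (w j) = 0) ∧
      W ≤ Submodule.span ℝ (Set.range w) := by
  let b := Module.finBasis ℝ W
  have hle := finrank_le_of_isotropic hB hV hW
  obtain ⟨w, h1, h2, h3⟩ := exists_lagrangian_extension hB hA hV (fun i => (b i : V))
    (b.linearIndependent.map' W.subtype W.ker_subtype) (fun i j => hW (b j).2 _ (b i).2) hle le_rfl
  refine ⟨w, h1, h2, fun x hx => ?_⟩
  have h4 := b.sum_repr ⟨x, hx⟩
  have h5 : x = ∑ i, b.repr ⟨x, hx⟩ i • (b i : V) := by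
    have := congrArg (Submodule.subtype W) h4
    rw [map_sum] at this
    exact this.symm
  rw [h5]
  exact Submodule.sum_mem _ fun i _ => Submodule.smul_mem _ _
    (Submodule.subset_span ⟨Fin.castLE hle i, h3 i⟩)

/-- A Lagrangian subspace is its own orthogonal complement. -/
lemma mem_span_of_orthogonal_lagrangian (hB : B.Nondegenerate)
    (hV : Module.finrank ℝ V = 2 * n) {w : Fin n → V} (hw : LinearIndependent ℝ w)
    (hiso : ∀ i j, B (w i) (w j) = 0) {x : V} (hx : ∀ i, B (w i) x = 0) :
    x ∈ Submodule.span ℝ (Set.range w) := by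
  have h1 := span_le_orthogonal_span hiso
  have h2 : Submodule.span ℝ (Set.range w) = B.orthogonal (Submodule.span ℝ (Set.range w)) := by
    apply Submodule.eq_of_le_of_finrank_eq h1
    rw [LinearMap.BilinForm.finrank_orthogonal hB, hV, finrank_span_eq_card hw, Fintype.card_fin]
    omega
  rw [h2]
  intro y hy
  have : Submodule.span ℝ (Set.range w) ≤ LinearMap.ker (B.flip x) := by
    rw [Submodule.span_le]
    rintro _ ⟨i, rfl⟩
    exact hx i
  exact this hy

/-- An isotropic subspace is the intersection of the Lagrangian subspaces containing it. -/
lemma mem_of_forall_lagrangian (hB : B.Nondegenerate) (hA : B.IsAlt)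
    (hV : Module.finrank ℝ V = 2 * n) {W : Submodule ℝ V} (hW : W ≤ B.orthogonal W) {x : V}
    (hx : ∀ w : Fin n → V, LinearIndependent ℝ w → (∀ i j, B (w i) (w j) = 0) →
      W ≤ Submodule.span ℝ (Set.range w) → x ∈ Submodule.span ℝ (Set.range w)) : x ∈ W := by
  rw [← LinearMap.BilinForm.orthogonal_orthogonal hB hA.isRefl W]
  intro y hy
  have hsymm : ∀ a b, B a b = 0 → B b a = 0 := fun a b h => hA.isRefl a b h
  have hWy : W ⊔ Submodule.span ℝ {y} ≤ B.orthogonal (W ⊔ Submodule.span ℝ {y}) := by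
    intro a ha b hb
    obtain ⟨a₁, ha₁, a₂, ha₂, rfl⟩ := Submodule.mem_sup.1 ha
    obtain ⟨b₁, hb₁, b₂, hb₂, rfl⟩ := Submodule.mem_sup.1 hb
    obtain ⟨s, rfl⟩ := Submodule.mem_span_singleton.1 ha₂
    obtain ⟨t, rfl⟩ := Submodule.mem_span_singleton.1 hb₂
    have h1 : B b₁ a₁ = 0 := hW ha₁ _ hb₁
    have h2 : B b₁ y = 0 := hy _ hb₁
    have h3 : B y a₁ = 0 := hsymm _ _ (hy _ ha₁)
    have h4 : B y y = 0 := hA y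
    change B (b₁ + t • y) (a₁ + s • y) = 0
    simp [h1, h2, h3, h4]
  obtain ⟨w, h1, h2, h3⟩ := exists_lagrangian_ge hB hA hV hWy
  have h4 := hx w h1 h2 (le_sup_left.trans h3)
  exact span_le_orthogonal_span h2 h4 _ (h3 (Submodule.mem_sup_right (Submodule.mem_span_singleton_self y)))

end Symplectic

namespace LocalConnection

variable {E : Type*} [NormedAddCommGroup E] [NormedSpace ℝ E] [FiniteDimensional ℝ E]
  {L : LocalConnection E}

/-- The pullback, by a local field of Legendrian frames `a`, of the forms `τ(a_i, ∇ a_j)` of the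
system of geodesic Legendrian submanifolds. -/
noncomputable def parallelForm (L : LocalConnection E) (a b : E → E) (e : E) : E →L[ℝ] ℝ :=
  (L.τ e (a e)).comp (fderiv ℝ b e + (L.Γ e).flip (b e))

omit [FiniteDimensional ℝ E] in
/-- At a point where `b` is parallel, the exterior derivative of `τ(a, ∇ b)` is the curvature. -/
lemma dForm_parallelForm {a b : E → E} {e : E} (hτ : ContDiffAt ℝ ∞ L.τ e)
    (hΓ : ContDiffAt ℝ ∞ L.Γ e) (ha : ContDiffAt ℝ ∞ a e) (hb : ContDiffAt ℝ ∞ b e)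
    (hpar : ∀ v, fderiv ℝ b e v + L.Γ e v (b e) = 0) (v w : E) :
    dForm (L.parallelForm a b) e v w = L.τ e (a e) (L.curvature e v w (b e)) := by
  have hτd := (hτ.differentiableAt (by simp)).hasFDerivAt
  have hΓd := (hΓ.differentiableAt (by simp)).hasFDerivAt
  have had := (ha.differentiableAt (by simp)).hasFDerivAt
  have hbd := (hb.differentiableAt (by simp)).hasFDerivAt
  have hbdd := ((hb.fderiv_right (m := ∞) (by norm_cast)).differentiableAt (by simp)).hasFDerivAt
  have hflip : HasFDerivAt (fun e => (L.Γ e).flip)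
      ((ContinuousLinearMap.flipₗᵢ ℝ E E E).toContinuousLinearEquiv.toContinuousLinearMap.comp
        (fderiv ℝ L.Γ e)) e :=
    (ContinuousLinearMap.flipₗᵢ ℝ E E E).toContinuousLinearEquiv.toContinuousLinearMap.hasFDerivAt.comp
      e hΓd
  have h1 := (hτd.clm_apply had).clm_comp (hbdd.add (hflip.clm_apply hbd))
  have hz : fderiv ℝ b e + (L.Γ e).flip (b e) = 0 := by
    ext v
    exact hpar v
  have hsymm := (hb.isSymmSndFDerivAt (by simp; norm_cast)) v w
  have hb' : ∀ v, fderiv ℝ b e v = -L.Γ e v (b e) := fun v => eq_neg_of_add_eq_zero_left (hpar v)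
  have hval : ∀ v w, fderiv ℝ (L.parallelForm a b) e v w = L.τ e (a e)
      (fderiv ℝ (fderiv ℝ b) e v w + (fderiv ℝ L.Γ e v w (b e) - L.Γ e w (L.Γ e v (b e)))) := by
    intro v w
    rw [HasFDerivAt.fderiv (f := L.parallelForm a b) h1]
    simp [hz, hb']
    ring
  rw [dForm, hval, hval, ← map_sub, hsymm, curvature]
  congr 1
  abel

/-- Nondegeneracy of `τ` on `ker θ`, in dimension `2n + 1`. -/
structure IsSymplecticAt (L : LocalConnection E) (n : ℕ) (e : E) : Prop where
  finrank_eq : Module.finrank ℝ E = 2 * n + 1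
  ne_zero : L.θ e ≠ 0
  alt : ∀ v, L.τ e v v = 0
  nondegenerate : ∀ v, L.θ e v = 0 → (∀ w, L.θ e w = 0 → L.τ e v w = 0) → v = 0

/-- The restriction of `τ` to `ker θ`. -/
noncomputable def symplecticForm (L : LocalConnection E) (e : E) :
    LinearMap.BilinForm ℝ (LinearMap.ker (L.θ e).toLinearMap) :=
  LinearMap.mk₂ ℝ (fun v w => L.τ e v w) (by simp) (by simp) (by simp) (by simp)

lemma IsSymplecticAt.finrank_ker {n : ℕ} {e : E} (h : L.IsSymplecticAt n e) :
    Module.finrank ℝ (LinearMap.ker (L.θ e).toLinearMap) = 2 * n := by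
  have h1 := (L.θ e).toLinearMap.finrank_range_add_finrank_ker
  have h2 : LinearMap.range (L.θ e).toLinearMap = ⊤ := by
    rw [LinearMap.range_eq_top]
    exact LinearMap.surjective (fun h0 => h.ne_zero (ContinuousLinearMap.ext fun x =>
      DFunLike.congr_fun h0 x))
  rw [h2, finrank_top, Module.finrank_self, h.finrank_eq] at h1
  omega

omit [FiniteDimensional ℝ E] in
lemma IsSymplecticAt.isAlt {n : ℕ} {e : E} (h : L.IsSymplecticAt n e) :
    (L.symplecticForm e).IsAlt := fun v => h.alt v

omit [FiniteDimensional ℝ E] in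
lemma IsSymplecticAt.symplecticForm_nondegenerate {n : ℕ} {e : E} (h : L.IsSymplecticAt n e) :
    (L.symplecticForm e).Nondegenerate := by
  constructor
  · intro v hv
    exact Subtype.ext (h.nondegenerate v v.2 fun w hw => hv ⟨w, hw⟩)
  · intro v hv
    refine Subtype.ext (h.nondegenerate v v.2 fun w hw => ?_)
    have := h.isAlt.isRefl _ _ (hv ⟨w, hw⟩)
    exact this

omit [FiniteDimensional ℝ E] in
/-- The curvature of a connection that preserves `θ` takes values in `ker θ`. -/
lemma theta_curvature {e : E} (h : ∀ᶠ e in 𝓝 e, L.IsConformalAt e) (v w u : E) :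
    L.θ e (L.curvature e v w u) = 0 := by
  have hθd := (h.self_of_nhds.smooth_θ.differentiableAt (by simp)).hasFDerivAt
  have hΓd := (h.self_of_nhds.smooth_Γ.differentiableAt (by simp)).hasFDerivAt
  have hθdd := ((h.self_of_nhds.smooth_θ.fderiv_right (m := ∞) (by norm_cast)).differentiableAt
    (by simp)).hasFDerivAt
  have hsymm := (h.self_of_nhds.smooth_θ.isSymmSndFDerivAt (by simp; norm_cast)) v w
  have key : ∀ v w, fderiv ℝ (fderiv ℝ L.θ) e v w u =
      L.θ e (fderiv ℝ L.Γ e v w u) + L.θ e (L.Γ e v (L.Γ e w u)) := by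
    intro v w
    have h1 := (hθdd.clm_apply (hasFDerivAt_const w e)).clm_apply (hasFDerivAt_const u e)
    have h2 := hθd.clm_apply ((hΓd.clm_apply (hasFDerivAt_const w e)).clm_apply
      (hasFDerivAt_const u e))
    have h3 : (fun e => fderiv ℝ L.θ e w u) =ᶠ[𝓝 e] fun e => L.θ e (L.Γ e w u) :=
      h.mono fun e he => he.parallel_θ w u
    have h4 := DFunLike.congr_fun (h1.unique (h2.congr_of_eventuallyEq h3)) v
    simpa [h.self_of_nhds.parallel_θ] using h4
  have h1 := key v w
  have h2 := key w v
  rw [hsymm] at h1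
  have h3 := h1.symm.trans h2
  simp only [curvature, map_add, map_sub]
  linarith

/-- If the system of geodesic Legendrian submanifolds is Frobenius, the curvature preserves all
isotropic subspaces. It suffices to test the Frobenius condition on frames that are parallel at the
given point; isotropic subspaces are intersections of Lagrangian ones. -/
theorem curvature_mem_of_frobenius {n : ℕ} {e₀ : E}
    (hL : ∀ᶠ e in 𝓝 e₀, L.IsConformalAt e) (hs : L.IsSymplecticAt n e₀)
    (hF : ∀ a : Fin n → E → E, (∀ i, ∀ᶠ e in 𝓝 e₀, ContDiffAt ℝ ∞ (a i) e) →
      (∀ᶠ e in 𝓝 e₀, LinearIndependent ℝ (fun i => a i e) ∧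
        ∀ i, L.θ e (a i e) = 0 ∧ ∀ j, L.τ e (a i e) (a j e) = 0) →
      (∀ i v, fderiv ℝ (a i) e₀ v + L.Γ e₀ v (a i e₀) = 0) →
      ∀ v ∈ Submodule.span ℝ (Set.range fun i => a i e₀),
      ∀ w ∈ Submodule.span ℝ (Set.range fun i => a i e₀), ∀ i j,
        dForm (L.parallelForm (a i) (a j)) e₀ v w = 0)
    {W : Submodule ℝ E} (hW : L.IsIsotropic e₀ W) {v w u : E} (hv : v ∈ W) (hw : w ∈ W)
    (hu : u ∈ W) : L.curvature e₀ v w u ∈ W := by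
  have hcomp : CompleteSpace E := FiniteDimensional.complete ℝ E
  -- First the case of a Lagrangian subspace with basis `l`.
  have hlag : ∀ l : Fin n → LinearMap.ker (L.θ e₀).toLinearMap, LinearIndependent ℝ l →
      (∀ i j, L.symplecticForm e₀ (l i) (l j) = 0) →
      v ∈ Submodule.span ℝ (Set.range fun i => (l i : E)) →
      w ∈ Submodule.span ℝ (Set.range fun i => (l i : E)) → ∀ i j,
      L.τ e₀ (l i) (L.curvature e₀ v w (l j)) = 0 := by
    intro l hl hiso hvl hwl i j
    obtain ⟨A, hA0, hA⟩ := L.exists_radially_parallel_frame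
      (hL.mono fun e he => he.smooth_Γ)
    have htr : Tendsto (fun e => e - e₀) (𝓝 e₀) (𝓝 0) := by
      have : Continuous (fun e => e - e₀) := by fun_prop
      simpa using this.tendsto e₀
    have htr' : Tendsto (fun x => e₀ + x) (𝓝 0) (𝓝 e₀) := by
      have : Continuous (fun x => e₀ + x) := by fun_prop
      simpa using this.tendsto 0
    let a : Fin n → E → E := fun i e => A (e - e₀) (l i)
    have ha0 : ∀ i, a i e₀ = l i := by
      intro i
      simp [a, hA0]
    have hiso' : ∀ᶠ e in 𝓝 e₀, ∀ i, L.θ e (a i e) = 0 ∧ ∀ j, L.τ e (a i e) (a j e) = 0 := by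
      have h1 := eventually_isotropic_transport (L := L) (σ := fun x => e₀ + x) (A := A)
        (htr'.eventually hL) (Eventually.of_forall fun x => contDiffAt_const.add contDiffAt_id)
        (hA.mono fun x hx => hx.1) (hA.mono fun x hx => by
          have h0 : fderiv ℝ (fun x => e₀ + x) x = ContinuousLinearMap.id ℝ E :=
            ((hasFDerivAt_id x).const_add e₀).fderiv
          rw [hx.2, h0]
          rfl)
        hA0 (W := Submodule.span ℝ (Set.range fun i => (l i : E))) (by
          rw [add_zero]
          exact isIsotropic_span (fun i => (l i).2) (fun i j => hiso i j))
      filter_upwards [htr.eventually h1] with e he i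
      have hmem : ∀ i, a i e ∈ (Submodule.span ℝ (Set.range fun i => (l i : E))).map
          (A (e - e₀)).toLinearMap := fun i =>
        Submodule.mem_map_of_mem (f := (A (e - e₀)).toLinearMap) (Submodule.subset_span ⟨i, rfl⟩)
      rw [add_sub_cancel] at he
      exact ⟨(he _ (hmem i)).1, fun j => (he _ (hmem i)).2 _ (hmem j)⟩
    have hind : ∀ᶠ e in 𝓝 e₀, LinearIndependent ℝ (fun i => a i e) := by
      have h1 : ContinuousAt A 0 := hA.self_of_nhds.1.continuousAt
      have h2 := (ContinuousLinearEquiv.refl ℝ E).nhds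
      have h3 : (ContinuousLinearEquiv.refl ℝ E : E →L[ℝ] E) = A 0 := hA0.symm
      rw [h3] at h2
      filter_upwards [htr.eventually (h1.eventually_mem h2)] with e he
      obtain ⟨f, hf⟩ := he
      have h4 := hl.map' (LinearMap.ker (L.θ e₀).toLinearMap).subtype (Submodule.ker_subtype _)
      have h5 := h4.map' f.toLinearEquiv.toLinearMap f.toLinearEquiv.ker
      have h6 : (fun i => a i e) = fun i => f (l i : E) := by
        ext i
        simp only [a, ← hf]
        rfl
      rw [h6]
      exact h5
    have hsm : ∀ i, ∀ᶠ e in 𝓝 e₀, ContDiffAt ℝ ∞ (a i) e := by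
      intro i
      filter_upwards [htr.eventually hA] with e he
      exact (he.1.comp e (contDiffAt_id.sub contDiffAt_const)).clm_apply contDiffAt_const
    have hpar : ∀ i v, fderiv ℝ (a i) e₀ v + L.Γ e₀ v (a i e₀) = 0 := by
      intro i v
      have h1 : fderiv ℝ A 0 = -((ContinuousLinearMap.compL ℝ E E E).flip (A 0)).comp (L.Γ e₀) := by
        have hΓc : ContinuousAt (fun x => L.Γ (e₀ + x)) 0 := by
          refine ContinuousAt.comp (g := L.Γ) (f := fun x => e₀ + x) ?_ (by fun_prop)
          rw [add_zero]
          exact hL.self_of_nhds.smooth_Γ.continuousAt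
        have := radial_eq_at_zero (H := fderiv ℝ A)
          (L := fun x => -((ContinuousLinearMap.compL ℝ E E E).flip (A x)).comp (L.Γ (e₀ + x)))
          (hA.self_of_nhds.1.fderiv_right (m := 0) (by simp)).continuousAt
          ((continuousAt_const.clm_apply hA.self_of_nhds.1.continuousAt).clm_comp hΓc).neg
          (hA.mono fun x hx => by rw [hx.2]; rfl)
        rw [this, add_zero]
      have h2 : HasFDerivAt A (fderiv ℝ A 0) (e₀ - e₀) := by
        rw [sub_self]
        exact (hA.self_of_nhds.1.differentiableAt (by simp)).hasFDerivAt
      have h3 := (HasFDerivAt.comp (f := fun e => e - e₀) e₀ h2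
          ((hasFDerivAt_id e₀).sub_const e₀)).clm_apply
        (hasFDerivAt_const (l i : E) e₀)
      rw [HasFDerivAt.fderiv (f := a i) h3, h1, ha0]
      simp [hA0]
    have h1 := hF a hsm (hind.and hiso') hpar v (by simpa only [ha0] using hvl) w
      (by simpa only [ha0] using hwl) i j
    rw [dForm_parallelForm hL.self_of_nhds.smooth_τ hL.self_of_nhds.smooth_Γ
      (hsm i).self_of_nhds (hsm j).self_of_nhds (hpar j), ha0, ha0] at h1
    exact h1
  -- Then the general case.
  let W' : Submodule ℝ (LinearMap.ker (L.θ e₀).toLinearMap) := W.comap (Submodule.subtype _)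
  let x : LinearMap.ker (L.θ e₀).toLinearMap := ⟨L.curvature e₀ v w u, theta_curvature hL v w u⟩
  have hspan : ∀ {l : Fin n → LinearMap.ker (L.θ e₀).toLinearMap}
      {y : LinearMap.ker (L.θ e₀).toLinearMap}, y ∈ Submodule.span ℝ (Set.range l) →
      (y : E) ∈ Submodule.span ℝ (Set.range fun i => (l i : E)) := by
    intro l y hy
    have := Submodule.mem_map_of_mem (f := Submodule.subtype _) hy
    rwa [Submodule.map_span, ← Set.range_comp] at this
  have hx : x ∈ W' := by
    refine mem_of_forall_lagrangian hs.symplecticForm_nondegenerate hs.isAlt hs.finrank_ker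
      (fun a ha b hb => (hW b hb).2 a ha) (fun l hl hiso hWl => ?_)
    refine mem_span_of_orthogonal_lagrangian hs.symplecticForm_nondegenerate hs.finrank_ker hl hiso
      (fun i => ?_)
    have h1 := hlag l hl hiso (hspan (hWl (x := ⟨v, (hW v hv).1⟩) hv))
      (hspan (hWl (x := ⟨w, (hW w hw).1⟩) hw)) i
    have h2 : Submodule.span ℝ (Set.range fun i => (l i : E)) ≤ LinearMap.ker
        ((L.τ e₀ (l i)).toLinearMap.comp ((fderiv ℝ L.Γ e₀ v w - fderiv ℝ L.Γ e₀ w v +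
          (L.Γ e₀ v).comp (L.Γ e₀ w) - (L.Γ e₀ w).comp (L.Γ e₀ v)).toLinearMap)) := by
      rw [Submodule.span_le]
      rintro _ ⟨j, rfl⟩
      exact h1 j
    exact h2 (hspan (hWl (x := ⟨u, (hW u hu).1⟩) hu))
  exact hx

end LocalConnection

/-! ### Pullback of 1-forms and vector fields to coordinates -/

section Coordinates

variable {d m : ℕ} {M : Type*} [TopologicalSpace M] [ChartedSpace (Euc d) M]

/-- The derivative at `z` of the preferred chart at `y`. -/
noncomputable def chartD (y z : M) : TangentSpace (𝓡 d) z →L[ℝ] Euc d :=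
  mfderiv (𝓡 d) 𝓘(ℝ, Euc d) (extChartAt (𝓡 d) y) z

/-- The derivative at `e` of the inverse of the preferred chart at `y`. -/
noncomputable def chartDSymm (y : M) (e : Euc d) :
    Euc d →L[ℝ] TangentSpace (𝓡 d) ((extChartAt (𝓡 d) y).symm e) :=
  mfderiv 𝓘(ℝ, Euc d) (𝓡 d) (extChartAt (𝓡 d) y).symm e

/-- The pullback of a 1-form under a map from a Euclidean space. -/
noncomputable def OneForm.pull (α : OneForm d M) (f : Euc m → M) (e : Euc m) : Euc m →L[ℝ] ℝ :=
  LinearMap.toContinuousLinearMap ((α (f e)).comp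
    (mfderiv 𝓘(ℝ, Euc m) (𝓡 d) f e : Euc m →L[ℝ] TangentSpace (𝓡 d) (f e)).toLinearMap)

lemma OneForm.pull_apply (α : OneForm d M) (f : Euc m → M) (e v : Euc m) :
    α.pull f e v = α (f e) (mfderiv 𝓘(ℝ, Euc m) (𝓡 d) f e v) := rfl

lemma OneForm.inChart_apply (α : OneForm d M) (y : M) (e v : Euc d) :
    α.inChart y e v = α ((extChartAt (𝓡 d) y).symm e) (chartDSymm y e v) := rfl

lemma OneForm.extD_apply (α : OneForm d M) (x : M) (v w : TangentSpace (𝓡 d) x) :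
    α.extD x v w = dForm (α.inChart x) (extChartAt (𝓡 d) x x) v w := rfl

lemma OneForm.congr_point (α : OneForm d M) {p q : M} (h : p = q) {a b : Euc d} (hab : a = b) :
    α p (a : TangentSpace (𝓡 d) p) = α q (b : TangentSpace (𝓡 d) q) := by
  subst h hab
  rfl

lemma contDiffAt_chart_comp [IsManifold (𝓡 d) ∞ M] {f : Euc m → M} {e : Euc m} {y : M}
    (hf : ContMDiffAt 𝓘(ℝ, Euc m) (𝓡 d) ∞ f e) (hy : f e ∈ (chartAt (Euc d) y).source) :
    ContDiffAt ℝ ∞ (extChartAt (𝓡 d) y ∘ f) e := by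
  rw [contMDiffAt_iff_target_of_mem_source hy] at hf
  exact hf.2.contDiffAt

lemma mfderiv_self_chart {f : Euc m → M} {e : Euc m}
    (hf : MDifferentiableAt 𝓘(ℝ, Euc m) (𝓡 d) f e) (v : Euc m) :
    (mfderiv 𝓘(ℝ, Euc m) (𝓡 d) f e v : Euc d) =
      fderiv ℝ (extChartAt (𝓡 d) (f e) ∘ f) e v := by
  rw [hf.mfderiv]
  simp only [writtenInExtChartAt, extChartAt_model_space_eq_id, modelWithCornersSelf_coe,
    Set.range_id, fderivWithin_univ, PartialEquiv.refl_symm, PartialEquiv.refl_coe,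
    Function.comp_id, id_eq]
  rfl

lemma chartD_mfderiv [IsManifold (𝓡 d) ∞ M] {f : Euc m → M} {e : Euc m} {y : M}
    (hf : MDifferentiableAt 𝓘(ℝ, Euc m) (𝓡 d) f e) (hy : f e ∈ (chartAt (Euc d) y).source)
    (v : Euc m) :
    chartD y (f e) (mfderiv 𝓘(ℝ, Euc m) (𝓡 d) f e v) = fderiv ℝ (extChartAt (𝓡 d) y ∘ f) e v := by
  have h1 : MDifferentiableAt (𝓡 d) 𝓘(ℝ, Euc d) (extChartAt (𝓡 d) y) (f e) :=
    mdifferentiableAt_extChartAt hy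
  have h2 := mfderiv_comp e h1 hf
  rw [← mfderiv_eq_fderiv, h2]
  rfl

lemma chartD_chartDSymm [IsManifold (𝓡 d) ∞ M] {y : M} {e : Euc d}
    (he : e ∈ (extChartAt (𝓡 d) y).target) (v : Euc d) :
    chartD y ((extChartAt (𝓡 d) y).symm e) (chartDSymm y e v) = v := by
  have := mfderiv_extChartAt_comp_mfderivWithin_extChartAt_symm (I := 𝓡 d) he
  simp only [modelWithCornersSelf_coe, Set.range_id, mfderivWithin_univ] at this
  exact congrArg (fun f : Euc d →L[ℝ] Euc d => f v) this

lemma chartDSymm_chartD [IsManifold (𝓡 d) ∞ M] {y : M} {e : Euc d}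
    (he : e ∈ (extChartAt (𝓡 d) y).target)
    (v : TangentSpace (𝓡 d) ((extChartAt (𝓡 d) y).symm e)) :
    chartDSymm y e (chartD y ((extChartAt (𝓡 d) y).symm e) v) = v := by
  have := mfderivWithin_extChartAt_symm_comp_mfderiv_extChartAt (I := 𝓡 d) he
  simp only [modelWithCornersSelf_coe, Set.range_id, mfderivWithin_univ] at this
  exact congrArg (fun f : Euc d →L[ℝ] Euc d => f v) this

lemma isInvertible_chartD [IsManifold (𝓡 d) ∞ M] {y z : M}
    (hz : z ∈ (chartAt (Euc d) y).source) : (chartD (d := d) y z).IsInvertible :=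
  isInvertible_mfderiv_extChartAt (by rwa [extChartAt_source])

lemma chartDSymm_eq_inverse [IsManifold (𝓡 d) ∞ M] {y : M} {e : Euc d}
    (he : e ∈ (extChartAt (𝓡 d) y).target) (v : Euc d) :
    (chartD y ((extChartAt (𝓡 d) y).symm e)).inverse v = chartDSymm y e v := by
  have h1 : (extChartAt (𝓡 d) y).symm e ∈ (chartAt (Euc d) y).source := by
    rw [← extChartAt_source (𝓡 d)]
    exact (extChartAt (𝓡 d) y).map_target he
  obtain ⟨f, hf⟩ := isInvertible_chartD h1
  have h2 := chartD_chartDSymm he v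
  rw [← hf] at h2 ⊢
  rw [ContinuousLinearMap.inverse_equiv]
  conv_lhs => rw [← h2]
  exact f.symm_apply_apply _

lemma mem_target_chart {y z : M} (hz : z ∈ (chartAt (Euc d) y).source) :
    extChartAt (𝓡 d) y z ∈ (extChartAt (𝓡 d) y).target :=
  (extChartAt (𝓡 d) y).map_source (by rwa [extChartAt_source])

lemma chart_left_inv {y z : M} (hz : z ∈ (chartAt (Euc d) y).source) :
    (extChartAt (𝓡 d) y).symm (extChartAt (𝓡 d) y z) = z :=
  (extChartAt (𝓡 d) y).left_inv (by rwa [extChartAt_source])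

lemma symm_mem_source {y : M} {e : Euc d} (he : e ∈ (extChartAt (𝓡 d) y).target) :
    (extChartAt (𝓡 d) y).symm e ∈ (chartAt (Euc d) y).source := by
  rw [← extChartAt_source (𝓡 d)]
  exact (extChartAt (𝓡 d) y).map_target he

lemma contMDiffAt_chart_symm [IsManifold (𝓡 d) ∞ M] {y : M} {e : Euc d}
    (he : e ∈ (extChartAt (𝓡 d) y).target) :
    ContMDiffAt 𝓘(ℝ, Euc d) (𝓡 d) ∞ (extChartAt (𝓡 d) y).symm e :=
  (contMDiffOn_extChartAt_symm y).contMDiffAt ((isOpen_extChartAt_target y).mem_nhds he)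

/-- In terms of the chart at `y`, the pullback of a 1-form under `f` is the ordinary pullback of
its coordinate expression. -/
lemma OneForm.pull_eventuallyEq [IsManifold (𝓡 d) ∞ M] (α : OneForm d M) {f : Euc m → M}
    {e : Euc m} {y : M} (hf : ContMDiffAt 𝓘(ℝ, Euc m) (𝓡 d) ∞ f e)
    (hy : f e ∈ (chartAt (Euc d) y).source) :
    α.pull f =ᶠ[𝓝 e] fun e' => (α.inChart y ((extChartAt (𝓡 d) y ∘ f) e')).comp
      (fderiv ℝ (extChartAt (𝓡 d) y ∘ f) e') := by
  have h1 : ∀ᶠ e' in 𝓝 e, f e' ∈ (chartAt (Euc d) y).source :=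
    hf.continuousAt.eventually_mem ((chartAt (Euc d) y).open_source.mem_nhds hy)
  have h2 : ∀ᶠ e' in 𝓝 e, ContMDiffAt 𝓘(ℝ, Euc m) (𝓡 d) 1 f e' :=
    (contMDiffAt_iff_contMDiffAt_nhds (by simp)).1 (hf.of_le (by simp))
  filter_upwards [h1.eventually_nhds, h1, h2] with e' h1 h1' h2
  ext v
  have h3 : MDifferentiableAt 𝓘(ℝ, Euc m) (𝓡 d) f e' := h2.mdifferentiableAt (by simp)
  rw [pull_apply]
  change _ = α.inChart y _ (fderiv ℝ (extChartAt (𝓡 d) y ∘ f) e' v)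
  rw [inChart_apply]
  have h4 : f e' = (extChartAt (𝓡 d) y).symm ((extChartAt (𝓡 d) y ∘ f) e') :=
    (chart_left_inv h1').symm
  refine α.congr_point h4 ?_
  rw [← chartD_mfderiv h3 h1' v]
  have h5 : ∀ z (h : f e' = z) (w : TangentSpace (𝓡 d) (f e')),
      (chartD y (f e') w : Euc d) = chartD y z (w : Euc d) := by
    rintro z rfl w
    rfl
  rw [h5 _ h4]
  exact (chartDSymm_chartD (mem_target_chart h1') _).symm

/-- Exterior differentiation commutes with pullback to a Euclidean space. -/
theorem OneForm.dForm_pull [IsManifold (𝓡 d) ∞ M] {α : OneForm d M} {f : Euc m → M}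
    {e : Euc m} (hf : ContMDiffAt 𝓘(ℝ, Euc m) (𝓡 d) ∞ f e) (hα : α.IsSmoothAt (f e)) :
    ContDiffAt ℝ ∞ (α.pull f) e ∧ ∀ v w, dForm (α.pull f) e v w =
      α.extD (f e) (mfderiv 𝓘(ℝ, Euc m) (𝓡 d) f e v) (mfderiv 𝓘(ℝ, Euc m) (𝓡 d) f e w) := by
  have hy : f e ∈ (chartAt (Euc d) (f e)).source := mem_chart_source _ _
  have h1 := α.pull_eventuallyEq hf hy
  have h2 := contDiffAt_chart_comp hf hy
  have h3 : ContDiffAt ℝ ∞ (α.inChart (f e)) ((extChartAt (𝓡 d) (f e) ∘ f) e) := hα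
  refine ⟨((h3.comp e h2).clm_comp (h2.fderiv_right (by simp))).congr_of_eventuallyEq h1,
    fun v w => ?_⟩
  have h4 := dForm_pullback (h2.of_le (by norm_cast)) (h3.differentiableAt (by simp)) v w
  have h5 : MDifferentiableAt 𝓘(ℝ, Euc m) (𝓡 d) f e := hf.mdifferentiableAt (by simp)
  rw [extD_apply]
  have h6 : dForm (α.pull f) e v w = dForm (fun e' => (α.inChart (f e)
      ((extChartAt (𝓡 d) (f e) ∘ f) e')).comp (fderiv ℝ (extChartAt (𝓡 d) (f e) ∘ f) e')) e v w := by
    simp only [dForm, h1.fderiv_eq]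
  rw [h6, h4.2]
  rw [← mfderiv_self_chart h5, ← mfderiv_self_chart h5]
  rfl

lemma OneForm.isSmoothAt_of_inChart [IsManifold (𝓡 d) ∞ M] {α : OneForm d M} {y : M} {e : Euc d}
    (he : e ∈ (extChartAt (𝓡 d) y).target) (h : ContDiffAt ℝ ∞ (α.inChart y) e) :
    α.IsSmoothAt ((extChartAt (𝓡 d) y).symm e) := by
  set z := (extChartAt (𝓡 d) y).symm e with hz
  have h0 : (extChartAt (𝓡 d) z).symm (extChartAt (𝓡 d) z z) = z := extChartAt_to_inv z
  have hy : (extChartAt (𝓡 d) z).symm (extChartAt (𝓡 d) z z) ∈ (chartAt (Euc d) y).source := by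
    rw [h0]
    exact symm_mem_source he
  have hf := contMDiffAt_chart_symm (mem_extChartAt_target (I := 𝓡 d) z)
  have h1 := α.pull_eventuallyEq hf hy
  have h2 := contDiffAt_chart_comp hf hy
  have h3 : (extChartAt (𝓡 d) y ∘ (extChartAt (𝓡 d) z).symm) (extChartAt (𝓡 d) z z) = e := by
    rw [Function.comp_apply, h0, hz]
    exact (extChartAt (𝓡 d) y).right_inv he
  exact (((h3.symm ▸ h : ContDiffAt ℝ ∞ (α.inChart y) _).comp _ h2).clm_comp
    (h2.fderiv_right (by simp))).congr_of_eventuallyEq h1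

lemma OneForm.inChart_of_isSmoothAt [IsManifold (𝓡 d) ∞ M] {α : OneForm d M} {y : M} {e : Euc d}
    (he : e ∈ (extChartAt (𝓡 d) y).target)
    (h : α.IsSmoothAt ((extChartAt (𝓡 d) y).symm e)) :
    ContDiffAt ℝ ∞ (α.inChart y) e ∧ ∀ v w, dForm (α.inChart y) e v w =
      α.extD ((extChartAt (𝓡 d) y).symm e) (chartDSymm y e v) (chartDSymm y e w) :=
  OneForm.dForm_pull (contMDiffAt_chart_symm he) h

/-- The expression of a vector field in the preferred chart at `y`. -/
noncomputable def chartField (y : M) (V : VField d M) (e : Euc d) : Euc d :=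
  chartD y ((extChartAt (𝓡 d) y).symm e) (V ((extChartAt (𝓡 d) y).symm e))

/-- The vector field with expression `v` in the preferred chart at `y`. -/
noncomputable def fieldOfChart (y : M) (v : Euc d → Euc d) : VField d M :=
  fun z => (chartD y z).inverse (v (extChartAt (𝓡 d) y z))

lemma chartField_fieldOfChart [IsManifold (𝓡 d) ∞ M] {y : M} {e : Euc d}
    (he : e ∈ (extChartAt (𝓡 d) y).target) (v : Euc d → Euc d) :
    chartField y (fieldOfChart y v) e = v e := by
  rw [chartField, fieldOfChart, (extChartAt (𝓡 d) y).right_inv he]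
  obtain ⟨f, hf⟩ := isInvertible_chartD (symm_mem_source he)
  rw [← hf, ContinuousLinearMap.inverse_equiv]
  exact f.apply_symm_apply _

lemma fieldOfChart_chartField [IsManifold (𝓡 d) ∞ M] {y z : M}
    (hz : z ∈ (chartAt (Euc d) y).source) (V : VField d M) :
    fieldOfChart y (chartField y V) z = V z := by
  rw [fieldOfChart, chartField]
  obtain ⟨f, hf⟩ := isInvertible_chartD hz
  have h : ∀ z' (_ : z' = z), (chartD y z' (V z') : Euc d) = chartD y z (V z) := by
    rintro z' rfl
    rfl
  rw [h _ (chart_left_inv hz), ← hf, ContinuousLinearMap.inverse_equiv]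
  exact f.symm_apply_apply _

lemma chartD_apply_eq_chartField {y z : M}
    (hz : z ∈ (chartAt (Euc d) y).source) (V : VField d M) :
    chartD y z (V z) = chartField y V (extChartAt (𝓡 d) y z) := by
  rw [chartField, chart_left_inv hz]

lemma contMDiffAt_field_iff [IsManifold (𝓡 d) ∞ M] {V : VField d M} {y : M} {e : Euc d}
    (he : e ∈ (extChartAt (𝓡 d) y).target) :
    ContMDiffAt (𝓡 d) (𝓡 d).tangent ∞ (fun p => (⟨p, V p⟩ : TangentBundle (𝓡 d) M))
      ((extChartAt (𝓡 d) y).symm e) ↔ ContDiffAt ℝ ∞ (chartField y V) e := by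
  have hz := symm_mem_source he
  have h1 : (extChartAt (𝓡 d) y).symm e ∈
      (trivializationAt (Euc d) (TangentSpace (𝓡 d)) y).baseSet := hz
  have h2 := (trivializationAt (Euc d) (TangentSpace (𝓡 d)) y).contMDiffAt_section_iff
    (IB := 𝓡 d) (n := ∞) (s := V) h1
  refine h2.trans ?_
  have h3 : (fun x => ((trivializationAt (Euc d) (TangentSpace (𝓡 d)) y) ⟨x, V x⟩).2) =ᶠ[
      𝓝 ((extChartAt (𝓡 d) y).symm e)] fun x => chartField y V (extChartAt (𝓡 d) y x) := by
    filter_upwards [(chartAt (Euc d) y).open_source.mem_nhds hz] with x hx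
    rw [← chartD_apply_eq_chartField hx, chartD,
      ← TangentBundle.continuousLinearMapAt_trivializationAt hx]
    rw [Bundle.Trivialization.continuousLinearMapAt_apply, Bundle.Trivialization.linearMapAt_apply]
    exact (if_pos hx).symm
  have hsymm := contMDiffAt_chart_symm he
  have hright : extChartAt (𝓡 d) y ((extChartAt (𝓡 d) y).symm e) = e :=
    (extChartAt (𝓡 d) y).right_inv he
  constructor
  · intro h
    have h4 := (h.congr_of_eventuallyEq h3.symm).comp e hsymm
    refine h4.contDiffAt.congr_of_eventuallyEq ?_
    filter_upwards [(isOpen_extChartAt_target y).mem_nhds he] with e' he'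
    rw [Function.comp_apply, (extChartAt (𝓡 d) y).right_inv he']
  · intro h
    refine ContMDiffAt.congr_of_eventuallyEq ?_ h3
    have h5 : ContMDiffAt (𝓡 d) 𝓘(ℝ, Euc d) ∞ (extChartAt (𝓡 d) y)
      ((extChartAt (𝓡 d) y).symm e) := contMDiffAt_extChartAt' hz
    exact ContMDiffAt.comp _ (hright.symm ▸ h.contMDiffAt) h5

lemma tendsto_chart_symm [IsManifold (𝓡 d) ∞ M] {y : M} {e : Euc d}
    (he : e ∈ (extChartAt (𝓡 d) y).target) :
    Tendsto (extChartAt (𝓡 d) y).symm (𝓝 e) (𝓝 ((extChartAt (𝓡 d) y).symm e)) :=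
  (contMDiffAt_chart_symm he).continuousAt

lemma tendsto_chart [IsManifold (𝓡 d) ∞ M] {y z : M}
    (hz : z ∈ (chartAt (Euc d) y).source) :
    Tendsto (extChartAt (𝓡 d) y) (𝓝 z) (𝓝 (extChartAt (𝓡 d) y z)) :=
  (contMDiffAt_extChartAt' (I := 𝓡 d) (n := ∞) hz).continuousAt

lemma eventually_chart_iff [IsManifold (𝓡 d) ∞ M] {y : M} {e : Euc d}
    (he : e ∈ (extChartAt (𝓡 d) y).target) {p : M → Prop} :
    (∀ᶠ z in 𝓝 ((extChartAt (𝓡 d) y).symm e), p z) ↔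
      ∀ᶠ e' in 𝓝 e, p ((extChartAt (𝓡 d) y).symm e') := by
  refine ⟨fun h => (tendsto_chart_symm he).eventually h, fun h => ?_⟩
  have h1 := tendsto_chart (symm_mem_source he)
  rw [(extChartAt (𝓡 d) y).right_inv he] at h1
  filter_upwards [h1.eventually h,
    (chartAt (Euc d) y).open_source.mem_nhds (symm_mem_source he)] with z hz hz'
  rwa [chart_left_inv hz'] at hz

lemma smoothNear_iff [IsManifold (𝓡 d) ∞ M] {V : VField d M} {y : M} {e : Euc d}
    (he : e ∈ (extChartAt (𝓡 d) y).target) :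
    SmoothNear V ((extChartAt (𝓡 d) y).symm e) ↔
      ∀ᶠ e' in 𝓝 e, ContDiffAt ℝ ∞ (chartField y V) e' := by
  rw [SmoothNear, eventually_chart_iff he]
  refine eventually_congr ?_
  filter_upwards [(isOpen_extChartAt_target y).mem_nhds he] with e' he'
  exact contMDiffAt_field_iff he'

lemma mfderiv_chartDSymm [IsManifold (𝓡 d) ∞ M] {F : M → ℝ} {g : Euc d → ℝ} {y : M} {e : Euc d}
    (he : e ∈ (extChartAt (𝓡 d) y).target) (hg : DifferentiableAt ℝ g e)
    (hF : ∀ᶠ e' in 𝓝 e, F ((extChartAt (𝓡 d) y).symm e') = g e') (v : Euc d) :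
    (show ℝ from mfderiv (𝓡 d) 𝓘(ℝ, ℝ) F ((extChartAt (𝓡 d) y).symm e) (chartDSymm y e v)) =
      fderiv ℝ g e v := by
  have hright := (extChartAt (𝓡 d) y).right_inv he
  have h1 : F =ᶠ[𝓝 ((extChartAt (𝓡 d) y).symm e)] g ∘ extChartAt (𝓡 d) y := by
    rw [Filter.EventuallyEq, eventually_chart_iff he]
    filter_upwards [hF, (isOpen_extChartAt_target y).mem_nhds he] with e' h1 h2
    rw [h1, Function.comp_apply, (extChartAt (𝓡 d) y).right_inv h2]
  have h4 : MDifferentiableAt (𝓡 d) 𝓘(ℝ, Euc d) (extChartAt (𝓡 d) y)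
      ((extChartAt (𝓡 d) y).symm e) := mdifferentiableAt_extChartAt (symm_mem_source he)
  have h5 : MDifferentiableAt 𝓘(ℝ, Euc d) 𝓘(ℝ, ℝ) g
      (extChartAt (𝓡 d) y ((extChartAt (𝓡 d) y).symm e)) := by
    rw [hright]
    exact hg.mdifferentiableAt
  rw [h1.mfderiv_eq, mfderiv_comp _ h5 h4, mfderiv_eq_fderiv]
  have h7 := chartD_chartDSymm he v
  change fderiv ℝ g (extChartAt (𝓡 d) y ((extChartAt (𝓡 d) y).symm e))
    (chartD y _ (chartDSymm y e v)) = _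
  rw [h7, hright]

lemma mlieBracket_chart [IsManifold (𝓡 d) ∞ M] {V W : VField d M} {y : M} {e : Euc d}
    (he : e ∈ (extChartAt (𝓡 d) y).target)
    (hV : ContDiffAt ℝ ∞ (chartField y V) e) (hW : ContDiffAt ℝ ∞ (chartField y W) e) :
    chartD y ((extChartAt (𝓡 d) y).symm e)
      (VectorField.mlieBracket (𝓡 d) V W ((extChartAt (𝓡 d) y).symm e)) =
      fderiv ℝ (chartField y W) e (chartField y V e) -
        fderiv ℝ (chartField y V) e (chartField y W e) := by
  have hV' := ((contMDiffAt_field_iff he).2 hV).mdifferentiableAt (by simp)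
  have hW' := ((contMDiffAt_field_iff he).2 hW).mdifferentiableAt (by simp)
  have : IsManifold (𝓡 d) (minSmoothness ℝ 3) M := by
    rw [minSmoothness_of_isRCLikeNormedField]
    exact IsManifold.of_le (n := ∞) (by norm_cast)
  have h1 := VectorField.mpullback_mlieBracket (I := 𝓘(ℝ, Euc d)) (I' := 𝓡 d) (n := ∞)
    (f := (extChartAt (𝓡 d) y).symm) (x₀ := e) hV' hW' (contMDiffAt_chart_symm he)
    (by rw [minSmoothness_of_isRCLikeNormedField]; norm_cast)
  have h2 : ∀ X : VField d M, ∀ e' ∈ (extChartAt (𝓡 d) y).target,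
      VectorField.mpullback 𝓘(ℝ, Euc d) (𝓡 d) (extChartAt (𝓡 d) y).symm X e' =
        chartField y X e' := by
    intro X e' he'
    rw [VectorField.mpullback_apply]
    have h3 : ContinuousLinearMap.inverse (chartDSymm y e') =
        chartD y ((extChartAt (𝓡 d) y).symm e') :=
      ContinuousLinearMap.inverse_eq
        (ContinuousLinearMap.ext fun v => chartDSymm_chartD he' v)
        (ContinuousLinearMap.ext fun v => chartD_chartDSymm he' v)
    exact congrArg (fun f : Euc d →L[ℝ] Euc d => f (X ((extChartAt (𝓡 d) y).symm e'))) h3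
  have h4 : ∀ X : VField d M, VectorField.mpullback 𝓘(ℝ, Euc d) (𝓡 d)
      (extChartAt (𝓡 d) y).symm X =ᶠ[𝓝 e] chartField y X := by
    intro X
    filter_upwards [(isOpen_extChartAt_target y).mem_nhds he] with e' he'
    exact h2 X e' he'
  rw [h2 _ _ he] at h1
  have h5 : ∀ A B : (e' : Euc d) → TangentSpace 𝓘(ℝ, Euc d) e',
      VectorField.mlieBracket 𝓘(ℝ, Euc d) A B e =
      VectorField.lieBracketWithin ℝ (A : Euc d → Euc d) (B : Euc d → Euc d) Set.univ e := by
    intro A B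
    rw [← VectorField.mlieBracketWithin_univ, VectorField.mlieBracketWithin_eq_lieBracketWithin]
  rw [← chartField, h1]
  refine (h5 _ _).trans ?_
  have h6 : ∀ A : Euc d → Euc d, fderivWithin ℝ A Set.univ e = fderiv ℝ A e := fun A => by
    rw [fderivWithin_univ]
  simp only [VectorField.lieBracketWithin]
  rw [h2 V e he, h2 W e he, ← (h4 V).fderiv_eq, ← (h4 W).fderiv_eq]
  exact congrArg₂ (fun P Q : Euc d →L[ℝ] Euc d => P (chartField y V e) - Q (chartField y W e))
    (h6 _) (h6 _)

end Coordinates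

/-! ### Coordinate expression of a conformal symplectic connection -/

section ChartConnection

variable {n : ℕ} {Y : Type*} [TopologicalSpace Y] [ChartedSpace (Euc (2 * n + 1)) Y]
  [IsManifold (𝓡 (2 * n + 1)) ∞ Y] {C : ContactStructure n Y}

namespace ContactStructure

lemma IsSectionNear.congr {V V' : VField (2 * n + 1) Y} {z : Y} (h : C.IsSectionNear V z)
    (hV : V =ᶠ[𝓝 z] V') : C.IsSectionNear V' z := by
  refine ⟨?_, ?_⟩
  · filter_upwards [h.1, hV.eventually_nhds] with w hw hVw
    refine hw.congr_of_eventuallyEq ?_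
    filter_upwards [hVw] with p hp
    rw [hp]
  · filter_upwards [h.2, hV] with w hw hVw
    rwa [← hVw]

omit [IsManifold (𝓡 (2 * n + 1)) ∞ Y] in
lemma IsGenerator.eventually {θ : OneForm (2 * n + 1) Y} {y : Y} (h : C.IsGenerator θ y) :
    ∀ᶠ z in 𝓝 y, C.IsGenerator θ z :=
  Filter.Eventually.eventually_nhds h

end ContactStructure

namespace ConformalSymplecticConnection

variable (D : ConformalSymplecticConnection C)

/-- The covariant derivative only depends on the germ of the section. -/
lemma cov_congr {V V' : VField (2 * n + 1) Y} {z : Y} (h : C.IsSectionNear V z)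
    (hV : V =ᶠ[𝓝 z] V') : D.cov V z = D.cov V' z := by
  classical
  let f : Y → ℝ := fun w => if V w = V' w then 1 else 0
  have hf : f =ᶠ[𝓝 z] fun _ => 1 := by
    filter_upwards [hV] with w hw
    exact if_pos hw
  have hfs : ∀ᶠ w in 𝓝 z, ContMDiffAt (𝓡 (2 * n + 1)) 𝓘(ℝ, ℝ) ∞ f w := by
    filter_upwards [hf.eventually_nhds] with w hw
    exact contMDiffAt_const.congr_of_eventuallyEq hw
  have hf0 : mfderiv (𝓡 (2 * n + 1)) 𝓘(ℝ, ℝ) f z = 0 := by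
    rw [hf.mfderiv_eq]
    exact mfderiv_const
  have hfV : (fun w => f w • V w) = fun w => f w • V' w := by
    ext1 w
    by_cases hw : V w = V' w
    · rw [hw]
    · simp [f, hw]
  ext1 X
  have h1 := D.leibniz f V z X h hfs
  have h2 := D.leibniz f V' z X (h.congr hV) hfs
  rw [hfV, h2, hf.self_of_nhds, hf0] at h1
  change (1 : ℝ) • D.cov V' z X + (0 : ℝ) • V' z = (1 : ℝ) • D.cov V z X + (0 : ℝ) • V z at h1
  simpa using h1.symm

lemma cov_zero (z : Y) (h : C.IsSectionNear (fun _ => 0) z) : D.cov (fun _ => 0) z = 0 := by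
  ext1 X
  have h1 := D.leibniz (fun _ => 0) (fun _ => 0) z X h
    (Eventually.of_forall fun w => contMDiffAt_const)
  have h2 : mfderiv (𝓡 (2 * n + 1)) 𝓘(ℝ, ℝ) (fun _ : Y => (0 : ℝ)) z = 0 := mfderiv_const
  rw [h2] at h1
  change _ = (0 : ℝ) • _ + (0 : ℝ) • (0 : TangentSpace (𝓡 (2 * n + 1)) z) at h1
  simpa using h1

end ConformalSymplecticConnection

/-- In the preferred chart at `y`, the 1-form `θ` generates the contact structure near `e`, and the
coordinate vector field `t` satisfies `θ(t) = 1`. -/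
def IsAdaptedNear (C : ContactStructure n Y) (y : Y) (θ : OneForm (2 * n + 1) Y)
    (t : Euc (2 * n + 1) → Euc (2 * n + 1)) (e : Euc (2 * n + 1)) : Prop :=
  ∀ᶠ e' in 𝓝 e, e' ∈ (extChartAt (𝓡 (2 * n + 1)) y).target ∧
    C.IsGenerator θ ((extChartAt (𝓡 (2 * n + 1)) y).symm e') ∧ ContDiffAt ℝ ∞ t e' ∧
    θ.inChart y e' (t e') = 1

variable {y : Y} {θ : OneForm (2 * n + 1) Y} {t : Euc (2 * n + 1) → Euc (2 * n + 1)}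
  {e : Euc (2 * n + 1)}

/-- The projection to `ker θ` along `t`. -/
noncomputable def contactProj (y : Y) (θ : OneForm (2 * n + 1) Y)
    (t : Euc (2 * n + 1) → Euc (2 * n + 1)) (e : Euc (2 * n + 1)) :
    Euc (2 * n + 1) →L[ℝ] Euc (2 * n + 1) :=
  ContinuousLinearMap.id ℝ _ - (θ.inChart y e).smulRight (t e)

omit [IsManifold (𝓡 (2 * n + 1)) ∞ Y] in
lemma contactProj_apply (v : Euc (2 * n + 1)) :
    contactProj y θ t e v = v - θ.inChart y e v • t e := rfl

namespace IsAdaptedNear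

omit [IsManifold (𝓡 (2 * n + 1)) ∞ Y] in
lemma eventually (h : IsAdaptedNear C y θ t e) : ∀ᶠ e' in 𝓝 e, IsAdaptedNear C y θ t e' :=
  Filter.Eventually.eventually_nhds h

omit [IsManifold (𝓡 (2 * n + 1)) ∞ Y] in
lemma mem_target (h : IsAdaptedNear C y θ t e) : e ∈ (extChartAt (𝓡 (2 * n + 1)) y).target :=
  (Filter.Eventually.self_of_nhds h).1

omit [IsManifold (𝓡 (2 * n + 1)) ∞ Y] in
lemma isGenerator (h : IsAdaptedNear C y θ t e) :
    C.IsGenerator θ ((extChartAt (𝓡 (2 * n + 1)) y).symm e) :=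
  (Filter.Eventually.self_of_nhds h).2.1

omit [IsManifold (𝓡 (2 * n + 1)) ∞ Y] in
lemma isSmoothAt (h : IsAdaptedNear C y θ t e) :
    θ.IsSmoothAt ((extChartAt (𝓡 (2 * n + 1)) y).symm e) :=
  (Filter.Eventually.self_of_nhds h.isGenerator).1

omit [IsManifold (𝓡 (2 * n + 1)) ∞ Y] in
lemma contDiffAt_t (h : IsAdaptedNear C y θ t e) : ContDiffAt ℝ ∞ t e :=
  (Filter.Eventually.self_of_nhds h).2.2.1

omit [IsManifold (𝓡 (2 * n + 1)) ∞ Y] in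
lemma theta_t (h : IsAdaptedNear C y θ t e) : θ.inChart y e (t e) = 1 :=
  (Filter.Eventually.self_of_nhds h).2.2.2

lemma contDiffAt_theta (h : IsAdaptedNear C y θ t e) : ContDiffAt ℝ ∞ (θ.inChart y) e :=
  (OneForm.inChart_of_isSmoothAt h.mem_target h.isSmoothAt).1

lemma theta_chartD (h : IsAdaptedNear C y θ t e)
    (v : TangentSpace (𝓡 (2 * n + 1)) ((extChartAt (𝓡 (2 * n + 1)) y).symm e)) :
    θ.inChart y e (chartD y _ v) = θ _ v := by
  rw [OneForm.inChart_apply, chartDSymm_chartD h.mem_target]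

lemma mem_plane_iff (h : IsAdaptedNear C y θ t e)
    (v : TangentSpace (𝓡 (2 * n + 1)) ((extChartAt (𝓡 (2 * n + 1)) y).symm e)) :
    v ∈ C.plane _ ↔ θ.inChart y e (chartD y _ v) = 0 := by
  rw [h.theta_chartD, ← (Filter.Eventually.self_of_nhds h.isGenerator).2.2.1, LinearMap.mem_ker]

omit [IsManifold (𝓡 (2 * n + 1)) ∞ Y] in
lemma theta_contactProj (h : IsAdaptedNear C y θ t e) (v : Euc (2 * n + 1)) :
    θ.inChart y e (contactProj y θ t e v) = 0 := by
  rw [contactProj_apply]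
  simp [h.theta_t]

lemma contDiffAt_contactProj (h : IsAdaptedNear C y θ t e) :
    ContDiffAt ℝ ∞ (contactProj y θ t) e :=
  contDiffAt_const.sub (h.contDiffAt_theta.smulRight h.contDiffAt_t)

lemma isSectionNear (h : IsAdaptedNear C y θ t e) {v : Euc (2 * n + 1) → Euc (2 * n + 1)}
    (hv : ∀ᶠ e' in 𝓝 e, ContDiffAt ℝ ∞ v e') (hθ : ∀ᶠ e' in 𝓝 e, θ.inChart y e' (v e') = 0) :
    C.IsSectionNear (fieldOfChart y v) ((extChartAt (𝓡 (2 * n + 1)) y).symm e) := by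
  have h1 : ∀ᶠ e' in 𝓝 e, chartField y (fieldOfChart y v) e' = v e' := by
    filter_upwards [h] with e' he'
    exact chartField_fieldOfChart he'.1 v
  refine ⟨(smoothNear_iff h.mem_target).2 ?_, (eventually_chart_iff h.mem_target).2 ?_⟩
  · filter_upwards [h1.eventually_nhds, hv] with e' he' hv'
    exact hv'.congr_of_eventuallyEq he'
  · filter_upwards [h1, hθ, h.eventually] with e' he' hθ' ha
    rw [ha.mem_plane_iff]
    rw [← he'] at hθ'
    exact hθ'

lemma isSectionNear_contactProj (h : IsAdaptedNear C y θ t e)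
    {a : Euc (2 * n + 1) → Euc (2 * n + 1)} (ha : ∀ᶠ e' in 𝓝 e, ContDiffAt ℝ ∞ a e') :
    C.IsSectionNear (fieldOfChart y fun e' => contactProj y θ t e' (a e'))
      ((extChartAt (𝓡 (2 * n + 1)) y).symm e) := by
  refine h.isSectionNear ?_ (h.eventually.mono fun e' he' => he'.theta_contactProj _)
  filter_upwards [ha, h.eventually] with e' ha he'
  exact he'.contDiffAt_contactProj.clm_apply ha

end IsAdaptedNear

/-- The transversal line field has a generator `t` with `θ(t) = 1`. -/
lemma exists_isAdaptedNear {ℓ : (y : Y) → Submodule ℝ (TangentSpace (𝓡 (2 * n + 1)) y)}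
    (hℓ : ∀ y, IsCompl (ℓ y) (C.plane y)) {T : VField (2 * n + 1) Y} (hT : SmoothNear T y)
    (hTℓ : ∀ᶠ z in 𝓝 y, ℓ z = Submodule.span ℝ {T z}) (hθ : C.IsGenerator θ y) :
    ∃ t : Euc (2 * n + 1) → Euc (2 * n + 1),
      IsAdaptedNear C y θ t (extChartAt (𝓡 (2 * n + 1)) y y) ∧
      ∀ᶠ e in 𝓝 (extChartAt (𝓡 (2 * n + 1)) y y),
        ∀ v ∈ ℓ ((extChartAt (𝓡 (2 * n + 1)) y).symm e), ∃ r : ℝ, chartD y _ v = r • t e := by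
  have he := mem_extChartAt_target (I := 𝓡 (2 * n + 1)) y
  have hy : (extChartAt (𝓡 (2 * n + 1)) y).symm (extChartAt (𝓡 (2 * n + 1)) y y) = y :=
    extChartAt_to_inv y
  rw [← hy] at hT hTℓ hθ
  rw [smoothNear_iff he] at hT
  rw [eventually_chart_iff he] at hTℓ
  have hθ' := (eventually_chart_iff he).1 hθ.eventually
  have htar := (isOpen_extChartAt_target (I := 𝓡 (2 * n + 1)) y).mem_nhds he
  have hne : ∀ᶠ e in 𝓝 (extChartAt (𝓡 (2 * n + 1)) y y),
      θ.inChart y e (chartField y T e) ≠ 0 := by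
    filter_upwards [hTℓ, hθ', htar] with e h1 h2 h3 h4
    rw [OneForm.inChart_apply, chartField, chartDSymm_chartD h3] at h4
    have h5 := Filter.Eventually.self_of_nhds h2
    have h6 : T ((extChartAt (𝓡 (2 * n + 1)) y).symm e) ∈ C.plane _ := by
      rw [← h5.2.2.1]
      exact h4
    have h7 := (hℓ ((extChartAt (𝓡 (2 * n + 1)) y).symm e)).codisjoint
    rw [codisjoint_iff, h1, sup_eq_right.2 (by
      rw [Submodule.span_singleton_le_iff_mem]
      exact h6), ← h5.2.2.1, LinearMap.ker_eq_top] at h7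
    exact h5.2.1 h7
  refine ⟨fun e => (θ.inChart y e (chartField y T e))⁻¹ • chartField y T e, ?_, ?_⟩
  · filter_upwards [hθ', htar, hne, hT] with e h1 h2 h3 h4
    have h5 : ContDiffAt ℝ ∞ (θ.inChart y) e :=
      (OneForm.inChart_of_isSmoothAt h2 (Filter.Eventually.self_of_nhds h1).1).1
    exact ⟨h2, h1, ((h5.clm_apply h4).inv h3).smul h4, by
      rw [map_smul, smul_eq_mul, inv_mul_cancel₀ h3]⟩
  · filter_upwards [hTℓ, hne] with e h1 h2 v hv
    rw [h1, Submodule.mem_span_singleton] at hv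
    obtain ⟨a, rfl⟩ := hv
    refine ⟨a * θ.inChart y e (chartField y T e), ?_⟩
    rw [smul_smul, mul_assoc, mul_inv_cancel₀ h2, mul_one, map_smul]
    rfl

lemma euc_sum_single {d : ℕ} (a : Euc d) : ∑ i, a i • EuclideanSpace.single i (1 : ℝ) = a := by
  have := (EuclideanSpace.basisFun (Fin d) ℝ).sum_repr a
  simpa using this

lemma clm_euc_apply {d : ℕ} {F : Type*} [AddCommMonoid F] [Module ℝ F] (f : Euc d →ₗ[ℝ] F)
    (a : Euc d) : f a = ∑ i, a i • f (EuclideanSpace.single i (1 : ℝ)) := by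
  conv_lhs => rw [← euc_sum_single a]
  simp

namespace ConformalSymplecticConnection

variable (D : ConformalSymplecticConnection C)

/-- The covariant derivative of the projection of the coordinate field `a` to the contact planes,
in the direction with coordinates `v`, in coordinates. -/
noncomputable def chartCov (y : Y) (θ : OneForm (2 * n + 1) Y)
    (t a : Euc (2 * n + 1) → Euc (2 * n + 1)) (e : Euc (2 * n + 1)) :
    Euc (2 * n + 1) →ₗ[ℝ] Euc (2 * n + 1) :=
  (chartD y _).toLinearMap ∘ₗ
    (D.cov (fieldOfChart y fun e' => contactProj y θ t e' (a e'))
      ((extChartAt (𝓡 (2 * n + 1)) y).symm e)) ∘ₗ (chartDSymm y e).toLinearMap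

lemma chartCov_apply (a : Euc (2 * n + 1) → Euc (2 * n + 1)) (v : Euc (2 * n + 1)) :
    D.chartCov y θ t a e v = chartD y _ (D.cov (fieldOfChart y fun e' => contactProj y θ t e' (a e'))
      ((extChartAt (𝓡 (2 * n + 1)) y).symm e) (chartDSymm y e v)) := rfl

lemma chartCov_smul (h : IsAdaptedNear C y θ t e) {f : Euc (2 * n + 1) → ℝ}
    {a : Euc (2 * n + 1) → Euc (2 * n + 1)}
    (hf : ∀ᶠ e' in 𝓝 e, ContDiffAt ℝ ∞ f e') (ha : ∀ᶠ e' in 𝓝 e, ContDiffAt ℝ ∞ a e')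
    (v : Euc (2 * n + 1)) :
    D.chartCov y θ t (fun e' => f e' • a e') e v =
      f e • D.chartCov y θ t a e v + fderiv ℝ f e v • contactProj y θ t e (a e) := by
  have hright : extChartAt (𝓡 (2 * n + 1)) y ((extChartAt (𝓡 (2 * n + 1)) y).symm e) = e :=
    (extChartAt (𝓡 (2 * n + 1)) y).right_inv h.mem_target
  let F : Y → ℝ := f ∘ extChartAt (𝓡 (2 * n + 1)) y
  have hF : ∀ᶠ z in 𝓝 ((extChartAt (𝓡 (2 * n + 1)) y).symm e),
      ContMDiffAt (𝓡 (2 * n + 1)) 𝓘(ℝ, ℝ) ∞ F z := by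
    rw [eventually_chart_iff h.mem_target]
    filter_upwards [hf, h] with e' hf he'
    have h5 : ContMDiffAt (𝓡 (2 * n + 1)) 𝓘(ℝ, Euc (2 * n + 1)) ∞ (extChartAt (𝓡 (2 * n + 1)) y)
      ((extChartAt (𝓡 (2 * n + 1)) y).symm e') := contMDiffAt_extChartAt' (symm_mem_source he'.1)
    refine ContMDiffAt.comp _ ?_ h5
    rw [(extChartAt (𝓡 (2 * n + 1)) y).right_inv he'.1]
    exact hf.contMDiffAt
  have h1 := D.leibniz F _ _ (chartDSymm y e v) (h.isSectionNear_contactProj ha) hF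
  have h2 : (fieldOfChart y fun e' => contactProj y θ t e' (f e' • a e')) =
      fun z => F z • fieldOfChart y (fun e' => contactProj y θ t e' (a e')) z := by
    ext1 z
    rw [fieldOfChart, fieldOfChart, map_smul, map_smul]
    rfl
  have h3 : (show ℝ from mfderiv (𝓡 (2 * n + 1)) 𝓘(ℝ, ℝ) F
      ((extChartAt (𝓡 (2 * n + 1)) y).symm e) (chartDSymm y e v)) = fderiv ℝ f e v := by
    refine mfderiv_chartDSymm h.mem_target (hf.self_of_nhds.differentiableAt (by simp)) ?_ v
    filter_upwards [h] with e' he'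
    simp only [F, Function.comp_apply, (extChartAt (𝓡 (2 * n + 1)) y).right_inv he'.1]
  rw [chartCov_apply, chartCov_apply, h2, h1, h3, map_add, map_smul, map_smul]
  have h8 := chartField_fieldOfChart h.mem_target (fun e' => contactProj y θ t e' (a e'))
  rw [chartField] at h8
  rw [h8]
  simp only [F, Function.comp_apply, hright]

lemma chartCov_sum (h : IsAdaptedNear C y θ t e) {ι : Type*} (s : Finset ι)
    {a : ι → Euc (2 * n + 1) → Euc (2 * n + 1)}
    (ha : ∀ i, ∀ᶠ e' in 𝓝 e, ContDiffAt ℝ ∞ (a i) e') :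
    D.chartCov y θ t (fun e' => ∑ i ∈ s, a i e') e = ∑ i ∈ s, D.chartCov y θ t (a i) e := by
  classical
  induction s using Finset.induction_on with
  | empty =>
    have h1 : (fieldOfChart y fun e' => contactProj y θ t e' 0) = fun _ => 0 := by
      ext1 z
      rw [fieldOfChart, map_zero, map_zero]
    have h2 := h.isSectionNear_contactProj (a := fun _ => 0)
      (Eventually.of_forall fun e' => contDiffAt_const)
    ext1 v
    simp only [Finset.sum_empty, chartCov_apply]
    rw [h1] at h2 ⊢
    rw [D.cov_zero _ h2]
    exact map_zero _
  | insert i s hi ih =>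
    have hs : ∀ᶠ e' in 𝓝 e, ContDiffAt ℝ ∞ (fun e' => ∑ i ∈ s, a i e') e' := by
      have := (Filter.eventually_all_finset s).2 fun i _ => ha i
      filter_upwards [this] with e' he'
      exact ContDiffAt.sum he'
    have h1 : (fieldOfChart y fun e' => contactProj y θ t e' (∑ i ∈ insert i s, a i e')) =
        fun z => fieldOfChart y (fun e' => contactProj y θ t e' (a i e')) z +
          fieldOfChart y (fun e' => contactProj y θ t e' (∑ i ∈ s, a i e')) z := by
      ext1 z
      rw [fieldOfChart, fieldOfChart, fieldOfChart, Finset.sum_insert hi, map_add, map_add]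
    rw [Finset.sum_insert hi, ← ih]
    ext1 v
    rw [LinearMap.add_apply, chartCov_apply, chartCov_apply, chartCov_apply, h1,
      D.add _ _ _ (h.isSectionNear_contactProj (ha i)) (h.isSectionNear_contactProj hs)]
    exact map_add _ _ _

lemma chartCov_expand (h : IsAdaptedNear C y θ t e) {a : Euc (2 * n + 1) → Euc (2 * n + 1)}
    (ha : ∀ᶠ e' in 𝓝 e, ContDiffAt ℝ ∞ a e') (v : Euc (2 * n + 1)) :
    D.chartCov y θ t a e v = ∑ i, a e i •
      D.chartCov y θ t (fun _ => EuclideanSpace.single i 1) e v +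
      contactProj y θ t e (fderiv ℝ a e v) := by
  have hai : ∀ i, ∀ᶠ e' in 𝓝 e, ContDiffAt ℝ ∞ (fun e' => a e' i) e' := by
    intro i
    filter_upwards [ha] with e' he'
    exact (EuclideanSpace.proj (𝕜 := ℝ) i).contDiff.contDiffAt.comp e' he'
  have h1 : a = fun e' => ∑ i, a e' i • EuclideanSpace.single i (1 : ℝ) := by
    ext1 e'
    rw [euc_sum_single]
  have h2 : ∀ i, fderiv ℝ (fun e' => a e' i) e v = (fderiv ℝ a e v) i := by
    intro i
    have := (EuclideanSpace.proj (𝕜 := ℝ) i).hasFDerivAt.comp e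
      (ha.self_of_nhds.differentiableAt (by simp)).hasFDerivAt
    rw [HasFDerivAt.fderiv (f := fun e' => a e' i) this]
    rfl
  conv_lhs => rw [h1]
  rw [D.chartCov_sum h Finset.univ (a := fun i e' => a e' i • EuclideanSpace.single i (1 : ℝ))
    fun i => (hai i).mono fun e' he' => he'.smul contDiffAt_const]
  rw [LinearMap.sum_apply]
  rw [Finset.sum_congr rfl fun i _ => D.chartCov_smul h (hai i)
    (Eventually.of_forall fun e' => contDiffAt_const) v]
  rw [Finset.sum_add_distrib]
  congr 1
  simp only [h2]
  exact (clm_euc_apply (contactProj y θ t e).toLinearMap _).symm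

end ConformalSymplecticConnection

end ChartConnection

section ChartConnection

variable {n : ℕ} {Y : Type*} [TopologicalSpace Y] [ChartedSpace (Euc (2 * n + 1)) Y]
  [IsManifold (𝓡 (2 * n + 1)) ∞ Y] {C : ContactStructure n Y}
  {y : Y} {θ : OneForm (2 * n + 1) Y} {t : Euc (2 * n + 1) → Euc (2 * n + 1)}
  {e : Euc (2 * n + 1)}

/-! ### Christoffel symbols -/

/-- `dα` as a continuous bilinear form, for a 1-form `α` on a vector space. -/
noncomputable def dFormL {E : Type*} [NormedAddCommGroup E] [NormedSpace ℝ E] (α : E → E →L[ℝ] ℝ)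
    (e : E) : E →L[ℝ] E →L[ℝ] ℝ :=
  fderiv ℝ α e - (fderiv ℝ α e).flip

/-- The form `dθ` on the contact planes, extended by the transversal field `t` in its kernel. -/
noncomputable def contactTau (y : Y) (θ : OneForm (2 * n + 1) Y)
    (t : Euc (2 * n + 1) → Euc (2 * n + 1)) (e : Euc (2 * n + 1)) :
    Euc (2 * n + 1) →L[ℝ] Euc (2 * n + 1) →L[ℝ] ℝ :=
  (dFormL (θ.inChart y) e).bilinearComp (contactProj y θ t e) (contactProj y θ t e)

omit [IsManifold (𝓡 (2 * n + 1)) ∞ Y] in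
lemma contactTau_apply (v w : Euc (2 * n + 1)) : contactTau y θ t e v w =
    dForm (θ.inChart y) e (contactProj y θ t e v) (contactProj y θ t e w) := rfl

omit [IsManifold (𝓡 (2 * n + 1)) ∞ Y] in
lemma contactProj_of_theta_eq_zero {v : Euc (2 * n + 1)} (hv : θ.inChart y e v = 0) :
    contactProj y θ t e v = v := by
  rw [contactProj_apply, hv, zero_smul, sub_zero]

lemma contDiffAt_clm_flip {E F G X : Type*} [NormedAddCommGroup E] [NormedSpace ℝ E]
    [NormedAddCommGroup F] [NormedSpace ℝ F] [NormedAddCommGroup G] [NormedSpace ℝ G]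
    [NormedAddCommGroup X] [NormedSpace ℝ X] {m : WithTop ℕ∞} {f : X → E →L[ℝ] F →L[ℝ] G} {x : X}
    (hf : ContDiffAt ℝ m f x) : ContDiffAt ℝ m (fun x => (f x).flip) x := by
  have h : ContDiff ℝ m (fun f : E →L[ℝ] F →L[ℝ] G => f.flip) := by
    have : IsBoundedLinearMap ℝ (fun f : E →L[ℝ] F →L[ℝ] G => f.flip) :=
      { map_add := fun _ _ => rfl
        map_smul := fun _ _ => rfl
        bound := ⟨1, one_pos, fun f => by rw [ContinuousLinearMap.opNorm_flip, one_mul]⟩ }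
    exact this.contDiff
  exact h.contDiffAt.comp x hf

namespace IsAdaptedNear

lemma contDiffAt_contactTau (h : IsAdaptedNear C y θ t e) : ContDiffAt ℝ ∞ (contactTau y θ t) e := by
  have h1 : ContDiffAt ℝ ∞ (fderiv ℝ (θ.inChart y)) e :=
    h.contDiffAt_theta.fderiv_right (by simp)
  have h2 : ContDiffAt ℝ ∞ (dFormL (θ.inChart y)) e := h1.sub (contDiffAt_clm_flip h1)
  exact contDiffAt_clm_flip ((contDiffAt_clm_flip
    (h2.clm_comp h.contDiffAt_contactProj)).clm_comp h.contDiffAt_contactProj)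

omit [IsManifold (𝓡 (2 * n + 1)) ∞ Y] in
lemma contactProj_t (h : IsAdaptedNear C y θ t e) : contactProj y θ t e (t e) = 0 := by
  rw [contactProj_apply, h.theta_t, one_smul, sub_self]

lemma extD_eq (h : IsAdaptedNear C y θ t e)
    {v w : TangentSpace (𝓡 (2 * n + 1)) ((extChartAt (𝓡 (2 * n + 1)) y).symm e)}
    (hv : v ∈ C.plane _) (hw : w ∈ C.plane _) :
    θ.extD _ v w = contactTau y θ t e (chartD y _ v) (chartD y _ w) := by
  rw [h.mem_plane_iff] at hv hw
  rw [contactTau_apply, contactProj_of_theta_eq_zero hv, contactProj_of_theta_eq_zero hw,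
    (OneForm.inChart_of_isSmoothAt h.mem_target h.isSmoothAt).2, chartDSymm_chartD h.mem_target,
    chartDSymm_chartD h.mem_target]

end IsAdaptedNear

namespace ConformalSymplecticConnection

variable (D : ConformalSymplecticConnection C)

/-- The Christoffel symbols in the preferred chart at `y` of the extension of `D` to the tangent
bundle that makes the field `t` parallel. -/
noncomputable def christoffel (y : Y) (θ : OneForm (2 * n + 1) Y)
    (t : Euc (2 * n + 1) → Euc (2 * n + 1)) (e : Euc (2 * n + 1)) :
    Euc (2 * n + 1) →L[ℝ] Euc (2 * n + 1) →L[ℝ] Euc (2 * n + 1) :=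
  ∑ j, ∑ i, (EuclideanSpace.proj (𝕜 := ℝ) j).smulRight ((EuclideanSpace.proj (𝕜 := ℝ) i).smulRight
    (D.chartCov y θ t (fun _ => EuclideanSpace.single i 1) e (EuclideanSpace.single j 1) +
      fderiv ℝ (θ.inChart y) e (EuclideanSpace.single j 1) (EuclideanSpace.single i 1) • t e))

lemma christoffel_apply (v a : Euc (2 * n + 1)) : D.christoffel y θ t e v a =
    ∑ i, a i • D.chartCov y θ t (fun _ => EuclideanSpace.single i 1) e v +
      fderiv ℝ (θ.inChart y) e v a • t e := by
  have h1 : ∀ j i, ((EuclideanSpace.proj (𝕜 := ℝ) j).smulRight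
      ((EuclideanSpace.proj (𝕜 := ℝ) i).smulRight
      (D.chartCov y θ t (fun _ => EuclideanSpace.single i 1) e (EuclideanSpace.single j 1) +
      fderiv ℝ (θ.inChart y) e (EuclideanSpace.single j 1) (EuclideanSpace.single i 1) • t e)) :
      Euc (2 * n + 1) →L[ℝ] Euc (2 * n + 1) →L[ℝ] Euc (2 * n + 1)) v a =
      a i • v j • D.chartCov y θ t (fun _ => EuclideanSpace.single i 1) e
        (EuclideanSpace.single j 1) + (a i • v j • fderiv ℝ (θ.inChart y) e
        (EuclideanSpace.single j 1) (EuclideanSpace.single i 1)) • t e := by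
    intro j i
    change v j • a i • (D.chartCov y θ t (fun _ => EuclideanSpace.single i 1) e
      (EuclideanSpace.single j 1) + fderiv ℝ (θ.inChart y) e (EuclideanSpace.single j 1)
        (EuclideanSpace.single i 1) • t e) = _
    rw [smul_comm, smul_add, smul_add, smul_assoc, smul_assoc]
  rw [christoffel]
  simp only [_root_.sum_apply, h1]
  rw [Finset.sum_comm]
  simp only [Finset.sum_add_distrib, ← Finset.smul_sum, ← Finset.sum_smul]
  congr 1
  · refine Finset.sum_congr rfl fun i _ => ?_
    rw [clm_euc_apply (D.chartCov y θ t (fun _ => EuclideanSpace.single i 1) e) v]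
  · congr 1
    refine Eq.trans ?_ (clm_euc_apply (fderiv ℝ (θ.inChart y) e v).toLinearMap a).symm
    refine Finset.sum_congr rfl fun i _ => ?_
    exact congrArg (a i • ·) (clm_euc_apply
      ((fderiv ℝ (θ.inChart y) e).flip (EuclideanSpace.single i 1)).toLinearMap v).symm

variable {D}

/-- The covariant derivative in terms of the Christoffel symbols. -/
lemma chartCov_eq (h : IsAdaptedNear C y θ t e) {a : Euc (2 * n + 1) → Euc (2 * n + 1)}
    (ha : ∀ᶠ e' in 𝓝 e, ContDiffAt ℝ ∞ a e') (v : Euc (2 * n + 1)) :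
    D.chartCov y θ t a e v = contactProj y θ t e (fderiv ℝ a e v) +
      D.christoffel y θ t e v (a e) - fderiv ℝ (θ.inChart y) e v (a e) • t e := by
  rw [D.chartCov_expand h ha, christoffel_apply]
  abel

lemma theta_chartCov (h : IsAdaptedNear C y θ t e) {a : Euc (2 * n + 1) → Euc (2 * n + 1)}
    (ha : ∀ᶠ e' in 𝓝 e, ContDiffAt ℝ ∞ a e') (v : Euc (2 * n + 1)) :
    θ.inChart y e (D.chartCov y θ t a e v) = 0 := by
  rw [chartCov_apply, ← h.mem_plane_iff]
  exact D.mem_plane _ _ _ (h.isSectionNear_contactProj ha)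

lemma fderiv_theta (h : IsAdaptedNear C y θ t e) (v a : Euc (2 * n + 1)) :
    fderiv ℝ (θ.inChart y) e v a = θ.inChart y e (D.christoffel y θ t e v a) := by
  have h1 := chartCov_eq (D := D) h (a := fun _ => a)
    (Eventually.of_forall fun e' => contDiffAt_const) v
  have h2 := theta_chartCov (D := D) h (a := fun _ => a)
    (Eventually.of_forall fun e' => contDiffAt_const) v
  rw [h1] at h2
  simp only [map_sub, map_add, h.theta_contactProj, map_smul, h.theta_t, smul_eq_mul, mul_one,
    zero_add] at h2
  linarith

/-- The covariant derivative of a section of the contact planes. -/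
lemma chartCov_section (h : IsAdaptedNear C y θ t e) {a : Euc (2 * n + 1) → Euc (2 * n + 1)}
    (ha : ∀ᶠ e' in 𝓝 e, ContDiffAt ℝ ∞ a e') (hθ : ∀ᶠ e' in 𝓝 e, θ.inChart y e' (a e') = 0)
    (v : Euc (2 * n + 1)) :
    chartD y _ (D.cov (fieldOfChart y a) ((extChartAt (𝓡 (2 * n + 1)) y).symm e)
      (chartDSymm y e v)) = fderiv ℝ a e v + D.christoffel y θ t e v (a e) := by
  have h1 : fieldOfChart y a =ᶠ[𝓝 ((extChartAt (𝓡 (2 * n + 1)) y).symm e)]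
      fieldOfChart y fun e' => contactProj y θ t e' (a e') := by
    refine (eventually_chart_iff h.mem_target).2 ?_
    filter_upwards [hθ, h] with e' he' h'
    rw [fieldOfChart, fieldOfChart, (extChartAt (𝓡 (2 * n + 1)) y).right_inv h'.1,
      contactProj_of_theta_eq_zero he']
  rw [D.cov_congr (h.isSectionNear ha hθ) h1, ← chartCov_apply, chartCov_eq h ha]
  have h2 : fderiv ℝ (fun e' => θ.inChart y e' (a e')) e v = 0 := by
    have h3 : (fun e' => θ.inChart y e' (a e')) =ᶠ[𝓝 e] fun _ => 0 := hθ
    rw [h3.fderiv_eq]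
    simp
  rw [HasFDerivAt.fderiv (f := fun e' => θ.inChart y e' (a e'))
    ((h.contDiffAt_theta.differentiableAt (by simp)).hasFDerivAt.clm_apply
      (ha.self_of_nhds.differentiableAt (by simp)).hasFDerivAt)] at h2
  have h4 : θ.inChart y e (fderiv ℝ a e v) + fderiv ℝ (θ.inChart y) e v (a e) = 0 := h2
  rw [contactProj_apply, eq_neg_of_add_eq_zero_left h4]
  module

lemma contDiffAt_christoffel (h : IsAdaptedNear C y θ t e) :
    ContDiffAt ℝ ∞ (D.christoffel y θ t) e := by
  have h1 : ∀ i j, ContDiffAt ℝ ∞ (fun e' => D.chartCov y θ t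
      (fun _ => EuclideanSpace.single i 1) e' (EuclideanSpace.single j 1)) e := by
    intro i j
    let V := fieldOfChart y fun e' => contactProj y θ t e' (EuclideanSpace.single i (1 : ℝ))
    let X := fieldOfChart y fun _ => EuclideanSpace.single j (1 : ℝ)
    have hV : C.IsSectionNear V ((extChartAt (𝓡 (2 * n + 1)) y).symm e) :=
      h.isSectionNear_contactProj (Eventually.of_forall fun e' => contDiffAt_const)
    have hX : SmoothNear X ((extChartAt (𝓡 (2 * n + 1)) y).symm e) := by
      rw [smoothNear_iff h.mem_target]
      have h2 : ∀ᶠ e' in 𝓝 e, chartField y X e' = EuclideanSpace.single j (1 : ℝ) := by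
        filter_upwards [h] with e' he'
        exact chartField_fieldOfChart he'.1 _
      filter_upwards [h2.eventually_nhds] with e' he'
      exact contDiffAt_const.congr_of_eventuallyEq he'
    have h3 := (smoothNear_iff h.mem_target).1 (D.smooth V X _ hV hX)
    refine h3.self_of_nhds.congr_of_eventuallyEq ?_
    filter_upwards [h] with e' he'
    rw [chartCov_apply, chartField]
    have h4 : X ((extChartAt (𝓡 (2 * n + 1)) y).symm e') =
        chartDSymm y e' (EuclideanSpace.single j (1 : ℝ)) := by
      rw [← chartDSymm_eq_inverse he'.1]
      rfl
    rw [h4]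
  have h2 : ContDiffAt ℝ ∞ (fderiv ℝ (θ.inChart y)) e :=
    h.contDiffAt_theta.fderiv_right (by simp)
  refine ContDiffAt.sum fun j _ => ContDiffAt.sum fun i _ => ?_
  exact contDiffAt_const.smulRight (contDiffAt_const.smulRight ((h1 i j).add
    (((h2.clm_apply contDiffAt_const).clm_apply contDiffAt_const).smul h.contDiffAt_t)))

/-- Torsion freeness in coordinates. -/
lemma christoffel_symm (h : IsAdaptedNear C y θ t e)
    {ℓ : (y : Y) → Submodule ℝ (TangentSpace (𝓡 (2 * n + 1)) y)}
    (hℓ : ∀ v ∈ ℓ ((extChartAt (𝓡 (2 * n + 1)) y).symm e), ∃ r : ℝ, chartD y _ v = r • t e)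
    (hD : ∀ V W y, C.IsSectionNear V y → C.IsSectionNear W y →
      VectorField.mlieBracket (𝓡 (2 * n + 1)) V W y - (D.cov W y (V y) - D.cov V y (W y)) ∈ ℓ y)
    {v w : Euc (2 * n + 1)} (hv : θ.inChart y e v = 0) (hw : θ.inChart y e w = 0)
    (hvw : contactTau y θ t e v w = 0) :
    D.christoffel y θ t e v w = D.christoffel y θ t e w v := by
  have hsm : ∀ u : Euc (2 * n + 1), ∀ᶠ e' in 𝓝 e,
      ContDiffAt ℝ ∞ (fun e' => contactProj y θ t e' u) e' := fun u => by
    filter_upwards [h.eventually] with e' he'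
    exact he'.contDiffAt_contactProj.clm_apply contDiffAt_const
  have hθ : ∀ u : Euc (2 * n + 1), ∀ᶠ e' in 𝓝 e,
      θ.inChart y e' (contactProj y θ t e' u) = 0 := fun u =>
    h.eventually.mono fun e' he' => he'.theta_contactProj u
  have hsec := fun u => h.isSectionNear (hsm u) (hθ u)
  have hfield : ∀ u, ∀ᶠ e' in 𝓝 e, chartField y (fieldOfChart y fun e' => contactProj y θ t e' u) e'
      = contactProj y θ t e' u := fun u => h.mono fun e' he' => chartField_fieldOfChart he'.1 _
  have hsm' : ∀ u, ContDiffAt ℝ ∞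
      (chartField y (fieldOfChart y fun e' => contactProj y θ t e' u)) e := fun u =>
    (hsm u).self_of_nhds.congr_of_eventuallyEq (hfield u)
  have hval : ∀ u, θ.inChart y e u = 0 →
      (fieldOfChart y fun e' => contactProj y θ t e' u) ((extChartAt (𝓡 (2 * n + 1)) y).symm e) =
        chartDSymm y e u := by
    intro u hu
    rw [fieldOfChart, (extChartAt (𝓡 (2 * n + 1)) y).right_inv h.mem_target,
      chartDSymm_eq_inverse h.mem_target, contactProj_of_theta_eq_zero hu]
  obtain ⟨r, hr⟩ := hℓ _ (hD _ _ _ (hsec v) (hsec w))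
  rw [hval v hv, hval w hw, map_sub, map_sub, mlieBracket_chart h.mem_target (hsm' v) (hsm' w),
    chartCov_section h (hsm v) (hθ v), chartCov_section h (hsm w) (hθ w),
    (hfield v).self_of_nhds, (hfield w).self_of_nhds, Filter.EventuallyEq.fderiv_eq (hfield v),
    Filter.EventuallyEq.fderiv_eq (hfield w), contactProj_of_theta_eq_zero hv,
    contactProj_of_theta_eq_zero hw] at hr
  have h1 : D.christoffel y θ t e w v - D.christoffel y θ t e v w = r • t e := by
    rw [← hr]
    abel
  have h2 := congrArg (θ.inChart y e) h1
  rw [map_sub, ← fderiv_theta h, ← fderiv_theta h, map_smul, h.theta_t, smul_eq_mul, mul_one] at h2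
  rw [contactTau_apply, contactProj_of_theta_eq_zero hv, contactProj_of_theta_eq_zero hw,
    dForm] at hvw
  have h3 : r = 0 := by linarith
  rw [h3, zero_smul, sub_eq_zero] at h1
  exact h1.symm

/-- The conformal class of `dθ` is parallel, in coordinates. -/
lemma exists_conformal_factor (h : IsAdaptedNear C y θ t e) : ∃ c : Euc (2 * n + 1) → ℝ,
    ∀ v a b, fderiv ℝ (contactTau y θ t) e v a b -
      contactTau y θ t e (D.christoffel y θ t e v a) b -
      contactTau y θ t e a (D.christoffel y θ t e v b) = c v * contactTau y θ t e a b := by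
  obtain ⟨c, hc⟩ := D.conformal θ _ h.isGenerator
  refine ⟨fun v => c (chartDSymm y e v), fun v a b => ?_⟩
  have hconst : ∀ a : Euc (2 * n + 1), ∀ᶠ e' in 𝓝 e, ContDiffAt ℝ ∞ (fun _ => a) e' :=
    fun a => Eventually.of_forall fun e' => contDiffAt_const
  have h1 := hc _ _ (chartDSymm y e v) (h.isSectionNear_contactProj (hconst a))
    (h.isSectionNear_contactProj (hconst b))
  have hmem : ∀ a : Euc (2 * n + 1), ∀ {e' : Euc (2 * n + 1)}, IsAdaptedNear C y θ t e' →
      (fieldOfChart y fun e' => contactProj y θ t e' a) ((extChartAt (𝓡 (2 * n + 1)) y).symm e') ∈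
        C.plane _ ∧ chartD y _ ((fieldOfChart y fun e' => contactProj y θ t e' a)
          ((extChartAt (𝓡 (2 * n + 1)) y).symm e')) = contactProj y θ t e' a := by
    intro a e' he'
    have h2 := chartField_fieldOfChart he'.mem_target (fun e' => contactProj y θ t e' a)
    rw [chartField] at h2
    rw [he'.mem_plane_iff, h2]
    exact ⟨he'.theta_contactProj a, rfl⟩
  have hcov : ∀ a : Euc (2 * n + 1),
      chartD y _ (D.cov (fieldOfChart y fun e' => contactProj y θ t e' a)
        ((extChartAt (𝓡 (2 * n + 1)) y).symm e) (chartDSymm y e v)) =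
      contactProj y θ t e (D.christoffel y θ t e v a) := by
    intro a
    have h2 := chartCov_eq (D := D) h (hconst a) v
    have h3 := theta_chartCov (D := D) h (hconst a) v
    rw [← chartCov_apply, ← contactProj_of_theta_eq_zero (t := t) h3, h2]
    simp [h.contactProj_t]
  have hτp : ∀ u w, contactTau y θ t e (contactProj y θ t e u) (contactProj y θ t e w) =
      contactTau y θ t e u w := by
    intro u w
    rw [contactTau_apply, contactTau_apply, contactProj_of_theta_eq_zero (h.theta_contactProj u),
      contactProj_of_theta_eq_zero (h.theta_contactProj w)]
  rw [h.extD_eq (D.mem_plane _ _ _ (h.isSectionNear_contactProj (hconst a))) (hmem b h).1,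
    h.extD_eq (hmem a h).1 (D.mem_plane _ _ _ (h.isSectionNear_contactProj (hconst b))),
    h.extD_eq (hmem a h).1 (hmem b h).1, hcov, hcov, (hmem a h).2, (hmem b h).2, hτp, hτp, hτp] at h1
  rw [← h1]
  congr 2
  have hd := (h.contDiffAt_contactTau.differentiableAt (by simp)).hasFDerivAt
  have hd' := (hd.clm_apply (hasFDerivAt_const a e)).clm_apply (hasFDerivAt_const b e)
  refine Eq.trans ?_ (mfderiv_chartDSymm (g := fun e' => contactTau y θ t e' a b) h.mem_target
    hd'.differentiableAt ?_ v).symm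
  swap
  · filter_upwards [h.eventually] with e' he'
    rw [he'.extD_eq (hmem a he').1 (hmem b he').1, (hmem a he').2, (hmem b he').2]
    rw [contactTau_apply, contactTau_apply,
      contactProj_of_theta_eq_zero (he'.theta_contactProj a),
      contactProj_of_theta_eq_zero (he'.theta_contactProj b)]
  · rw [hd'.fderiv]
    simp

end ConformalSymplecticConnection

end ChartConnection

section ChartConnection

variable {n : ℕ} {Y : Type*} [TopologicalSpace Y] [ChartedSpace (Euc (2 * n + 1)) Y]
  [IsManifold (𝓡 (2 * n + 1)) ∞ Y] {C : ContactStructure n Y}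
  {y : Y} {θ : OneForm (2 * n + 1) Y} {t : Euc (2 * n + 1) → Euc (2 * n + 1)}
  {e : Euc (2 * n + 1)}

/-! ### Coordinate representation of a Legendrian connection -/

/-- The local connection `L` is the expression of `D` in the preferred chart at `y`, near `z`. -/
structure LocalConnection.Represents (L : LocalConnection (Euc (2 * n + 1)))
    (D : ConformalSymplecticConnection C) (y z : Y) : Prop where
  mem_source : z ∈ (chartAt (Euc (2 * n + 1)) y).source
  conformal : L.IsConformalAt (extChartAt (𝓡 (2 * n + 1)) y z)
  integrable : L.IsIntegrableAt (extChartAt (𝓡 (2 * n + 1)) y z)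
  theta_ne_zero : L.θ (extChartAt (𝓡 (2 * n + 1)) y z) ≠ 0
  mem_plane_iff : ∀ v, v ∈ C.plane z ↔ L.θ (extChartAt (𝓡 (2 * n + 1)) y z) (chartD y z v) = 0
  isotropic_iff : ∀ (k : ℕ) (W : Submodule ℝ (TangentSpace (𝓡 (2 * n + 1)) z)),
    C.IsIsotropicPlane k z W ↔ Module.finrank ℝ W = k ∧
      L.IsIsotropic (extChartAt (𝓡 (2 * n + 1)) y z) (W.map (chartD y z).toLinearMap)
  isSectionNear : ∀ v : Euc (2 * n + 1) → Euc (2 * n + 1),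
    (∀ᶠ e in 𝓝 (extChartAt (𝓡 (2 * n + 1)) y z), ContDiffAt ℝ ∞ v e ∧ L.θ e (v e) = 0) →
    C.IsSectionNear (fieldOfChart y v) z
  smooth : ∀ V, C.IsSectionNear V z →
    ContDiffAt ℝ ∞ (chartField y V) (extChartAt (𝓡 (2 * n + 1)) y z)
  cov_eq : ∀ V, C.IsSectionNear V z → ∀ X, chartD y z (D.cov V z X) =
    fderiv ℝ (chartField y V) (extChartAt (𝓡 (2 * n + 1)) y z) (chartD y z X) +
      L.Γ (extChartAt (𝓡 (2 * n + 1)) y z) (chartD y z X)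
        (chartField y V (extChartAt (𝓡 (2 * n + 1)) y z))

namespace IsAdaptedNear

/-- The exterior derivatives of two contact forms are proportional on the contact plane. -/
lemma exists_extD_eq (h : IsAdaptedNear C y θ t e) {θ' : OneForm (2 * n + 1) Y}
    (hθ' : C.IsGenerator θ' ((extChartAt (𝓡 (2 * n + 1)) y).symm e)) :
    ∃ f : ℝ, ∀ v ∈ C.plane ((extChartAt (𝓡 (2 * n + 1)) y).symm e), ∀ w ∈ C.plane _,
      θ'.extD _ v w = f * θ.extD _ v w := by
  have hsm := (OneForm.inChart_of_isSmoothAt h.mem_target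
    (Filter.Eventually.self_of_nhds hθ').1)
  have h1 : θ'.inChart y =ᶠ[𝓝 e] fun e' => (θ'.inChart y e' (t e')) • θ.inChart y e' := by
    filter_upwards [(eventually_chart_iff h.mem_target).1 hθ', h.eventually] with e' h2 h3
    ext v
    have h4 : θ'.inChart y e' (contactProj y θ t e' v) = 0 := by
      have h5 : chartDSymm y e' (contactProj y θ t e' v) ∈ C.plane _ := by
        rw [h3.mem_plane_iff, chartD_chartDSymm h3.mem_target, h3.theta_contactProj]
      rw [← h2.2.2.1, LinearMap.mem_ker] at h5
      exact h5
    rw [contactProj_apply, map_sub, map_smul, sub_eq_zero] at h4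
    rw [h4, smul_apply, smul_eq_mul, smul_eq_mul, mul_comm]
  refine ⟨θ'.inChart y e (t e), fun v hv w hw => ?_⟩
  have hval : ∀ {θ₀ : OneForm (2 * n + 1) Y}
      (_ : θ₀.IsSmoothAt ((extChartAt (𝓡 (2 * n + 1)) y).symm e)), θ₀.extD _ v w =
      dForm (θ₀.inChart y) e (chartD y _ v) (chartD y _ w) := by
    intro θ₀ h2
    rw [(OneForm.inChart_of_isSmoothAt h.mem_target h2).2, chartDSymm_chartD h.mem_target,
      chartDSymm_chartD h.mem_target]
  rw [hval (Filter.Eventually.self_of_nhds hθ').1, hval h.isSmoothAt]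
  rw [h.mem_plane_iff] at hv hw
  have h2 : HasFDerivAt (fun e' => (θ'.inChart y e' (t e')) • θ.inChart y e') _ e :=
    ((hsm.1.clm_apply h.contDiffAt_t).differentiableAt (by simp)).hasFDerivAt.smul
      (h.contDiffAt_theta.differentiableAt (by simp)).hasFDerivAt
  simp only [dForm, h1.fderiv_eq, h2.fderiv]
  generalize chartD y _ v = v' at hv ⊢
  generalize chartD y _ w = w' at hw ⊢
  simp [hv, hw]
  ring

lemma exists_tau_ne_zero (hn : 0 < n) (h : IsAdaptedNear C y θ t e) :
    ∃ a b, contactTau y θ t e a b ≠ 0 := by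
  by_contra! hcon
  have h1 : ∀ v, θ.inChart y e v = 0 → v = 0 := by
    intro v hv
    have h2 : chartDSymm y e v ∈ C.plane _ := by
      rw [h.mem_plane_iff, chartD_chartDSymm h.mem_target, hv]
    have h3 := (Filter.Eventually.self_of_nhds h.isGenerator).2.2.2 _ h2 (fun w hw => by
      rw [h.extD_eq h2 hw, hcon])
    have h4 := congrArg (chartD y _) h3
    rwa [chartD_chartDSymm h.mem_target, map_zero] at h4
  have h2 := LinearMap.finrank_range_add_finrank_ker (θ.inChart y e).toLinearMap
  have h3 : LinearMap.ker (θ.inChart y e).toLinearMap = ⊥ := by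
    rw [LinearMap.ker_eq_bot']
    exact h1
  have h4 := Submodule.finrank_le (LinearMap.range (θ.inChart y e).toLinearMap)
  rw [h3, finrank_bot, finrank_euclideanSpace_fin] at h2
  rw [Module.finrank_self] at h4
  omega

end IsAdaptedNear

namespace ConformalSymplecticConnection

variable (D : ConformalSymplecticConnection C)

/-- The expression in the preferred chart at `y` of the connection that extends `D` and makes `t`
parallel; `a₀` and `b₀` are auxiliary vectors with `dθ(a₀, b₀) ≠ 0`, from which the conformal factor
is computed. -/
noncomputable def localConnection (y : Y) (θ : OneForm (2 * n + 1) Y)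
    (t : Euc (2 * n + 1) → Euc (2 * n + 1)) (a₀ b₀ : Euc (2 * n + 1)) :
    LocalConnection (Euc (2 * n + 1)) where
  θ := θ.inChart y
  τ := contactTau y θ t
  Γ := D.christoffel y θ t
  c := fun e => (contactTau y θ t e a₀ b₀)⁻¹ • (fderiv ℝ (fun e' => contactTau y θ t e' a₀ b₀) e -
    ((contactTau y θ t e).flip b₀).comp ((D.christoffel y θ t e).flip a₀) -
    (contactTau y θ t e a₀).comp ((D.christoffel y θ t e).flip b₀))

variable {D} {a₀ b₀ : Euc (2 * n + 1)}

lemma isConformalAt (h : IsAdaptedNear C y θ t e) (h0 : contactTau y θ t e a₀ b₀ ≠ 0) :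
    (D.localConnection y θ t a₀ b₀).IsConformalAt e where
  smooth_θ := h.contDiffAt_theta
  smooth_τ := h.contDiffAt_contactTau
  smooth_Γ := contDiffAt_christoffel h
  cont_c := by
    have h1 := h.contDiffAt_contactTau
    have h2 : ContDiffAt ℝ ∞ (D.christoffel y θ t) e := contDiffAt_christoffel h
    have h4 : ContDiffAt ℝ ∞ (fun e => contactTau y θ t e a₀ b₀) e :=
      (h1.clm_apply contDiffAt_const).clm_apply contDiffAt_const
    have h3 : ContDiffAt ℝ ∞ (fderiv ℝ fun e => contactTau y θ t e a₀ b₀) e :=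
      h4.fderiv_right (by simp)
    have h5 := (h3.sub
        (((contDiffAt_clm_flip h1).clm_apply (contDiffAt_const (c := b₀))).clm_comp
        ((contDiffAt_clm_flip h2).clm_apply (contDiffAt_const (c := a₀))))).sub
        ((h1.clm_apply (contDiffAt_const (c := a₀))).clm_comp
        ((contDiffAt_clm_flip h2).clm_apply (contDiffAt_const (c := b₀))))
    exact ((h4.inv h0).smul h5).continuousAt
  parallel_θ := fun v a => fderiv_theta h v a
  parallel_τ := by
    obtain ⟨c, hc⟩ := exists_conformal_factor (D := D) h
    intro v a b
    have h1 : (D.localConnection y θ t a₀ b₀).c e v = c v := by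
      have h2 : (D.localConnection y θ t a₀ b₀).c e v = (contactTau y θ t e a₀ b₀)⁻¹ *
        (fderiv ℝ (fun e' => contactTau y θ t e' a₀ b₀) e v -
          contactTau y θ t e (D.christoffel y θ t e v a₀) b₀ -
          contactTau y θ t e a₀ (D.christoffel y θ t e v b₀)) := rfl
      have h3 : fderiv ℝ (fun e' => contactTau y θ t e' a₀ b₀) e v =
          fderiv ℝ (contactTau y θ t) e v a₀ b₀ := by
        rw [((((h.contDiffAt_contactTau.differentiableAt (by simp)).hasFDerivAt).clm_apply
          (hasFDerivAt_const a₀ e)).clm_apply (hasFDerivAt_const b₀ e)).fderiv]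
        simp
      rw [h2, h3, hc, mul_comm, mul_assoc, mul_inv_cancel₀ h0, mul_one]
    rw [h1]
    exact hc v a b

lemma isSymplecticAt (h : IsAdaptedNear C y θ t e) :
    (D.localConnection y θ t a₀ b₀).IsSymplecticAt n e where
  finrank_eq := finrank_euclideanSpace_fin
  ne_zero := fun h0 => by
    have h1 := h.theta_t
    have h2 : θ.inChart y e = 0 := h0
    rw [h2] at h1
    simp at h1
  alt := fun v => by
    change contactTau y θ t e v v = 0
    rw [contactTau_apply, dForm, sub_self]
  nondegenerate := fun v hv hw => by
    have h2 : chartDSymm y e v ∈ C.plane _ := by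
      rw [h.mem_plane_iff, chartD_chartDSymm h.mem_target]
      exact hv
    have h3 := (Filter.Eventually.self_of_nhds h.isGenerator).2.2.2 _ h2 (fun w hw' => by
      rw [h.extD_eq h2 hw', chartD_chartDSymm h.mem_target]
      exact hw _ ((h.mem_plane_iff _).1 hw'))
    have h4 := congrArg (chartD y _) h3
    rwa [chartD_chartDSymm h.mem_target, map_zero] at h4

/-- The Frobenius condition for the system of geodesic Legendrian submanifolds, in coordinates. -/
lemma dForm_parallelForm_eq_zero (h : IsAdaptedNear C y θ t e)
    (hD : ∀ A, IsLegendrianFrameNear C θ A ((extChartAt (𝓡 (2 * n + 1)) y).symm e) →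
      IsFrobeniusAt (D.legendrianSystem θ A) ((extChartAt (𝓡 (2 * n + 1)) y).symm e))
    {a : Fin n → Euc (2 * n + 1) → Euc (2 * n + 1)}
    (hsm : ∀ i, ∀ᶠ e' in 𝓝 e, ContDiffAt ℝ ∞ (a i) e')
    (ha : ∀ᶠ e' in 𝓝 e, LinearIndependent ℝ (fun i => a i e') ∧
        ∀ i, θ.inChart y e' (a i e') = 0 ∧ ∀ j, contactTau y θ t e' (a i e') (a j e') = 0)
    (hpar : ∀ i v, fderiv ℝ (a i) e v + D.christoffel y θ t e v (a i e) = 0)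
    {v w : Euc (2 * n + 1)} (hv : v ∈ Submodule.span ℝ (Set.range fun i => a i e))
    (hw : w ∈ Submodule.span ℝ (Set.range fun i => a i e)) (i j : Fin n) :
    dForm ((D.localConnection y θ t a₀ b₀).parallelForm (a i) (a j)) e v w = 0 := by
  have hθ : ∀ i, ∀ᶠ e' in 𝓝 e, θ.inChart y e' (a i e') = 0 := fun i =>
    ha.mono fun e' he' => (he'.2 i).1
  have hsec : ∀ i, ∀ {e'}, IsAdaptedNear C y θ t e' → (∀ᶠ e'' in 𝓝 e', ContDiffAt ℝ ∞ (a i) e'') →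
      (∀ᶠ e'' in 𝓝 e', θ.inChart y e'' (a i e'') = 0) → C.IsSectionNear (fieldOfChart y (a i))
      ((extChartAt (𝓡 (2 * n + 1)) y).symm e') := fun i _ h' h1 h2 => h'.isSectionNear h1 h2
  have hval : ∀ i, ∀ {e'}, IsAdaptedNear C y θ t e' →
      chartD y _ (fieldOfChart y (a i) ((extChartAt (𝓡 (2 * n + 1)) y).symm e')) = a i e' :=
    fun i _ h' => chartField_fieldOfChart h'.mem_target (a i)
  have hframe : IsLegendrianFrameNear C θ (fun i => fieldOfChart y (a i))
      ((extChartAt (𝓡 (2 * n + 1)) y).symm e) := by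
    refine ⟨fun i => hsec i h (hsm i) (hθ i), (eventually_chart_iff h.mem_target).2 ?_⟩
    filter_upwards [ha, h.eventually] with e' h1 h2
    constructor
    · refine LinearIndependent.of_comp (chartD y _).toLinearMap ?_
      convert! h1.1 using 1
      ext1 i
      exact hval i h2
    · intro i j
      have hmem : ∀ i, fieldOfChart y (a i) ((extChartAt (𝓡 (2 * n + 1)) y).symm e') ∈
          C.plane _ := by
        intro i
        rw [h2.mem_plane_iff, hval i h2]
        exact (h1.2 i).1
      rw [h2.extD_eq (hmem i) (hmem j), hval i h2, hval j h2]
      exact (h1.2 i).2 j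
  have hvec : ∀ v ∈ Submodule.span ℝ (Set.range fun i => a i e), ∀ s,
      D.legendrianSystem θ (fun i => fieldOfChart y (a i)) s _ (chartDSymm y e v) = 0 := by
    intro v hv s
    have hv' : θ.inChart y e v = 0 ∧ ∀ i, contactTau y θ t e (a i e) v = 0 := by
      have hle : Submodule.span ℝ (Set.range fun i => a i e) ≤
          LinearMap.ker (θ.inChart y e).toLinearMap ⊓
            ⨅ i, LinearMap.ker (contactTau y θ t e (a i e)).toLinearMap := by
        rw [Submodule.span_le]
        rintro _ ⟨j, rfl⟩
        refine ⟨(hθ j).self_of_nhds, ?_⟩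
        rw [SetLike.mem_coe, Submodule.mem_iInf]
        exact fun i => (ha.self_of_nhds.2 i).2 j
      have h1 := hle hv
      rw [Submodule.mem_inf, Submodule.mem_iInf] at h1
      exact ⟨h1.1, h1.2⟩
    have hmem : chartDSymm y e v ∈ C.plane _ := by
      rw [h.mem_plane_iff, chartD_chartDSymm h.mem_target]
      exact hv'.1
    have hmem' : ∀ i, fieldOfChart y (a i) ((extChartAt (𝓡 (2 * n + 1)) y).symm e) ∈
        C.plane _ := by
      intro i
      rw [h.mem_plane_iff, hval i h]
      exact (hθ i).self_of_nhds
    rcases s with s | i | ⟨i, j⟩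
    · exact hv'.1
    · change θ.extD _ _ _ = 0
      rw [h.extD_eq (hmem' i) hmem, hval i h, chartD_chartDSymm h.mem_target]
      exact hv'.2 i
    · change θ.extD _ _ (D.cov _ _ _) = 0
      rw [h.extD_eq (hmem' i) (D.mem_plane _ _ _ (hsec j h (hsm j) (hθ j))),
        chartCov_section h (hsm j) (hθ j), hpar, map_zero]
  have h1 := hD _ hframe _ _ (hvec v hv) (hvec w hw) (Sum.inr (Sum.inr (i, j)))
  -- The remaining family of the system is the `parallelForm` of the coordinate frame.
  have h2 : (D.legendrianSystem θ (fun i => fieldOfChart y (a i))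
      (Sum.inr (Sum.inr (i, j)))).inChart y =ᶠ[𝓝 e]
      (D.localConnection y θ t a₀ b₀).parallelForm (a i) (a j) := by
    filter_upwards [h.eventually, (hsm i).eventually_nhds, (hsm j).eventually_nhds,
      (hθ i).eventually_nhds, (hθ j).eventually_nhds] with e' h2 h3 h4 h5 h6
    ext v
    rw [OneForm.inChart_apply]
    change θ.extD _ _ (D.cov _ _ _) = contactTau y θ t e' (a i e')
      (fderiv ℝ (a j) e' v + D.christoffel y θ t e' v (a j e'))
    have hmem : fieldOfChart y (a i) ((extChartAt (𝓡 (2 * n + 1)) y).symm e') ∈ C.plane _ := by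
      rw [h2.mem_plane_iff, hval i h2]
      exact h5.self_of_nhds
    rw [h2.extD_eq hmem (D.mem_plane _ _ _ (hsec j h2 h4 h6)),
      chartCov_section h2 h4 h6, hval i h2]
  have h3 : ContDiffAt ℝ ∞ ((D.localConnection y θ t a₀ b₀).parallelForm (a i) (a j)) e := by
    have h4 := (hsm j).self_of_nhds
    have h5 : ContDiffAt ℝ ∞ (fderiv ℝ (a j)) e := h4.fderiv_right (by simp)
    have h6 : ContDiffAt ℝ ∞ (D.christoffel y θ t) e := contDiffAt_christoffel h
    exact (h.contDiffAt_contactTau.clm_apply (hsm i).self_of_nhds).clm_comp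
      (h5.add ((contDiffAt_clm_flip h6).clm_apply h4))
  have h4 := OneForm.inChart_of_isSmoothAt h.mem_target (OneForm.isSmoothAt_of_inChart h.mem_target
    (h3.congr_of_eventuallyEq h2))
  have h5 := h4.2 v w
  rw [h1] at h5
  simp only [dForm, h2.fderiv_eq] at h5
  exact h5

end ConformalSymplecticConnection

end ChartConnection

section ChartConnection

variable {n : ℕ} {Y : Type*} [TopologicalSpace Y] [ChartedSpace (Euc (2 * n + 1)) Y]
  [IsManifold (𝓡 (2 * n + 1)) ∞ Y] {C : ContactStructure n Y}
  {y : Y} {θ : OneForm (2 * n + 1) Y} {t : Euc (2 * n + 1) → Euc (2 * n + 1)}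
  {e : Euc (2 * n + 1)} {D : ConformalSymplecticConnection C} {a₀ b₀ : Euc (2 * n + 1)}

namespace ConformalSymplecticConnection

/-- The two integrability properties of a Legendrian connection, in coordinates: vanishing torsion
on isotropic pairs, as `dθ(v, w)` is up to sign the transversal component of the bracket,
and curvature preserving isotropic subspaces, by the Frobenius condition. -/
lemma isIntegrableAt (hD : D.IsLegendrian) (h : IsAdaptedNear C y θ t e)
    (h0 : contactTau y θ t e a₀ b₀ ≠ 0)
    {ℓ : (y : Y) → Submodule ℝ (TangentSpace (𝓡 (2 * n + 1)) y)}
    (hℓ : ∀ v ∈ ℓ ((extChartAt (𝓡 (2 * n + 1)) y).symm e), ∃ r : ℝ, chartD y _ v = r • t e)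
    (hT : ∀ V W y, C.IsSectionNear V y → C.IsSectionNear W y →
      VectorField.mlieBracket (𝓡 (2 * n + 1)) V W y - (D.cov W y (V y) - D.cov V y (W y)) ∈ ℓ y) :
    (D.localConnection y θ t a₀ b₀).IsIntegrableAt e where
  torsion := fun _ _ hv hw hvw => christoffel_symm h hℓ hT hv hw hvw
  curv := by
    intro W hW v hv w hw u hu
    refine LocalConnection.curvature_mem_of_frobenius ?_ (isSymplecticAt h) ?_ hW hv hw hu
    · have h1 : ContDiffAt ℝ ∞ (fun e => contactTau y θ t e a₀ b₀) e :=
        (h.contDiffAt_contactTau.clm_apply contDiffAt_const).clm_apply contDiffAt_const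
      filter_upwards [h.eventually, h1.continuousAt.eventually_ne h0] with e' h2 h3
      exact isConformalAt h2 h3
    · intro a hsm ha hpar v hv w hw i j
      exact dForm_parallelForm_eq_zero h (fun A hA => hD.2 _ θ A h.isGenerator hA) hsm ha hpar hv hw
        i j

/-- The connection that extends `D` by making `t` parallel represents `D` at each point of the chart
where the data are adapted, if `t` spans the line field of the torsion condition. -/
lemma represents_symm (hD : D.IsLegendrian) (h : IsAdaptedNear C y θ t e)
    (h0 : contactTau y θ t e a₀ b₀ ≠ 0)
    {ℓ : (y : Y) → Submodule ℝ (TangentSpace (𝓡 (2 * n + 1)) y)}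
    (hℓ : ∀ v ∈ ℓ ((extChartAt (𝓡 (2 * n + 1)) y).symm e), ∃ r : ℝ, chartD y _ v = r • t e)
    (hT : ∀ V W y, C.IsSectionNear V y → C.IsSectionNear W y →
      VectorField.mlieBracket (𝓡 (2 * n + 1)) V W y - (D.cov W y (V y) - D.cov V y (W y)) ∈ ℓ y) :
    (D.localConnection y θ t a₀ b₀).Represents D y ((extChartAt (𝓡 (2 * n + 1)) y).symm e) := by
  have hright := (extChartAt (𝓡 (2 * n + 1)) y).right_inv h.mem_target
  have hsm : ∀ V, C.IsSectionNear V ((extChartAt (𝓡 (2 * n + 1)) y).symm e) →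
      (∀ᶠ e' in 𝓝 e, ContDiffAt ℝ ∞ (chartField y V) e') ∧
      ∀ᶠ e' in 𝓝 e, θ.inChart y e' (chartField y V e') = 0 := by
    intro V hV
    refine ⟨(smoothNear_iff h.mem_target).1 hV.1, ?_⟩
    filter_upwards [(eventually_chart_iff h.mem_target).1 hV.2, h.eventually] with e' h1 h2
    exact (h2.mem_plane_iff _).1 h1
  constructor
  · exact symm_mem_source h.mem_target
  · rw [hright]
    exact isConformalAt h h0
  · rw [hright]
    exact isIntegrableAt hD h h0 hℓ hT
  · rw [hright]
    exact (isSymplecticAt (D := D) (a₀ := a₀) (b₀ := b₀) h).ne_zero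
  · intro v
    rw [hright]
    exact h.mem_plane_iff v
  · intro k W
    rw [hright]
    constructor
    · rintro ⟨h1, h2, h3⟩
      refine ⟨h1, ?_⟩
      rintro _ ⟨v, hv, rfl⟩
      refine ⟨(h.mem_plane_iff v).1 (h2 hv), ?_⟩
      rintro _ ⟨w, hw, rfl⟩
      exact (h.extD_eq (h2 hv) (h2 hw)).symm.trans (h3 θ h.isGenerator v hv w hw)
    · rintro ⟨h1, h2⟩
      have hW : ∀ v ∈ W, v ∈ C.plane _ := fun v hv =>
        (h.mem_plane_iff v).2 (h2 _ (Submodule.mem_map_of_mem hv)).1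
      refine ⟨h1, hW, fun θ' hθ' v hv w hw => ?_⟩
      obtain ⟨f, hf⟩ := h.exists_extD_eq hθ'
      rw [hf v (hW v hv) w (hW w hw), h.extD_eq (hW v hv) (hW w hw)]
      have h3 := (h2 _ (Submodule.mem_map_of_mem hv)).2 _ (Submodule.mem_map_of_mem hw)
      change contactTau y θ t e (chartD y _ v) (chartD y _ w) = 0 at h3
      rw [h3, mul_zero]
  · intro v hv
    rw [hright] at hv
    exact h.isSectionNear (hv.mono fun e' he' => he'.1) (hv.mono fun e' he' => he'.2)
  · intro V hV
    rw [hright]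
    exact (hsm V hV).1.self_of_nhds
  · intro V hV X
    rw [hright]
    have h1 := chartCov_section (D := D) h (hsm V hV).1 (hsm V hV).2 (chartD y _ X)
    rw [chartDSymm_chartD h.mem_target] at h1
    rw [← D.cov_congr hV (V' := fieldOfChart y (chartField y V))] at h1
    · exact h1
    · filter_upwards [(chartAt (Euc (2 * n + 1)) y).open_source.mem_nhds
        (symm_mem_source h.mem_target)] with z hz
      exact (fieldOfChart_chartField hz V).symm

end ConformalSymplecticConnection

/-- Every Legendrian connection has a coordinate expression in each chart near its centre. -/
theorem exists_represents (hn : 0 < n) (hD : D.IsLegendrian) (y : Y) :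
    ∃ L : LocalConnection (Euc (2 * n + 1)), ∀ᶠ z in 𝓝 y, L.Represents D y z := by
  obtain ⟨ℓ, hℓ, hT, htor⟩ := hD.1
  obtain ⟨T, hT1, hT2⟩ := hT y
  obtain ⟨θ, hθ⟩ := C.exists_form y
  obtain ⟨t, ht, hℓt⟩ := exists_isAdaptedNear hℓ hT1 hT2 hθ
  obtain ⟨a₀, b₀, h0⟩ := ht.exists_tau_ne_zero hn
  refine ⟨D.localConnection y θ t a₀ b₀, ?_⟩
  have h1 : ContDiffAt ℝ ∞ (fun e => contactTau y θ t e a₀ b₀) (extChartAt (𝓡 (2 * n + 1)) y y) :=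
    (ht.contDiffAt_contactTau.clm_apply contDiffAt_const).clm_apply contDiffAt_const
  have h2 := (eventually_chart_iff (mem_extChartAt_target (I := 𝓡 (2 * n + 1)) y)
    (p := fun z => (D.localConnection y θ t a₀ b₀).Represents D y z)).2
  rw [extChartAt_to_inv] at h2
  refine h2 ?_
  filter_upwards [ht.eventually, h1.continuousAt.eventually_ne h0, hℓt] with e h3 h4 h5
  exact ConformalSymplecticConnection.represents_symm hD h3 h4 h5 htor

end ChartConnection

/-! ### Geodesic isotropic folds in coordinates -/

section FoldChart

variable {n k : ℕ} {Y : Type*} [TopologicalSpace Y] [ChartedSpace (Euc (2 * n + 1)) Y]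
  [IsManifold (𝓡 (2 * n + 1)) ∞ Y] {C : ContactStructure n Y}
  {D : ConformalSymplecticConnection C} {y : Y} {L : LocalConnection (Euc (2 * n + 1))}
  {σ : Euc k → Y} {x : Euc k}

lemma map_chartD_tangentPlane (hσ : MDifferentiableAt (𝓡 k) (𝓡 (2 * n + 1)) σ x)
    (hy : σ x ∈ (chartAt (Euc (2 * n + 1)) y).source) :
    (tangentPlane (n := n) σ x).map (chartD y (σ x)).toLinearMap =
      LinearMap.range (fderiv ℝ (extChartAt (𝓡 (2 * n + 1)) y ∘ σ) x).toLinearMap := by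
  ext v
  constructor
  · rintro ⟨_, ⟨a, rfl⟩, rfl⟩
    exact ⟨a, (chartD_mfderiv hσ hy a).symm⟩
  · rintro ⟨a, rfl⟩
    exact ⟨_, ⟨a, rfl⟩, chartD_mfderiv hσ hy a⟩

lemma chartD_injective {d : ℕ} {M : Type*} [TopologicalSpace M] [ChartedSpace (Euc d) M]
    [IsManifold (𝓡 d) ∞ M] {y z : M} (hz : z ∈ (chartAt (Euc d) y).source) :
    Function.Injective (chartD (d := d) y z) := by
  obtain ⟨f, hf⟩ := isInvertible_chartD hz
  rw [← hf]
  exact f.injective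

lemma mem_tangentPlane_iff (hσ : MDifferentiableAt (𝓡 k) (𝓡 (2 * n + 1)) σ x)
    (hy : σ x ∈ (chartAt (Euc (2 * n + 1)) y).source) (v : TangentSpace (𝓡 (2 * n + 1)) (σ x)) :
    v ∈ tangentPlane σ x ↔ chartD y (σ x) v ∈
      LinearMap.range (fderiv ℝ (extChartAt (𝓡 (2 * n + 1)) y ∘ σ) x).toLinearMap := by
  rw [← map_chartD_tangentPlane hσ hy]
  exact ((chartD_injective hy).mem_set_image (s := (tangentPlane (n := n) σ x : Set _))).symm

lemma injective_mfderiv_iff (hσ : MDifferentiableAt (𝓡 k) (𝓡 (2 * n + 1)) σ x)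
    (hy : σ x ∈ (chartAt (Euc (2 * n + 1)) y).source) :
    Function.Injective (mfderiv (𝓡 k) (𝓡 (2 * n + 1)) σ x) ↔
      Function.Injective (fderiv ℝ (extChartAt (𝓡 (2 * n + 1)) y ∘ σ) x) := by
  have h1 : ⇑(fderiv ℝ (extChartAt (𝓡 (2 * n + 1)) y ∘ σ) x) =
      chartD y (σ x) ∘ mfderiv (𝓡 k) (𝓡 (2 * n + 1)) σ x :=
    funext fun v => (chartD_mfderiv hσ hy v).symm
  rw [h1]
  exact ((chartD_injective hy).of_comp_iff (mfderiv (𝓡 k) (𝓡 (2 * n + 1)) σ x)).symm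

omit [IsManifold (𝓡 (2 * n + 1)) ∞ Y] in
lemma finrank_tangentPlane (h : Function.Injective (mfderiv (𝓡 k) (𝓡 (2 * n + 1)) σ x)) :
    Module.finrank ℝ (tangentPlane (n := n) σ x) = k := by
  rw [tangentPlane, LinearMap.finrank_range_of_inj h]
  exact finrank_euclideanSpace_fin

/-- The condition of parallel tangent planes, in coordinates. -/
lemma isTotallyGeodesicAt_iff (hL : ∀ᶠ z in 𝓝 (σ x), L.Represents D y z)
    (hσ' : ∀ᶠ x' in 𝓝 x, ContMDiffAt (𝓡 k) (𝓡 (2 * n + 1)) ∞ σ x')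
    (hinj : Function.Injective (mfderiv (𝓡 k) (𝓡 (2 * n + 1)) σ x))
    (hP : ∀ᶠ x' in 𝓝 x, tangentPlane σ x' ≤ C.plane (σ x')) :
    L.IsTotallyGeodesicAt (extChartAt (𝓡 (2 * n + 1)) y ∘ σ) x ↔
    ∀ V : VField (2 * n + 1) Y, C.IsSectionNear V (σ x) →
      (∀ᶠ x' in 𝓝 x, V (σ x') ∈ tangentPlane σ x') →
      ∀ w ∈ tangentPlane σ x, D.cov V (σ x) w ∈ tangentPlane σ x := by
  set s := extChartAt (𝓡 (2 * n + 1)) y ∘ σ with hs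
  have hσ := hσ'.self_of_nhds
  have hrep := hL.self_of_nhds
  have hd := hσ.mdifferentiableAt (by simp)
  have hinj' := (injective_mfderiv_iff hd hrep.mem_source).1 hinj
  have hrep' := hσ.continuousAt.eventually hL
  have hsx' : ∀ᶠ x' in 𝓝 x, ContDiffAt ℝ ∞ s x' := by
    filter_upwards [hσ', hrep'] with x' h1 h2
    exact contDiffAt_chart_comp h1 h2.mem_source
  have hsx : ContDiffAt ℝ ∞ s x := hsx'.self_of_nhds
  have hds : ContDiffAt ℝ ∞ (fderiv ℝ s) x := hsx.fderiv_right (by simp)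
  obtain ⟨g, hg⟩ := LocalConnection.exists_leftInverse_clm hinj'
  constructor
  · rintro hTG V hV htan _ ⟨a, rfl⟩
    rw [mem_tangentPlane_iff hd hrep.mem_source, hrep.cov_eq V hV]
    have ha : chartD y (σ x) (mfderiv (𝓡 k) (𝓡 (2 * n + 1)) σ x a) = fderiv ℝ s x a :=
      chartD_mfderiv hd hrep.mem_source a
    change fderiv ℝ _ (s x) (chartD y (σ x) (mfderiv (𝓡 k) (𝓡 (2 * n + 1)) σ x a)) +
      L.Γ (s x) (chartD y (σ x) (mfderiv (𝓡 k) (𝓡 (2 * n + 1)) σ x a)) _ ∈ _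
    rw [ha]
    have hinv := LocalConnection.eventually_isInvertible_comp hds.continuousAt hg
    have hVs : ContDiffAt ℝ ∞ (chartField y V) (s x) := hrep.smooth V hV
    have hVs' : ContDiffAt ℝ ∞ (fun x' => g (chartField y V (s x'))) x :=
      g.contDiff.contDiffAt.comp x (hVs.comp x hsx)
    -- The coefficients of the tangent field with respect to the parameters.
    let c : Euc k → Euc k := fun x' => (g.comp (fderiv ℝ s x')).inverse (g (chartField y V (s x')))
    have hc : ContDiffAt ℝ ∞ c x := by
      obtain ⟨f, hf⟩ := hinv.self_of_nhds
      have h1 : ContDiffAt ℝ ∞ (ContinuousLinearMap.inverse : (Euc k →L[ℝ] Euc k) → _)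
          (g.comp (fderiv ℝ s x)) := by
        rw [← hf]
        exact contDiffAt_map_inverse f
      exact (h1.comp x (contDiffAt_const.clm_comp hds)).clm_apply hVs'
    have hcV : chartField y V ∘ s =ᶠ[𝓝 x] fun x' => fderiv ℝ s x' (c x') := by
      filter_upwards [hinv, htan, hσ', hrep'] with x' h1 h2 h3 h4
      rw [mem_tangentPlane_iff (h3.mdifferentiableAt (by simp)) h4.mem_source,
        chartD_apply_eq_chartField h4.mem_source] at h2
      obtain ⟨b, hb⟩ := h2
      have hb' : fderiv ℝ s x' b = chartField y V (s x') := hb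
      obtain ⟨f, hf⟩ := h1
      have h5 : c x' = b := by
        have h6 : g (fderiv ℝ s x' b) = f b := (DFunLike.congr_fun hf b).symm
        simp only [c]
        rw [← hb', h6, ← hf, ContinuousLinearMap.inverse_equiv]
        exact f.symm_apply_apply b
      rw [Function.comp_apply, h5, hb']
    have h1 := ((hVs.differentiableAt (by simp)).hasFDerivAt.comp x
      (hsx.differentiableAt (by simp)).hasFDerivAt).fderiv
    rw [hcV.fderiv_eq, ((hds.differentiableAt (by simp)).hasFDerivAt.clm_apply
      (hc.differentiableAt (by simp)).hasFDerivAt).fderiv] at h1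
    have h2 : fderiv ℝ s x (fderiv ℝ c x a) + fderiv ℝ (fderiv ℝ s) x a (c x) =
        fderiv ℝ (chartField y V) (s x) (fderiv ℝ s x a) := DFunLike.congr_fun h1 a
    have h3 : chartField y V (s x) = fderiv ℝ s x (c x) := hcV.self_of_nhds
    have h4 := Submodule.add_mem _ (hTG a (c x))
      (LinearMap.mem_range_self (fderiv ℝ s x).toLinearMap (fderiv ℝ c x a))
    convert h4 using 1
    rw [← h2]
    change _ + L.Γ (s x) _ (chartField y V (s x)) = _ + fderiv ℝ s x (fderiv ℝ c x a)
    rw [h3]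
    abel
  · intro hpar a b
    have hchart : ∀ᶠ e in 𝓝 (s x), L.IsConformalAt e ∧
        e ∈ (extChartAt (𝓡 (2 * n + 1)) y).target := by
      have hL' := hL
      have hm := mem_target_chart hrep.mem_source
      rw [← chart_left_inv hrep.mem_source] at hL'
      filter_upwards [(eventually_chart_iff hm).1 hL',
        (isOpen_extChartAt_target (I := 𝓡 (2 * n + 1)) y).mem_nhds hm] with e h1 h2
      have h3 := h1.conformal
      rw [(extChartAt (𝓡 (2 * n + 1)) y).right_inv h2] at h3
      exact ⟨h3, h2⟩
    obtain ⟨t, ht⟩ : ∃ t, L.θ (s x) t ≠ 0 := by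
      by_contra! hcon
      exact hrep.theta_ne_zero (ContinuousLinearMap.ext hcon)
    have htne : ∀ᶠ e in 𝓝 (s x), L.θ e t ≠ 0 :=
      (hrep.conformal.smooth_θ.clm_apply (contDiffAt_const (c := t))).continuousAt.eventually_ne ht
    -- Extend the tangent field with constant coefficients `b` by means of the retraction `g`.
    have hgs : HasFDerivAt (g ∘ s) ((ContinuousLinearEquiv.refl ℝ (Euc k) : Euc k ≃L[ℝ] Euc k) :
        Euc k →L[ℝ] Euc k) x := by
      have h1 := g.hasFDerivAt.comp x (hsx.differentiableAt (by simp)).hasFDerivAt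
      refine h1.congr_fderiv ?_
      ext1 v
      exact hg v
    obtain ⟨φ, hφx, hφs, hφ, -, hφ'⟩ := exists_smooth_localInverse (f := g ∘ s)
      (hsx'.mono fun x' h1 => g.contDiff.contDiffAt.comp x' h1) hgs hsx'
    let v₀ : Euc (2 * n + 1) → Euc (2 * n + 1) := fun e => fderiv ℝ s (φ.symm (g e)) b
    let v : Euc (2 * n + 1) → Euc (2 * n + 1) := fun e => v₀ e - ((L.θ e t)⁻¹ * L.θ e (v₀ e)) • t
    have hgx : g (s x) = φ x := (hφ x).symm
    have htar : ∀ᶠ e in 𝓝 (s x), g e ∈ φ.target := by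
      refine g.continuous.continuousAt.eventually_mem (φ.open_target.mem_nhds ?_)
      rw [hgx]
      exact φ.map_source hφx
    have hv : ∀ᶠ e in 𝓝 (s x), ContDiffAt ℝ ∞ v e ∧ L.θ e (v e) = 0 := by
      filter_upwards [htar, htne, hchart] with e h1 h2 h3
      have h4 : ContDiffAt ℝ ∞ s (φ.symm (g e)) := hφs (φ.map_target h1)
      have h5 : ContDiffAt ℝ ∞ v₀ e :=
        (ContDiffAt.comp e (h4.fderiv_right (m := ∞) (by simp))
          ((hφ' _ h1).comp e g.contDiff.contDiffAt)).clm_apply contDiffAt_const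
      have h6 := h3.1.smooth_θ
      refine ⟨h5.sub ((((h6.clm_apply contDiffAt_const).inv h2).mul (h6.clm_apply h5)).smul
        contDiffAt_const), ?_⟩
      simp only [v, map_sub, map_smul, smul_eq_mul]
      field_simp
      ring
    have hvs : (fun x' => v (s x')) =ᶠ[𝓝 x] fun x' => fderiv ℝ s x' b := by
      filter_upwards [φ.open_source.mem_nhds hφx, hσ', hrep', hP] with x' h1 h2 h3 h4
      have h5 : v₀ (s x') = fderiv ℝ s x' b := by
        have h6 : g (s x') = φ x' := (hφ x').symm
        simp only [v₀]
        rw [h6, φ.left_inv h1]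
      have h6 := (h3.mem_plane_iff _).1 (h4 (LinearMap.mem_range_self _ b))
      have h7 := chartD_mfderiv (h2.mdifferentiableAt (by simp)) h3.mem_source b
      have h8 : L.θ (s x') (fderiv ℝ s x' b) = 0 := by
        rw [← h7]
        exact h6
      simp only [v, h5, h8, mul_zero, zero_smul, sub_zero]
    have hfield : ∀ᶠ e in 𝓝 (s x), chartField y (fieldOfChart y v) e = v e := by
      filter_upwards [hchart] with e h1
      exact chartField_fieldOfChart h1.2 v
    have hsec := hrep.isSectionNear v hv
    have h1 := hpar (fieldOfChart y v) hsec ?_ _ (LinearMap.mem_range_self _ a)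
    · rw [mem_tangentPlane_iff hd hrep.mem_source, hrep.cov_eq _ hsec] at h1
      have ha : chartD y (σ x) (mfderiv (𝓡 k) (𝓡 (2 * n + 1)) σ x a) = fderiv ℝ s x a :=
        chartD_mfderiv hd hrep.mem_source a
      change fderiv ℝ _ (s x) (chartD y (σ x) (mfderiv (𝓡 k) (𝓡 (2 * n + 1)) σ x a)) +
        L.Γ (s x) (chartD y (σ x) (mfderiv (𝓡 k) (𝓡 (2 * n + 1)) σ x a)) (chartField y _ (s x)) ∈ _
        at h1
      rw [ha, Filter.EventuallyEq.fderiv_eq hfield, hfield.self_of_nhds] at h1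
      have h2 := ((hv.self_of_nhds.1.differentiableAt (by simp)).hasFDerivAt.comp x
        (hsx.differentiableAt (by simp)).hasFDerivAt).fderiv
      have h3 : fderiv ℝ (v ∘ s) x = _ := hvs.fderiv_eq
      rw [h3, ((hds.differentiableAt (by simp)).hasFDerivAt.clm_apply
        (hasFDerivAt_const b x)).fderiv] at h2
      have h4 : fderiv ℝ s x 0 + fderiv ℝ (fderiv ℝ s) x a b =
        fderiv ℝ v (s x) (fderiv ℝ s x a) := DFunLike.congr_fun h2 a
      have h5 : v (s x) = fderiv ℝ s x b := hvs.self_of_nhds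
      rw [h5, ← h4, map_zero, zero_add] at h1
      exact h1
    · filter_upwards [hvs, hσ', hrep', hsx.continuousAt.eventually hfield] with x' h1 h2 h3 h4
      rw [mem_tangentPlane_iff (h2.mdifferentiableAt (by simp)) h3.mem_source,
        chartD_apply_eq_chartField h3.mem_source]
      change chartField y _ (s x') ∈ _
      rw [h4]
      exact ⟨b, h1.symm⟩

/-- Geodesic isotropic folds are the immersions that are isotropic and totally geodesic in
coordinates. -/
theorem isGeodesicIsotropic_iff {U : Set (Euc k)} (hU : IsImmersedOn (n := n) U σ)
    {L : Y → LocalConnection (Euc (2 * n + 1))} {c : Euc k → Y}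
    (hL : ∀ x ∈ U, ∀ᶠ z in 𝓝 (σ x), (L (c x)).Represents D (c x) z) :
    IsGeodesicIsotropic D U σ ↔ ∀ x ∈ U, (tangentPlane σ x ≤ C.plane (σ x) ∧
      (L (c x)).IsIsotropic (extChartAt (𝓡 (2 * n + 1)) (c x) (σ x)) (LinearMap.range
        (fderiv ℝ (extChartAt (𝓡 (2 * n + 1)) (c x) ∘ σ) x).toLinearMap)) ∧
      (L (c x)).IsTotallyGeodesicAt (extChartAt (𝓡 (2 * n + 1)) (c x) ∘ σ) x := by
  have h1 : ∀ x ∈ U, C.IsIsotropicPlane k (σ x) (tangentPlane σ x) ↔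
      (tangentPlane σ x ≤ C.plane (σ x) ∧
      (L (c x)).IsIsotropic (extChartAt (𝓡 (2 * n + 1)) (c x) (σ x)) (LinearMap.range
        (fderiv ℝ (extChartAt (𝓡 (2 * n + 1)) (c x) ∘ σ) x).toLinearMap)) := by
    intro x hx
    have h2 := (hL x hx).self_of_nhds
    have h3 := h2.isotropic_iff k (tangentPlane σ x)
    rw [map_chartD_tangentPlane ((hU.2 x hx).1.mdifferentiableAt (by simp)) h2.mem_source] at h3
    constructor
    · exact fun h => ⟨h.2.1, (h3.1 h).2⟩
    · exact fun h => h3.2 ⟨finrank_tangentPlane (hU.2 x hx).2, h.2⟩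
  have h2 : (∀ x ∈ U, tangentPlane σ x ≤ C.plane (σ x)) → ∀ x ∈ U, _ := fun hP x hx =>
    isTotallyGeodesicAt_iff (hL x hx)
      (by filter_upwards [hU.1.mem_nhds hx] with x' hx' using (hU.2 x' hx').1) (hU.2 x hx).2
      (by filter_upwards [hU.1.mem_nhds hx] with x' hx' using hP x' hx')
  constructor
  · rintro ⟨-, h⟩ x hx
    exact ⟨(h1 x hx).1 (h x hx).1, (h2 (fun x' hx' => (h x' hx').1.2.1) x hx).2 (h x hx).2⟩
  · intro h
    exact ⟨hU, fun x hx => ⟨(h1 x hx).2 (h x hx).1,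
      (h2 (fun x' hx' => (h x' hx').1.1) x hx).1 (h x hx).2⟩⟩

end FoldChart

/-! ### Existence and uniqueness of geodesic isotropic folds -/

section Existence

variable {n k : ℕ} {Y : Type*} [TopologicalSpace Y] [ChartedSpace (Euc (2 * n + 1)) Y]
  [IsManifold (𝓡 (2 * n + 1)) ∞ Y] {C : ContactStructure n Y}
  {D : ConformalSymplecticConnection C} {y : Y}

lemma LocalConnection.IsTotallyGeodesicAt.congr {E X : Type*} [NormedAddCommGroup E]
    [NormedSpace ℝ E] [NormedAddCommGroup X] [NormedSpace ℝ X] {L : LocalConnection E}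
    {s s' : X → E} {x : X} (h : L.IsTotallyGeodesicAt s x) (hs : s =ᶠ[𝓝 x] s') :
    L.IsTotallyGeodesicAt s' x := by
  intro a b
  have h1 := h a b
  rwa [hs.fderiv.fderiv_eq, hs.fderiv_eq, hs.self_of_nhds] at h1

lemma LocalConnection.Represents.eventually_symm {L : LocalConnection (Euc (2 * n + 1))} {z : Y}
    (hz : z ∈ (chartAt (Euc (2 * n + 1)) y).source) (hL : ∀ᶠ z in 𝓝 z, L.Represents D y z) :
    ∀ᶠ e in 𝓝 (extChartAt (𝓡 (2 * n + 1)) y z), e ∈ (extChartAt (𝓡 (2 * n + 1)) y).target ∧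
      (∀ᶠ z in 𝓝 ((extChartAt (𝓡 (2 * n + 1)) y).symm e), L.Represents D y z) ∧
      L.IsConformalAt e ∧ L.IsIntegrableAt e := by
  have hm := mem_target_chart hz
  rw [← chart_left_inv hz] at hL
  filter_upwards [(eventually_chart_iff hm).1 hL, (eventually_chart_iff hm).1 hL.eventually_nhds,
    (isOpen_extChartAt_target (I := 𝓡 (2 * n + 1)) y).mem_nhds hm] with e h1 h2 h3
  have h4 := h1.conformal
  have h5 := h1.integrable
  rw [(extChartAt (𝓡 (2 * n + 1)) y).right_inv h3] at h4 h5
  exact ⟨h3, h2, h4, h5⟩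

lemma isTangentTo_iff {σ : Euc k → Y} {x : Euc k}
    (hσ : MDifferentiableAt (𝓡 k) (𝓡 (2 * n + 1)) σ x)
    (W : Submodule ℝ (TangentSpace (𝓡 (2 * n + 1)) y)) :
    IsTangentTo σ x y W ↔ σ x = y ∧ LinearMap.range
      (fderiv ℝ (extChartAt (𝓡 (2 * n + 1)) y ∘ σ) x).toLinearMap =
        W.map (chartD y y).toLinearMap := by
  have key : ∀ h : σ x = y, h ▸ tangentPlane σ x = W ↔ LinearMap.range
      (fderiv ℝ (extChartAt (𝓡 (2 * n + 1)) y ∘ σ) x).toLinearMap =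
        W.map (chartD y y).toLinearMap := by
    rintro rfl
    have hy := mem_chart_source (Euc (2 * n + 1)) (σ x)
    rw [← map_chartD_tangentPlane hσ hy]
    exact ((Submodule.map_injective_of_injective (chartD_injective hy)).eq_iff).symm
  exact ⟨fun ⟨h, h'⟩ => ⟨h, (key h).1 h'⟩, fun ⟨h, h'⟩ => ⟨h, (key h).2 h'⟩⟩

/-- A parametrization of the coordinate expression of a `k`-plane. -/
lemma exists_parametrization {W : Submodule ℝ (TangentSpace (𝓡 (2 * n + 1)) y)}
    (hW : Module.finrank ℝ W = k) : ∃ ι : Euc k →L[ℝ] Euc (2 * n + 1), Function.Injective ι ∧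
      LinearMap.range ι.toLinearMap = W.map (chartD y y).toLinearMap := by
  have hinj := chartD_injective (mem_chart_source (Euc (2 * n + 1)) y)
  have h1 : Module.finrank ℝ (W.map (chartD y y).toLinearMap) = k := by
    rw [← hW]
    exact (LinearEquiv.finrank_eq (Submodule.equivMapOfInjective (chartD y y).toLinearMap hinj W)).symm
  have h2 : Module.finrank ℝ (Euc k) = Module.finrank ℝ (W.map (chartD y y).toLinearMap) := by
    rw [h1, finrank_euclideanSpace_fin]
  let f := LinearEquiv.ofFinrankEq _ _ h2
  refine ⟨LinearMap.toContinuousLinearMap ((Submodule.subtype _).comp f.toLinearMap), ?_, ?_⟩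
  · exact (Submodule.injective_subtype _).comp f.injective
  · change LinearMap.range ((Submodule.subtype _).comp f.toLinearMap) = _
    rw [LinearMap.range_comp, LinearEquiv.range, Submodule.map_top, Submodule.range_subtype]

lemma exists_equiv_comp_eq {E X : Type*} [NormedAddCommGroup E] [NormedSpace ℝ E]
    [NormedAddCommGroup X] [NormedSpace ℝ X] [FiniteDimensional ℝ X] {f g : X →L[ℝ] E}
    (hf : Function.Injective f) (hg : Function.Injective g)
    (h : LinearMap.range f.toLinearMap = LinearMap.range g.toLinearMap) :
    ∃ f₀ : X ≃L[ℝ] X, f.comp (f₀ : X →L[ℝ] X) = g := by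
  let a := LinearEquiv.ofInjective f.toLinearMap hf
  let b := LinearEquiv.ofInjective g.toLinearMap hg
  let c := (b.trans (LinearEquiv.ofEq _ _ h.symm)).trans a.symm
  refine ⟨c.toContinuousLinearEquiv, ?_⟩
  ext x
  have h1 : a (c x) = LinearEquiv.ofEq _ _ h.symm (b x) := a.apply_symm_apply _
  exact congrArg Subtype.val h1

/-- Through every isotropic plane there is a geodesic isotropic fold, namely the image of the plane
under the exponential map. -/
theorem exists_isGeodesicIsotropic (hn : 0 < n) (hD : D.IsLegendrian)
    {W : Submodule ℝ (TangentSpace (𝓡 (2 * n + 1)) y)} (hW : C.IsIsotropicPlane k y W) :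
    ∃ (U : Set (Euc k)) (σ : Euc k → Y) (x : Euc k), x ∈ U ∧ IsGeodesicIsotropic D U σ ∧
      IsTangentTo σ x y W := by
  obtain ⟨L, hL⟩ := exists_represents hn hD y
  have hy := mem_chart_source (Euc (2 * n + 1)) y
  obtain ⟨ι, hι, hιW⟩ := exists_parametrization hW.1
  have hiso := ((hL.self_of_nhds.isotropic_iff k W).1 hW).2
  rw [← hιW] at hiso
  have hL' := LocalConnection.Represents.eventually_symm hy hL
  obtain ⟨σ, A, hσ0, hA0, hσA⟩ := L.exists_exp ι (hL'.mono fun e he => he.2.2) hiso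
  obtain ⟨hdσ, hgeo⟩ := L.eventually_isTotallyGeodesicAt_exp hι hA0
    (hσA.mono fun x hx => ⟨hx.1, hx.2.1, hx.2.2.1, hx.2.2.2.1, hx.2.2.2.2.2.2⟩)
  have hσc : ContinuousAt σ 0 := hσA.self_of_nhds.1.continuousAt
  rw [← hσ0] at hL'
  obtain ⟨U, hU, hUo, hU0⟩ := _root_.eventually_nhds_iff.1
    ((hσA.and hgeo).and (hσc.eventually hL'))
  have htar : ∀ x ∈ U, σ x ∈ (extChartAt (𝓡 (2 * n + 1)) y).target := fun x hx => (hU x hx).2.1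
  have hloc : ∀ x ∈ U, extChartAt (𝓡 (2 * n + 1)) y ∘ (extChartAt (𝓡 (2 * n + 1)) y).symm ∘ σ
      =ᶠ[𝓝 x] σ := by
    intro x hx
    filter_upwards [hUo.mem_nhds hx] with x' hx'
    exact (extChartAt (𝓡 (2 * n + 1)) y).right_inv (htar x' hx')
  have hsm : ∀ x ∈ U, ContMDiffAt (𝓡 k) (𝓡 (2 * n + 1)) ∞
      ((extChartAt (𝓡 (2 * n + 1)) y).symm ∘ σ) x := fun x hx =>
    (contMDiffAt_chart_symm (htar x hx)).comp x (hU x hx).1.1.1.contMDiffAt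
  have himm : IsImmersedOn (n := n) U ((extChartAt (𝓡 (2 * n + 1)) y).symm ∘ σ) := by
    refine ⟨hUo, fun x hx => ⟨hsm x hx, ?_⟩⟩
    rw [injective_mfderiv_iff ((hsm x hx).mdifferentiableAt (by simp))
      (symm_mem_source (htar x hx)), (hloc x hx).fderiv_eq]
    exact (hU x hx).1.2.1
  refine ⟨U, (extChartAt (𝓡 (2 * n + 1)) y).symm ∘ σ, 0, hU0, ?_, ?_⟩
  · rw [isGeodesicIsotropic_iff himm (L := fun _ => L) (c := fun _ => y)
      (fun x hx => (hU x hx).2.2.1)]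
    intro x hx
    have h1 := (hU x hx).1.1.2.2.2.2.2.1
    rw [← (hU x hx).1.2.2.1] at h1
    have h2 : extChartAt (𝓡 (2 * n + 1)) y (((extChartAt (𝓡 (2 * n + 1)) y).symm ∘ σ) x) = σ x :=
      (hloc x hx).self_of_nhds
    refine ⟨⟨?_, ?_⟩, (hU x hx).1.2.2.2.congr (hloc x hx).symm⟩
    · rintro _ ⟨a, rfl⟩
      refine (((hU x hx).2.2.1.self_of_nhds).mem_plane_iff _).2 ?_
      have h3 := chartD_mfderiv ((hsm x hx).mdifferentiableAt (by simp))
        (symm_mem_source (htar x hx)) a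
      refine Eq.trans (congrArg (L.θ (extChartAt (𝓡 (2 * n + 1)) y
        (((extChartAt (𝓡 (2 * n + 1)) y).symm ∘ σ) x))) h3) ?_
      rw [(hloc x hx).fderiv_eq]
      have h4 := (h1 _ ⟨a, rfl⟩).1
      rw [← h2] at h4
      exact h4
    · rw [(hloc x hx).fderiv_eq, h2]
      exact h1
  · rw [isTangentTo_iff ((hsm 0 hU0).mdifferentiableAt (by simp))]
    refine ⟨?_, ?_⟩
    · rw [Function.comp_apply, hσ0, extChartAt_to_inv]
    · rw [(hloc 0 hU0).fderiv_eq, hdσ, hιW]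

/-- Two geodesic isotropic folds with the same tangent plane at a point are both reparametrizations
of the exponential map on this plane. -/
theorem sameGerm_of_isTangentTo (hn : 0 < n) (hD : D.IsLegendrian)
    {W : Submodule ℝ (TangentSpace (𝓡 (2 * n + 1)) y)} (hW : C.IsIsotropicPlane k y W)
    {U U' : Set (Euc k)} {σ σ' : Euc k → Y} {x x' : Euc k} (hx : x ∈ U) (hx' : x' ∈ U')
    (h : IsGeodesicIsotropic D U σ) (h' : IsGeodesicIsotropic D U' σ')
    (hT : IsTangentTo σ x y W) (hT' : IsTangentTo σ' x' y W) : SameGerm U σ x U' σ' x' := by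
  obtain ⟨L, hL⟩ := exists_represents hn hD y
  have hy := mem_chart_source (Euc (2 * n + 1)) y
  obtain ⟨ι, hι, hιW⟩ := exists_parametrization hW.1
  have hiso := ((hL.self_of_nhds.isotropic_iff k W).1 hW).2
  rw [← hιW] at hiso
  have hL' := LocalConnection.Represents.eventually_symm hy hL
  obtain ⟨τ, A, hτ0, hA0, hτA⟩ := L.exists_exp ι (hL'.mono fun e he => he.2.2) hiso
  have key : ∀ {U : Set (Euc k)} {σ : Euc k → Y} {x : Euc k}, x ∈ U → IsGeodesicIsotropic D U σ →
      IsTangentTo σ x y W → ∃ φ : OpenPartialHomeomorph (Euc k) (Euc k), 0 ∈ φ.source ∧ φ 0 = x ∧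
        φ.target ⊆ U ∩ σ ⁻¹' (chartAt (Euc (2 * n + 1)) y).source ∧
        (∀ x ∈ φ.source, ContDiffAt ℝ ∞ φ x) ∧ (∀ x ∈ φ.target, ContDiffAt ℝ ∞ φ.symm x) ∧
        ∀ z ∈ φ.source, extChartAt (𝓡 (2 * n + 1)) y (σ (φ z)) = τ z := by
    intro U σ x hx h hT
    rw [isTangentTo_iff ((h.1.2 x hx).1.mdifferentiableAt (by simp))] at hT
    obtain ⟨hxy, hT⟩ := hT
    have hc : ContinuousAt σ x := (h.1.2 x hx).1.continuousAt
    have hLx : ∀ᶠ z in 𝓝 (σ x), L.Represents D y z := hxy.symm ▸ hL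
    have hyx : σ x ∈ (chartAt (Euc (2 * n + 1)) y).source := hxy.symm ▸ hy
    have hN : U ∩ σ ⁻¹' (chartAt (Euc (2 * n + 1)) y).source ∈ 𝓝 x :=
      inter_mem (h.1.1.mem_nhds hx)
        (hc.preimage_mem_nhds ((chartAt (Euc (2 * n + 1)) y).open_source.mem_nhds hyx))
    have hinj := (injective_mfderiv_iff ((h.1.2 x hx).1.mdifferentiableAt (by simp)) hyx).1
      (h.1.2 x hx).2
    obtain ⟨f₀, hf₀⟩ := exists_equiv_comp_eq hinj hι (by rw [hT, hιW])
    refine L.exists_reparam_exp (s := extChartAt (𝓡 (2 * n + 1)) y ∘ σ) hN ?_ hinj f₀ hf₀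
      (by rw [hτ0, Function.comp_apply, hxy]) hA0
      (hτA.mono fun x hx => ⟨hx.1, hx.2.1, hx.2.2.2.1, hx.2.2.2.2.1⟩)
    filter_upwards [h.1.1.mem_nhds hx, hc.eventually hLx.eventually_nhds] with x₁ h1 h2
    refine ⟨contDiffAt_chart_comp (h.1.2 x₁ h1).1 h2.self_of_nhds.mem_source,
      h2.self_of_nhds.conformal.smooth_Γ, ?_⟩
    refine (isTotallyGeodesicAt_iff h2 ?_ (h.1.2 x₁ h1).2 ?_).2 (h.2 x₁ h1).2
    · filter_upwards [h.1.1.mem_nhds h1] with x₂ h3 using (h.1.2 x₂ h3).1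
    · filter_upwards [h.1.1.mem_nhds h1] with x₂ h3 using (h.2 x₂ h3).1.2.1
  obtain ⟨φ, hφ0, hφx, hφU, hφ, hφ', hφσ⟩ := key hx h hT
  obtain ⟨φ', hφ0', hφx', hφU', hψ, hψ', hφσ'⟩ := key hx' h' hT'
  have hx0 : φ.symm x = 0 := by rw [← hφx, φ.left_inv hφ0]
  refine ⟨φ.symm.trans φ', ?_, ?_, ?_, ?_, ?_, ?_, ?_⟩
  · rw [OpenPartialHomeomorph.trans_source]
    refine ⟨?_, ?_⟩
    · rw [← hφx]
      exact φ.map_source hφ0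
    · rw [Set.mem_preimage, hx0]
      exact hφ0'
  · rw [OpenPartialHomeomorph.coe_trans, Function.comp_apply, hx0, hφx']
  · rw [OpenPartialHomeomorph.trans_source]
    exact fun z hz => (hφU hz.1).1
  · rw [OpenPartialHomeomorph.trans_target]
    exact fun z hz => (hφU' hz.1).1
  · intro z hz
    rw [OpenPartialHomeomorph.trans_source] at hz
    exact ((hψ _ hz.2).comp z (hφ' z hz.1)).contDiffWithinAt
  · intro z hz
    rw [OpenPartialHomeomorph.trans_target] at hz
    exact ((hφ _ hz.2).comp z (hψ' z hz.1)).contDiffWithinAt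
  · intro z hz
    rw [OpenPartialHomeomorph.trans_source] at hz
    have h1 := hφσ' _ hz.2
    have h2 := hφσ _ (φ.map_target hz.1)
    have hr : φ (φ.symm z) = z := φ.right_inv hz.1
    rw [hr] at h2
    have h3 : σ z ∈ (extChartAt (𝓡 (2 * n + 1)) y).source := by
      rw [extChartAt_source]
      exact (hφU hz.1).2
    have h4 : σ' (φ' (φ.symm z)) ∈ (extChartAt (𝓡 (2 * n + 1)) y).source := by
      rw [extChartAt_source]
      exact (hφU' (φ'.map_source hz.2)).2
    exact (extChartAt (𝓡 (2 * n + 1)) y).injOn h4 h3 (h1.trans h2.symm)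

end Existence

/-! ### The flag subalgebra and the Frobenius condition -/

section Algebra

variable {n : ℕ}

lemma spAlg_apply {M : Matrix (Idx n) (Idx n) ℝ} (hM : M ∈ spAlg n) (i j : Fin (n + 1)) :
    M (.inr i) (.inl j) = M (.inr j) (.inl i) ∧ M (.inr i) (.inr j) = -M (.inl j) (.inl i) := by
  rw [spAlg, mem_skewAdjointMatricesSubmodule, Matrix.IsSkewAdjoint, Matrix.IsAdjointPair] at hM
  obtain ⟨a, b, c, d, rfl⟩ : ∃ a b c d, M = Matrix.fromBlocks a b c d :=
    ⟨_, _, _, _, (Matrix.fromBlocks_toBlocks M).symm⟩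
  rw [Matrix.J, Matrix.fromBlocks_transpose, Matrix.fromBlocks_neg, Matrix.fromBlocks_multiply,
    Matrix.fromBlocks_multiply, Matrix.fromBlocks_inj] at hM
  obtain ⟨h1, h2, h3, h4⟩ := hM
  simp only [Matrix.mul_zero, Matrix.mul_one, Matrix.mul_neg, Matrix.zero_mul, Matrix.neg_mul,
    Matrix.one_mul, zero_add, add_zero, neg_neg, neg_zero] at h1 h2 h3 h4
  have h5 := congrFun (congrFun h1 i) j
  have h6 := congrFun (congrFun h2 i) j
  simp only [Matrix.transpose_apply, Matrix.neg_apply] at h5 h6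
  simp only [Matrix.fromBlocks_apply₂₁, Matrix.fromBlocks_apply₂₂, Matrix.fromBlocks_apply₁₁]
  exact ⟨h5.symm, h6.symm⟩

/-- The matrices that preserve the span of the first `k + 1` and of the first `n + 1` standard basis
vectors. -/
def flagAlg (n k : ℕ) : Submodule ℝ (Matrix (Idx n) (Idx n) ℝ) where
  carrier := {M | (∀ i j, M (.inr i) (.inl j) = 0) ∧
    ∀ i j : Fin (n + 1), k < i → j ≤ k → M (.inl i) (.inl j) = 0}
  zero_mem' := ⟨fun _ _ => rfl, fun _ _ _ _ => rfl⟩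
  add_mem' := by
    rintro a b ⟨h1, h2⟩ ⟨h3, h4⟩
    exact ⟨fun i j => by simp [h1, h3], fun i j hi hj => by simp [h2 i j hi hj, h4 i j hi hj]⟩
  smul_mem' := by
    rintro c a ⟨h1, h2⟩
    exact ⟨fun i j => by simp [h1], fun i j hi hj => by simp [h2 i j hi hj]⟩

lemma mul_mem_flagAlg {k : ℕ} {M M' : Matrix (Idx n) (Idx n) ℝ} (h : M ∈ flagAlg n k)
    (h' : M' ∈ flagAlg n k) : M * M' ∈ flagAlg n k := by
  refine ⟨fun i j => ?_, fun i j hi hj => ?_⟩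
  · rw [Matrix.mul_apply, Fintype.sum_sum_type]
    simp [h.1, h'.1]
  · rw [Matrix.mul_apply, Fintype.sum_sum_type]
    simp only [h'.1, mul_zero, Finset.sum_const_zero, add_zero]
    refine Finset.sum_eq_zero fun l _ => ?_
    rcases le_or_gt (l : ℕ) k with hl | hl
    · rw [h.2 i l hi hl, zero_mul]
    · rw [h'.2 l j hl hj, mul_zero]

/-- The linear functional that expresses the `i`-th generator of `I_k` through `Φ`. -/
noncomputable def flagFunctional (n k : ℕ) :
    Unit ⊕ Fin n ⊕ (Fin n × Fin n) ⊕ {i : Fin n // k ≤ i} ⊕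
      ({i : Fin n // k ≤ i} × {j : Fin n // j < k}) → Matrix (Idx n) (Idx n) ℝ →ₗ[ℝ] ℝ :=
  Sum.elim (fun _ => (2⁻¹ : ℝ) • Matrix.entryLinearMap ℝ ℝ (.inr 0) (.inl 0)) <|
    Sum.elim (fun i => Matrix.entryLinearMap ℝ ℝ (.inr i.succ) (.inl 0)) <|
    Sum.elim (fun p => Matrix.entryLinearMap ℝ ℝ (.inr p.1.succ) (.inl p.2.succ)) <|
    Sum.elim (fun i => Matrix.entryLinearMap ℝ ℝ (.inl i.1.succ) (.inl 0)) <|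
    fun p => Matrix.entryLinearMap ℝ ℝ (.inl p.1.1.succ) (.inl p.2.1.succ)

lemma flagFunctional_eq_zero {k : ℕ} {M : Matrix (Idx n) (Idx n) ℝ} (h : M ∈ flagAlg n k) (i) :
    flagFunctional n k i M = 0 := by
  obtain ⟨h1, h2⟩ := h
  rcases i with i | i | ⟨i, j⟩ | ⟨i, hi⟩ | ⟨⟨i, hi⟩, ⟨j, hj⟩⟩
  · simp [flagFunctional, h1]
  · exact h1 _ _
  · exact h1 _ _
  · exact h2 _ _ (Nat.lt_succ_of_le hi) (Nat.zero_le _)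
  · exact h2 _ _ (Nat.lt_succ_of_le hi) (Nat.succ_le_of_lt hj)

lemma flagFunctional_eq_zero_iff {k : ℕ} {M : Matrix (Idx n) (Idx n) ℝ} (hM : M ∈ spAlg n) :
    (∀ i, flagFunctional n k i M = 0) ↔ M ∈ flagAlg n k := by
  constructor
  · intro h
    have h0 : M (.inr 0) (.inl 0) = 0 := by
      have := h (.inl ())
      simpa [flagFunctional] using this
    have h1 : ∀ i : Fin n, M (.inr i.succ) (.inl 0) = 0 := fun i => h (.inr (.inl i))
    refine ⟨fun i j => ?_, fun i j hi hj => ?_⟩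
    · refine Fin.cases ?_ (fun i => ?_) i <;> refine Fin.cases ?_ (fun j => ?_) j
      · exact h0
      · rw [(spAlg_apply hM _ _).1, h1]
      · exact h1 i
      · exact h (.inr (.inr (.inl (i, j))))
    · obtain ⟨i, rfl⟩ : ∃ i' : Fin n, i = i'.succ := by
        refine ⟨i.pred ?_, (Fin.succ_pred i _).symm⟩
        rintro rfl
        simp at hi
      rw [Fin.val_succ] at hi
      revert hj
      refine Fin.cases ?_ (fun j => ?_) j
      · intro _
        exact h (.inr (.inr (.inr (.inl ⟨i, by omega⟩))))
      · intro hj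
        rw [Fin.val_succ] at hj
        exact h (.inr (.inr (.inr (.inr (⟨i, by omega⟩, ⟨j, by omega⟩)))))
  · exact fun h i => flagFunctional_eq_zero h i

end Algebra

section Bundle

variable {n : ℕ} {Y : Type*} [TopologicalSpace Y] [ChartedSpace (Euc (2 * n + 1)) Y]
  [IsManifold (𝓡 (2 * n + 1)) ∞ Y] {C : ContactStructure n Y} {B : Type*} [TopologicalSpace B]
  [ChartedSpace (Euc (dimSp n)) B] [IsManifold (𝓡 (dimSp n)) ∞ B]

namespace SymplecticConnection

variable (N : SymplecticConnection C B)

/-- The 1-form `ℓ ∘ Φ` for a linear functional `ℓ`. -/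
noncomputable def component (ℓ : Matrix (Idx n) (Idx n) ℝ →ₗ[ℝ] ℝ) : OneForm (dimSp n) B :=
  fun u => ℓ.comp ((spAlg n).subtype.comp (N.form u).toLinearMap)

omit [IsManifold (𝓡 (2 * n + 1)) ∞ Y] in
lemma flagSystem_eq_component (k : ℕ) (i) : N.flagSystem k i = N.component (flagFunctional n k i) := by
  rcases i with i | i | ⟨i, j⟩ | ⟨i, hi⟩ | ⟨⟨i, hi⟩, ⟨j, hj⟩⟩ <;> rfl

omit [IsManifold (𝓡 (2 * n + 1)) ∞ Y] in
lemma flagSystem_eq_zero_iff (k : ℕ) (u : B) (v : TangentSpace (𝓡 (dimSp n)) u) :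
    (∀ i, N.flagSystem k i u v = 0) ↔
      (N.form u v : Matrix (Idx n) (Idx n) ℝ) ∈ flagAlg n k := by
  simp only [flagSystem_eq_component]
  exact flagFunctional_eq_zero_iff (N.form u v).2

lemma linearFunctional_apply (ℓ : Matrix (Idx n) (Idx n) ℝ →ₗ[ℝ] ℝ) (M : Matrix (Idx n) (Idx n) ℝ) :
    ℓ M = ∑ i, ∑ j, ℓ (Matrix.single i j 1) * M i j := by
  conv_lhs => rw [Matrix.matrix_eq_sum_single M]
  simp only [map_sum]
  refine Finset.sum_congr rfl fun i _ => Finset.sum_congr rfl fun j _ => ?_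
  have : Matrix.single i j (M i j) = M i j • Matrix.single i j (1 : ℝ) := by simp
  rw [this, map_smul, smul_eq_mul, mul_comm]

omit [IsManifold (𝓡 (2 * n + 1)) ∞ Y] in
lemma component_inChart (ℓ : Matrix (Idx n) (Idx n) ℝ →ₗ[ℝ] ℝ) (b : B) :
    (N.component ℓ).inChart b = fun e => ∑ i, ∑ j, ℓ (Matrix.single i j 1) •
      (N.entry i j).inChart b e := by
  ext e v
  rw [OneForm.inChart_apply]
  change ℓ _ = _
  rw [linearFunctional_apply]
  simp only [_root_.sum_apply, smul_apply, OneForm.inChart_apply, smul_eq_mul]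
  rfl

omit [IsManifold (𝓡 (2 * n + 1)) ∞ Y] in
lemma contDiffAt_entry {b : B} {e : Euc (dimSp n)}
    (he : e ∈ (extChartAt (𝓡 (dimSp n)) b).target) (i j : Idx n) :
    ContDiffAt ℝ ∞ ((N.entry i j).inChart b) e :=
  (OneForm.inChart_of_isSmoothAt he (N.form_smooth i j _)).1

omit [IsManifold (𝓡 (2 * n + 1)) ∞ Y] in
lemma isSmoothAt_component (ℓ : Matrix (Idx n) (Idx n) ℝ →ₗ[ℝ] ℝ) (u : B) :
    (N.component ℓ).IsSmoothAt u := by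
  rw [OneForm.IsSmoothAt, component_inChart]
  exact ContDiffAt.sum fun i _ => ContDiffAt.sum fun j _ =>
    ContDiffAt.const_smul (ℓ (Matrix.single i j 1))
      (N.contDiffAt_entry (mem_extChartAt_target u) i j)

omit [IsManifold (𝓡 (2 * n + 1)) ∞ Y] in
lemma extD_component (ℓ : Matrix (Idx n) (Idx n) ℝ →ₗ[ℝ] ℝ) (u : B)
    (v w : TangentSpace (𝓡 (dimSp n)) u) : (N.component ℓ).extD u v w =
      ℓ (Matrix.of fun i j => (N.entry i j).extD u v w) := by
  have h1 : HasFDerivAt (fun e => ∑ i, ∑ j, ℓ (Matrix.single i j 1) • (N.entry i j).inChart u e)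
      (∑ i, ∑ j, ℓ (Matrix.single i j 1) •
        fderiv ℝ ((N.entry i j).inChart u) (extChartAt (𝓡 (dimSp n)) u u))
      (extChartAt (𝓡 (dimSp n)) u u) :=
    HasFDerivAt.fun_sum fun i _ => HasFDerivAt.fun_sum fun j _ =>
      ((N.contDiffAt_entry (mem_extChartAt_target u) i j).differentiableAt
        (by simp)).hasFDerivAt.fun_const_smul _
  have h2 : ∀ v w : Euc (dimSp n), (∑ i, ∑ j, ℓ (Matrix.single i j 1) •
        fderiv ℝ ((N.entry i j).inChart u) (extChartAt (𝓡 (dimSp n)) u u)) v w -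
      (∑ i, ∑ j, ℓ (Matrix.single i j 1) •
        fderiv ℝ ((N.entry i j).inChart u) (extChartAt (𝓡 (dimSp n)) u u)) w v =
      ∑ i, ∑ j, ℓ (Matrix.single i j 1) *
        dForm ((N.entry i j).inChart u) (extChartAt (𝓡 (dimSp n)) u u) v w := fun v w => by
    simp only [_root_.sum_apply, smul_apply, smul_eq_mul, ← Finset.sum_sub_distrib, ← mul_sub,
      dForm]
  rw [OneForm.extD_apply, component_inChart, linearFunctional_apply]
  simp only [dForm, h1.fderiv]
  exact h2 v w

omit [IsManifold (𝓡 (2 * n + 1)) ∞ Y] in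
lemma extD_entries (u : B) (v w : TangentSpace (𝓡 (dimSp n)) u) :
    (Matrix.of fun i j => (N.entry i j).extD u v w) = N.curv u v w -
      ((N.form u v : Matrix (Idx n) (Idx n) ℝ) * (N.form u w : Matrix (Idx n) (Idx n) ℝ)
      - (N.form u w : Matrix (Idx n) (Idx n) ℝ) * (N.form u v : Matrix (Idx n) (Idx n) ℝ)) := by
  rw [curv, add_sub_cancel_right]

omit [IsManifold (𝓡 (2 * n + 1)) ∞ Y] in
/-- The system `I_k` is Frobenius: the flag subalgebra is closed under brackets, and the curvature
has no components in the system modulo `θ₀`. -/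
theorem isFrobeniusAt_flagSystem {N : SymplecticConnection C B} (hN : N.IsNormal) (k : ℕ) (b : B) :
    IsFrobeniusAt (N.flagSystem k) b := by
  intro v w hv hw i
  have hv' := (N.flagSystem_eq_zero_iff k b v).1 hv
  have hw' := (N.flagSystem_eq_zero_iff k b w).1 hw
  have hbr := Submodule.sub_mem _ (mul_mem_flagAlg hv' hw') (mul_mem_flagAlg hw' hv')
  have htor := fun i => hN.torsion b v w i
  have hmod := hN.mod_theta0 b v w (hv (.inl ())) (hw (.inl ()))
  rw [flagSystem_eq_component, extD_component, extD_entries, map_sub]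
  have h2 : flagFunctional n k i (N.curv b v w) = 0 := by
    rcases i with i | i | ⟨i, j⟩ | ⟨i, hi⟩ | ⟨⟨i, hi⟩, ⟨j, hj⟩⟩
    · change (2⁻¹ : ℝ) • N.curv b v w _ _ = 0
      rw [htor, smul_zero]
    · exact htor _
    · exact hmod (.inr i) (.inl j)
    · exact htor _
    · exact hmod (.inl i) (.inl j)
  rw [h2, flagFunctional_eq_zero hbr, sub_zero]

end SymplecticConnection

end Bundle

/-! ### Integral manifolds of the flag system -/

lemma dForm_clm_comp {E F G : Type*} [NormedAddCommGroup E] [NormedSpace ℝ E]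
    [NormedAddCommGroup F] [NormedSpace ℝ F] [NormedAddCommGroup G] [NormedSpace ℝ G]
    {Φ : E → E →L[ℝ] F} {e : E} (ℓ : F →L[ℝ] G) (h : DifferentiableAt ℝ Φ e) (v w : E) :
    dForm (fun e => ℓ.comp (Φ e)) e v w = ℓ (dForm Φ e v w) := by
  have h1 : HasFDerivAt (fun e => ℓ.comp (Φ e))
      ((ContinuousLinearMap.compL ℝ E F G ℓ).comp (fderiv ℝ Φ e)) e :=
    (ContinuousLinearMap.compL ℝ E F G ℓ).hasFDerivAt.comp e h.hasFDerivAt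
  rw [dForm, dForm, h1.fderiv, map_sub]
  rfl

section Bundle

variable {n : ℕ} {Y : Type*} [TopologicalSpace Y] [ChartedSpace (Euc (2 * n + 1)) Y]
  [IsManifold (𝓡 (2 * n + 1)) ∞ Y] {C : ContactStructure n Y} {B : Type*} [TopologicalSpace B]
  [ChartedSpace (Euc (dimSp n)) B] [IsManifold (𝓡 (dimSp n)) ∞ B]

namespace SymplecticConnection

variable (N : SymplecticConnection C B)

/-- The Cartan connection form in the preferred chart at `b`, with values transported to the tangent
space at `b` by the isomorphism `form b`. -/
noncomputable def formChart (b : B) (e : Euc (dimSp n)) :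
    Euc (dimSp n) →L[ℝ] Euc (dimSp n) :=
  LinearMap.toContinuousLinearMap (((N.form b).symm.toLinearMap.comp
    (N.form ((extChartAt (𝓡 (dimSp n)) b).symm e)).toLinearMap).comp
      (chartDSymm b e).toLinearMap)

omit [IsManifold (𝓡 (2 * n + 1)) ∞ Y] in
lemma form_formChart (b : B) (e v : Euc (dimSp n)) :
    N.form b (N.formChart b e v) =
      N.form ((extChartAt (𝓡 (dimSp n)) b).symm e) (chartDSymm b e v) :=
  (N.form b).apply_symm_apply _

omit [IsManifold (𝓡 (2 * n + 1)) ∞ Y] in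
lemma contDiffAt_formChart {b : B} {e : Euc (dimSp n)}
    (he : e ∈ (extChartAt (𝓡 (dimSp n)) b).target) : ContDiffAt ℝ ∞ (N.formChart b) e := by
  -- the inverse of `form b`, extended linearly to all matrices
  obtain ⟨Λ, hΛ⟩ : ∃ Λ : Matrix (Idx n) (Idx n) ℝ →ₗ[ℝ] Euc (dimSp n),
      ∀ M : spAlg n, Λ M = (N.form b).symm M := by
    obtain ⟨Λ, hΛ⟩ := LinearMap.exists_extend (p := spAlg n) (N.form b).symm.toLinearMap
    exact ⟨Λ, fun M => LinearMap.congr_fun hΛ M⟩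
  have h : N.formChart b = fun e => ∑ i, ∑ j,
      ((N.entry i j).inChart b e).smulRight (Λ (Matrix.single i j 1)) := by
    funext e
    ext1 v
    have h1 : N.formChart b e v =
        Λ (N.form ((extChartAt (𝓡 (dimSp n)) b).symm e) (chartDSymm b e v)).1 :=
      (hΛ _).symm
    rw [h1, Matrix.matrix_eq_sum_single (N.form _ _).1]
    simp only [map_sum, _root_.sum_apply, ContinuousLinearMap.smulRight_apply]
    refine Finset.sum_congr rfl fun i _ => Finset.sum_congr rfl fun j _ => ?_
    rw [← map_smul, Matrix.smul_single, smul_eq_mul, mul_one]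
    rfl
  rw [h]
  exact ContDiffAt.sum fun i _ => ContDiffAt.sum fun j _ =>
    (N.contDiffAt_entry he i j).smulRight contDiffAt_const

omit [IsManifold (𝓡 (2 * n + 1)) ∞ Y] in
lemma isInvertible_formChart {b : B} {e : Euc (dimSp n)}
    (he : e ∈ (extChartAt (𝓡 (dimSp n)) b).target) : (N.formChart b e).IsInvertible := by
  have hinj : Function.Injective (N.formChart b e).toLinearMap := by
    intro v w hvw
    have h1 : N.form b (N.formChart b e v) = N.form b (N.formChart b e w) := congrArg _ hvw
    rw [form_formChart, form_formChart] at h1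
    have h2 := congrArg (chartD b _) ((N.form _).injective h1)
    rwa [chartD_chartDSymm he, chartD_chartDSymm he] at h2
  exact ⟨(LinearEquiv.ofInjectiveEndo _ hinj).toContinuousLinearEquiv, by ext1 v; rfl⟩

lemma mfderiv_chart_symm_comp {d k : ℕ} {M : Type*} [TopologicalSpace M] [ChartedSpace (Euc d) M]
    [IsManifold (𝓡 d) ∞ M] {b : M} {u : Euc k → Euc d} {x : Euc k} (hu : DifferentiableAt ℝ u x)
    (hx : u x ∈ (extChartAt (𝓡 d) b).target) (v : Euc k) :
    mfderiv (𝓡 k) (𝓡 d) ((extChartAt (𝓡 d) b).symm ∘ u) x v =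
      chartDSymm b (u x) (fderiv ℝ u x v) := by
  rw [mfderiv_comp (I' := 𝓘(ℝ, Euc d)) x ((contMDiffAt_chart_symm hx).mdifferentiableAt (by simp))
    hu.mdifferentiableAt, mfderiv_eq_fderiv]
  rfl

omit [IsManifold (𝓡 (2 * n + 1)) ∞ Y] in
/-- Through every point of `B` there is an integral manifold of `I_k`, projecting to a `k`-fold that
is tangent to the first `k` vectors of the frame. -/
theorem exists_integral_flagSystem {N : SymplecticConnection C B} (hN : N.IsNormal) {k : ℕ}
    (hk : k ≤ n) (b : B) : ∃ τ : Euc k → B, τ 0 = b ∧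
      (∀ᶠ x in 𝓝 0, ContMDiffAt (𝓡 k) (𝓡 (dimSp n)) ∞ τ x ∧
        ∀ i (v : TangentSpace (𝓡 k) x),
          N.flagSystem k i (τ x) (mfderiv (𝓡 k) (𝓡 (dimSp n)) τ x v) = 0) ∧
      ∀ v : Euc k, N.form (τ 0) (mfderiv (𝓡 k) (𝓡 (dimSp n)) τ 0 v) =
        ∑ i, v i • basisElt n (.inl (Fin.castLE hk i)) := by
  set ψ := extChartAt (𝓡 (dimSp n)) b with hψ
  let Ξ : Euc k →L[ℝ] Euc (dimSp n) := ∑ i, (EuclideanSpace.proj i).smulRight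
    ((N.form b).symm (basisElt n (.inl (Fin.castLE hk i))))
  have hΞ : ∀ v : Euc k, N.form b (Ξ v) = ∑ i, v i • basisElt n (.inl (Fin.castLE hk i)) := by
    intro v
    have h1 : Ξ v = ∑ i, v i • (N.form b).symm (basisElt n (.inl (Fin.castLE hk i))) := by
      simp only [Ξ, _root_.sum_apply]
      rfl
    refine (congrArg (N.form b) h1).trans ?_
    refine (map_sum (N.form b) _ _).trans (Finset.sum_congr rfl fun i _ => ?_)
    exact (map_smul (N.form b) _ _).trans (by rw [LinearEquiv.apply_symm_apply])
  have htgt : ∀ᶠ e in 𝓝 (ψ b), e ∈ ψ.target := extChartAt_target_mem_nhds b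
  obtain ⟨u, hu0, hu⟩ := exists_radial_flow
    (fun e => (N.formChart b e).inverse.comp Ξ) (ψ b) (by
      filter_upwards [htgt] with e he
      obtain ⟨A, hA⟩ := N.isInvertible_formChart he
      have := (contDiffAt_map_inverse (𝕜 := ℝ) (n := ∞) A)
      rw [hA] at this
      exact (this.comp e (N.contDiffAt_formChart he)).clm_comp contDiffAt_const)
  have hcont : ContinuousAt u 0 := hu.self_of_nhds.1.continuousAt
  have htgt' : ∀ᶠ x in 𝓝 0, u x ∈ ψ.target := hcont.eventually (by rwa [hu0])
  let q : Submodule ℝ (Euc (dimSp n)) :=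
    (flagAlg n k).comap ((spAlg n).subtype.comp (N.form b).toLinearMap)
  have hq : ∀ e v, N.formChart b e v ∈ q ↔
      ∀ i, N.flagSystem k i (ψ.symm e) (chartDSymm b e v) = 0 := by
    intro e v
    rw [flagSystem_eq_zero_iff, ← form_formChart]
    rfl
  have hmem := radial_coframe_mem (Φ := N.formChart b) (u := u) (Ξ := Ξ) (q := q) (by
    filter_upwards [hu, htgt'] with x hx hx'
    have hinv := N.isInvertible_formChart hx'
    refine ⟨hx.1, N.contDiffAt_formChart hx', hinv, ?_, ?_⟩
    · rw [hx.2]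
      exact hinv.self_apply_inverse _
    · intro v w hv hw
      rw [hq] at hv hw
      refine (flagFunctional_eq_zero_iff (N.form b _).2).1 fun i => ?_
      let ℓ : Euc (dimSp n) →L[ℝ] ℝ := LinearMap.toContinuousLinearMap
        ((flagFunctional n k i).comp ((spAlg n).subtype.comp (N.form b).toLinearMap))
      change ℓ _ = 0
      have h1 : (fun e => ℓ.comp (N.formChart b e)) = (N.flagSystem k i).inChart b := by
        funext e
        ext1 v
        rw [OneForm.inChart_apply, flagSystem_eq_component]
        exact congrArg (fun M : spAlg n => flagFunctional n k i M.1) (N.form_formChart b e v)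
      have hs : (N.flagSystem k i).IsSmoothAt (ψ.symm (u x)) := by
        rw [flagSystem_eq_component]
        exact N.isSmoothAt_component _ _
      rw [← dForm_clm_comp ℓ ((N.contDiffAt_formChart hx').differentiableAt (by simp)), h1,
        (OneForm.inChart_of_isSmoothAt hx' hs).2]
      exact isFrobeniusAt_flagSystem hN k _ _ _ hv hw i) (by
    intro x
    change ((N.form b (Ξ x) : spAlg n) : Matrix (Idx n) (Idx n) ℝ) ∈ flagAlg n k
    rw [hΞ, Submodule.coe_sum]
    refine Submodule.sum_mem _ fun i _ => Submodule.smul_mem _ _ ⟨fun i' j' => rfl, ?_⟩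
    intro i' j' hi' hj'
    simp only [basisElt, Matrix.fromBlocks_apply₁₁, Matrix.single_apply]
    rw [if_neg]
    rintro ⟨rfl, -⟩
    simp only [Fin.val_succ, Fin.val_castLE] at hi'
    omega)
  have hform : ∀ᶠ x in 𝓝 0, ∀ v : Euc k,
      mfderiv (𝓡 k) (𝓡 (dimSp n)) (ψ.symm ∘ u) x v = chartDSymm b (u x) (fderiv ℝ u x v) := by
    filter_upwards [hu, htgt'] with x hx hx' v
    exact mfderiv_chart_symm_comp (hx.1.differentiableAt (by simp)) hx' v
  refine ⟨ψ.symm ∘ u, ?_, ?_, ?_⟩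
  · rw [Function.comp_apply, hu0, hψ, extChartAt_to_inv]
  · filter_upwards [hu, htgt', hmem, hform] with x hx hx' hm hf
    refine ⟨(contMDiffAt_chart_symm hx').comp x hx.1.contMDiffAt, fun i v => ?_⟩
    exact (congrArg _ (hf v)).trans ((hq _ _).1 (hm v) i)
  · intro v
    refine (congrArg (N.form _) (hform.self_of_nhds v)).trans ?_
    refine (N.form_formChart b (u 0) _).symm.trans ?_
    rw [← hΞ]
    refine congrArg (N.form b) ?_
    have hinv := N.isInvertible_formChart htgt'.self_of_nhds
    have h0 : fderiv ℝ u 0 = (N.formChart b (u 0)).inverse.comp Ξ := by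
      refine radial_eq_at_zero (H := fderiv ℝ u)
        (L := fun x => (N.formChart b (u x)).inverse.comp Ξ) ?_ ?_ (hu.mono fun x hx => hx.2)
      · exact (hu.self_of_nhds.1.fderiv_right (m := 0) (by simp)).continuousAt
      · obtain ⟨A, hA⟩ := hinv
        have := (contDiffAt_map_inverse (𝕜 := ℝ) (n := ∞) A)
        rw [hA] at this
        exact (((this.comp (u 0) (N.contDiffAt_formChart htgt'.self_of_nhds)).clm_comp
          contDiffAt_const).continuousAt (f := fun e => (N.formChart b e).inverse.comp Ξ)).comp
          hcont
    rw [h0]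
    exact hinv.self_apply_inverse _

end SymplecticConnection

end Bundle

/-! ### The parabolic subgroup and its one-parameter subgroups -/

section Group

variable {n : ℕ}

lemma mem_spAlg_iff {M : Matrix (Idx n) (Idx n) ℝ} :
    M ∈ spAlg n ↔ Mᵀ * Matrix.J (Fin (n + 1)) ℝ = Matrix.J (Fin (n + 1)) ℝ * -M := by
  rw [spAlg, mem_skewAdjointMatricesSubmodule, Matrix.IsSkewAdjoint, Matrix.IsAdjointPair]

section Exp

open scoped Matrix.Norms.Operator

lemma exp_mem_symplecticGroup {M : Matrix (Idx n) (Idx n) ℝ} (hM : M ∈ spAlg n) :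
    NormedSpace.exp M ∈ Matrix.symplecticGroup (Fin (n + 1)) ℝ := by
  have hdet := Matrix.isUnit_det_J (Fin (n + 1)) ℝ
  have hJ : IsUnit (Matrix.J (Fin (n + 1)) ℝ) := (Matrix.isUnit_iff_isUnit_det _).2 hdet
  rw [mem_spAlg_iff] at hM
  have hMt : Mᵀ = Matrix.J (Fin (n + 1)) ℝ * -M * (Matrix.J (Fin (n + 1)) ℝ)⁻¹ := by
    rw [← hM, Matrix.mul_nonsing_inv_cancel_right _ _ hdet]
  rw [SymplecticGroup.mem_iff', ← Matrix.exp_transpose, hMt, Matrix.exp_conj _ _ hJ,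
    Matrix.nonsing_inv_mul_cancel_right _ _ hdet, Matrix.exp_neg, Matrix.mul_assoc,
    Matrix.nonsing_inv_mul _ ((Matrix.isUnit_iff_isUnit_det _).1 (Matrix.isUnit_exp M)),
    Matrix.mul_one]

lemma exp_apply_inl_zero {M : Matrix (Idx n) (Idx n) ℝ} (hM : ∀ i ≠ .inl 0, M i (.inl 0) = 0)
    {i : Idx n} (hi : i ≠ .inl 0) : NormedSpace.exp M i (.inl 0) = 0 := by
  have hpow : ∀ (k : ℕ) (i : Idx n), i ≠ .inl 0 → (M ^ k) i (.inl 0) = 0 := by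
    intro k
    induction k with
    | zero => exact fun i hi => by rw [pow_zero, Matrix.one_apply_ne hi]
    | succ k ih =>
      intro i hi
      rw [pow_succ', Matrix.mul_apply]
      refine Finset.sum_eq_zero fun j _ => ?_
      by_cases hj : j = .inl 0
      · rw [hj, hM i hi, zero_mul]
      · rw [ih j hj, mul_zero]
  have h := (NormedSpace.exp_series_hasSum_exp' (𝕂 := ℝ) M).map
    (Matrix.entryLinearMap ℝ ℝ i (.inl 0)) (LinearMap.continuous_of_finiteDimensional _)
  refine h.unique ?_
  convert hasSum_zero with k
  change ((k.factorial : ℝ)⁻¹ : ℝ) • (M ^ k) i (.inl 0) = 0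
  rw [hpow k i hi, smul_zero]

/-- A one-parameter subgroup of the parabolic subgroup with prescribed generator. -/
lemma exists_curve_parabolic {M : Matrix (Idx n) (Idx n) ℝ} (hM : M ∈ spAlg n)
    (h0 : ∀ i ≠ .inl 0, M i (.inl 0) = 0) : ∃ g : ℝ → parabolic n, g 0 = 1 ∧
      (∀ i j, ContDiff ℝ ∞ (fun t => pmat (g t) i j)) ∧
      ∀ i j, HasDerivAt (fun t => pmat (g t) i j) (M i j) 0 := by
  let g : ℝ → parabolic n := fun t => ⟨⟨NormedSpace.exp (t • M),
    exp_mem_symplecticGroup (Submodule.smul_mem _ t hM)⟩,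
    NormedSpace.exp (t • M) (.inl 0) (.inl 0), by
      ext i
      rw [Matrix.mulVec_single_one, Matrix.col_apply, Pi.smul_apply, smul_eq_mul]
      by_cases hi : i = .inl 0
      · rw [hi, Pi.single_eq_same, mul_one]
      · rw [Pi.single_eq_of_ne hi, mul_zero]
        exact exp_apply_inl_zero (fun j hj => by
          rw [Matrix.smul_apply, h0 j hj, smul_zero]) hi⟩
  have hg : ∀ t, pmat (g t) = NormedSpace.exp (t • M) := fun t => rfl
  refine ⟨g, ?_, fun i j => ?_, fun i j => ?_⟩
  · refine Subtype.ext (Subtype.ext ?_)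
    change NormedSpace.exp ((0 : ℝ) • M) = 1
    rw [zero_smul, NormedSpace.exp_zero]
  · have h1 : ContDiff ℝ ∞ (fun t : ℝ => NormedSpace.exp (t • M)) :=
      contDiff_iff_contDiffAt.2 fun t =>
        ((NormedSpace.exp_analytic (𝕂 := ℝ) (t • M)).contDiffAt).comp t
          (contDiff_id.smul contDiff_const).contDiffAt
    exact (LinearMap.toContinuousLinearMap (Matrix.entryLinearMap ℝ ℝ i j)).contDiff.comp h1
  · have h1 := hasDerivAt_exp_smul_const (𝕂 := ℝ) M 0
    rw [zero_smul, NormedSpace.exp_zero, one_mul] at h1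
    exact (LinearMap.toContinuousLinearMap (Matrix.entryLinearMap ℝ ℝ i j)).hasFDerivAt.comp_hasDerivAt
      0 h1

end Exp

lemma pmat_transpose_mul_J (g : parabolic n) :
    (pmat g)ᵀ * Matrix.J (Fin (n + 1)) ℝ * pmat g = Matrix.J (Fin (n + 1)) ℝ :=
  SymplecticGroup.mem_iff'.1 (g : Matrix.symplecticGroup (Fin (n + 1)) ℝ).2

lemma pmat_mul_inv (g : parabolic n) : pmat g * pmat g⁻¹ = 1 := by
  change ((g * g⁻¹ : parabolic n) : Matrix.symplecticGroup (Fin (n + 1)) ℝ).1 = 1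
  rw [mul_inv_cancel]
  rfl

lemma pmat_inv_mul (g : parabolic n) : pmat g⁻¹ * pmat g = 1 := by
  change ((g⁻¹ * g : parabolic n) : Matrix.symplecticGroup (Fin (n + 1)) ℝ).1 = 1
  rw [inv_mul_cancel]
  rfl

lemma pmat_one : pmat (1 : parabolic n) = 1 := rfl

lemma pmat_apply_inl_zero (g : parabolic n) {i : Idx n} (hi : i ≠ .inl 0) :
    pmat g i (.inl 0) = 0 := by
  obtain ⟨c, hc⟩ := g.2
  have h := congrFun hc i
  rw [Matrix.mulVec_single_one, Matrix.col_apply, Pi.smul_apply, Pi.single_eq_of_ne hi,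
    smul_zero] at h
  exact h

lemma pmat_inl_zero_mul (g : parabolic n) (j : Idx n) :
    pmat g (.inl 0) (.inl 0) * pmat g (.inr 0) j = if j = .inr 0 then 1 else 0 := by
  have h := congrFun (congrFun (pmat_transpose_mul_J g) (.inl 0)) j
  rw [Matrix.mul_assoc, Matrix.mul_apply, Finset.sum_eq_single (Sum.inl 0), Matrix.transpose_apply,
    Matrix.mul_apply, Finset.sum_eq_single (Sum.inr 0)] at h
  · rcases j with j | j
    · simpa [Matrix.J] using h
    · rw [Matrix.J, Matrix.fromBlocks_apply₁₂, Matrix.fromBlocks_apply₁₂] at h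
      simp only [Matrix.neg_apply, Matrix.one_apply_eq, Matrix.one_apply] at h
      simp only [Sum.inr.injEq, eq_comm (a := j)]
      linarith
  · rintro (i | i) - hi
    · simp [Matrix.J]
    · have : (0 : Fin (n + 1)) ≠ i := fun h => hi (by rw [h])
      simp [Matrix.J, this]
  · simp
  · intro i _ hi
    rw [Matrix.transpose_apply, pmat_apply_inl_zero g hi, zero_mul]
  · simp

lemma pmat_inl_zero_ne_zero (g : parabolic n) : pmat g (.inl 0) (.inl 0) ≠ 0 := by
  intro h
  have := pmat_inl_zero_mul g (.inr 0)
  rw [h, zero_mul, if_pos rfl] at this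
  exact zero_ne_one this

lemma pmat_inr_zero (g : parabolic n) {j : Idx n} (hj : j ≠ .inr 0) : pmat g (.inr 0) j = 0 := by
  have := pmat_inl_zero_mul g j
  rw [if_neg hj] at this
  exact (mul_eq_zero.1 this).resolve_left (pmat_inl_zero_ne_zero g)

lemma conj_mem_spAlg (g : parabolic n) {M : Matrix (Idx n) (Idx n) ℝ} (hM : M ∈ spAlg n) :
    pmat g * M * pmat g⁻¹ ∈ spAlg n := by
  set J := Matrix.J (Fin (n + 1)) ℝ with hJ
  rw [mem_spAlg_iff, ← hJ] at hM ⊢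
  have h1 : (pmat g)ᵀ * J = J * pmat g⁻¹ := by
    rw [← Matrix.mul_one ((pmat g)ᵀ * J), ← pmat_mul_inv g, ← Matrix.mul_assoc,
      pmat_transpose_mul_J]
  have h2 : (pmat g⁻¹)ᵀ * J = J * pmat g := by
    conv_lhs => rw [hJ, ← pmat_transpose_mul_J g]
    rw [← Matrix.mul_assoc, ← Matrix.mul_assoc, ← Matrix.transpose_mul, pmat_mul_inv,
      Matrix.transpose_one, Matrix.one_mul]
  rw [Matrix.transpose_mul, Matrix.transpose_mul, Matrix.mul_assoc, Matrix.mul_assoc, h1,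
    ← Matrix.mul_assoc Mᵀ, hM, ← Matrix.mul_assoc, ← Matrix.mul_assoc, h2]
  simp only [Matrix.mul_assoc, Matrix.mul_neg, Matrix.neg_mul]

lemma basisElt_apply_inl_zero (a : Fin n ⊕ Fin n) (i : Idx n) :
    (basisElt n a : Matrix (Idx n) (Idx n) ℝ) i (.inl 0) = if i = subIdx a then 1 else 0 := by
  rcases a with a | a <;> rcases i with i | i <;>
    simp [basisElt, subIdx, Matrix.single_apply, eq_comm]

lemma eq_or_eq_or_exists_subIdx (i : Idx n) : i = .inl 0 ∨ i = .inr 0 ∨ ∃ a, i = subIdx a := by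
  rcases i with i | i
  · refine Fin.cases (.inl rfl) (fun i => ?_) i
    exact .inr (.inr ⟨.inl i, rfl⟩)
  · refine Fin.cases (.inr (.inl rfl)) (fun i => ?_) i
    exact .inr (.inr ⟨.inr i, rfl⟩)

lemma subIdx_injective : Function.Injective (subIdx : Fin n ⊕ Fin n → Idx n) :=
  Sum.map_injective.2 ⟨Fin.succ_injective _, Fin.succ_injective _⟩

lemma subIdx_ne_inl_zero (a : Fin n ⊕ Fin n) : (subIdx a : Idx n) ≠ .inl 0 := by
  rcases a with a | a <;> simp [subIdx]

lemma subIdx_ne_inr_zero (a : Fin n ⊕ Fin n) : (subIdx a : Idx n) ≠ .inr 0 := by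
  rcases a with a | a <;> simp [subIdx]

lemma sum_idx {A : Type*} [AddCommMonoid A] (f : Idx n → A) :
    ∑ i, f i = f (.inl 0) + f (.inr 0) + ∑ a : Fin n ⊕ Fin n, f (subIdx a) := by
  rw [Fintype.sum_sum_type, Fintype.sum_sum_type, Fin.sum_univ_succ, Fin.sum_univ_succ]
  exact add_add_add_comm _ _ _ _

end Group

/-! ### Frames of the contact hyperplanes -/

section Bundle

variable {n : ℕ} {Y : Type*} [TopologicalSpace Y] [ChartedSpace (Euc (2 * n + 1)) Y]
  [IsManifold (𝓡 (2 * n + 1)) ∞ Y] {C : ContactStructure n Y} {B : Type*} [TopologicalSpace B]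
  [ChartedSpace (Euc (dimSp n)) B] [IsManifold (𝓡 (dimSp n)) ∞ B]

namespace SymplecticConnection

variable (N : SymplecticConnection C B)

omit [IsManifold (𝓡 (2 * n + 1)) ∞ Y] in
/-- A vertical vector is the velocity of an orbit of a one-parameter subgroup, which differentiates
functions accordingly. -/
lemma exists_curve_of_vertical {u : B} {Z : TangentSpace (𝓡 (dimSp n)) u}
    (hZ : ∀ i ≠ .inl 0, (N.form u Z : Matrix (Idx n) (Idx n) ℝ) i (.inl 0) = 0) :
    ∃ g : ℝ → parabolic n, g 0 = 1 ∧
      (∀ i j, HasDerivAt (fun t => pmat (g t) i j)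
        ((N.form u Z : Matrix (Idx n) (Idx n) ℝ) i j) 0) ∧
      ∀ (m : ℕ) (H : B → Euc m), MDifferentiableAt (𝓡 (dimSp n)) (𝓡 m) H u →
        HasDerivAt (fun t => H (N.act u (g t))) (mfderiv (𝓡 (dimSp n)) (𝓡 m) H u Z) 0 := by
  obtain ⟨g, hg0, hgs, hgd⟩ := exists_curve_parabolic (N.form u Z).2 hZ
  refine ⟨g, hg0, hgd, fun m H hH => ?_⟩
  have hu : N.act u (g 0) = u := by rw [hg0, N.act_one]
  have hsm : MDifferentiableAt 𝓘(ℝ, ℝ) (𝓡 (dimSp n)) (fun t => N.act u (g t)) 0 := by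
    -- the smoothness of the action is only assumed for families over Euclidean spaces
    let ι : ℝ → Euc 1 := fun t => t • EuclideanSpace.single 0 1
    have h1 := N.act_smooth 1 (fun _ => u) (fun z => g (z 0)) (ι 0) contMDiffAt_const
      (fun i j => ((hgs i j).contDiffAt).comp (ι 0)
        (EuclideanSpace.proj (𝕜 := ℝ) (0 : Fin 1)).contDiff.contDiffAt)
    have h2 : ContDiffAt ℝ ∞ ι 0 := (contDiff_id.smul contDiff_const).contDiffAt
    have h3 := (h1.comp (0 : ℝ) h2.contMDiffAt).mdifferentiableAt (by simp)
    have h4 : (fun t => N.act u (g t)) = (fun z : Euc 1 => N.act u (g (z 0))) ∘ ι := by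
      funext t
      simp [ι]
    rw [h4]
    exact h3
  have hf := N.form_fundamental u g _ hg0 (fun i j => (hgs i j).contDiffAt) hgd
  -- the velocity of the orbit
  have hvel : mfderiv 𝓘(ℝ, ℝ) (𝓡 (dimSp n)) (fun t => N.act u (g t)) 0 (1 : ℝ) = Z := by
    have h5 : ∀ u' (hu' : u' = u) (Z' : TangentSpace (𝓡 (dimSp n)) u'),
        (N.form u' Z' : Matrix (Idx n) (Idx n) ℝ) = N.form u Z → Z' = Z := by
      rintro u' rfl Z' h
      exact (N.form u').injective (Subtype.ext h)
    exact h5 _ hu _ hf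
  have hH' : MDifferentiableAt (𝓡 (dimSp n)) (𝓡 m) H (N.act u (g 0)) := by rwa [hu]
  let L : ℝ →L[ℝ] Euc m := (mfderiv (𝓡 (dimSp n)) (𝓡 m) H (N.act u (g 0))).comp
    (mfderiv 𝓘(ℝ, ℝ) (𝓡 (dimSp n)) (fun t => N.act u (g t)) 0)
  have h6 : HasFDerivAt (fun t => H (N.act u (g t))) L 0 :=
    (hH'.hasMFDerivAt.comp (0 : ℝ) hsm.hasMFDerivAt).hasFDerivAt
  refine h6.hasDerivAt.congr_deriv ?_
  change mfderiv (𝓡 (dimSp n)) (𝓡 m) H (N.act u (g 0)) (mfderiv 𝓘(ℝ, ℝ) (𝓡 (dimSp n))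
    (fun t => N.act u (g t)) 0 (1 : ℝ)) = _
  rw [hvel]
  have h7 : ∀ u' (hu' : u' = u) (Z : Euc (dimSp n)), mfderiv (𝓡 (dimSp n)) (𝓡 m) H u' Z =
      mfderiv (𝓡 (dimSp n)) (𝓡 m) H u Z := by
    rintro u' rfl Z
    rfl
  exact h7 _ hu Z

omit [IsManifold (𝓡 (2 * n + 1)) ∞ Y] in
lemma mdifferentiableAt_proj (u : B) :
    MDifferentiableAt (𝓡 (dimSp n)) (𝓡 (2 * n + 1)) N.proj u :=
  (N.proj_smooth u).mdifferentiableAt (by simp)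

lemma mfderiv_proj_eq_zero {u : B} {Z : TangentSpace (𝓡 (dimSp n)) u}
    (hZ : ∀ i ≠ .inl 0, (N.form u Z : Matrix (Idx n) (Idx n) ℝ) i (.inl 0) = 0) :
    mfderiv (𝓡 (dimSp n)) (𝓡 (2 * n + 1)) N.proj u Z = 0 := by
  obtain ⟨g, -, -, hg⟩ := N.exists_curve_of_vertical hZ
  have hz := mem_chart_source (Euc (2 * n + 1)) (N.proj u)
  have hc : MDifferentiableAt (𝓡 (2 * n + 1)) 𝓘(ℝ, Euc (2 * n + 1))
      (extChartAt (𝓡 (2 * n + 1)) (N.proj u)) (N.proj u) :=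
    mdifferentiableAt_extChartAt hz
  have h1 := hg _ (extChartAt (𝓡 (2 * n + 1)) (N.proj u) ∘ N.proj)
    (hc.comp u (N.mdifferentiableAt_proj u))
  have h2 := h1.unique ((hasDerivAt_const (0 : ℝ)
    (extChartAt (𝓡 (2 * n + 1)) (N.proj u) (N.proj u))).congr_of_eventuallyEq
      (.of_forall fun t => congrArg (extChartAt (𝓡 (2 * n + 1)) (N.proj u))
        (N.proj_act u (g t))))
  rw [mfderiv_comp u hc (N.mdifferentiableAt_proj u)] at h2
  exact chartD_injective hz (h2.trans (map_zero _).symm)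

lemma finrank_tangentSpace {d : ℕ} {M : Type*} [TopologicalSpace M] [ChartedSpace (Euc d) M]
    (x : M) : Module.finrank ℝ (TangentSpace (𝓡 d) x) = d :=
  finrank_euclideanSpace_fin (𝕜 := ℝ) (n := d)

/-- The vertical vectors are those with `ω = θ = θ₀ = 0`. -/
lemma mfderiv_proj_eq_zero_iff {u : B} {Z : TangentSpace (𝓡 (dimSp n)) u} :
    mfderiv (𝓡 (dimSp n)) (𝓡 (2 * n + 1)) N.proj u Z = 0 ↔
      ∀ i ≠ .inl 0, (N.form u Z : Matrix (Idx n) (Idx n) ℝ) i (.inl 0) = 0 := by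
  refine ⟨fun h => ?_, N.mfderiv_proj_eq_zero⟩
  let q : TangentSpace (𝓡 (dimSp n)) u →ₗ[ℝ] ({i : Idx n // i ≠ .inl 0} → ℝ) :=
    LinearMap.pi fun i => N.entry i.1 (.inl 0) u
  have hle : LinearMap.ker q ≤
      LinearMap.ker (mfderiv (𝓡 (dimSp n)) (𝓡 (2 * n + 1)) N.proj u).toLinearMap := by
    intro Z hZ
    exact N.mfderiv_proj_eq_zero fun i hi => congrFun (LinearMap.mem_ker.1 hZ) ⟨i, hi⟩
  have : FiniteDimensional ℝ (TangentSpace (𝓡 (dimSp n)) u) :=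
    inferInstanceAs (FiniteDimensional ℝ (Euc (dimSp n)))
  have : FiniteDimensional ℝ (TangentSpace (𝓡 (2 * n + 1)) (N.proj u)) :=
    inferInstanceAs (FiniteDimensional ℝ (Euc (2 * n + 1)))
  have heq : LinearMap.ker q =
      LinearMap.ker (mfderiv (𝓡 (dimSp n)) (𝓡 (2 * n + 1)) N.proj u).toLinearMap := by
    refine Submodule.eq_of_le_of_finrank_le hle ?_
    have h1 := LinearMap.finrank_range_add_finrank_ker q
    have h2 := LinearMap.finrank_range_add_finrank_ker
      (mfderiv (𝓡 (dimSp n)) (𝓡 (2 * n + 1)) N.proj u).toLinearMap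
    rw [LinearMap.range_eq_top.2 (N.proj_submersion u), finrank_top, finrank_tangentSpace] at h2
    have h3 := (LinearMap.range q).finrank_le
    rw [Module.finrank_fintype_fun_eq_card, Fintype.card_subtype_compl, Fintype.card_subtype_eq,
      Fintype.card_sum, Fintype.card_fin] at h3
    rw [finrank_tangentSpace] at h1 h2
    omega
  have hZ : Z ∈ LinearMap.ker q := by
    rw [heq]
    exact h
  exact fun i hi => congrFun (LinearMap.mem_ker.1 hZ) ⟨i, hi⟩

/-- The vector `dπ (Φ_u⁻¹ M)` in the preferred chart at `y`. -/
noncomputable def chartFrame (y : Y) (u : B) : spAlg n →ₗ[ℝ] Euc (2 * n + 1) :=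
  ((chartD y (N.proj u)).comp
    (mfderiv (𝓡 (dimSp n)) (𝓡 (2 * n + 1)) N.proj u)).toLinearMap.comp (N.form u).symm.toLinearMap

omit [IsManifold (𝓡 (2 * n + 1)) ∞ Y] in
lemma chartFrame_form (y : Y) (u : B) (v : TangentSpace (𝓡 (dimSp n)) u) :
    N.chartFrame y u (N.form u v) =
      chartD y (N.proj u) (mfderiv (𝓡 (dimSp n)) (𝓡 (2 * n + 1)) N.proj u v) := by
  simp only [chartFrame, LinearMap.comp_apply]
  erw [LinearEquiv.symm_apply_apply]
  rfl

lemma chartFrame_eq_zero (y : Y) (u : B) {M : spAlg n}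
    (hM : ∀ i ≠ .inl 0, (M : Matrix (Idx n) (Idx n) ℝ) i (.inl 0) = 0) :
    N.chartFrame y u M = 0 := by
  obtain ⟨v, rfl⟩ := (N.form u).surjective M
  rw [chartFrame_form, N.mfderiv_proj_eq_zero hM, map_zero]

lemma chartFrame_eq_zero_iff {y : Y} {u : B} (hy : N.proj u ∈ (chartAt (Euc (2 * n + 1)) y).source)
    (M : spAlg n) : N.chartFrame y u M = 0 ↔
      ∀ i ≠ .inl 0, (M : Matrix (Idx n) (Idx n) ℝ) i (.inl 0) = 0 := by
  refine ⟨fun h => ?_, N.chartFrame_eq_zero y u⟩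
  obtain ⟨v, rfl⟩ := (N.form u).surjective M
  rw [chartFrame_form] at h
  exact N.mfderiv_proj_eq_zero_iff.1 (chartD_injective hy (h.trans (map_zero _).symm))

lemma chartFrame_eq_sum (y : Y) (u : B) {M : spAlg n}
    (hM : (M : Matrix (Idx n) (Idx n) ℝ) (.inr 0) (.inl 0) = 0) :
    N.chartFrame y u M = ∑ a, (M : Matrix (Idx n) (Idx n) ℝ) (subIdx a) (.inl 0) •
      N.chartFrame y u (basisElt n a) := by
  rw [← sub_eq_zero]
  simp only [← map_smul]
  rw [← map_sum, ← map_sub]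
  refine N.chartFrame_eq_zero y u fun i hi => ?_
  rw [Submodule.coe_sub, Submodule.coe_sum, Matrix.sub_apply, Matrix.sum_apply]
  simp only [Submodule.coe_smul, Matrix.smul_apply, basisElt_apply_inl_zero]
  rcases eq_or_eq_or_exists_subIdx i with rfl | rfl | ⟨b, rfl⟩
  · exact absurd rfl hi
  · rw [hM, zero_sub, neg_eq_zero]
    exact Finset.sum_eq_zero fun a _ => by rw [if_neg (subIdx_ne_inr_zero a).symm, smul_zero]
  · rw [Finset.sum_eq_single b]
    · rw [if_pos rfl, smul_eq_mul, mul_one, sub_self]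
    · intro a _ hab
      rw [if_neg fun h => hab (subIdx_injective h).symm, smul_zero]
    · exact fun h => absurd (Finset.mem_univ b) h

omit [IsManifold (𝓡 (2 * n + 1)) ∞ Y] in
lemma mdifferentiableAt_act (u : B) (g : parabolic n) :
    MDifferentiableAt (𝓡 (dimSp n)) (𝓡 (dimSp n)) (fun z => N.act z g) u := by
  have he := mem_extChartAt_target (I := 𝓡 (dimSp n)) u
  have h1 := N.act_smooth (dimSp n) (extChartAt (𝓡 (dimSp n)) u).symm (fun _ => g)
    (extChartAt (𝓡 (dimSp n)) u u) (contMDiffAt_chart_symm he) fun i j => contDiffAt_const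
  have h2 := (h1.comp u (contMDiffAt_extChartAt (I := 𝓡 (dimSp n)))).mdifferentiableAt (by simp)
  refine h2.congr_of_eventuallyEq ?_
  filter_upwards [chart_source_mem_nhds (Euc (dimSp n)) u] with z hz
  rw [Function.comp_apply, chart_left_inv hz]

/-- Equivariance of the frames. -/
lemma chartFrame_act (y : Y) (u : B) (g : parabolic n) (a : Fin n ⊕ Fin n) :
    N.chartFrame y (N.act u g) (basisElt n a) = (pmat g (.inl 0) (.inl 0))⁻¹ •
      ∑ b, pmat g (subIdx b) (subIdx a) • N.chartFrame y u (basisElt n b) := by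
  let M' : spAlg n := ⟨_, conj_mem_spAlg g (basisElt n a).2⟩
  obtain ⟨v, hv⟩ := (N.form u).surjective M'
  have h1 : N.form (N.act u g) (mfderiv (𝓡 (dimSp n)) (𝓡 (dimSp n)) (fun z => N.act z g) u v) =
      basisElt n a := by
    refine Subtype.ext ?_
    rw [N.form_act, hv]
    change pmat g⁻¹ * (pmat g * _ * pmat g⁻¹) * pmat g = _
    rw [Matrix.mul_assoc, Matrix.mul_assoc, Matrix.mul_assoc, pmat_inv_mul, Matrix.mul_one,
      ← Matrix.mul_assoc, pmat_inv_mul, Matrix.one_mul]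
  have h2 : N.chartFrame y (N.act u g) (basisElt n a) = N.chartFrame y u M' := by
    rw [← h1, ← hv, chartFrame_form, chartFrame_form]
    have h3 : N.proj ∘ (fun z => N.act z g) = N.proj := funext fun z => N.proj_act z g
    have h4 := mfderiv_comp u (N.mdifferentiableAt_proj (N.act u g)) (N.mdifferentiableAt_act u g)
    rw [h3] at h4
    have h5 := congrArg (fun L => chartD y (N.proj u) (L v)) h4
    refine Eq.trans ?_ h5.symm
    have h6 : ∀ z z' : Y, z = z' → ∀ w : Euc (2 * n + 1), chartD y z w = chartD y z' w := by
      rintro z _ rfl w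
      rfl
    exact h6 _ _ (N.proj_act u g) _
  have hcol : ∀ i, M'.1 i (.inl 0) =
      (pmat g (.inl 0) (.inl 0))⁻¹ * pmat g i (subIdx a) := by
    intro i
    have h7 : pmat g⁻¹ (.inl 0) (.inl 0) = (pmat g (.inl 0) (.inl 0))⁻¹ := by
      have := congrFun (congrFun (pmat_inv_mul g) (.inl 0)) (.inl 0)
      rw [Matrix.mul_apply, Finset.sum_eq_single (Sum.inl 0), Matrix.one_apply_eq] at this
      · exact eq_inv_of_mul_eq_one_left this
      · exact fun j _ hj => by rw [pmat_apply_inl_zero g hj, mul_zero]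
      · simp
    change (pmat g * (basisElt n a).1 * pmat g⁻¹) i (.inl 0) = _
    rw [Matrix.mul_apply, Finset.sum_eq_single (Sum.inl 0), h7, Matrix.mul_apply,
      Finset.sum_eq_single (subIdx a), basisElt_apply_inl_zero, if_pos rfl, mul_one, mul_comm]
    · exact fun j _ hj => by rw [basisElt_apply_inl_zero, if_neg hj, mul_zero]
    · simp
    · exact fun j _ hj => by rw [pmat_apply_inl_zero _ hj, mul_zero]
    · simp
  rw [h2, N.chartFrame_eq_sum y u (by
    rw [hcol, pmat_inr_zero g (subIdx_ne_inr_zero a), mul_zero]), Finset.smul_sum]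
  simp only [hcol, smul_smul]

lemma contMDiffAt_chartFrame {y : Y} {u : B}
    (hy : N.proj u ∈ (chartAt (Euc (2 * n + 1)) y).source) (M : spAlg n) :
    ContMDiffAt (𝓡 (dimSp n)) (𝓡 (2 * n + 1)) ∞ (fun u => N.chartFrame y u M) u := by
  set ψ := extChartAt (𝓡 (dimSp n)) u with hψ
  have he : ψ u ∈ ψ.target := mem_extChartAt_target (I := 𝓡 (dimSp n)) u
  have hPs : ∀ e ∈ ψ.target, ContMDiffAt (𝓡 (dimSp n)) (𝓡 (2 * n + 1)) ∞ (N.proj ∘ ψ.symm) e :=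
    fun e he => (N.proj_smooth _).comp e (contMDiffAt_chart_symm he)
  have hsrc : ∀ᶠ e in 𝓝 (ψ u), (N.proj ∘ ψ.symm) e ∈ (chartAt (Euc (2 * n + 1)) y).source := by
    refine (hPs _ he).continuousAt.eventually ((chartAt _ y).open_source.mem_nhds ?_)
    rwa [Function.comp_apply, hψ, extChartAt_to_inv]
  have htgt : ∀ᶠ e in 𝓝 (ψ u), e ∈ ψ.target := extChartAt_target_mem_nhds u
  let P := extChartAt (𝓡 (2 * n + 1)) y ∘ (N.proj ∘ ψ.symm)
  have hP : ContDiffAt ℝ ∞ P (ψ u) := contDiffAt_chart_comp (hPs _ he) hsrc.self_of_nhds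
  let K : Euc (dimSp n) → Euc (2 * n + 1) := fun e =>
    fderiv ℝ P e ((N.formChart u e).inverse ((N.form u).symm M))
  have hK : ContDiffAt ℝ ∞ K (ψ u) := by
    obtain ⟨A, hA⟩ := N.isInvertible_formChart he
    have := (contDiffAt_map_inverse (𝕜 := ℝ) (n := ∞) A)
    rw [hA] at this
    exact (hP.fderiv_right (m := ∞) (by simp)).clm_apply
      ((this.comp _ (N.contDiffAt_formChart he)).clm_apply contDiffAt_const)
  have hEq : ∀ᶠ e in 𝓝 (ψ u), N.chartFrame y (ψ.symm e) M = K e := by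
    filter_upwards [hsrc, htgt] with e h1 h2
    have h3 : N.form (ψ.symm e) (chartDSymm u e
        ((N.formChart u e).inverse ((N.form u).symm M))) = M := by
      rw [← form_formChart]
      exact (congrArg (N.form u) ((N.isInvertible_formChart h2).self_apply_inverse _)).trans
        ((N.form u).apply_symm_apply M)
    rw [← h3, chartFrame_form]
    have h4 := chartD_mfderiv ((hPs e h2).mdifferentiableAt (by simp)) h1
      ((N.formChart u e).inverse ((N.form u).symm M))
    refine Eq.trans ?_ h4
    rw [mfderiv_comp (I' := 𝓡 (dimSp n)) e (N.mdifferentiableAt_proj _)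
      ((contMDiffAt_chart_symm h2).mdifferentiableAt (by simp))]
    rfl
  have h5 : ContMDiffAt (𝓡 (dimSp n)) (𝓡 (2 * n + 1)) ∞ (K ∘ ψ) u :=
    hK.contMDiffAt.comp u contMDiffAt_extChartAt
  refine h5.congr_of_eventuallyEq ?_
  have h6 := (continuousAt_extChartAt (I := 𝓡 (dimSp n)) u).eventually hEq
  filter_upwards [h6, chart_source_mem_nhds (Euc (dimSp n)) u] with z h7 h8
  rw [chart_left_inv h8] at h7
  exact h7

end SymplecticConnection

end Bundle

/-! ### The covariant derivative of the frames over `B` -/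

/-- The frame `f' = c⁻¹ f G` has the connection matrix `G⁻¹ N G`, up to terms in the directions of
the differentiated vector `f' a` and of the vector `∑ N_{b0} f b` along which it is differentiated.
-/
lemma sum_frame_change {n : ℕ} {E : Type*} [AddCommGroup E] [Module ℝ E]
    {G Nm N' : Matrix (Idx n) (Idx n) ℝ} (hG : Nm * G = G * N') (f : Fin n ⊕ Fin n → E) (c ρ : ℝ)
    {a : Fin n ⊕ Fin n} (hG1 : ∀ b : Fin n ⊕ Fin n, G (subIdx b) (.inl 0) = 0)
    (hG2 : G (.inr 0) (subIdx a) = 0) (hN' : N' (.inr 0) (subIdx a) = 0) :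
    c • ∑ b, G (subIdx b) (subIdx a) • ∑ d, (Nm (subIdx d) (subIdx b) +
        if d = b then ρ else 0) • f d =
      ∑ b, N' (subIdx b) (subIdx a) • (c • ∑ d, G (subIdx d) (subIdx b) • f d) +
        ρ • (c • ∑ d, G (subIdx d) (subIdx a) • f d) -
        (c * G (.inl 0) (subIdx a)) • ∑ d, Nm (subIdx d) (.inl 0) • f d := by
  have key : ∀ d : Fin n ⊕ Fin n, ∑ b, G (subIdx b) (subIdx a) * Nm (subIdx d) (subIdx b) =
      ∑ b, N' (subIdx b) (subIdx a) * G (subIdx d) (subIdx b) -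
        G (.inl 0) (subIdx a) * Nm (subIdx d) (.inl 0) := by
    intro d
    have h := congrFun (congrFun hG (subIdx d)) (subIdx a)
    rw [Matrix.mul_apply, Matrix.mul_apply, sum_idx, sum_idx, hG1, hG2, hN', zero_mul, mul_zero,
      mul_zero, add_zero, zero_add, zero_add] at h
    simp only [mul_comm (G (subIdx _) (subIdx a)), mul_comm (N' _ _), ← h]
    ring
  have e1 : ∑ b, G (subIdx b) (subIdx a) • ∑ d, (Nm (subIdx d) (subIdx b) +
        if d = b then ρ else 0) • f d =
      ∑ d, (∑ b, G (subIdx b) (subIdx a) * Nm (subIdx d) (subIdx b)) • f d +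
        ρ • ∑ d, G (subIdx d) (subIdx a) • f d := by
    simp only [Finset.smul_sum, smul_smul, smul_add, add_smul, Finset.sum_add_distrib,
      Finset.sum_smul]
    refine congrArg₂ (· + ·) ?_ ?_
    · exact Finset.sum_comm
    · refine Finset.sum_congr rfl fun b _ => ?_
      rw [Finset.sum_eq_single b]
      · rw [if_pos rfl, mul_comm]
      · intro d _ hd
        rw [if_neg hd, mul_zero, zero_smul]
      · exact fun h => absurd (Finset.mem_univ b) h
  have e2 : ∑ b, N' (subIdx b) (subIdx a) • (c • ∑ d, G (subIdx d) (subIdx b) • f d) =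
      c • ∑ d, (∑ b, N' (subIdx b) (subIdx a) * G (subIdx d) (subIdx b)) • f d := by
    simp only [Finset.smul_sum, smul_smul, Finset.sum_smul]
    rw [Finset.sum_comm]
    refine Finset.sum_congr rfl fun b _ => Finset.sum_congr rfl fun d _ => ?_
    ring_nf
  rw [e1, e2]
  simp only [key, sub_smul, Finset.sum_sub_distrib, mul_smul, ← Finset.smul_sum]
  module

section Bundle

variable {n : ℕ} {Y : Type*} [TopologicalSpace Y] [ChartedSpace (Euc (2 * n + 1)) Y]
  [IsManifold (𝓡 (2 * n + 1)) ∞ Y] {C : ContactStructure n Y} {B : Type*} [TopologicalSpace B]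
  [ChartedSpace (Euc (dimSp n)) B] [IsManifold (𝓡 (dimSp n)) ∞ B]
  {D : ConformalSymplecticConnection C}

namespace SymplecticConnection

variable {N : SymplecticConnection C B}

/-- Over a map `S` into `B` that covers the chart, the chart expression of `dπ ∘ dS` is the
identity. -/
lemma chartFrame_mfderiv_section {y : Y} {e : Euc (2 * n + 1)}
    (he : e ∈ (extChartAt (𝓡 (2 * n + 1)) y).target) {S : Euc (2 * n + 1) → B}
    (hS : MDifferentiableAt (𝓡 (2 * n + 1)) (𝓡 (dimSp n)) S e)
    (hp : ∀ᶠ e' in 𝓝 e, N.proj (S e') = (extChartAt (𝓡 (2 * n + 1)) y).symm e')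
    (v : Euc (2 * n + 1)) :
    N.chartFrame y (S e) (N.form (S e) (mfderiv (𝓡 (2 * n + 1)) (𝓡 (dimSp n)) S e v)) = v := by
  have hsrc : (N.proj ∘ S) e ∈ (chartAt (Euc (2 * n + 1)) y).source := by
    rw [Function.comp_apply, hp.self_of_nhds]
    exact symm_mem_source he
  have h1 := chartD_mfderiv ((N.mdifferentiableAt_proj (S e)).comp e hS) hsrc v
  rw [mfderiv_comp (I' := 𝓡 (dimSp n)) e (N.mdifferentiableAt_proj _) hS] at h1
  rw [chartFrame_form]
  refine h1.trans ?_
  have h2 : extChartAt (𝓡 (2 * n + 1)) y ∘ (N.proj ∘ S) =ᶠ[𝓝 e] id := by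
    filter_upwards [hp, (isOpen_extChartAt_target y).mem_nhds he] with e' h3 h4
    rw [Function.comp_apply, Function.comp_apply, h3, (extChartAt (𝓡 (2 * n + 1)) y).right_inv h4,
      id]
  rw [h2.fderiv_eq, fderiv_id]
  rfl

/-- Every point of `B` lies on a local section whose frame has, modulo `θ₀`, the connection matrix
given by `Φ`. -/
lemma exists_section (hA : N.ArisesFrom D) {y : Y} {L : LocalConnection (Euc (2 * n + 1))}
    {e : Euc (2 * n + 1)} (he : e ∈ (extChartAt (𝓡 (2 * n + 1)) y).target)
    (hL : ∀ᶠ z in 𝓝 ((extChartAt (𝓡 (2 * n + 1)) y).symm e), L.Represents D y z) {u : B}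
    (hu : N.proj u = (extChartAt (𝓡 (2 * n + 1)) y).symm e) :
    ∃ S : Euc (2 * n + 1) → B, S e = u ∧
      ContMDiffAt (𝓡 (2 * n + 1)) (𝓡 (dimSp n)) ∞ S e ∧
      (∀ᶠ e' in 𝓝 e, N.proj (S e') = (extChartAt (𝓡 (2 * n + 1)) y).symm e') ∧
      ∀ (a : Fin n ⊕ Fin n) (v : Euc (2 * n + 1)), L.θ e v = 0 →
        (N.form (S e) (mfderiv (𝓡 (2 * n + 1)) (𝓡 (dimSp n)) S e v) : Matrix (Idx n) (Idx n) ℝ)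
          (.inr 0) (subIdx a) = 0 →
        ∃ r t : ℝ, fderiv ℝ (fun e' => N.chartFrame y (S e') (basisElt n a)) e v +
            L.Γ e v (N.chartFrame y (S e) (basisElt n a)) =
          ∑ c, (N.form (S e) (mfderiv (𝓡 (2 * n + 1)) (𝓡 (dimSp n)) S e v) :
              Matrix (Idx n) (Idx n) ℝ) (subIdx c) (subIdx a) •
              N.chartFrame y (S e) (basisElt n c) +
            r • N.chartFrame y (S e) (basisElt n a) + t • v := by
  set ψ := extChartAt (𝓡 (2 * n + 1)) y with hψ
  obtain ⟨s, f, hs⟩ := hA (ψ.symm e)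
  obtain ⟨g, hg, -⟩ := N.act_simply_transitive (s (ψ.symm e)) u (hs.self_of_nhds.2.1.trans hu.symm)
  have hev := (eventually_chart_iff he).1 hs
  have htgt : ∀ᶠ e' in 𝓝 e, e' ∈ ψ.target := (isOpen_extChartAt_target y).mem_nhds he
  let s' : Euc (2 * n + 1) → B := fun e' => s (ψ.symm e')
  have hs's : ∀ᶠ e' in 𝓝 e, ContMDiffAt (𝓡 (2 * n + 1)) (𝓡 (dimSp n)) ∞ s' e' := by
    filter_upwards [hev, htgt] with e' h1 h2
    exact h1.1.comp e' (contMDiffAt_chart_symm h2)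
  have hs'p : ∀ᶠ e' in 𝓝 e, N.proj (s' e') = ψ.symm e' := hev.mono fun e' h => h.2.1
  have hs'd := hs's.self_of_nhds.mdifferentiableAt (by simp)
  have hS : ContMDiffAt (𝓡 (2 * n + 1)) (𝓡 (dimSp n)) ∞ (fun e' => N.act (s' e') g) e :=
    N.act_smooth _ s' (fun _ => g) e hs's.self_of_nhds fun i j => contDiffAt_const
  refine ⟨fun e' => N.act (s' e') g, hg, hS, hs'p.mono fun e' h => (N.proj_act _ _).trans h, ?_⟩
  intro a v hv hva
  -- the connection matrices along the two sections are conjugate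
  set Nm : Matrix (Idx n) (Idx n) ℝ :=
    (N.form (s' e) (mfderiv (𝓡 (2 * n + 1)) (𝓡 (dimSp n)) s' e v)).1 with hNm
  set N' : Matrix (Idx n) (Idx n) ℝ := (N.form (N.act (s' e) g)
    (mfderiv (𝓡 (2 * n + 1)) (𝓡 (dimSp n)) (fun e' => N.act (s' e') g) e v)).1 with hN'
  have hconj : Nm * pmat g = pmat g * N' := by
    have h1 : N' = pmat g⁻¹ * Nm * pmat g := by
      rw [hNm, ← N.form_act, hN']
      have h2 := mfderiv_comp (I' := 𝓡 (dimSp n)) e (N.mdifferentiableAt_act (s' e) g) hs'd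
      exact congrArg (fun T => (N.form (N.act (s' e) g) (T v) : Matrix (Idx n) (Idx n) ℝ)) h2
    rw [h1, Matrix.mul_assoc, ← Matrix.mul_assoc, pmat_mul_inv, Matrix.one_mul]
  -- the frame along `s` is a frame of smooth sections of the contact hyperplanes
  have hfield : ∀ᶠ e' in 𝓝 e, ∀ b,
      N.chartFrame y (s' e') (basisElt n b) = chartField y (f b) e' := by
    filter_upwards [hev] with e' h b
    have h1 : N.chartFrame y (s' e') (basisElt n b) =
        chartD y (N.proj (s' e')) (N.frame (s' e') b) := rfl
    rw [h1, ← h.2.2.1 b]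
    exact congrArg (fun z => (chartD y z (f b z) : Euc (2 * n + 1))) h.2.1
  have hsrc : ∀ᶠ e' in 𝓝 e, N.proj (s' e') ∈ (chartAt (Euc (2 * n + 1)) y).source := by
    filter_upwards [hs'p, htgt] with e' h1 h2
    rw [h1]
    exact symm_mem_source h2
  have hsec : ∀ b, C.IsSectionNear (f b) (ψ.symm e) := by
    intro b
    refine ⟨(smoothNear_iff he).2 ?_, (eventually_chart_iff he).2 ?_⟩
    · filter_upwards [hfield.eventually_nhds, hs's, hsrc] with e' h1 h2 h3
      exact ((N.contMDiffAt_chartFrame h3 (basisElt n b)).comp e' h2).contDiffAt.congr_of_eventuallyEq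
        (h1.mono fun e'' h => (h b).symm)
    · filter_upwards [hev] with e' h
      have h1 : ∀ z z', z = z' → f b z ∈ C.plane z → f b z' ∈ C.plane z' := by
        rintro z _ rfl h
        exact h
      refine h1 _ _ h.2.1 ?_
      rw [h.2.2.1 b]
      refine (N.contact _ _).1 ?_
      rw [baseVec, LinearEquiv.apply_symm_apply, basisElt_apply_inl_zero,
        if_neg (subIdx_ne_inr_zero b).symm]
  -- the connection along the section `s`
  have hp : N.proj (s' e) = ψ.symm e := hs'p.self_of_nhds
  have hψp : ψ (N.proj (s' e)) = e := by rw [hp, ψ.right_inv he]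
  have hLp : L.Represents D y (N.proj (s' e)) := by
    rw [hp]
    exact hL.self_of_nhds
  have hLe : L.Represents D y (ψ.symm e) := hL.self_of_nhds
  have hds : mfderiv (𝓡 (2 * n + 1)) (𝓡 (dimSp n)) s' e v =
      mfderiv (𝓡 (2 * n + 1)) (𝓡 (dimSp n)) s (ψ.symm e) (chartDSymm y e v) := by
    have h2 := mfderiv_comp (I' := 𝓡 (2 * n + 1)) e (hs.self_of_nhds.1.mdifferentiableAt (by simp))
      ((contMDiffAt_chart_symm he).mdifferentiableAt (by simp))
    exact congrArg (fun T => T v) h2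
  have hx : chartD y (N.proj (s' e)) (mfderiv (𝓡 (dimSp n)) (𝓡 (2 * n + 1)) N.proj (s' e)
      (mfderiv (𝓡 (2 * n + 1)) (𝓡 (dimSp n)) s' e v)) = v := by
    rw [← chartFrame_form]
    exact chartFrame_mfderiv_section he hs'd hs'p v
  have hX : chartDSymm y e v ∈ C.plane (ψ.symm e) := by
    rw [hLe.mem_plane_iff, chartD_chartDSymm he, ← hψ, ψ.right_inv he]
    exact hv
  have hNm0 : Nm (.inr 0) (.inl 0) = 0 := by
    rw [hNm, N.contact, hLp.mem_plane_iff, hx, ← hψ, hψp]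
    exact hv
  have hfd : ∀ b, fderiv ℝ (fun e' => N.chartFrame y (s' e') (basisElt n b)) e =
      fderiv ℝ (chartField y (f b)) e := fun b =>
    Filter.EventuallyEq.fderiv_eq (hfield.mono fun e' h => h b)
  have hcov : ∀ b, fderiv ℝ (fun e' => N.chartFrame y (s' e') (basisElt n b)) e v +
      L.Γ e v (N.chartFrame y (s' e) (basisElt n b)) =
      ∑ d, (Nm (subIdx d) (subIdx b) + if d = b then -Nm (.inl 0) (.inl 0) else 0) •
        N.chartFrame y (s' e) (basisElt n d) := by
    intro b
    have h1 := hLp.cov_eq (f b) (by rw [hp]; exact hsec b)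
      (mfderiv (𝓡 (dimSp n)) (𝓡 (2 * n + 1)) N.proj (s' e)
        (mfderiv (𝓡 (2 * n + 1)) (𝓡 (dimSp n)) s' e v))
    rw [hx, ← hψ, hψp, ← hfd, ← hfield.self_of_nhds b] at h1
    rw [← h1]
    have h2 := hs.self_of_nhds.2.2.2 (chartDSymm y e v) b hX
    rw [← hds] at h2
    refine (congrArg (chartD y (N.proj (s' e))) h2).trans ?_
    rw [map_sum]
    refine Finset.sum_congr rfl fun d _ => ?_
    refine (map_smul (chartD y (N.proj (s' e))) _ _).trans ?_
    have h3 : f d (N.proj (s (ψ.symm e))) = N.frame (s' e) d := hs.self_of_nhds.2.2.1 d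
    rw [h3]
    rfl
  have hdiff : ∀ b, DifferentiableAt ℝ (fun e' => N.chartFrame y (s' e') (basisElt n b)) e :=
    fun b => ((N.contMDiffAt_chartFrame hsrc.self_of_nhds (basisElt n b)).comp e
      hs's.self_of_nhds).contDiffAt.differentiableAt (by simp)
  have hfd' : fderiv ℝ (fun e' => N.chartFrame y (N.act (s' e') g) (basisElt n a)) e =
      (pmat g (.inl 0) (.inl 0))⁻¹ • ∑ b, pmat g (subIdx b) (subIdx a) •
        fderiv ℝ (fun e' => N.chartFrame y (s' e') (basisElt n b)) e := by
    simp only [chartFrame_act]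
    exact ((HasFDerivAt.fun_sum fun b _ =>
      (hdiff b).hasFDerivAt.fun_const_smul _).fun_const_smul _).fderiv
  have hv' : v = ∑ d, Nm (subIdx d) (.inl 0) • N.chartFrame y (s' e) (basisElt n d) := by
    rw [← N.chartFrame_eq_sum y (s' e) hNm0]
    exact (chartFrame_mfderiv_section he hs'd hs'p v).symm
  have hsum := sum_frame_change hconj (fun b => N.chartFrame y (s' e) (basisElt n b))
    (pmat g (.inl 0) (.inl 0))⁻¹ (-Nm (.inl 0) (.inl 0))
    (fun b => pmat_apply_inl_zero g (subIdx_ne_inl_zero b))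
    (pmat_inr_zero g (subIdx_ne_inr_zero a)) hva
  rw [← hv'] at hsum
  refine ⟨-Nm (.inl 0) (.inl 0),
    -((pmat g (.inl 0) (.inl 0))⁻¹ * pmat g (.inl 0) (subIdx a)), ?_⟩
  rw [hfd']
  simp only [chartFrame_act]
  rw [neg_smul _ v, ← sub_eq_add_neg, ← hsum]
  simp only [← hcov, smul_apply, _root_.sum_apply, map_smul, map_sum, smul_add,
    Finset.sum_add_distrib]

/-- In vertical directions the frame changes by the infinitesimal right action of the parabolic
subgroup on `sp(n+1, ℝ)` modulo the parabolic subalgebra; the last term is due to the scaling of the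
first basis vector. -/
lemma mfderiv_chartFrame_vertical {y : Y} {u : B}
    (hy : N.proj u ∈ (chartAt (Euc (2 * n + 1)) y).source) {Z : TangentSpace (𝓡 (dimSp n)) u}
    (hZ : ∀ i ≠ .inl 0, (N.form u Z : Matrix (Idx n) (Idx n) ℝ) i (.inl 0) = 0)
    (a : Fin n ⊕ Fin n) :
    mfderiv (𝓡 (dimSp n)) (𝓡 (2 * n + 1)) (fun u => N.chartFrame y u (basisElt n a)) u Z =
      ∑ b, (N.form u Z : Matrix (Idx n) (Idx n) ℝ) (subIdx b) (subIdx a) •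
        N.chartFrame y u (basisElt n b) -
      (N.form u Z : Matrix (Idx n) (Idx n) ℝ) (.inl 0) (.inl 0) •
        N.chartFrame y u (basisElt n a) := by
  obtain ⟨g, hg0, hg, hH⟩ := N.exists_curve_of_vertical hZ
  have h1 := hH _ _ ((N.contMDiffAt_chartFrame hy (basisElt n a)).mdifferentiableAt (by simp))
  simp only [chartFrame_act] at h1
  have hone : ∀ i, pmat (g 0) i i = 1 := fun i => by rw [hg0, pmat_one, Matrix.one_apply_eq]
  have h2 : HasDerivAt (fun t => (pmat (g t) (.inl 0) (.inl 0))⁻¹)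
      (-(N.form u Z : Matrix (Idx n) (Idx n) ℝ) (.inl 0) (.inl 0)) 0 := by
    have := (hg (.inl 0) (.inl 0)).fun_inv (by rw [hone]; exact one_ne_zero)
    rwa [hone, one_pow, div_one] at this
  have h3 : HasDerivAt (fun t => ∑ b, pmat (g t) (subIdx b) (subIdx a) •
      N.chartFrame y u (basisElt n b))
      (∑ b, (N.form u Z : Matrix (Idx n) (Idx n) ℝ) (subIdx b) (subIdx a) •
        N.chartFrame y u (basisElt n b)) 0 :=
    HasDerivAt.fun_sum fun b _ => (hg _ _).smul_const _
  refine (h1.unique (h2.fun_smul h3)).trans ?_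
  have h4 : ∑ b, pmat (g 0) (subIdx b) (subIdx a) • N.chartFrame y u (basisElt n b) =
      N.chartFrame y u (basisElt n a) := by
    rw [Finset.sum_eq_single a, hone, one_smul]
    · intro b _ hb
      rw [hg0, pmat_one, Matrix.one_apply_ne (fun h => hb (subIdx_injective h)), zero_smul]
    · exact fun h => absurd (Finset.mem_univ a) h
  rw [h4, hone, inv_one, one_smul, neg_smul, sub_eq_add_neg]

/-- The derivative of the chart expression of the `a`-th vector of the frame. -/
noncomputable def chartFrameDeriv (N : SymplecticConnection C B) (y : Y) (u : B)
    (a : Fin n ⊕ Fin n) : Euc (dimSp n) →L[ℝ] Euc (2 * n + 1) :=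
  mfderiv (𝓡 (dimSp n)) (𝓡 (2 * n + 1)) (fun u => N.chartFrame y u (basisElt n a)) u

/-- The covariant derivative of the frames along a vector `X` tangent to `B`: it is given by the
matrix `Φ(X)`, up to multiples of the frame vector itself and of the projection of `X`. -/
theorem chartFrame_covariant (hA : N.ArisesFrom D) {y : Y} {L : LocalConnection (Euc (2 * n + 1))}
    {e : Euc (2 * n + 1)} (he : e ∈ (extChartAt (𝓡 (2 * n + 1)) y).target)
    (hL : ∀ᶠ z in 𝓝 ((extChartAt (𝓡 (2 * n + 1)) y).symm e), L.Represents D y z) {u : B}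
    (hu : N.proj u = (extChartAt (𝓡 (2 * n + 1)) y).symm e) (X : TangentSpace (𝓡 (dimSp n)) u)
    (a : Fin n ⊕ Fin n)
    (h0 : (N.form u X : Matrix (Idx n) (Idx n) ℝ) (.inr 0) (.inl 0) = 0)
    (ha : (N.form u X : Matrix (Idx n) (Idx n) ℝ) (.inr 0) (subIdx a) = 0) :
    ∃ r t : ℝ,
      N.chartFrameDeriv y u a X +
        L.Γ e (N.chartFrame y u (N.form u X)) (N.chartFrame y u (basisElt n a)) =
      ∑ c, (N.form u X : Matrix (Idx n) (Idx n) ℝ) (subIdx c) (subIdx a) •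
          N.chartFrame y u (basisElt n c) +
        r • N.chartFrame y u (basisElt n a) + t • N.chartFrame y u (N.form u X) := by
  obtain ⟨S, rfl, hS, hSp, hcov⟩ := exists_section hA he hL hu
  have hSd := hS.mdifferentiableAt (by simp)
  have hsrc : N.proj (S e) ∈ (chartAt (Euc (2 * n + 1)) y).source := by
    rw [hu]
    exact symm_mem_source he
  set v := N.chartFrame y (S e) (N.form (S e) X) with hv
  set X₁ : TangentSpace (𝓡 (dimSp n)) (S e) := mfderiv (𝓡 (2 * n + 1)) (𝓡 (dimSp n)) S e v
    with hX₁
  have hZ : ∀ i ≠ .inl 0, (N.form (S e) (X - X₁) : Matrix (Idx n) (Idx n) ℝ) i (.inl 0) = 0 := by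
    rw [← N.chartFrame_eq_zero_iff (y := y) hsrc, map_sub, map_sub, hX₁,
      chartFrame_mfderiv_section he hSd hSp, ← hv, sub_self]
  have hX : N.form (S e) X = N.form (S e) X₁ + N.form (S e) (X - X₁) := by
    rw [← map_add, add_sub_cancel]
  have hZa : (N.form (S e) (X - X₁) : Matrix (Idx n) (Idx n) ℝ) (.inr 0) (subIdx a) = 0 := by
    have h1 := (N.form (S e) (X - X₁)).2
    rcases a with a | a
    · exact (spAlg_apply h1 _ _).1.trans (hZ _ (by simp))
    · exact (spAlg_apply h1 _ _).2.trans (by rw [hZ _ (by simp), neg_zero])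
  have hLe : L.θ e v = 0 := by
    have h1 := (N.contact _ _).1 h0
    have hLp : L.Represents D y (N.proj (S e)) := by
      rw [hu]
      exact hL.self_of_nhds
    rw [hLp.mem_plane_iff, ← chartFrame_form, ← hv, hu,
      (extChartAt (𝓡 (2 * n + 1)) y).right_inv he] at h1
    exact h1
  obtain ⟨r, t, hrt⟩ := hcov a v hLe (by
    rw [hX, Submodule.coe_add, Matrix.add_apply, hZa, add_zero] at ha
    exact ha)
  refine ⟨r - (N.form (S e) (X - X₁) : Matrix (Idx n) (Idx n) ℝ) (.inl 0) (.inl 0), t, ?_⟩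
  have hd1 : N.chartFrameDeriv y (S e) a X₁ = fderiv ℝ (fun e' => N.chartFrame y (S e') (basisElt n a)) e v := by
    have h2 := mfderiv_comp (I' := 𝓡 (dimSp n)) e
      ((N.contMDiffAt_chartFrame hsrc (basisElt n a)).mdifferentiableAt (by simp)) hSd
    rw [← mfderiv_eq_fderiv]
    exact congrArg (fun T => T v) h2.symm
  have hd2 := mfderiv_chartFrame_vertical hsrc hZ a
  have hd : N.chartFrameDeriv y (S e) a X = fderiv ℝ (fun e' => N.chartFrame y (S e') (basisElt n a)) e v +
      (∑ b, (N.form (S e) (X - X₁) : Matrix (Idx n) (Idx n) ℝ) (subIdx b) (subIdx a) •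
        N.chartFrame y (S e) (basisElt n b) -
      (N.form (S e) (X - X₁) : Matrix (Idx n) (Idx n) ℝ) (.inl 0) (.inl 0) •
        N.chartFrame y (S e) (basisElt n a)) := by
    rw [← hd1, ← hd2]
    exact (congrArg (N.chartFrameDeriv y (S e) a) (add_sub_cancel X₁ X).symm).trans (map_add _ _ _)
  rw [hd, add_right_comm, hrt, hX]
  simp only [Submodule.coe_add, Matrix.add_apply, add_smul, Finset.sum_add_distrib, sub_smul]
  abel

end SymplecticConnection

end Bundle

/-! ### Projections of integral manifolds are geodesic -/

section Bundle

variable {n : ℕ} {Y : Type*} [TopologicalSpace Y] [ChartedSpace (Euc (2 * n + 1)) Y]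
  [IsManifold (𝓡 (2 * n + 1)) ∞ Y] {C : ContactStructure n Y} {B : Type*} [TopologicalSpace B]
  [ChartedSpace (Euc (dimSp n)) B] [IsManifold (𝓡 (dimSp n)) ∞ B]
  {D : ConformalSymplecticConnection C} {k : ℕ}

/-- A submanifold tangent to the contact hyperplanes is isotropic. -/
lemma extD_eq_zero_of_tangent {σ : Euc k → Y} {x : Euc k}
    (hσ : ContMDiffAt (𝓡 k) (𝓡 (2 * n + 1)) ∞ σ x)
    (hP : ∀ᶠ x' in 𝓝 x, tangentPlane σ x' ≤ C.plane (σ x')) {θ : OneForm (2 * n + 1) Y}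
    (hθ : C.IsGenerator θ (σ x)) :
    ∀ v ∈ tangentPlane σ x, ∀ w ∈ tangentPlane σ x, θ.extD (σ x) v w = 0 := by
  rintro _ ⟨v, rfl⟩ _ ⟨w, rfl⟩
  have h0 : θ.pull σ =ᶠ[𝓝 x] fun _ => 0 := by
    filter_upwards [hP, hσ.continuousAt.eventually hθ] with x' h1 h2
    ext1 v
    have h3 := h1 ⟨v, rfl⟩
    rw [← h2.2.2.1, LinearMap.mem_ker] at h3
    exact h3
  have h1 : ∀ v w : Euc k, dForm (θ.pull σ) x v w = 0 := fun v w => by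
    rw [dForm, h0.fderiv_eq, fderiv_fun_const]
    simp
  exact ((OneForm.dForm_pull hσ hθ.self_of_nhds.1).2 v w).symm.trans (h1 v w)

namespace SymplecticConnection

variable {N : SymplecticConnection C B}

/-- The differential of a map into `Y` with a lift `τ` to `B`, in terms of the frames and the
Cartan connection form. -/
lemma fderiv_chart_lift {σ : Euc k → Y} {τ : Euc k → B} {x : Euc k} {y : Y}
    (hτ : MDifferentiableAt (𝓡 k) (𝓡 (dimSp n)) τ x) (hp : ∀ᶠ x' in 𝓝 x, N.proj (τ x') = σ x')
    (hy : σ x ∈ (chartAt (Euc (2 * n + 1)) y).source) (v : Euc k) :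
    fderiv ℝ (extChartAt (𝓡 (2 * n + 1)) y ∘ σ) x v =
      N.chartFrame y (τ x) (N.form (τ x) (mfderiv (𝓡 k) (𝓡 (dimSp n)) τ x v)) := by
  have h1 : extChartAt (𝓡 (2 * n + 1)) y ∘ σ =ᶠ[𝓝 x]
      extChartAt (𝓡 (2 * n + 1)) y ∘ (N.proj ∘ τ) :=
    hp.mono fun x' h => congrArg (extChartAt (𝓡 (2 * n + 1)) y) h.symm
  rw [← hp.self_of_nhds] at hy
  rw [h1.fderiv_eq, chartFrame_form, ← chartD_mfderiv ((N.mdifferentiableAt_proj (τ x)).comp x hτ) hy,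
    mfderiv_comp (I' := 𝓡 (dimSp n)) x (N.mdifferentiableAt_proj _) hτ]
  rfl

/-- A tangent vector of `B` annihilated by `I_k` projects to the span of the first `k` vectors of
the frame. -/
lemma chartFrame_of_mem_flagAlg (hk : k ≤ n) (y : Y) (u : B) {M : spAlg n}
    (hM : (M : Matrix (Idx n) (Idx n) ℝ) ∈ flagAlg n k) : N.chartFrame y u M =
      ∑ i : Fin k, (M : Matrix (Idx n) (Idx n) ℝ) (.inl (Fin.castLE hk i).succ) (.inl 0) •
        N.chartFrame y u (basisElt n (.inl (Fin.castLE hk i))) := by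
  rw [N.chartFrame_eq_sum y u (hM.1 _ _), Fintype.sum_sum_type,
    Finset.sum_eq_zero (s := (Finset.univ : Finset (Fin n))) (f := fun i =>
      M.1 (subIdx (.inr i)) (.inl 0) • N.chartFrame y u (basisElt n (.inr i)))
      (fun i _ => by
        have : M.1 (subIdx (.inr i)) (.inl 0) = 0 := hM.1 _ _
        rw [this, zero_smul]), add_zero]
  refine (Fintype.sum_of_injective (Fin.castLE hk) (Fin.castLE_injective hk) _ _ ?_ ?_).symm
  · intro i hi
    have hki : k ≤ i := by
      by_contra h
      exact hi ⟨⟨i, not_le.1 h⟩, rfl⟩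
    have : M.1 (subIdx (.inl i)) (.inl 0) = 0 := hM.2 _ _ (Nat.lt_succ_of_le hki) (Nat.zero_le _)
    rw [this, zero_smul]
  · exact fun i => rfl

/-- The projection of an integral manifold of `I_k`, if immersed, is totally geodesic: its tangent
planes are spanned by the first `k` vectors of the frame, and the connection matrix preserves their
span. -/
lemma isTotallyGeodesicAt_of_integral (hA : N.ArisesFrom D) (hk : k ≤ n) {σ : Euc k → Y}
    {τ : Euc k → B} {x : Euc k} {y : Y} {L : LocalConnection (Euc (2 * n + 1))}
    (hL : ∀ᶠ z in 𝓝 (σ x), L.Represents D y z)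
    (hτ : ∀ᶠ x' in 𝓝 x, ContMDiffAt (𝓡 k) (𝓡 (dimSp n)) ∞ τ x' ∧ N.proj (τ x') = σ x' ∧
      ∀ i (v : TangentSpace (𝓡 k) x'),
        N.flagSystem k i (τ x') (mfderiv (𝓡 k) (𝓡 (dimSp n)) τ x' v) = 0)
    (hσ : ContMDiffAt (𝓡 k) (𝓡 (2 * n + 1)) ∞ σ x)
    (hinj : Function.Injective (mfderiv (𝓡 k) (𝓡 (2 * n + 1)) σ x)) :
    L.IsTotallyGeodesicAt (extChartAt (𝓡 (2 * n + 1)) y ∘ σ) x := by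
  intro a b
  set s := extChartAt (𝓡 (2 * n + 1)) y ∘ σ with hs
  set R := LinearMap.range (fderiv ℝ s x).toLinearMap with hR
  have hy := hL.self_of_nhds.mem_source
  let p : Fin k → Euc k → Euc k →L[ℝ] ℝ := fun i => (N.omega (Fin.castLE hk i)).pull τ
  let q : Fin k → Euc k → Euc (2 * n + 1) := fun i x' =>
    N.chartFrame y (τ x') (basisElt n (.inl (Fin.castLE hk i)))
  have hsrc : ∀ᶠ x' in 𝓝 x, σ x' ∈ (chartAt (Euc (2 * n + 1)) y).source :=
    hσ.continuousAt.eventually ((chartAt _ y).open_source.mem_nhds hy)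
  have hds : ∀ᶠ x' in 𝓝 x, ∀ w, fderiv ℝ s x' w = ∑ i, p i x' w • q i x' := by
    filter_upwards [hτ.eventually_nhds, hsrc] with x' h1 h2 w
    rw [hs, fderiv_chart_lift (h1.self_of_nhds.1.mdifferentiableAt (by simp))
      (h1.mono fun x'' h => h.2.1) h2]
    exact chartFrame_of_mem_flagAlg hk y _
      ((N.flagSystem_eq_zero_iff k _ _).1 fun i => h1.self_of_nhds.2.2 i w)
  have hsm : ContDiffAt ℝ ∞ s x := contDiffAt_chart_comp hσ hy
  have hpu : N.proj (τ x) = σ x := hτ.self_of_nhds.2.1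
  have hysrc : N.proj (τ x) ∈ (chartAt (Euc (2 * n + 1)) y).source := by rwa [hpu]
  have hτd := hτ.self_of_nhds.1.mdifferentiableAt (by simp)
  have hpd : ∀ i, DifferentiableAt ℝ (p i) x := fun i =>
    (OneForm.dForm_pull hτ.self_of_nhds.1 (N.form_smooth _ _ _)).1.differentiableAt (by simp)
  let T : Euc k →L[ℝ] Euc (dimSp n) := mfderiv (𝓡 k) (𝓡 (dimSp n)) τ x
  have hqd : ∀ i, HasFDerivAt (q i)
      ((N.chartFrameDeriv y (τ x) (.inl (Fin.castLE hk i))).comp T) x := fun i =>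
    (((N.contMDiffAt_chartFrame hysrc _).mdifferentiableAt (by simp)).hasMFDerivAt.comp x
      hτd.hasMFDerivAt).hasFDerivAt
  -- the tangent plane is spanned by the first `k` vectors of the frame
  have hqR : ∀ i, q i x ∈ R := by
    have hle : R ≤ Submodule.span ℝ (Set.range fun i => q i x) := by
      rintro _ ⟨w, rfl⟩
      have := hds.self_of_nhds w
      refine Eq.symm this ▸ ?_
      exact Submodule.sum_mem _ fun i _ =>
        Submodule.smul_mem _ _ (Submodule.subset_span ⟨i, rfl⟩)
    have hfin : Module.finrank ℝ R = k := by
      have h1 := LinearMap.finrank_range_of_inj (f := (fderiv ℝ s x).toLinearMap)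
        ((injective_mfderiv_iff (hσ.mdifferentiableAt (by simp)) hy).1 hinj)
      rw [hR, h1, finrank_euclideanSpace_fin]
    have heq := Submodule.eq_of_le_of_finrank_le hle
      (((finrank_range_le_card fun i => q i x).trans (Fintype.card_fin k).le).trans hfin.ge)
    intro i
    rw [heq]
    exact Submodule.subset_span ⟨i, rfl⟩
  have hmemR : ∀ w, fderiv ℝ s x w ∈ R := fun w => ⟨w, rfl⟩
  set X := mfderiv (𝓡 k) (𝓡 (dimSp n)) τ x a with hX
  have hflag := (N.flagSystem_eq_zero_iff k _ _).1 fun i => hτ.self_of_nhds.2.2 i a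
  have hXs : N.chartFrame y (τ x) (N.form (τ x) X) = fderiv ℝ s x a :=
    (fderiv_chart_lift hτd (hτ.mono fun x' h => h.2.1) hy a).symm
  -- the frame vectors are parallel modulo their span
  have hcov : ∀ i, N.chartFrameDeriv y (τ x) (.inl (Fin.castLE hk i)) X +
      L.Γ (s x) (fderiv ℝ s x a) (q i x) ∈ R := by
    intro i
    have hinv : (extChartAt (𝓡 (2 * n + 1)) y).symm (s x) = σ x := chart_left_inv hy
    obtain ⟨r, t, hrt⟩ := chartFrame_covariant hA (y := y) (L := L) (e := s x)
      (mem_target_chart hy) (by rwa [hinv]) (hpu.trans hinv.symm) X (.inl (Fin.castLE hk i))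
      (hflag.1 _ _) (hflag.1 _ _)
    rw [hXs] at hrt
    refine hrt.symm ▸ R.add_mem (R.add_mem (R.sum_mem fun c _ => ?_) (R.smul_mem _ (hqR i)))
      (R.smul_mem _ (hmemR a))
    rcases c with c | c
    · by_cases hc : (c : ℕ) < k
      · exact R.smul_mem _ (hqR ⟨c, hc⟩)
      · have h0 : (N.form (τ x) X).1 (subIdx (.inl c)) (subIdx (.inl (Fin.castLE hk i))) = 0 :=
          hflag.2 _ _ (Nat.lt_succ_of_le (not_lt.1 hc)) (Nat.succ_le_of_lt i.2)
        rw [h0, zero_smul]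
        exact R.zero_mem
    · have h0 : (N.form (τ x) X).1 (subIdx (.inr c)) (subIdx (.inl (Fin.castLE hk i))) = 0 :=
        hflag.1 _ _
      rw [h0, zero_smul]
      exact R.zero_mem
  have hdd : fderiv ℝ (fderiv ℝ s) x a b =
      ∑ i, (p i x b • N.chartFrameDeriv y (τ x) (.inl (Fin.castLE hk i)) X +
        fderiv ℝ (p i) x a b • q i x) := by
    have h1 : fderiv ℝ (fderiv ℝ s) x a b = fderiv ℝ (fun x' => fderiv ℝ s x' b) x a := by
      have h2 := (((hsm.fderiv_right (m := 1) (by norm_cast)).differentiableAt (by simp)).hasFDerivAt.clm_apply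
        (hasFDerivAt_const b x)).fderiv
      rw [h2]
      simp
    have h3 : HasFDerivAt (fun x' => ∑ i, p i x' b • q i x')
        (∑ i, (p i x b • (N.chartFrameDeriv y (τ x) (.inl (Fin.castLE hk i))).comp T +
          ((fderiv ℝ (p i) x).flip b).smulRight (q i x))) x := by
      refine HasFDerivAt.fun_sum fun i _ => HasFDerivAt.fun_smul ?_ (hqd i)
      have h4 := (hpd i).hasFDerivAt.clm_apply (hasFDerivAt_const b x)
      refine h4.congr_fderiv ?_
      ext1 v
      simp
    rw [h1, Filter.EventuallyEq.fderiv_eq (hds.mono fun x' h => h b), h3.fderiv, _root_.sum_apply]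
    rfl
  rw [hdd, hds.self_of_nhds b]
  simp only [map_sum, map_smul, ← Finset.sum_add_distrib]
  refine R.sum_mem fun i _ => ?_
  have := R.add_mem (R.smul_mem (p i x b) (hcov i)) (R.smul_mem (fderiv ℝ (p i) x a b) (hqR i))
  rw [smul_add, add_right_comm] at this
  exact this

/-- Projections of integral manifolds of `I_k` are geodesic isotropic folds. -/
theorem isGeodesicIsotropic_of_isProjectionOfIntegral (hn : 0 < n) (hD : D.IsLegendrian)
    (hA : N.ArisesFrom D) (hk : k ≤ n) {U : Set (Euc k)} {σ : Euc k → Y}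
    (hU : IsImmersedOn (n := n) U σ) (h : N.IsProjectionOfIntegral k U σ) :
    IsGeodesicIsotropic D U σ := by
  refine ⟨hU, fun x hx => ?_⟩
  obtain ⟨τ, hτ⟩ := h x hx
  obtain ⟨L, hL⟩ := exists_represents hn hD (σ x)
  have hUx : ∀ᶠ x' in 𝓝 x, x' ∈ U := hU.1.mem_nhds hx
  have hσ := (hU.2 x hx).1
  have hinj := (hU.2 x hx).2
  have hP : ∀ᶠ x' in 𝓝 x, tangentPlane σ x' ≤ C.plane (σ x') := by
    filter_upwards [hτ.eventually_nhds, hσ.continuousAt.eventually hL, hUx] with x' h1 h2 h3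
    rintro _ ⟨v, rfl⟩
    have h5 := h1.self_of_nhds
    have h4 := (N.contact (τ x') _).1
      (((N.flagSystem_eq_zero_iff k _ _).1 fun i => h5.2.2 i v).1 0 0)
    have h6 : L.Represents D (σ x) (N.proj (τ x')) := by rwa [h5.2.1]
    rw [h6.mem_plane_iff, ← chartFrame_form] at h4
    have h7 := fderiv_chart_lift (h5.1.mdifferentiableAt (by simp)) (h1.mono fun x'' h => h.2.1)
      h2.mem_source v
    refine (h2.mem_plane_iff _).2 ((congrArg _ ((chartD_mfderiv
      ((hU.2 x' h3).1.mdifferentiableAt (by simp)) h2.mem_source v).trans h7)).trans ?_)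
    rw [← h5.2.1]
    exact h4
  refine ⟨⟨finrank_tangentPlane hinj, hP.self_of_nhds, fun θ hθ =>
    extD_eq_zero_of_tangent hσ hP hθ⟩, ?_⟩
  exact (isTotallyGeodesicAt_iff hL (hUx.mono fun x' hx' => (hU.2 x' hx').1) hinj hP).1
    (isTotallyGeodesicAt_of_integral hA hk hL hτ hσ hinj)

end SymplecticConnection

end Bundle

/-! ### Adapted points of `B` over an isotropic plane -/

section Symplectic

variable {n : ℕ}

lemma toBilin'_J_apply (x y : Idx n → ℝ) : Matrix.toBilin' (Matrix.J (Fin (n + 1)) ℝ) x y =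
    ∑ i, (x (.inr i) * y (.inl i) - x (.inl i) * y (.inr i)) := by
  rw [Matrix.toBilin'_apply', Matrix.J]
  simp only [dotProduct, Fintype.sum_sum_type, Matrix.fromBlocks_mulVec, Sum.elim_inl, Sum.elim_inr,
    Matrix.zero_mulVec, Matrix.one_mulVec, Matrix.neg_mulVec, zero_add, add_zero, Pi.neg_apply,
    Function.comp_apply, Finset.sum_sub_distrib, mul_neg, Finset.sum_neg_distrib]
  ring

/-- An isotropic family of vectors annihilated by `e_{n+1}` gives, together with the first basis
vector, the first columns of an element of the parabolic subgroup. If `P`, `Q` are the blocks of a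
Lagrangian basis, then `(P, -Q G⁻¹; Q, P G⁻¹)` with `G = Pᵀ P + Qᵀ Q` is symplectic. -/
lemma exists_parabolic_columns {k : ℕ} (hk : k ≤ n) (ξ : Fin k → Idx n → ℝ)
    (hli : LinearIndependent ℝ (Fin.cons (Pi.single (.inl 0) 1) ξ : Fin (k + 1) → Idx n → ℝ))
    (h0 : ∀ i, ξ i (.inr 0) = 0)
    (hiso : ∀ i j, Matrix.toBilin' (Matrix.J (Fin (n + 1)) ℝ) (ξ i) (ξ j) = 0) :
    ∃ g : parabolic n, pmat g (.inl 0) (.inl 0) = 1 ∧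
      ∀ i j, pmat g j (.inl (Fin.castLE hk i).succ) = ξ i j := by
  set Ω := Matrix.toBilin' (Matrix.J (Fin (n + 1)) ℝ) with hΩ
  have hnd : Ω.Nondegenerate := LinearMap.BilinForm.nondegenerate_toBilin'_of_det_ne_zero' _
    (Matrix.isUnit_det_J _ _).ne_zero
  have halt : Ω.IsAlt := fun x => by
    rw [hΩ, toBilin'_J_apply]
    exact Finset.sum_eq_zero fun i _ => by ring
  have hdim : Module.finrank ℝ (Idx n → ℝ) = 2 * (n + 1) := by
    rw [Module.finrank_fintype_fun_eq_card, Fintype.card_sum, Fintype.card_fin, two_mul]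
  have he : ∀ x : Idx n → ℝ, x (.inr 0) = 0 → Ω (Pi.single (.inl 0) 1) x = 0 := by
    intro x hx
    rw [hΩ, toBilin'_J_apply]
    refine Finset.sum_eq_zero fun i _ => ?_
    by_cases hi : i = 0
    · rw [hi, hx]
      simp
    · simp [hi]
  have hcons : ∀ i j : Fin (k + 1), Ω ((Fin.cons (Pi.single (.inl 0) 1) ξ :
      Fin (k + 1) → Idx n → ℝ) i) ((Fin.cons (Pi.single (.inl 0) 1) ξ :
      Fin (k + 1) → Idx n → ℝ) j) = 0 := by
    intro i j
    refine Fin.cases (Fin.cases ?_ (fun j => ?_) j) (fun i => Fin.cases ?_ (fun j => ?_) j) i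
    · exact halt _
    · exact he _ (h0 j)
    · rw [Fin.cons_succ, Fin.cons_zero, ← halt.neg_eq, he _ (h0 i), neg_zero]
    · exact hiso i j
  obtain ⟨w, hw, hwi, hwc⟩ := exists_lagrangian_extension hnd halt hdim _ hli hcons
    (Nat.succ_le_succ hk) le_rfl
  have hw0 : w 0 = Pi.single (.inl 0) 1 := hwc 0
  have hws : ∀ i : Fin k, w (Fin.castLE hk i).succ = ξ i := fun i => hwc i.succ
  let P : Matrix (Fin (n + 1)) (Fin (n + 1)) ℝ := Matrix.of fun i j => w j (.inl i)
  let Q : Matrix (Fin (n + 1)) (Fin (n + 1)) ℝ := Matrix.of fun i j => w j (.inr i)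
  have hPQ : Pᵀ * Q = Qᵀ * P := by
    ext i j
    have := hwi i j
    rw [hΩ, toBilin'_J_apply, Finset.sum_sub_distrib, sub_eq_zero] at this
    exact this.symm
  set G := Pᵀ * P + Qᵀ * Q with hG
  have hGt : Gᵀ = G := by
    rw [hG, Matrix.transpose_add, Matrix.transpose_mul, Matrix.transpose_mul,
      Matrix.transpose_transpose, Matrix.transpose_transpose]
  have hGu : IsUnit G := by
    rw [← Matrix.mulVec_injective_iff_isUnit]
    refine (injective_iff_map_eq_zero G.mulVecLin).2 fun v hv => ?_
    have h1 : P *ᵥ v ⬝ᵥ P *ᵥ v + Q *ᵥ v ⬝ᵥ Q *ᵥ v = 0 := by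
      have h2 : v ⬝ᵥ G *ᵥ v = 0 := by
        rw [← Matrix.mulVecLin_apply, hv, dotProduct_zero]
      rw [hG, Matrix.add_mulVec, dotProduct_add, ← Matrix.mulVec_mulVec, ← Matrix.mulVec_mulVec,
        Matrix.dotProduct_mulVec v Pᵀ, Matrix.dotProduct_mulVec v Qᵀ, Matrix.vecMul_transpose,
        Matrix.vecMul_transpose] at h2
      exact h2
    have hP0 : 0 ≤ P *ᵥ v ⬝ᵥ P *ᵥ v := Finset.sum_nonneg fun i _ => mul_self_nonneg _
    have hQ0 : 0 ≤ Q *ᵥ v ⬝ᵥ Q *ᵥ v := Finset.sum_nonneg fun i _ => mul_self_nonneg _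
    have hPv : P *ᵥ v = 0 := dotProduct_self_eq_zero.1 (by linarith)
    have hQv : Q *ᵥ v = 0 := dotProduct_self_eq_zero.1 (by linarith)
    funext j
    refine Fintype.linearIndependent_iff.1 hw v ?_ j
    ext i
    rw [Finset.sum_apply]
    rcases i with i | i
    · refine Eq.trans ?_ (congrFun hPv i)
      exact Finset.sum_congr rfl fun j _ => mul_comm _ _
    · refine Eq.trans ?_ (congrFun hQv i)
      exact Finset.sum_congr rfl fun j _ => mul_comm _ _
  have hGd := (Matrix.isUnit_iff_isUnit_det _).1 hGu
  have hS : Matrix.fromBlocks P (-(Q * G⁻¹)) Q (P * G⁻¹) ∈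
      Matrix.symplecticGroup (Fin (n + 1)) ℝ := by
    refine SymplecticGroup.fromBlocks_mem_iff.2 ⟨hPQ, ?_, ?_⟩
    · rw [Matrix.transpose_neg, Matrix.neg_mul, Matrix.mul_neg, Matrix.transpose_mul,
        Matrix.transpose_mul, Matrix.mul_assoc, Matrix.mul_assoc, ← Matrix.mul_assoc Qᵀ,
        ← Matrix.mul_assoc Pᵀ, hPQ]
    · rw [Matrix.mul_neg, sub_neg_eq_add, ← Matrix.mul_assoc, ← Matrix.mul_assoc, ← Matrix.add_mul,
        ← hG, Matrix.mul_nonsing_inv _ hGd]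
  have hcol : ∀ (i : Idx n) (j : Fin (n + 1)),
      Matrix.fromBlocks P (-(Q * G⁻¹)) Q (P * G⁻¹) i (.inl j) = w j i := by
    rintro (i | i) j <;> rfl
  refine ⟨⟨⟨_, hS⟩, 1, ?_⟩, ?_, fun i j => ?_⟩
  · ext i
    rw [Matrix.mulVec_single_one, Matrix.col_apply, one_smul, ← hw0]
    exact hcol i 0
  · change Matrix.fromBlocks P (-(Q * G⁻¹)) Q (P * G⁻¹) _ _ = 1
    rw [hcol, hw0, Pi.single_eq_same]
  · change Matrix.fromBlocks P (-(Q * G⁻¹)) Q (P * G⁻¹) _ _ = _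
    rw [hcol, hws]

end Symplectic

/-- If `β` vanishes on the kernel of the nowhere zero form `α`, then `β` is a multiple of `α`, so on
this kernel `dβ` vanishes where `dα` does. -/
lemma dForm_eq_zero_of_ker_le {E : Type*} [NormedAddCommGroup E] [NormedSpace ℝ E]
    {α β : E → E →L[ℝ] ℝ} {e : E} (hα : DifferentiableAt ℝ α e) (hβ : DifferentiableAt ℝ β e)
    (hne : α e ≠ 0) (hker : ∀ᶠ e' in 𝓝 e, ∀ v, α e' v = 0 → β e' v = 0) {v w : E}
    (hv : α e v = 0) (hw : α e w = 0) (h : dForm α e v w = 0) : dForm β e v w = 0 := by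
  obtain ⟨t, ht⟩ : ∃ t, α e t ≠ 0 := by
    by_contra! h
    exact hne (ContinuousLinearMap.ext h)
  have hαt : DifferentiableAt ℝ (fun e' => α e' t) e := hα.clm_apply (differentiableAt_const t)
  have hβt : DifferentiableAt ℝ (fun e' => β e' t) e := hβ.clm_apply (differentiableAt_const t)
  have h1 : β =ᶠ[𝓝 e] fun e' => (β e' t * (α e' t)⁻¹) • α e' := by
    filter_upwards [hker, hαt.continuousAt.eventually_ne ht] with e' h1 h2
    ext x
    have h3 := h1 (x - (α e' x * (α e' t)⁻¹) • t) (by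
      rw [map_sub, map_smul, smul_eq_mul, inv_mul_cancel_right₀ h2, sub_self])
    rw [map_sub, map_smul, smul_eq_mul, sub_eq_zero] at h3
    rw [h3, smul_apply, smul_eq_mul]
    ring
  have h2 : HasFDerivAt (fun e' => (β e' t * (α e' t)⁻¹) • α e') _ e :=
    (hβt.fun_mul (hαt.fun_inv ht)).hasFDerivAt.smul hα.hasFDerivAt
  rw [dForm, sub_eq_zero] at h
  simp only [dForm, h1.fderiv_eq, h2.fderiv]
  simp [hv, hw, h]

section Bundle

variable {n : ℕ} {Y : Type*} [TopologicalSpace Y] [ChartedSpace (Euc (2 * n + 1)) Y]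
  [IsManifold (𝓡 (2 * n + 1)) ∞ Y] {C : ContactStructure n Y} {B : Type*} [TopologicalSpace B]
  [ChartedSpace (Euc (dimSp n)) B] [IsManifold (𝓡 (dimSp n)) ∞ B]
  {D : ConformalSymplecticConnection C} {k : ℕ}

namespace SymplecticConnection

variable {N : SymplecticConnection C B}

/-- By the vanishing of the torsion, `dθ₀` is given on lifts by the symplectic form in the frame. -/
lemma toBilin'_J_form_eq_zero (hN : N.IsNormal) {u : B} {θ : OneForm (2 * n + 1) Y}
    (hθ : C.IsGenerator θ (N.proj u)) {X X' : TangentSpace (𝓡 (dimSp n)) u}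
    (hX : mfderiv (𝓡 (dimSp n)) (𝓡 (2 * n + 1)) N.proj u X ∈ C.plane (N.proj u))
    (hX' : mfderiv (𝓡 (dimSp n)) (𝓡 (2 * n + 1)) N.proj u X' ∈ C.plane (N.proj u))
    (h : θ.extD (N.proj u) (mfderiv (𝓡 (dimSp n)) (𝓡 (2 * n + 1)) N.proj u X)
      (mfderiv (𝓡 (dimSp n)) (𝓡 (2 * n + 1)) N.proj u X') = 0) :
    Matrix.toBilin' (Matrix.J (Fin (n + 1)) ℝ) (fun i => (N.form u X).1 i (.inl 0))
      (fun i => (N.form u X').1 i (.inl 0)) = 0 := by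
  have hext : (N.entry (.inr 0) (.inl 0)).extD u X X' = 0 := by
    obtain ⟨b, e, he, rfl⟩ : ∃ (b : B) (e : Euc (dimSp n)),
        e ∈ (extChartAt (𝓡 (dimSp n)) b).target ∧ u = (extChartAt (𝓡 (dimSp n)) b).symm e :=
      ⟨u, extChartAt (𝓡 (dimSp n)) u u, mem_extChartAt_target u, (extChartAt_to_inv u).symm⟩
    obtain ⟨v, hv⟩ : ∃ v, chartDSymm b e v = X := ⟨_, chartDSymm_chartD he X⟩
    obtain ⟨v', hv'⟩ : ∃ v, chartDSymm b e v = X' := ⟨_, chartDSymm_chartD he X'⟩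
    have hf : ∀ e' ∈ (extChartAt (𝓡 (dimSp n)) b).target, ContMDiffAt (𝓡 (dimSp n))
        (𝓡 (2 * n + 1)) ∞ (N.proj ∘ (extChartAt (𝓡 (dimSp n)) b).symm) e' :=
      fun e' he' => (N.proj_smooth _).comp e' (contMDiffAt_chart_symm he')
    have hdf : ∀ e' ∈ (extChartAt (𝓡 (dimSp n)) b).target, ∀ w : Euc (dimSp n),
        mfderiv (𝓡 (dimSp n)) (𝓡 (2 * n + 1)) (N.proj ∘ (extChartAt (𝓡 (dimSp n)) b).symm) e' w =
          mfderiv (𝓡 (dimSp n)) (𝓡 (2 * n + 1)) N.proj ((extChartAt (𝓡 (dimSp n)) b).symm e')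
            (chartDSymm b e' w) := by
      intro e' he' w
      rw [mfderiv_comp (I' := 𝓡 (dimSp n)) e' (N.mdifferentiableAt_proj _)
        ((contMDiffAt_chart_symm he').mdifferentiableAt (by simp))]
      rfl
    have hβ := OneForm.inChart_of_isSmoothAt (α := N.entry (.inr 0) (.inl 0)) he
      (N.form_smooth (.inr 0) (.inl 0) _)
    have hα := OneForm.dForm_pull (hf e he) hθ.self_of_nhds.1
    rw [← hv, ← hv']
    refine (hβ.2 v v').symm.trans ?_
    refine dForm_eq_zero_of_ker_le (α := θ.pull (N.proj ∘ (extChartAt (𝓡 (dimSp n)) b).symm))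
      (hα.1.differentiableAt (by simp)) (hβ.1.differentiableAt (by simp)) ?_ ?_ ?_ ?_ ?_
    · intro h0
      refine hθ.self_of_nhds.2.1 (LinearMap.ext fun w => ?_)
      obtain ⟨x, rfl⟩ := N.proj_submersion _ w
      have h1 := DFunLike.congr_fun h0 (chartD b _ x)
      rw [OneForm.pull_apply, hdf e he, chartDSymm_chartD he] at h1
      exact h1
    · filter_upwards [(hf e he).continuousAt.eventually hθ,
        (isOpen_extChartAt_target b).mem_nhds he] with e' h1 h2 w hw
      rw [OneForm.pull_apply, hdf e' h2] at hw
      exact (N.contact _ _).2 (h1.2.2.1 ▸ hw)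
    · rw [← hθ.self_of_nhds.2.2.1] at hX
      rw [OneForm.pull_apply, hdf e he, hv]
      exact hX
    · rw [← hθ.self_of_nhds.2.2.1] at hX'
      rw [OneForm.pull_apply, hdf e he, hv']
      exact hX'
    · rw [hα.2, hdf e he, hdf e he, hv, hv']
      exact h
  have hcurv := hN.torsion u X X' (.inr 0)
  rw [curv, Matrix.add_apply, Matrix.of_apply, hext, zero_add, Matrix.sub_apply, Matrix.mul_apply,
    Matrix.mul_apply, Fintype.sum_sum_type, Fintype.sum_sum_type] at hcurv
  simp only [(spAlg_apply (N.form u X).2 0 _).1, (spAlg_apply (N.form u X).2 0 _).2,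
    (spAlg_apply (N.form u X').2 0 _).1, (spAlg_apply (N.form u X').2 0 _).2] at hcurv
  rw [toBilin'_J_apply]
  simp only [neg_mul, Finset.sum_neg_distrib, mul_comm ((N.form u X').1 _ _)] at hcurv
  rw [Finset.sum_sub_distrib]
  linarith

/-- Over every isotropic plane there is a point of `B` the first vectors of whose frame form a
prescribed basis of the plane. -/
lemma exists_adapted_point (hN : N.IsNormal) (hk : k ≤ n) {z : Y}
    (w : Fin k → TangentSpace (𝓡 (2 * n + 1)) z) (hw : LinearIndependent ℝ w)
    (hwP : ∀ i, w i ∈ C.plane z)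
    (hiso : ∀ θ, C.IsGenerator θ z → ∀ i j, θ.extD z (w i) (w j) = 0) (y : Y) :
    ∃ b : B, N.proj b = z ∧
      ∀ i, N.chartFrame y b (basisElt n (.inl (Fin.castLE hk i))) = chartD y z (w i) := by
  obtain ⟨u, rfl⟩ := N.proj_surjective z
  choose X hX using fun i => N.proj_submersion u (w i)
  have h0 : ∀ i, (N.form u (X i)).1 (.inr 0) (.inl 0) = 0 := fun i =>
    (N.contact _ _).2 (by rw [hX]; exact hwP i)
  obtain ⟨θ, hθ⟩ := C.exists_form (N.proj u)
  obtain ⟨g, hg0, hg⟩ := exists_parabolic_columns hk (fun i j => (N.form u (X i)).1 j (.inl 0))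
    (by
      rw [Fintype.linearIndependent_iff]
      intro c hc
      have hcol : ∀ j ≠ .inl 0, (N.form u (∑ i, c (Fin.succ i) • X i)).1 j (.inl 0) = 0 := by
        intro j hj
        have h1 := congrFun hc j
        rw [Fin.sum_univ_succ] at h1
        simp only [Fin.cons_zero, Fin.cons_succ, Pi.add_apply, Pi.smul_apply, Finset.sum_apply,
          Pi.single_eq_of_ne hj, smul_zero, zero_add, Pi.zero_apply] at h1
        rw [map_sum, Submodule.coe_sum, Matrix.sum_apply]
        simp only [map_smul]
        exact h1
      have h2 := N.mfderiv_proj_eq_zero hcol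
      rw [map_sum] at h2
      simp only [map_smul, hX] at h2
      have h3 := Fintype.linearIndependent_iff.1 hw _ h2
      have h4 : c 0 = 0 := by
        have h1 := congrFun hc (.inl 0)
        rw [Fin.sum_univ_succ] at h1
        simpa [h3] using h1
      exact fun i => Fin.cases h4 h3 i) h0
    (fun i j => toBilin'_J_form_eq_zero hN hθ (by rw [hX]; exact hwP i) (by rw [hX]; exact hwP j)
      (by rw [hX, hX]; exact hiso θ hθ i j))
  refine ⟨N.act u g, N.proj_act u g, fun i => ?_⟩
  rw [chartFrame_act, hg0, inv_one, one_smul, ← hX i, ← chartFrame_form,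
    N.chartFrame_eq_sum y u (h0 i)]
  refine Finset.sum_congr rfl fun a _ => ?_
  have h5 : (subIdx (.inl (Fin.castLE hk i)) : Idx n) = .inl (Fin.castLE hk i).succ := rfl
  rw [h5, hg]

end SymplecticConnection

end Bundle

/-! ### Geodesic isotropic folds are projections of integral manifolds -/

section Bundle

variable {n : ℕ} {Y : Type*} [TopologicalSpace Y] [ChartedSpace (Euc (2 * n + 1)) Y]
  [IsManifold (𝓡 (2 * n + 1)) ∞ Y] {C : ContactStructure n Y} {B : Type*} [TopologicalSpace B]
  [ChartedSpace (Euc (dimSp n)) B] [IsManifold (𝓡 (dimSp n)) ∞ B]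
  {D : ConformalSymplecticConnection C} {k : ℕ}

namespace SymplecticConnection

variable {N : SymplecticConnection C B}

/-- The projection of the integral manifold through an adapted point is a geodesic isotropic fold
with prescribed isotropic tangent plane. -/
lemma exists_integral_tangent (hn : 0 < n) (hD : D.IsLegendrian) (hN : N.IsAssociated D)
    (hk : k ≤ n) {U : Set (Euc k)} {σ : Euc k → Y} (hσ : IsGeodesicIsotropic D U σ) {x : Euc k}
    (hx : x ∈ U) : ∃ (U' : Set (Euc k)) (τ : Euc k → B), 0 ∈ U' ∧
      IsGeodesicIsotropic D U' (N.proj ∘ τ) ∧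
      IsTangentTo (n := n) (N.proj ∘ τ) 0 (σ x) (tangentPlane σ x) ∧
      ∀ x' ∈ U', ContMDiffAt (𝓡 k) (𝓡 (dimSp n)) ∞ τ x' ∧ ∀ i (v : TangentSpace (𝓡 k) x'),
        N.flagSystem k i (τ x') (mfderiv (𝓡 k) (𝓡 (dimSp n)) τ x' v) = 0 := by
  set y := σ x with hy
  have hσd := (hσ.1.2 x hx).1.mdifferentiableAt (by simp)
  have hinj := (hσ.1.2 x hx).2
  have hW := (hσ.2 x hx).1
  have hys : σ x ∈ (chartAt (Euc (2 * n + 1)) y).source := mem_chart_source _ y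
  let w : Fin k → TangentSpace (𝓡 (2 * n + 1)) (σ x) := fun i =>
    mfderiv (𝓡 k) (𝓡 (2 * n + 1)) σ x (EuclideanSpace.single i (1 : ℝ))
  have hsum : ∀ v : Euc k, v = ∑ i, v i • EuclideanSpace.single i (1 : ℝ) := fun v => by
    simpa using ((EuclideanSpace.basisFun (Fin k) ℝ).sum_repr v).symm
  have hli : LinearIndependent ℝ w := by
    refine Fintype.linearIndependent_iff.2 fun c hc => ?_
    have h1 : mfderiv (𝓡 k) (𝓡 (2 * n + 1)) σ x (WithLp.toLp 2 c : Euc k) = 0 := by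
      rw [← hc, hsum (WithLp.toLp 2 c)]
      exact (map_sum (mfderiv (𝓡 k) (𝓡 (2 * n + 1)) σ x) _ _).trans
        (Finset.sum_congr rfl fun i _ => map_smul _ _ _)
    have h2 : (WithLp.toLp 2 c : Euc k) = 0 := hinj (h1.trans (map_zero _).symm)
    exact fun i => congrArg (fun v : Euc k => v i) h2
  have hwm : ∀ i, w i ∈ tangentPlane σ x := fun i => ⟨_, rfl⟩
  obtain ⟨b, hb, hbw⟩ := exists_adapted_point hN.1 hk w hli (fun i => hW.2.1 (hwm i))
    (fun θ hθ i j => hW.2.2 θ hθ _ (hwm i) _ (hwm j)) y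
  obtain ⟨τ, hτ0, hτ, hτd⟩ := exists_integral_flagSystem hN.1 hk b
  have hσ'0 : (N.proj ∘ τ) 0 = σ x := by rw [Function.comp_apply, hτ0, hb]
  have hsm : ∀ᶠ x' in 𝓝 0, ContMDiffAt (𝓡 k) (𝓡 (2 * n + 1)) ∞ (N.proj ∘ τ) x' :=
    hτ.mono fun x' h => (N.proj_smooth _).comp x' h.1
  have hsrc : ∀ᶠ x' in 𝓝 (0 : Euc k), (N.proj ∘ τ) x' ∈ (chartAt (Euc (2 * n + 1)) y).source :=
    hsm.self_of_nhds.continuousAt.eventually ((chartAt _ y).open_source.mem_nhds (by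
      rw [hσ'0]
      exact hys))
  set s := extChartAt (𝓡 (2 * n + 1)) y ∘ (N.proj ∘ τ) with hs
  -- both folds have the same differential in the chart
  have hds : fderiv ℝ s 0 = fderiv ℝ (extChartAt (𝓡 (2 * n + 1)) y ∘ σ) x := by
    ext1 v
    rw [hs, fderiv_chart_lift (σ := N.proj ∘ τ) (hτ.self_of_nhds.1.mdifferentiableAt (by simp))
      (.of_forall fun _ => rfl) hsrc.self_of_nhds, hτd, map_sum]
    simp only [map_smul]
    conv_rhs => rw [hsum v, map_sum]
    refine Finset.sum_congr rfl fun i _ => ?_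
    rw [map_smul, hτ0, hbw, ← chartD_mfderiv hσd hys]
  have hinj0 : Function.Injective (fderiv ℝ s 0) := by
    rw [hds]
    exact (injective_mfderiv_iff hσd hys).1 hinj
  have hinj' : ∀ᶠ x' in 𝓝 0, Function.Injective (fderiv ℝ s x') := by
    obtain ⟨g, hg⟩ := LocalConnection.exists_leftInverse_clm hinj0
    have h1 : ContDiffAt ℝ ∞ s 0 := contDiffAt_chart_comp hsm.self_of_nhds hsrc.self_of_nhds
    have h2 : ContinuousAt (fderiv ℝ s) 0 :=
      (h1.fderiv_right (m := 0) (by simp)).continuousAt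
    filter_upwards [LocalConnection.eventually_isInvertible_comp h2 hg] with x' h3
    exact LocalConnection.injective_of_isInvertible_comp h3
  obtain ⟨U', hU', hUo, hU0⟩ := _root_.eventually_nhds_iff.1 (((hτ.and hsm).and hsrc).and hinj')
  refine ⟨U', τ, hU0, ?_, ?_, fun x' hx' => (hU' x' hx').1.1.1⟩
  · refine isGeodesicIsotropic_of_isProjectionOfIntegral hn hD hN.2 hk
      ⟨hUo, fun x' hx' => ⟨(hU' x' hx').1.1.2, ?_⟩⟩ fun x' hx' => ⟨τ, ?_⟩
    · exact (injective_mfderiv_iff ((hU' x' hx').1.1.2.mdifferentiableAt (by simp))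
        (hU' x' hx').1.2).2 (hU' x' hx').2
    · filter_upwards [hUo.mem_nhds hx'] with x'' hx''
      exact ⟨(hU' x'' hx'').1.1.1.1, rfl, (hU' x'' hx'').1.1.1.2⟩
  · rw [isTangentTo_iff (hsm.self_of_nhds.mdifferentiableAt (by simp)), map_chartD_tangentPlane hσd hys]
    exact ⟨hσ'0, congrArg (fun T : Euc k →L[ℝ] Euc (2 * n + 1) => LinearMap.range T.toLinearMap) hds⟩

/-- Geodesic isotropic folds lift to integral manifolds of `I_k`: by uniqueness, they coincide with
the projection of the integral manifold through an adapted point. -/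
theorem isProjectionOfIntegral_of_isGeodesicIsotropic (hn : 0 < n) (hD : D.IsLegendrian)
    (hN : N.IsAssociated D) (hk : k ≤ n) {U : Set (Euc k)} {σ : Euc k → Y}
    (hσ : IsGeodesicIsotropic D U σ) : N.IsProjectionOfIntegral k U σ := by
  intro x hx
  obtain ⟨U', τ, h0, hgeo, htan, hτ⟩ := exists_integral_tangent hn hD hN hk hσ hx
  obtain ⟨φ, hxφ, hφx, hφU, hφU', hφ, -, hφσ⟩ := sameGerm_of_isTangentTo hn hD (hσ.2 x hx).1 hx h0
    hσ hgeo ⟨rfl, rfl⟩ htan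
  refine ⟨τ ∘ φ, ?_⟩
  filter_upwards [φ.open_source.mem_nhds hxφ] with x' hx'
  have h1 : ContDiffAt ℝ ∞ φ x' := hφ.contDiffAt (φ.open_source.mem_nhds hx')
  have h2 := hτ (φ x') (hφU' (φ.map_source hx'))
  refine ⟨h2.1.comp x' h1.contMDiffAt, hφσ x' hx', fun i v => ?_⟩
  rw [mfderiv_comp (I' := 𝓡 k) x' (h2.1.mdifferentiableAt (by simp))
    (h1.contMDiffAt.mdifferentiableAt (by simp))]
  exact h2.2 i _

theorem isGeodesicIsotropic_iff_isProjectionOfIntegral (hn : 0 < n) (hD : D.IsLegendrian)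
    (hN : N.IsAssociated D) (hk : k ≤ n) {U : Set (Euc k)} {σ : Euc k → Y}
    (hσ : IsImmersedOn (n := n) U σ) :
    IsGeodesicIsotropic D U σ ↔ N.IsProjectionOfIntegral k U σ :=
  ⟨isProjectionOfIntegral_of_isGeodesicIsotropic hn hD hN hk,
    isGeodesicIsotropic_of_isProjectionOfIntegral hn hD hN.2 hk hσ⟩

end SymplecticConnection

/-! ### Invariance under isomorphisms of the Cartan connection -/

section Iso

variable {Y' : Type*} [TopologicalSpace Y'] [ChartedSpace (Euc (2 * n + 1)) Y']
  [IsManifold (𝓡 (2 * n + 1)) ∞ Y'] {C' : ContactStructure n Y'} {B' : Type*} [TopologicalSpace B']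
  [ChartedSpace (Euc (dimSp n)) B'] [IsManifold (𝓡 (dimSp n)) ∞ B']
  {N : SymplecticConnection C B} {N' : SymplecticConnection C' B'}
  {F : Diffeomorph (𝓡 (dimSp n)) (𝓡 (dimSp n)) B B' ∞}
  {f : Diffeomorph (𝓡 (2 * n + 1)) (𝓡 (2 * n + 1)) Y Y' ∞}

omit [IsManifold (𝓡 (2 * n + 1)) ∞ Y] [IsManifold (𝓡 (2 * n + 1)) ∞ Y'] in
lemma IsImmersedOn.comp_diffeomorph {U : Set (Euc k)} {σ : Euc k → Y}
    (hσ : IsImmersedOn (n := n) U σ)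
    (f : Diffeomorph (𝓡 (2 * n + 1)) (𝓡 (2 * n + 1)) Y Y' ∞) :
    IsImmersedOn (n := n) U (f ∘ σ) := by
  refine ⟨hσ.1, fun x hx => ⟨(f.contMDiff _).comp x (hσ.2 x hx).1, ?_⟩⟩
  rw [mfderiv_comp (I' := 𝓡 (2 * n + 1)) x (f.mdifferentiable (by simp) _)
    ((hσ.2 x hx).1.mdifferentiableAt (by simp))]
  exact (f.mfderivToContinuousLinearEquiv (by simp) (σ x)).injective.comp (hσ.2 x hx).2

omit [IsManifold (𝓡 (2 * n + 1)) ∞ Y] in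
lemma IsConnectionIso.isProjectionOfIntegral (h : IsConnectionIso N N' F f) {U : Set (Euc k)}
    {σ : Euc k → Y} (hσ : N.IsProjectionOfIntegral k U σ) :
    N'.IsProjectionOfIntegral k U (f ∘ σ) := by
  intro x hx
  obtain ⟨τ, hτ⟩ := hσ x hx
  refine ⟨F ∘ τ, ?_⟩
  filter_upwards [hτ] with x' h1
  refine ⟨(F.contMDiff _).comp x' h1.1, ?_, ?_⟩
  · rw [Function.comp_apply, h.covers, h1.2.1, Function.comp_apply]
  · intro i v
    have h2 := (N.flagSystem_eq_zero_iff k _ _).1 fun i => h1.2.2 i v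
    refine (N'.flagSystem_eq_zero_iff k _ _).2 ?_ i
    rw [mfderiv_comp (I' := 𝓡 (dimSp n)) x' (F.mdifferentiable (by simp) _)
      (h1.1.mdifferentiableAt (by simp))]
    rw [← h.pullback] at h2
    exact h2

lemma IsConnectionIso.symm (h : IsConnectionIso N N' F f) : IsConnectionIso N' N F.symm f.symm where
  covers u := by
    obtain ⟨u, rfl⟩ : ∃ u', F u' = u := ⟨F.symm u, F.apply_symm_apply u⟩
    rw [h.covers, F.symm_apply_apply, f.symm_apply_apply]
  equivariant u g := by
    obtain ⟨u, rfl⟩ : ∃ u', F u' = u := ⟨F.symm u, F.apply_symm_apply u⟩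
    rw [← h.equivariant, F.symm_apply_apply, F.symm_apply_apply]
  pullback u v := by
    have h1 := h.pullback (F.symm u) (mfderiv (𝓡 (dimSp n)) (𝓡 (dimSp n)) F.symm u v)
    rw [← h1]
    have h2 : ∀ u' (_ : u' = u) (v' : TangentSpace (𝓡 (dimSp n)) u'),
        (v' : Euc (dimSp n)) = v → N'.form u' v' = N'.form u v := by
      rintro u' rfl v' rfl
      rfl
    refine h2 _ (F.apply_symm_apply u) _ ?_
    have h3 := mfderiv_comp (I' := 𝓡 (dimSp n)) u (F.mdifferentiable (by simp) (F.symm u))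
      (F.symm.mdifferentiable (by simp) u)
    have h4 : F ∘ F.symm = id := funext F.apply_symm_apply
    rw [h4, mfderiv_id] at h3
    exact (congrArg (fun T => T v) h3).symm

/-- Isomorphic normal symplectic connections have the same geodesic isotropic folds, as the folds
are determined by the systems `I_k`. -/
theorem isGeodesicIsotropic_comp_iff (hn : 0 < n) (hD : D.IsLegendrian) (hN : N.IsAssociated D)
    {D' : ConformalSymplecticConnection C'} (hD' : D'.IsLegendrian) (hN' : N'.IsAssociated D')
    (h : IsConnectionIso N N' F f) (hk : k ≤ n) {U : Set (Euc k)} {σ : Euc k → Y} :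
    IsGeodesicIsotropic D U σ ↔ IsGeodesicIsotropic D' U (f ∘ σ) := by
  constructor
  · intro hσ
    exact SymplecticConnection.isGeodesicIsotropic_of_isProjectionOfIntegral hn hD' hN'.2 hk
      (hσ.1.comp_diffeomorph f) (h.isProjectionOfIntegral
        (SymplecticConnection.isProjectionOfIntegral_of_isGeodesicIsotropic hn hD hN hk hσ))
  · intro hσ
    have hf : f.symm ∘ f ∘ σ = σ := funext fun x => f.symm_apply_apply (σ x)
    rw [← hf]
    exact SymplecticConnection.isGeodesicIsotropic_of_isProjectionOfIntegral hn hD hN.2 hk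
      (hσ.1.comp_diffeomorph f.symm) (h.symm.isProjectionOfIntegral
        (SymplecticConnection.isProjectionOfIntegral_of_isGeodesicIsotropic hn hD' hN' hk hσ))

end Iso

end Bundle

end LegendrianGeometry

theorem mainTheorem4 (n : ℕ) (hn : 2 ≤ n)
    (Y : Type*) [TopologicalSpace Y] [T2Space Y] [ChartedSpace (LegendrianGeometry.Euc (2 * n + 1)) Y]
    [IsManifold (𝓡 (2 * n + 1)) ∞ Y]
    (C : LegendrianGeometry.ContactStructure n Y)
    (D : LegendrianGeometry.ConformalSymplecticConnection C) (hD : D.IsLegendrian) :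
    -- existence and uniqueness of the geodesic isotropic fold tangent to a given isotropic plane
    (∀ k : ℕ, 1 ≤ k → k ≤ n → ∀ (y : Y) (W : Submodule ℝ (TangentSpace (𝓡 (2 * n + 1)) y)),
      C.IsIsotropicPlane k y W →
        (∃ (U : Set (LegendrianGeometry.Euc k)) (σ : LegendrianGeometry.Euc k → Y)
          (x : LegendrianGeometry.Euc k), x ∈ U ∧
          LegendrianGeometry.IsGeodesicIsotropic D U σ ∧
          LegendrianGeometry.IsTangentTo σ x y W) ∧
        (∀ (U U' : Set (LegendrianGeometry.Euc k)) (σ σ' : LegendrianGeometry.Euc k → Y)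
          (x x' : LegendrianGeometry.Euc k), x ∈ U → x' ∈ U' →
          LegendrianGeometry.IsGeodesicIsotropic D U σ →
          LegendrianGeometry.IsGeodesicIsotropic D U' σ' →
          LegendrianGeometry.IsTangentTo σ x y W → LegendrianGeometry.IsTangentTo σ' x' y W →
          LegendrianGeometry.SameGerm U σ x U' σ' x')) ∧
    -- for every normal symplectic connection associated to `D`
    (∀ (B : Type*) [TopologicalSpace B] [T2Space B]
      [ChartedSpace (LegendrianGeometry.Euc (LegendrianGeometry.dimSp n)) B]
      [IsManifold (𝓡 (LegendrianGeometry.dimSp n)) ∞ B]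
      (N : LegendrianGeometry.SymplecticConnection C B), N.IsAssociated D →
      -- the systems `I_k` are Frobenius and define exactly the geodesic isotropic folds of `D`
      (∀ k : ℕ, 1 ≤ k → k ≤ n →
        (∀ b : B, LegendrianGeometry.IsFrobeniusAt (N.flagSystem k) b) ∧
        ∀ (U : Set (LegendrianGeometry.Euc k)) (σ : LegendrianGeometry.Euc k → Y),
          LegendrianGeometry.IsImmersedOn (n := n) U σ →
          (LegendrianGeometry.IsGeodesicIsotropic D U σ ↔ N.IsProjectionOfIntegral k U σ)) ∧
      -- an isomorphism with the normal symplectic connection associated to a Legendrian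
      -- connection `D'` matches the geodesic isotropic folds of `D` and `D'`
      ∀ (Y' : Type*) [TopologicalSpace Y'] [T2Space Y']
        [ChartedSpace (LegendrianGeometry.Euc (2 * n + 1)) Y'] [IsManifold (𝓡 (2 * n + 1)) ∞ Y']
        (C' : LegendrianGeometry.ContactStructure n Y')
        (D' : LegendrianGeometry.ConformalSymplecticConnection C')
        (B' : Type*) [TopologicalSpace B'] [T2Space B']
        [ChartedSpace (LegendrianGeometry.Euc (LegendrianGeometry.dimSp n)) B']
        [IsManifold (𝓡 (LegendrianGeometry.dimSp n)) ∞ B']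
        (N' : LegendrianGeometry.SymplecticConnection C' B')
        (F : Diffeomorph (𝓡 (LegendrianGeometry.dimSp n)) (𝓡 (LegendrianGeometry.dimSp n)) B B' ∞)
        (f : Diffeomorph (𝓡 (2 * n + 1)) (𝓡 (2 * n + 1)) Y Y' ∞),
        D'.IsLegendrian → N'.IsAssociated D' → LegendrianGeometry.IsConnectionIso N N' F f →
        ∀ k : ℕ, 1 ≤ k → k ≤ n →
          ∀ (U : Set (LegendrianGeometry.Euc k)) (σ : LegendrianGeometry.Euc k → Y),
            LegendrianGeometry.IsGeodesicIsotropic D U σ ↔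
              LegendrianGeometry.IsGeodesicIsotropic D' U (f ∘ σ)) := by
  have hn' : 0 < n := by omega
  refine ⟨fun k _ _ y W hW => ⟨LegendrianGeometry.exists_isGeodesicIsotropic hn' hD hW,
    fun U U' σ σ' x x' hx hx' h h' hT hT' =>
      LegendrianGeometry.sameGerm_of_isTangentTo hn' hD hW hx hx' h h' hT hT'⟩, ?_⟩
  intro B _ _ _ _ N hN
  refine ⟨fun k _ hk => ⟨LegendrianGeometry.SymplecticConnection.isFrobeniusAt_flagSystem hN.1 k,
    fun U σ hσ => LegendrianGeometry.SymplecticConnection.isGeodesicIsotropic_iff_isProjectionOfIntegral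
      hn' hD hN hk hσ⟩, ?_⟩
  intro Y' _ _ _ _ C' D' B' _ _ _ _ N' F f hD' hN' hF k _ hk U σ
  exact LegendrianGeometry.isGeodesicIsotropic_comp_iff hn' hD hN hD' hN' hF hk
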